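/- **Setting.** Let $G=(\mathbb R^N,\circ,D(\lambda))$ be a Carnot group: a Lie group law $\circ$ on $\mathbb R^N$ with identity $0$ and inverse $x^{-1}=-x$, dilations $D(\lambda)x=(\lambda^{\omega_1}x_1,\dots,\lambda^{\omega_N}x_N)$, $\lambda>0$, that are group automorphisms, with integer exponents $1\le\omega_1\le\dots\le\omega_N$, and such that, if $X_i$ is the left invariant vector field with $X_i(0)=\partial_{x_i}$ and $V_j=\operatorname{span}\{X_i:\omega_i=j\}$, then $[V_1,V_j]=V_{j+1}$ for all $j\ge1$. Let $Q=\sum_i\omega_i$ be the homogeneous dimension. Let $d$ be the control distance of the fields $X_i$ with $\omega_i=1$: $d(x,y)$ is the infimum of the $\delta>0$ for which there is an absolutely continuous $\varphi:[0,1]\to\mathbb R^N$ from $x$ to $y$ with $\varphi'=\sum_{\omega_i=1}a_i(t)\,X_i(\varphi)$ a.e. and $|a_i|\le\delta$. Balls $B(x,r)$ and diameters are taken with respect to $d$, and $f_B=\frac1{|B|}\int_Bf$. For a bounded domain $\Omega\subset\mathbb R^N$ and $\Omega_1\subset\Omega_2\subseteq\Omega$ put $$[f]_{BMO_{loc}(\Omega_1,\Omega_2)}=\sup_{x\in\Omega_1,\;B(x,r)\subset\Omega_2}\frac1{|B(x,r)|}\int_{B(x,r)}|f-f_{B(x,r)}|,$$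 $$[f]_{LMO_{loc}(\Omega_1,\Omega_2)}=\sup_{x\in\Omega_1,\;B(x,r)\subset\Omega_2}\frac{1+\log\frac{\operatorname{diam}\Omega_2}{r}}{|B(x,r)|}\int_{B(x,r)}|f-f_{B(x,r)}|,$$ and write $BMO_{loc}(B(\bar x,R_1;R_2))$ for the choice $\Omega_1=B(\bar x,R_1)$, $\Omega_2=B(\bar x,R_2)$, and likewise for $LMO_{loc}$. The spaces consist of the locally integrable functions with finite seminorm; $f\in BMO^p_{loc}(\Omega_1,\Omega_2)$ means that moreover $f\in L^p(\Omega_2)$; $LMO_{loc}(\Omega)$ is the case $\Omega_1=\Omega_2=\Omega$; and $f\in VLMO_{loc}(\Omega)$ if $f\in LMO_{loc}(\Omega)$ and the supremum defining its seminorm, restricted to balls of radius at most $r$, tends to $0$ as $r\to0$. Let $k(x,y)=k_0(y^{-1}\circ x)$ be a real kernel such that, for constants $A,B$, * $|k(x,y)|\le A\,d(x,y)^{-Q}$ for $x\ne y$; * $|k(x,y)-k(x_0,y)|+|k(y,x)-k(y,x_0)|\le B\,\dfrac{d(x_0,x)}{d(x_0,y)^{Q+1}}$ whenever $x\neq y$,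 $x_0\ne y$ and $d(x_0,y)\ge2d(x_0,x)$; * $\displaystyle\int_{r_1<d(x,y)<r_2}k(x,y)\,dy=0=\int_{r_1<d(x,y)<r_2}k(y,x)\,dy$ for all $x$ and $0<r_1<r_2<\infty$. Let $Tf(x)=\mathrm{P.V.}\!\int k(x,y)f(y)\,dy=\lim_{\varepsilon\to0^+}\int_{d(x,y)>\varepsilon}k(x,y)f(y)\,dy$ and $T_bf=[T,b]f=T(bf)-b\,Tf$. **Theorem.** There is an absolute constant $K>4$ such that for every $p\in(1,\infty)$ there is a constant $C$, depending only on $G$, $p$, $A$ and $B$, for which the following holds for every bounded domain $\Omega$ and every $b\in LMO_{loc}(\Omega)$. 1. For every ball with $R>0$ and $B(\bar x,KR)\subset\Omega$, and every real-valued $f\in BMO^p_{loc}(B(\bar x,R;3R))$ that vanishes a.e. outside $B(\bar x,R)$, the principal values $Tf(x)$ and $T(bf)(x)$ exist for a.e. $x$, $T_bf\in BMO_{loc}(B(\bar x,R;3R))$, and $$[T_bf]_{BMO_{loc}(B(\bar x,R;3R))}\le C\,[b]_{LMO_{loc}(B(\bar x,4R;KR))}\Big\{[f]_{BMO_{loc}(B(\bar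 x,R;3R))}+\frac{1}{|B(\bar x,R)|^{1/p}}\|f\|_{L^p(B(\bar x,R))}\Big\}.$$ 2. In particular, if $b\in VLMO_{loc}(\Omega)$, then for every $\bar x\in\Omega$ and $\varepsilon>0$ there is $R_0>0$ such that, for all $0<R\le R_0$, $B(\bar x,KR)\subset\Omega$ and $C\,[b]_{LMO_{loc}(B(\bar x,4R;KR))}<\varepsilon$. -/

import Mathlib

open MeasureTheory Filter Set Topology
open scoped ENNReal NNReal ContDiff

noncomputable section

/-- A Lie group structure `mul` on `ℝ^N`, with the origin as identity and the Euclidean opposite as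
inverse, for which the dilations `x ↦ (t ^ ω₁ x₁, …, t ^ ω_N x_N)`, `t > 0`, are automorphisms.
The exponents `ω = weight` are positive integers, listed in nondecreasing order. -/
structure HomogeneousGroup (N : ℕ) where
  mul : EuclideanSpace ℝ (Fin N) → EuclideanSpace ℝ (Fin N) → EuclideanSpace ℝ (Fin N)
  weight : Fin N → ℕ
  contDiff_mul : ContDiff ℝ ∞
    (fun z : EuclideanSpace ℝ (Fin N) × EuclideanSpace ℝ (Fin N) => mul z.1 z.2)
  mul_assoc : ∀ x y z, mul (mul x y) z = mul x (mul y z)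
  zero_mul : ∀ x, mul 0 x = x
  mul_zero : ∀ x, mul x 0 = x
  neg_mul : ∀ x, mul (-x) x = 0
  mul_neg : ∀ x, mul x (-x) = 0
  one_le_weight : ∀ i, 1 ≤ weight i
  monotone_weight : Monotone weight
  dilation_mul : ∀ t : ℝ, 0 < t → ∀ x y,
    (WithLp.toLp 2 (fun i => t ^ weight i * mul x y i) : EuclideanSpace ℝ (Fin N)) =
      mul (WithLp.toLp 2 (fun i => t ^ weight i * x i)) (WithLp.toLp 2 (fun i => t ^ weight i * y i))

/-- The left invariant vector field `X_i` which agrees with `∂_{x_i}` at the origin. -/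
def HomogeneousGroup.field {N : ℕ} (G : HomogeneousGroup N) (i : Fin N)
    (x : EuclideanSpace ℝ (Fin N)) : EuclideanSpace ℝ (Fin N) :=
  fderiv ℝ (G.mul x) 0 (EuclideanSpace.single i 1)

/-- `V_j`: the span of the left invariant fields `X_i` of homogeneity `ω_i = j`. -/
def HomogeneousGroup.layer {N : ℕ} (G : HomogeneousGroup N) (j : ℕ) :
    Submodule ℝ (EuclideanSpace ℝ (Fin N) → EuclideanSpace ℝ (Fin N)) :=
  Submodule.span ℝ {X | ∃ i, G.weight i = j ∧ X = G.field i}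

/-- Carnot groups (stratified homogeneous groups) on `ℝ^N`: `[V_1, V_j] = V_{j+1}` for all `j ≥ 1`.
If `s` is the largest weight, then `V_{s+1} = 0`, so that `[V_1, V_s] = 0`; moreover each of
the layers `V_1, …, V_s` is nonzero. -/
structure CarnotGroup (N : ℕ) extends HomogeneousGroup N where
  stratified : ∀ j, 1 ≤ j → toHomogeneousGroup.layer (j + 1) =
    Submodule.span ℝ {Z | ∃ X ∈ toHomogeneousGroup.layer 1, ∃ Y ∈ toHomogeneousGroup.layer j,
      Z = VectorField.lieBracket ℝ X Y}

namespace CarnotGroup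

/-- The homogeneous dimension `Q`. -/
def homDim {N : ℕ} (G : CarnotGroup N) : ℕ := ∑ i, G.weight i

/-- `φ ∈ C_δ(x, y)`: `φ : [0,1] → ℝ^N` is absolutely continuous, joins `x` to `y`, and
`φ' = ∑ a_i X_i(φ)` almost everywhere, the sum being over the fields `X_i` of homogeneity `1`, with
controls `|a_i| ≤ δ`. -/
def IsAdmissible {N : ℕ} (G : CarnotGroup N) (δ : ℝ) (x y : EuclideanSpace ℝ (Fin N))
    (φ : ℝ → EuclideanSpace ℝ (Fin N)) : Prop :=
  AbsolutelyContinuousOnInterval φ 0 1 ∧ φ 0 = x ∧ φ 1 = y ∧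
    ∃ a : Fin N → ℝ → ℝ, (∀ i, ∀ t ∈ Ioo (0 : ℝ) 1, |a i t| ≤ δ) ∧
      ∀ᵐ t ∂(volume.restrict (Ioo (0 : ℝ) 1)),
        HasDerivAt φ (∑ i with G.weight i = 1, a i t • G.field i (φ t)) t

/-- The control distance. The set of the `δ` is nonempty for any `x` and `y`, since the fields of
homogeneity `1` generate the Lie algebra (Chow's theorem). -/
def ccDist {N : ℕ} (G : CarnotGroup N) (x y : EuclideanSpace ℝ (Fin N)) : ℝ :=
  sInf {δ : ℝ | 0 < δ ∧ ∃ φ, G.IsAdmissible δ x y φ}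

/-- The open balls of the control distance. -/
def ball {N : ℕ} (G : CarnotGroup N) (x : EuclideanSpace ℝ (Fin N)) (r : ℝ) :
    Set (EuclideanSpace ℝ (Fin N)) :=
  {y | G.ccDist x y < r}

/-- The diameter with respect to the control distance, used for bounded sets only. -/
def diam {N : ℕ} (G : CarnotGroup N) (S : Set (EuclideanSpace ℝ (Fin N))) : ℝ :=
  sSup {t | ∃ x ∈ S, ∃ y ∈ S, t = G.ccDist x y}

/-- The mean oscillation `|B|⁻¹ ∫_B |f - f_B|` on `B = B(x, r)`; it is `∞` if `f` is locally
integrable but not integrable on `B`. -/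
def meanOsc {N : ℕ} (G : CarnotGroup N) (f : EuclideanSpace ℝ (Fin N) → ℝ)
    (x : EuclideanSpace ℝ (Fin N)) (r : ℝ) : ℝ≥0∞ :=
  (∫⁻ y in G.ball x r, ‖f y - ⨍ z in G.ball x r, f z‖ₑ) / volume (G.ball x r)

/-- `[f]_{BMO_loc(Ω₁, Ω₂)}`. -/
def bmoSeminorm {N : ℕ} (G : CarnotGroup N) (f : EuclideanSpace ℝ (Fin N) → ℝ)
    (Ω₁ Ω₂ : Set (EuclideanSpace ℝ (Fin N))) : ℝ≥0∞ :=
  ⨆ (x : EuclideanSpace ℝ (Fin N)) (r : ℝ) (_ : x ∈ Ω₁ ∧ 0 < r ∧ G.ball x r ⊆ Ω₂), G.meanOsc f x r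

/-- `[f]_{LMO_loc(Ω₁, Ω₂)}`. -/
def lmoSeminorm {N : ℕ} (G : CarnotGroup N) (f : EuclideanSpace ℝ (Fin N) → ℝ)
    (Ω₁ Ω₂ : Set (EuclideanSpace ℝ (Fin N))) : ℝ≥0∞ :=
  ⨆ (x : EuclideanSpace ℝ (Fin N)) (r : ℝ) (_ : x ∈ Ω₁ ∧ 0 < r ∧ G.ball x r ⊆ Ω₂),
    ENNReal.ofReal (1 + Real.log (G.diam Ω₂ / r)) * G.meanOsc f x r

/-- `f ∈ BMO_loc(Ω₁, Ω₂)`. -/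
def MemBMOLoc {N : ℕ} (G : CarnotGroup N) (f : EuclideanSpace ℝ (Fin N) → ℝ)
    (Ω₁ Ω₂ : Set (EuclideanSpace ℝ (Fin N))) : Prop :=
  LocallyIntegrableOn f Ω₂ ∧ G.bmoSeminorm f Ω₁ Ω₂ < ⊤

/-- `f ∈ BMO^p_loc(Ω₁, Ω₂)`. -/
def MemBMOLocP {N : ℕ} (G : CarnotGroup N) (f : EuclideanSpace ℝ (Fin N) → ℝ) (p : ℝ)
    (Ω₁ Ω₂ : Set (EuclideanSpace ℝ (Fin N))) : Prop :=
  MemLp f (ENNReal.ofReal p) (volume.restrict Ω₂) ∧ G.MemBMOLoc f Ω₁ Ω₂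

/-- `f ∈ LMO_loc(Ω)`. -/
def MemLMOLoc {N : ℕ} (G : CarnotGroup N) (f : EuclideanSpace ℝ (Fin N) → ℝ)
    (Ω : Set (EuclideanSpace ℝ (Fin N))) : Prop :=
  LocallyIntegrableOn f Ω ∧ G.lmoSeminorm f Ω Ω < ⊤

/-- The `VLMO_loc(Ω)` modulus `η_f(r)`: the supremum over the balls `B(x, ρ) ⊆ Ω` with `ρ ≤ r`. -/
def vlmoModulus {N : ℕ} (G : CarnotGroup N) (f : EuclideanSpace ℝ (Fin N) → ℝ)
    (Ω : Set (EuclideanSpace ℝ (Fin N))) (r : ℝ) : ℝ≥0∞ :=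
  ⨆ (x : EuclideanSpace ℝ (Fin N)) (ρ : ℝ) (_ : 0 < ρ ∧ ρ ≤ r ∧ G.ball x ρ ⊆ Ω),
    ENNReal.ofReal (1 + Real.log (G.diam Ω / ρ)) * G.meanOsc f x ρ

/-- `f ∈ VLMO_loc(Ω)`. -/
def MemVLMOLoc {N : ℕ} (G : CarnotGroup N) (f : EuclideanSpace ℝ (Fin N) → ℝ)
    (Ω : Set (EuclideanSpace ℝ (Fin N))) : Prop :=
  G.MemLMOLoc f Ω ∧ Tendsto (G.vlmoModulus f Ω) (𝓝[>] 0) (𝓝 0)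

/-- The convolution kernel `k(x, y) = k₀(y⁻¹ ∘ x)`. -/
def kernel {N : ℕ} (G : CarnotGroup N) (k₀ : EuclideanSpace ℝ (Fin N) → ℝ)
    (x y : EuclideanSpace ℝ (Fin N)) : ℝ :=
  k₀ (G.mul (-y) x)

/-- `k(x, y) = k₀(y⁻¹ ∘ x)` is a singular kernel: it satisfies the standard size estimate with
constant `A`, the standard smoothness estimate with constant `B`, and the strong cancellation
property. The smoothness estimate makes `k₀` continuous outside the origin. -/
structure IsSingularKernel {N : ℕ} (G : CarnotGroup N) (k₀ : EuclideanSpace ℝ (Fin N) → ℝ)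
    (A B : ℝ) : Prop where
  size : ∀ x y, x ≠ y → |G.kernel k₀ x y| ≤ A / G.ccDist x y ^ G.homDim
  smooth : ∀ x₀ x y, 2 * G.ccDist x₀ x ≤ G.ccDist x₀ y →
    |G.kernel k₀ x y - G.kernel k₀ x₀ y| + |G.kernel k₀ y x - G.kernel k₀ y x₀| ≤
      B * (G.ccDist x₀ x / G.ccDist x₀ y ^ (G.homDim + 1))
  cancel : ∀ r₁ r₂ : ℝ, 0 < r₁ → r₁ < r₂ → ∀ x,
    (∫ y in {y | r₁ < G.ccDist x y ∧ G.ccDist x y < r₂}, G.kernel k₀ x y) = 0 ∧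
    (∫ y in {y | r₁ < G.ccDist x y ∧ G.ccDist x y < r₂}, G.kernel k₀ y x) = 0

/-- The truncated integral `∫_{d(x,y) > ε} k(x, y) f(y) dy`. -/
def truncated {N : ℕ} (G : CarnotGroup N) (k₀ f : EuclideanSpace ℝ (Fin N) → ℝ) (ε : ℝ)
    (x : EuclideanSpace ℝ (Fin N)) : ℝ :=
  ∫ y in {y | ε < G.ccDist x y}, G.kernel k₀ x y * f y

/-- The principal value integral that defines `Tf(x)` exists. -/
def PVExists {N : ℕ} (G : CarnotGroup N) (k₀ f : EuclideanSpace ℝ (Fin N) → ℝ)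
    (x : EuclideanSpace ℝ (Fin N)) : Prop :=
  (∀ ε : ℝ, 0 < ε → IntegrableOn (fun y => G.kernel k₀ x y * f y) {y | ε < G.ccDist x y}) ∧
    ∃ l : ℝ, Tendsto (fun ε => G.truncated k₀ f ε x) (𝓝[>] 0) (𝓝 l)

/-- `Tf(x) = P.V. ∫ k(x, y) f(y) dy`, meaningful where `PVExists` holds. -/
def singularIntegral {N : ℕ} (G : CarnotGroup N) (k₀ f : EuclideanSpace ℝ (Fin N) → ℝ)
    (x : EuclideanSpace ℝ (Fin N)) : ℝ :=
  limUnder (𝓝[>] (0 : ℝ)) (fun ε => G.truncated k₀ f ε x)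

/-- The commutator `T_b f = [T, b] f = T(bf) - b Tf`. -/
def commutator {N : ℕ} (G : CarnotGroup N) (k₀ b f : EuclideanSpace ℝ (Fin N) → ℝ)
    (x : EuclideanSpace ℝ (Fin N)) : ℝ :=
  G.singularIntegral k₀ (fun y => b y * f y) x - b x * G.singularIntegral k₀ f x

end CarnotGroup

end

/-!
The theorem is an estimate on metric measure spaces in which every ball of radius `r` has measure
exactly `c r ^ Q` (`RegularVolume`), applied to the control distance and Lebesgue measure of a
Carnot group.

**The commutator.** Let `B(x, ρ)` be a ball and `B(x, ρ 2ᴶ)` a ball of radius comparable to `R` that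
contains the support of `f`. Subtracting a constant from `b`, which does not change `[T, b]`, let `β`
be `b` minus its mean over `B(x, ρ)`. On `B(x, ρ 2ʲ)` the mean of `|f|` is `O(M (1 + J - j))`, since
each halving of the radius adds at most a multiple of the mean oscillation `M`, while `β` has mean
oscillation at most `Λ / (1 + J - j)` by the logarithmic condition, hence size
`O((j + 1) Λ / (1 + J - j))`. The factors `1 + J - j` cancel in the product, so `β f` has size
`O(Λ M (j + 1))`, and splitting `T(β f)` into a near part, bounded in `L²`, and a far part,
whose oscillation on `B(x, ρ)` is `O(Λ M ∑ 2⁻ʲ (j + 1))`, shows that `T(β f)` is within `O(Λ M)`, in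
mean, of a constant. In `β T f` the near part is again controlled in `L²`, and the far part is
`O(M (1 + J))`, because the kernel has mean zero on annuli and only the oscillation of `f` counts
there; this meets `|β| = O(Λ / (1 + J))`, in mean over `B(x, ρ)`. These are
`exists_integral_commutator_sub_le_of_average_eq_zero` and `SingularKernel.commutator_oscLE`. The
products are estimated through fourth moments, which is a case of the John–Nirenberg inequality
(`lintegral_osc_pow_four_le`), proved here by improving an a priori bound on truncated functions.

**The singular integral.** Boundedness on `L²` comes from the Cotlar–Stein lemma (`norm_sum_le`) for
the dyadic annular pieces of the kernel (`SingularKernel.norm_adjoint_mul_le`); the jumps of the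
cut-offs are harmless because shells are thin. The operator is a weak limit of truncations
(`SingularKernel.limitOp`). Principal values exist at Lebesgue points
(`SingularKernel.ae_tendsto_truncated`) without any maximal function: a truncated integral at `x` is
compared with an average of the limit operator near `x`, and by cancellation the limit operator of
the indicator of a ball centered at `x` is small near `x`.

**The Carnot group.** That the control distance is a metric for the Euclidean topology rests on
Chow's theorem (`CarnotGroup.exists_eventually_reach`). The span of the vectors `Ad(h) X`, with `h`
reachable and `X` horizontal, is invariant under `Ad` of reachable points, hence under brackets with
horizontal fields, hence everything by the stratification; therefore products of conjugates of
horizontal curves cover a neighborhood of the origin. Left translations have Jacobian `1`, since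
dilations leave their Jacobian at the origin unchanged while contracting the translation to the
identity (`CarnotGroup.det_fderiv_mul_left_zero`), and the dilations scale volume by `t ^ Q`.

The constant does not depend on `p`, which enters only through Hölder's inequality for `‖f‖₁`.
-/

/-! ### Metric measure spaces with exact volume growth -/

/-- The measure of every ball of radius `r` is exactly `c * r ^ Q`. The exact (rather than merely
comparable) growth makes spheres null sets and thin shells small. -/
structure RegularVolume {X : Type*} [MetricSpace X] [MeasurableSpace X] (μ : Measure X) (c : ℝ)
    (Q : ℕ) : Prop where
  pos : 0 < c
  one_le : 1 ≤ Q
  measure_ball : ∀ (x : X) (r : ℝ), 0 < r → μ (Metric.ball x r) = ENNReal.ofReal (c * r ^ Q)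

theorem pow_sub_pow_le_mul {a b : ℝ} (hb : 0 ≤ b) (hab : b ≤ a) (n : ℕ) :
    a ^ n - b ^ n ≤ n * (a - b) * a ^ (n - 1) := by
  induction n with
  | zero => simp
  | succ n ih =>
    have ha : 0 ≤ a := hb.trans hab
    rcases Nat.eq_zero_or_pos n with rfl | hn
    · simp
    · have h1 : a ^ (n + 1) - b ^ (n + 1) = a * (a ^ n - b ^ n) + (a - b) * b ^ n := by ring
      have h2 : b ^ n ≤ a ^ n := by gcongr
      have h3 : a * a ^ (n - 1) = a ^ n := by
        rw [← pow_succ', Nat.sub_add_cancel hn]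
      have h4 : a * (a ^ n - b ^ n) ≤ n * (a - b) * a ^ n := by
        calc a * (a ^ n - b ^ n) ≤ a * (n * (a - b) * a ^ (n - 1)) := by gcongr
          _ = n * (a - b) * (a * a ^ (n - 1)) := by ring
          _ = _ := by rw [h3]
      have h5 : (a - b) * b ^ n ≤ (a - b) * a ^ n :=
        mul_le_mul_of_nonneg_left h2 (by linarith)
      rw [h1, Nat.add_sub_cancel]
      push_cast
      nlinarith

namespace RegularVolume

variable {X : Type*} [MetricSpace X] [MeasurableSpace X] {μ : Measure X} {c : ℝ} {Q : ℕ}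

theorem measure_ball_lt_top (hμ : RegularVolume μ c Q) (x : X) (r : ℝ) :
    μ (Metric.ball x r) < ⊤ := by
  rcases lt_or_ge 0 r with hr | hr
  · rw [hμ.measure_ball x r hr]; exact ENNReal.ofReal_lt_top
  · simp [Metric.ball_eq_empty.2 hr]

theorem measureReal_ball (hμ : RegularVolume μ c Q) (x : X) {r : ℝ} (hr : 0 < r) :
    μ.real (Metric.ball x r) = c * r ^ Q := by
  have := hμ.pos
  rw [Measure.real, hμ.measure_ball x r hr, ENNReal.toReal_ofReal (by positivity)]

theorem measureReal_ball_pos (hμ : RegularVolume μ c Q) (x : X) {r : ℝ} (hr : 0 < r) :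
    0 < μ.real (Metric.ball x r) := by
  have := hμ.pos
  rw [hμ.measureReal_ball x hr]; positivity

theorem measure_closedBall (hμ : RegularVolume μ c Q) (x : X) {r : ℝ} (hr : 0 < r) :
    μ (Metric.closedBall x r) = ENNReal.ofReal (c * r ^ Q) := by
  apply le_antisymm
  · have h1 : Tendsto (fun s : ℝ => ENNReal.ofReal (c * s ^ Q)) (𝓝[>] r)
        (𝓝 (ENNReal.ofReal (c * r ^ Q))) := by
      apply Tendsto.mono_left _ nhdsWithin_le_nhds
      exact (ENNReal.continuous_ofReal.comp (by fun_prop)).tendsto _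
    apply ge_of_tendsto h1
    filter_upwards [self_mem_nhdsWithin] with s hs
    rw [← hμ.measure_ball x s (hr.trans hs)]
    exact measure_mono (Metric.closedBall_subset_ball hs)
  · rw [← hμ.measure_ball x r hr]
    exact measure_mono Metric.ball_subset_closedBall

theorem measure_sphere [BorelSpace X] (hμ : RegularVolume μ c Q) (x : X) {r : ℝ} (hr : 0 < r) :
    μ (Metric.sphere x r) = 0 := by
  rw [← Metric.closedBall_sdiff_ball, measure_sdiff Metric.ball_subset_closedBall
    measurableSet_ball.nullMeasurableSet (hμ.measure_ball_lt_top x r).ne,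
    hμ.measure_ball x r hr, hμ.measure_closedBall x hr, tsub_self]

theorem ball_ae_eq_closedBall [BorelSpace X] (hμ : RegularVolume μ c Q) (x : X) {r : ℝ}
    (hr : 0 < r) : Metric.ball x r =ᵐ[μ] Metric.closedBall x r := by
  rw [← Metric.ball_union_sphere]
  exact (union_ae_eq_left_of_ae_eq_empty (ae_eq_empty.2 (hμ.measure_sphere x hr))).symm

theorem restrict_closedBall [BorelSpace X] (hμ : RegularVolume μ c Q) (x : X) {r : ℝ}
    (hr : 0 < r) : μ.restrict (Metric.closedBall x r) = μ.restrict (Metric.ball x r) :=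
  (Measure.restrict_congr_set (hμ.ball_ae_eq_closedBall x hr)).symm

theorem ball_diff_le [BorelSpace X] (hμ : RegularVolume μ c Q) (x : X) {t h : ℝ} (hh : 0 < h)
    (hht : h ≤ t) : μ {y | t - h ≤ dist y x ∧ dist y x < t + h} ≤
      ENNReal.ofReal (c * (2 * Q * h * (2 * t) ^ (Q - 1))) := by
  have hc := hμ.pos
  have hset : {y | t - h ≤ dist y x ∧ dist y x < t + h} =
      Metric.ball x (t + h) \ Metric.ball x (t - h) := by
    ext y; simp [and_comm]
  have hth : 0 ≤ t - h := by linarith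
  have hball : μ (Metric.ball x (t - h)) = ENNReal.ofReal (c * (t - h) ^ Q) := by
    rcases hth.eq_or_lt with h0 | h0
    · rw [← h0]; simp [Nat.pos_iff_ne_zero.1 hμ.one_le]
    · exact hμ.measure_ball x _ h0
  rw [hset, measure_sdiff (Metric.ball_subset_ball (by linarith))
    measurableSet_ball.nullMeasurableSet (hμ.measure_ball_lt_top _ _).ne,
    hμ.measure_ball x _ (by linarith), hball, ← ENNReal.ofReal_sub _ (by positivity)]
  apply ENNReal.ofReal_le_ofReal
  rw [← mul_sub]
  gcongr
  calc (t + h) ^ Q - (t - h) ^ Q ≤ Q * ((t + h) - (t - h)) * (t + h) ^ (Q - 1) :=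
        pow_sub_pow_le_mul hth (by linarith) Q
    _ = 2 * Q * h * (t + h) ^ (Q - 1) := by ring
    _ ≤ 2 * Q * h * (2 * t) ^ (Q - 1) := by
        have : t + h ≤ 2 * t := by linarith
        have : 0 ≤ t + h := by linarith
        gcongr

theorem isUnifLocDoublingMeasure (hμ : RegularVolume μ c Q) : IsUnifLocDoublingMeasure μ := by
  refine ⟨⟨2 ^ Q, ?_⟩⟩
  filter_upwards [self_mem_nhdsWithin] with s hs x
  have hs : 0 < s := hs
  rw [hμ.measure_closedBall x hs, hμ.measure_closedBall x (by linarith)]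
  have : ((2 ^ Q : ℝ≥0) : ℝ≥0∞) = ENNReal.ofReal (2 ^ Q) := by
    rw [ENNReal.ofReal_pow (by norm_num)]; simp
  rw [this, ← ENNReal.ofReal_mul (by positivity)]
  apply ENNReal.ofReal_le_ofReal
  rw [mul_pow]; apply le_of_eq; ring

theorem isLocallyFiniteMeasure (hμ : RegularVolume μ c Q) : IsLocallyFiniteMeasure μ :=
  ⟨fun x => ⟨Metric.ball x 1, Metric.ball_mem_nhds x one_pos, hμ.measure_ball_lt_top x 1⟩⟩

/-- The volume ratio of balls is the `Q`-th power of the ratio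
of their radii. -/
theorem measureReal_ball_mul (hμ : RegularVolume μ c Q) (x y : X) {r a : ℝ} (hr : 0 < r)
    (ha : 0 < a) : μ.real (Metric.ball x (a * r)) = a ^ Q * μ.real (Metric.ball y r) := by
  rw [hμ.measureReal_ball x (by positivity), hμ.measureReal_ball y hr]; ring

end RegularVolume

/-! ### The Cotlar–Stein lemma -/

namespace CotlarStein

variable {E : Type*} [NormedAddCommGroup E] [InnerProductSpace ℝ E] [CompleteSpace E]
variable {ι : Type*}

/-- The composition `T_{i₁}† T_{j₁} T_{i₂}† T_{j₂} ⋯` read off a word of index pairs. -/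
noncomputable def word (T : ι → E →L[ℝ] E) : List (ι × ι) → E →L[ℝ] E
  | [] => 1
  | p :: w => ContinuousLinearMap.adjoint (T p.1) * T p.2 * word T w

/-- The product `γ(j, i₁) γ(i₁, j₁) γ(j₁, i₂) γ(i₂, j₂) ⋯` over the consecutive letters of a word
that is preceded by the letter `j`. -/
def weight (γ : ι → ι → ℝ) : ι → List (ι × ι) → ℝ
  | _, [] => 1
  | j, p :: w => γ j p.1 * γ p.1 p.2 * weight γ p.2 w

/-- The product `γ(i₁, j₁)² γ(i₂, j₂)² ⋯`. -/
def innerWeight (γ : ι → ι → ℝ) : List (ι × ι) → ℝ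
  | [] => 1
  | p :: w => γ p.1 p.2 ^ 2 * innerWeight γ w

/-- The product `γ(j, i₁)² γ(j₁, i₂)² ⋯`. -/
def outerWeight (γ : ι → ι → ℝ) : ι → List (ι × ι) → ℝ
  | _, [] => 1
  | j, p :: w => γ j p.1 ^ 2 * outerWeight γ p.2 w

theorem weight_sq (γ : ι → ι → ℝ) (w : List (ι × ι)) : ∀ j,
    weight γ j w ^ 2 = innerWeight γ w * outerWeight γ j w := by
  induction w with
  | nil => intro j; simp [weight, innerWeight, outerWeight]
  | cons p w ih => intro j; simp only [weight, innerWeight, outerWeight, mul_pow, ih]; ring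

theorem weight_nonneg {γ : ι → ι → ℝ} (hγ : ∀ i j, 0 ≤ γ i j) (w : List (ι × ι)) : ∀ j,
    0 ≤ weight γ j w := by
  induction w with
  | nil => intro j; simp [weight]
  | cons p w ih => intro j; exact mul_nonneg (mul_nonneg (hγ _ _) (hγ _ _)) (ih _)

theorem outerWeight_nonneg (γ : ι → ι → ℝ) (w : List (ι × ι)) : ∀ j, 0 ≤ outerWeight γ j w := by
  induction w with
  | nil => intro j; simp [outerWeight]
  | cons p w ih => intro j; exact mul_nonneg (sq_nonneg _) (ih _)

theorem norm_word_le {T : ι → E →L[ℝ] E} {γ : ι → ι → ℝ}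
    (h1 : ∀ i j, ‖ContinuousLinearMap.adjoint (T i) * T j‖ ≤ γ i j ^ 2) (w : List (ι × ι)) :
    ‖word T w‖ ≤ innerWeight γ w := by
  induction w with
  | nil => exact (ContinuousLinearMap.norm_id_le (𝕜 := ℝ) (E := E))
  | cons p w ih =>
    exact (norm_mul_le _ _).trans (mul_le_mul (h1 _ _) ih (norm_nonneg _) (sq_nonneg _))

theorem norm_mul_word_le_outerWeight {T : ι → E →L[ℝ] E} {γ : ι → ι → ℝ} {Γ : ℝ}
    (h2 : ∀ i j, ‖T i * ContinuousLinearMap.adjoint (T j)‖ ≤ γ i j ^ 2)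
    (hT : ∀ i, ‖T i‖ ≤ Γ) (w : List (ι × ι)) :
    ∀ j, ‖T j * word T w‖ ≤ outerWeight γ j w * Γ := by
  induction w with
  | nil => intro j; rw [word, outerWeight, mul_one, one_mul]; exact hT j
  | cons p w ih =>
    intro j
    have : T j * word T (p :: w) =
        (T j * ContinuousLinearMap.adjoint (T p.1)) * (T p.2 * word T w) := by
      simp only [word, mul_assoc]
    rw [this, outerWeight, mul_assoc (γ j p.1 ^ 2)]
    have e := ih p.2
    exact (ContinuousLinearMap.opNorm_comp_le (T j * ContinuousLinearMap.adjoint (T p.1))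
      (T p.2 * word T w)).trans (mul_le_mul (h2 j p.1) e (norm_nonneg _) (sq_nonneg _))

/-- The two ways of pairing neighbouring factors bound the norm of a word by two different
products; their geometric mean involves every pair of neighbours exactly once. -/
theorem norm_mul_word_le {T : ι → E →L[ℝ] E} {γ : ι → ι → ℝ} {Γ : ℝ} (hγ : ∀ i j, 0 ≤ γ i j)
    (h1 : ∀ i j, ‖ContinuousLinearMap.adjoint (T i) * T j‖ ≤ γ i j ^ 2)
    (h2 : ∀ i j, ‖T i * ContinuousLinearMap.adjoint (T j)‖ ≤ γ i j ^ 2)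
    (hT : ∀ i, ‖T i‖ ≤ Γ) (w : List (ι × ι)) (j : ι) :
    ‖T j * word T w‖ ≤ Γ * weight γ j w := by
  have hΓ : 0 ≤ Γ := (norm_nonneg _).trans (hT j)
  have a := norm_mul_word_le_outerWeight h2 hT w j
  have b : ‖T j * word T w‖ ≤ Γ * innerWeight γ w :=
    (norm_mul_le _ _).trans (mul_le_mul (hT j) (norm_word_le h1 w) (norm_nonneg _) hΓ)
  refine le_of_sq_le_sq ?_ (mul_nonneg hΓ (weight_nonneg hγ w j))
  calc ‖T j * word T w‖ ^ 2 = ‖T j * word T w‖ * ‖T j * word T w‖ := sq _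
    _ ≤ (outerWeight γ j w * Γ) * (Γ * innerWeight γ w) :=
        mul_le_mul a b (norm_nonneg _) (mul_nonneg (outerWeight_nonneg _ _ _) hΓ)
    _ = (Γ * weight γ j w) ^ 2 := by rw [mul_pow, weight_sq]; ring

variable [Fintype ι]

theorem sum_weight_le {γ : ι → ι → ℝ} {Γ : ℝ} (hγ : ∀ i j, 0 ≤ γ i j)
    (hΓ : 0 ≤ Γ) (hs : ∀ i, ∑ j, γ i j ≤ Γ) (m : ℕ) : ∀ j,
    ∑ v : Fin m → ι × ι, weight γ j (List.ofFn v) ≤ Γ ^ (2 * m) := by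
  induction m with
  | zero => intro j; simp [weight]
  | succ m ih =>
    intro j
    rw [← Fintype.sum_equiv (Fin.consEquiv (fun _ : Fin (m + 1) => ι × ι))
      (fun q => weight γ j (q.1 :: List.ofFn q.2)) _ (fun q => by
        simp [Fin.consEquiv])]
    rw [Fintype.sum_prod_type, Fintype.sum_prod_type]
    simp only [weight]
    calc ∑ i, ∑ k, ∑ v : Fin m → ι × ι, γ j i * γ i k * weight γ k (List.ofFn v)
        ≤ ∑ i, ∑ k, γ j i * γ i k * Γ ^ (2 * m) := by
          gcongr with i _ k _
          rw [← Finset.mul_sum]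
          exact mul_le_mul_of_nonneg_left (ih k) (mul_nonneg (hγ _ _) (hγ _ _))
      _ = ∑ i, γ j i * ((∑ k, γ i k) * Γ ^ (2 * m)) := by
          simp only [Finset.sum_mul, Finset.mul_sum, mul_assoc]
      _ ≤ ∑ i, γ j i * (Γ * Γ ^ (2 * m)) := by
          gcongr with i _
          · exact hγ _ _
          · exact hs i
      _ = (∑ i, γ j i) * (Γ * Γ ^ (2 * m)) := by rw [Finset.sum_mul]
      _ ≤ Γ * (Γ * Γ ^ (2 * m)) := by gcongr; exact hs j
      _ = Γ ^ (2 * (m + 1)) := by ring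

theorem pow_eq_sum_word (T : ι → E →L[ℝ] E) (m : ℕ) :
    (ContinuousLinearMap.adjoint (∑ i, T i) * ∑ i, T i) ^ m =
      ∑ v : Fin m → ι × ι, word T (List.ofFn v) := by
  induction m with
  | zero => simp [word]
  | succ m ih =>
    rw [← Fintype.sum_equiv (Fin.consEquiv (fun _ : Fin (m + 1) => ι × ι))
      (fun q => word T (q.1 :: List.ofFn q.2)) _ (fun q => by
        simp [Fin.consEquiv])]
    rw [Fintype.sum_prod_type, pow_succ', ih, map_sum, Finset.sum_mul_sum, ← Fintype.sum_prod_type',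
      Finset.sum_mul]
    simp only [word, Finset.mul_sum]

/-- **Cotlar–Stein lemma** for a finite family of operators on a real Hilbert space. -/
theorem norm_sum_le {T : ι → E →L[ℝ] E} {γ : ι → ι → ℝ} {Γ : ℝ} (hγ : ∀ i j, 0 ≤ γ i j)
    (hΓ : 0 ≤ Γ) (hs : ∀ i, ∑ j, γ i j ≤ Γ)
    (h1 : ∀ i j, ‖ContinuousLinearMap.adjoint (T i) * T j‖ ≤ γ i j ^ 2)
    (h2 : ∀ i j, ‖T i * ContinuousLinearMap.adjoint (T j)‖ ≤ γ i j ^ 2) :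
    ‖∑ i, T i‖ ≤ Γ := by
  set S := ∑ i, T i with hS
  have hT : ∀ i, ‖T i‖ ≤ Γ := fun i => by
    have h : ‖T i‖ ^ 2 ≤ γ i i ^ 2 := by
      have := h1 i i
      rwa [ContinuousLinearMap.mul_def, ContinuousLinearMap.norm_adjoint_comp_self, ← sq] at this
    have h' : γ i i ≤ Γ := (Finset.single_le_sum (f := fun j => γ i j) (fun j _ => hγ i j)
      (Finset.mem_univ i)).trans (hs i)
    exact (le_of_sq_le_sq h (hγ i i)).trans h'
  -- the factor `card ι` disappears on taking the root of order `2 m + 1`, as `m → ∞`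
  have key : ∀ m : ℕ, ‖S * (ContinuousLinearMap.adjoint S * S) ^ m‖ ≤
      Fintype.card ι * Γ ^ (2 * m + 1) := by
    intro m
    have e : S * (ContinuousLinearMap.adjoint S * S) ^ m =
        ∑ j, ∑ v : Fin m → ι × ι, T j * word T (List.ofFn v) := by
      rw [hS, pow_eq_sum_word, Finset.sum_mul_sum]
    rw [e]
    calc ‖∑ j, ∑ v : Fin m → ι × ι, T j * word T (List.ofFn v)‖
        ≤ ∑ j, ∑ v : Fin m → ι × ι, ‖T j * word T (List.ofFn v)‖ :=
          (_root_.norm_sum_le _ _).trans (Finset.sum_le_sum fun j _ => _root_.norm_sum_le _ _)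
      _ ≤ ∑ j, ∑ v : Fin m → ι × ι, Γ * weight γ j (List.ofFn v) := by
          gcongr with j _ v _
          exact norm_mul_word_le hγ h1 h2 hT _ j
      _ ≤ ∑ _j : ι, Γ * Γ ^ (2 * m) := by
          gcongr with j _
          rw [← Finset.mul_sum]
          exact mul_le_mul_of_nonneg_left (sum_weight_le hγ hΓ hs m j) hΓ
      _ = Fintype.card ι * Γ ^ (2 * m + 1) := by
          rw [Finset.sum_const, Finset.card_univ, nsmul_eq_mul]; ring
  -- `S† S` is self-adjoint, so repeated squaring computes the norm of its powers exactly
  have hpow : ∀ k : ℕ, ‖(ContinuousLinearMap.adjoint S * S) ^ 2 ^ k‖ = ‖S‖ ^ (2 * 2 ^ k) := by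
    have hadj : ∀ n : ℕ, ContinuousLinearMap.adjoint ((ContinuousLinearMap.adjoint S * S) ^ n) =
        (ContinuousLinearMap.adjoint S * S) ^ n := by
      intro n
      induction n with
      | zero => exact ContinuousLinearMap.adjoint_id
      | succ n ih =>
        rw [pow_succ, ContinuousLinearMap.mul_def, ContinuousLinearMap.adjoint_comp, ih,
          ContinuousLinearMap.mul_def, ContinuousLinearMap.adjoint_comp,
          ContinuousLinearMap.adjoint_adjoint]
        exact (pow_succ' _ n).symm.trans (pow_succ _ n)
    intro k
    induction k with
    | zero =>
      rw [pow_zero, pow_one, ContinuousLinearMap.mul_def,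
        ContinuousLinearMap.norm_adjoint_comp_self, mul_one, sq]
    | succ k ih =>
      have e : (ContinuousLinearMap.adjoint S * S) ^ 2 ^ (k + 1) =
          ContinuousLinearMap.adjoint ((ContinuousLinearMap.adjoint S * S) ^ 2 ^ k) ∘L
            (ContinuousLinearMap.adjoint S * S) ^ 2 ^ k := by
        rw [hadj, ← ContinuousLinearMap.mul_def, ← pow_add]; ring_nf
      rw [e, ContinuousLinearMap.norm_adjoint_comp_self, ih]; ring
  by_contra! hlt
  have hSpos : 0 < ‖S‖ := hΓ.trans_lt hlt
  have hb : ∀ k : ℕ, ‖S‖ ^ (2 * 2 ^ k - 1) ≤ Fintype.card ι * Γ ^ (2 * 2 ^ k - 1) := by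
    intro k
    obtain ⟨m, hm⟩ : ∃ m, 2 ^ k = m + 1 := ⟨2 ^ k - 1, (Nat.sub_add_cancel Nat.one_le_two_pow).symm⟩
    have h3 := hpow k
    have h4 := key m
    have e1 : 2 * 2 ^ k - 1 = 2 * m + 1 := by omega
    rw [e1]
    have h5 : ‖S‖ ^ (2 * m + 1) * ‖S‖ ≤ (Fintype.card ι * Γ ^ (2 * m + 1)) * ‖S‖ := by
      calc ‖S‖ ^ (2 * m + 1) * ‖S‖ = ‖(ContinuousLinearMap.adjoint S * S) ^ 2 ^ k‖ := by
            rw [h3, hm, ← pow_succ]; ring_nf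
        _ = ‖ContinuousLinearMap.adjoint S * (S * (ContinuousLinearMap.adjoint S * S) ^ m)‖ := by
            rw [hm, pow_succ', mul_assoc]
        _ ≤ ‖S‖ * (Fintype.card ι * Γ ^ (2 * m + 1)) := by
            refine (norm_mul_le _ _).trans ?_
            rw [LinearIsometryEquiv.norm_map]
            gcongr
        _ = _ := by ring
    exact le_of_mul_le_mul_right h5 hSpos
  rcases hΓ.eq_or_lt with h0 | h0
  · have := hb 0
    rw [← h0] at this
    simp at this
    exact absurd this (norm_pos_iff.1 hSpos)
  · have hq : 1 < ‖S‖ / Γ := (one_lt_div h0).2 hlt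
    have hlim := (tendsto_pow_atTop_atTop_of_one_lt hq)
    obtain ⟨n, hn⟩ := (hlim.eventually_gt_atTop (Fintype.card ι : ℝ)).exists_forall_of_atTop
    have hge : n ≤ 2 * 2 ^ n - 1 := by have := Nat.lt_two_pow_self (n := n); omega
    have h6 := hn _ hge
    rw [div_pow, lt_div_iff₀ (by positivity)] at h6
    exact absurd (hb n) (not_le.2 h6)

end CotlarStein

/-! ### Integral operators on `L²` -/

theorem eLpNorm_two_sq {X : Type*} [MeasurableSpace X] {μ : Measure X} (f : X → ℝ) :
    eLpNorm f 2 μ ^ 2 = ∫⁻ x, ‖f x‖ₑ ^ 2 ∂μ := by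
  rw [eLpNorm_eq_lintegral_rpow_enorm_toReal (by norm_num) (by norm_num), ← ENNReal.rpow_natCast,
    ← ENNReal.rpow_mul]
  simp

/-- **Schur test** for a nonnegative kernel. -/
theorem lintegral_sq_lintegral_mul_le {X : Type*} [MeasurableSpace X] {μ : Measure X} [SFinite μ]
    {K : X → X → ℝ≥0∞} (hK : Measurable (Function.uncurry K)) {F : X → ℝ≥0∞} (hF : Measurable F)
    {M₁ M₂ : ℝ≥0∞} (h1 : ∀ x, ∫⁻ y, K x y ∂μ ≤ M₁) (h2 : ∀ y, ∫⁻ x, K x y ∂μ ≤ M₂) :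
    ∫⁻ x, (∫⁻ y, K x y * F y ∂μ) ^ 2 ∂μ ≤ M₁ * M₂ * ∫⁻ x, F x ^ 2 ∂μ := by
  have hKx : ∀ x, Measurable (K x) := fun x => hK.comp measurable_prodMk_left
  have hpt : ∀ x, (∫⁻ y, K x y * F y ∂μ) ^ 2 ≤ M₁ * ∫⁻ y, K x y * F y ^ 2 ∂μ := by
    intro x
    have h := ENNReal.lintegral_mul_le_Lp_mul_Lq μ (p := 2) (q := 2)
      (Real.holderConjugate_iff.2 ⟨by norm_num, by norm_num⟩)
      (f := fun y => K x y ^ (1 / 2 : ℝ)) (g := fun y => K x y ^ (1 / 2 : ℝ) * F y)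
      ((hKx x).pow_const _).aemeasurable (((hKx x).pow_const _).mul hF).aemeasurable
    have e0 : ∀ a : ℝ≥0∞, a ^ (1 / 2 : ℝ) * a ^ (1 / 2 : ℝ) = a := fun a => by
      rw [← ENNReal.rpow_add_of_nonneg _ _ (by norm_num) (by norm_num)]; norm_num
    have e1 : ∀ y, ((fun y => K x y ^ (1 / 2 : ℝ)) * fun y => K x y ^ (1 / 2 : ℝ) * F y) y =
        K x y * F y := fun y => by
      simp only [Pi.mul_apply]; rw [← mul_assoc, e0]
    simp only [e1, ENNReal.rpow_two] at h
    have e2 : ∀ a : ℝ≥0∞, (a ^ (1 / 2 : ℝ)) ^ 2 = a := fun a => by rw [sq, e0]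
    simp only [mul_pow, e2] at h
    calc (∫⁻ y, K x y * F y ∂μ) ^ 2 ≤ ((∫⁻ y, K x y ∂μ) ^ (1 / 2 : ℝ) *
          (∫⁻ y, K x y * F y ^ 2 ∂μ) ^ (1 / 2 : ℝ)) ^ 2 := by gcongr
      _ = (∫⁻ y, K x y ∂μ) * ∫⁻ y, K x y * F y ^ 2 ∂μ := by rw [mul_pow, e2, e2]
      _ ≤ _ := by gcongr; exact h1 x
  calc ∫⁻ x, (∫⁻ y, K x y * F y ∂μ) ^ 2 ∂μ ≤ ∫⁻ x, M₁ * ∫⁻ y, K x y * F y ^ 2 ∂μ ∂μ :=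
        lintegral_mono hpt
    _ = M₁ * ∫⁻ x, ∫⁻ y, K x y * F y ^ 2 ∂μ ∂μ := by
        refine lintegral_const_mul _ (Measurable.lintegral_prod_right ?_)
        exact hK.mul ((hF.comp measurable_snd).pow_const 2)
    _ = M₁ * ∫⁻ y, ∫⁻ x, K x y * F y ^ 2 ∂μ ∂μ := by
        rw [lintegral_lintegral_swap]
        exact (hK.mul ((hF.comp measurable_snd).pow_const 2)).aemeasurable
    _ = M₁ * ∫⁻ y, (∫⁻ x, K x y ∂μ) * F y ^ 2 ∂μ := by
        congr 1
        refine lintegral_congr fun y => lintegral_mul_const _ (hK.comp measurable_prodMk_right)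
    _ ≤ M₁ * ∫⁻ y, M₂ * F y ^ 2 ∂μ := by gcongr with y; exact h2 y
    _ = M₁ * M₂ * ∫⁻ x, F x ^ 2 ∂μ := by
        rw [lintegral_const_mul _ (hF.pow_const 2), mul_assoc]

/-- A kernel that satisfies the hypotheses of Schur's test with constant `M`. -/
structure SchurKernel {X : Type*} [MeasurableSpace X] (μ : Measure X) (K : X → X → ℝ)
    (M : ℝ≥0) : Prop where
  measurable : Measurable (Function.uncurry K)
  row : ∀ x, ∫⁻ y, ‖K x y‖ₑ ∂μ ≤ M
  col : ∀ y, ∫⁻ x, ‖K x y‖ₑ ∂μ ≤ M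

namespace SchurKernel

variable {X : Type*} [MeasurableSpace X] {μ : Measure X} {K : X → X → ℝ} {M : ℝ≥0}

theorem swap (hK : SchurKernel μ K M) : SchurKernel μ (fun x y => K y x) M :=
  ⟨hK.measurable.comp measurable_swap, hK.col, hK.row⟩

theorem measurable_mul_snd (hK : SchurKernel μ K M) (f : Lp ℝ 2 μ) :
    Measurable (fun p : X × X => K p.1 p.2 * f p.2) :=
  hK.measurable.mul ((Lp.stronglyMeasurable f).measurable.comp measurable_snd)

variable [SFinite μ]

theorem lintegral_sq_le (hK : SchurKernel μ K M) {f : X → ℝ} (hf : Measurable f) :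
    ∫⁻ x, (∫⁻ y, ‖K x y‖ₑ * ‖f y‖ₑ ∂μ) ^ 2 ∂μ ≤ M ^ 2 * ∫⁻ x, ‖f x‖ₑ ^ 2 ∂μ := by
  rw [sq (M : ℝ≥0∞)]
  exact lintegral_sq_lintegral_mul_le (K := fun x y => ‖K x y‖ₑ) hK.measurable.enorm hf.enorm
    hK.row hK.col

theorem lintegral_sq_lt_top (hK : SchurKernel μ K M) (f : Lp ℝ 2 μ) :
    ∫⁻ x, (∫⁻ y, ‖K x y‖ₑ * ‖f y‖ₑ ∂μ) ^ 2 ∂μ < ⊤ := by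
  refine (hK.lintegral_sq_le (Lp.stronglyMeasurable f).measurable).trans_lt ?_
  rw [← eLpNorm_two_sq]
  exact ENNReal.mul_lt_top (by simp) (ENNReal.pow_lt_top (Lp.memLp f).eLpNorm_lt_top)

theorem ae_integrable (hK : SchurKernel μ K M) (f : Lp ℝ 2 μ) :
    ∀ᵐ x ∂μ, Integrable (fun y => K x y * f y) μ := by
  have hm : Measurable fun x => (∫⁻ y, ‖K x y‖ₑ * ‖f y‖ₑ ∂μ) ^ 2 := by
    have : Measurable fun p : X × X => ‖K p.1 p.2‖ₑ * ‖f p.2‖ₑ := by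
      simpa only [enorm_mul] using (hK.measurable_mul_snd f).enorm
    exact (Measurable.lintegral_prod_right' this).pow_const 2
  filter_upwards [ae_lt_top hm (hK.lintegral_sq_lt_top f).ne] with x hx
  refine ⟨((hK.measurable_mul_snd f).comp measurable_prodMk_left).aestronglyMeasurable, ?_⟩
  rw [hasFiniteIntegral_iff_enorm]
  simp only [enorm_mul]
  by_contra h
  rw [not_lt_top_iff.1 h] at hx
  simp at hx

theorem memLp (hK : SchurKernel μ K M) (f : Lp ℝ 2 μ) :
    MemLp (fun x => ∫ y, K x y * f y ∂μ) 2 μ ∧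
      eLpNorm (fun x => ∫ y, K x y * f y ∂μ) 2 μ ≤ M * eLpNorm f 2 μ := by
  have hsm : StronglyMeasurable (fun x => ∫ y, K x y * f y ∂μ) :=
    (hK.measurable_mul_snd f).stronglyMeasurable.integral_prod_right
  have hle : eLpNorm (fun x => ∫ y, K x y * f y ∂μ) 2 μ ≤ M * eLpNorm f 2 μ := by
    rw [← ENNReal.pow_le_pow_left_iff (n := 2) two_ne_zero, mul_pow, eLpNorm_two_sq, eLpNorm_two_sq]
    refine le_trans ?_ (hK.lintegral_sq_le (Lp.stronglyMeasurable f).measurable)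
    gcongr with x
    refine (enorm_integral_le_lintegral_enorm _).trans ?_
    simp only [enorm_mul, le_refl]
  exact ⟨⟨hsm.aestronglyMeasurable, hle.trans_lt
    (ENNReal.mul_lt_top (by simp) (Lp.memLp f).eLpNorm_lt_top)⟩, hle⟩

/-- The integral operator on `L²` with a Schur kernel. -/
noncomputable def op (hK : SchurKernel μ K M) : Lp ℝ 2 μ →L[ℝ] Lp ℝ 2 μ :=
  LinearMap.mkContinuous
    { toFun := fun f => (hK.memLp f).1.toLp _
      map_add' := fun f g => by
        rw [← MemLp.toLp_add]
        refine MemLp.toLp_congr _ _ ?_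
        filter_upwards [hK.ae_integrable f, hK.ae_integrable g] with x h1 h2
        rw [Pi.add_apply, ← integral_add h1 h2]
        refine integral_congr_ae ?_
        filter_upwards [Lp.coeFn_add f g] with y hy
        rw [hy, Pi.add_apply, mul_add]
      map_smul' := fun a f => by
        rw [RingHom.id_apply, ← MemLp.toLp_const_smul]
        refine MemLp.toLp_congr _ _ (Eventually.of_forall fun x => ?_)
        simp only [Pi.smul_apply, smul_eq_mul]
        rw [← integral_const_mul]
        refine integral_congr_ae ?_
        filter_upwards [Lp.coeFn_smul a f] with y hy
        rw [hy, Pi.smul_apply, smul_eq_mul]; ring }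
    M fun f => by
      simp only [LinearMap.coe_mk, AddHom.coe_mk]
      rw [Lp.norm_toLp, Lp.norm_def, ← ENNReal.coe_toReal M, ← ENNReal.toReal_mul]
      exact ENNReal.toReal_mono
        (ENNReal.mul_lt_top (by simp) (Lp.memLp f).eLpNorm_lt_top).ne (hK.memLp f).2

theorem norm_op_le (hK : SchurKernel μ K M) : ‖hK.op‖ ≤ M :=
  LinearMap.mkContinuous_norm_le _ M.2 _

theorem op_ae (hK : SchurKernel μ K M) (f : Lp ℝ 2 μ) :
    hK.op f =ᵐ[μ] fun x => ∫ y, K x y * f y ∂μ :=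
  (hK.memLp f).1.coeFn_toLp

theorem integrable_prod (hK : SchurKernel μ K M) (f g : Lp ℝ 2 μ) :
    Integrable (fun p : X × X => K p.1 p.2 * f p.2 * g p.1) (μ.prod μ) := by
  have hg := (Lp.stronglyMeasurable g).measurable
  have hf := (Lp.stronglyMeasurable f).measurable
  have hm := (hK.measurable_mul_snd f).mul (hg.comp measurable_fst)
  refine ⟨hm.aestronglyMeasurable, ?_⟩
  rw [hasFiniteIntegral_iff_enorm]
  have hKe : Measurable (fun p : X × X => ‖K p.1 p.2‖ₑ) := hK.measurable.enorm
  have hf2 : ∫⁻ y, ‖f y‖ₑ ^ 2 ∂μ < ⊤ := by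
    rw [← eLpNorm_two_sq]; exact ENNReal.pow_lt_top (Lp.memLp f).eLpNorm_lt_top
  have hg2 : ∫⁻ y, ‖g y‖ₑ ^ 2 ∂μ < ⊤ := by
    rw [← eLpNorm_two_sq]; exact ENNReal.pow_lt_top (Lp.memLp g).eLpNorm_lt_top
  calc ∫⁻ p : X × X, ‖K p.1 p.2 * f p.2 * g p.1‖ₑ ∂μ.prod μ
      ≤ ∫⁻ p : X × X, (‖K p.1 p.2‖ₑ * ‖f p.2‖ₑ ^ 2 + ‖K p.1 p.2‖ₑ * ‖g p.1‖ₑ ^ 2) ∂μ.prod μ := by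
        refine lintegral_mono fun p => ?_
        simp only [enorm_mul]
        rw [mul_assoc, ← mul_add]
        gcongr
        rcases le_total ‖f p.2‖ₑ ‖g p.1‖ₑ with h | h
        · exact le_add_left (by rw [sq]; gcongr)
        · exact le_add_right (by rw [sq]; gcongr)
    _ = (∫⁻ p : X × X, ‖K p.1 p.2‖ₑ * ‖f p.2‖ₑ ^ 2 ∂μ.prod μ) +
          ∫⁻ p : X × X, ‖K p.1 p.2‖ₑ * ‖g p.1‖ₑ ^ 2 ∂μ.prod μ := by
        rw [lintegral_add_left]
        exact hKe.mul ((hf.comp measurable_snd).enorm.pow_const 2)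
    _ = (∫⁻ y, ∫⁻ x, ‖K x y‖ₑ * ‖f y‖ₑ ^ 2 ∂μ ∂μ) + ∫⁻ x, ∫⁻ y, ‖K x y‖ₑ * ‖g x‖ₑ ^ 2 ∂μ ∂μ := by
        rw [lintegral_prod_symm, lintegral_prod]
        · exact (hKe.mul ((hg.comp measurable_fst).enorm.pow_const 2)).aemeasurable
        · exact (hKe.mul ((hf.comp measurable_snd).enorm.pow_const 2)).aemeasurable
    _ ≤ (∫⁻ y, M * ‖f y‖ₑ ^ 2 ∂μ) + ∫⁻ x, M * ‖g x‖ₑ ^ 2 ∂μ := by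
        gcongr with y x
        · rw [lintegral_mul_const _ (f := fun x => ‖K x y‖ₑ) (hKe.comp measurable_prodMk_right)]
          gcongr; exact hK.col y
        · rw [lintegral_mul_const _ (f := fun y => ‖K x y‖ₑ) (hKe.comp measurable_prodMk_left)]
          gcongr; exact hK.row x
    _ < ⊤ := by
        rw [lintegral_const_mul _ (hf.enorm.pow_const 2), lintegral_const_mul _ (hg.enorm.pow_const 2)]
        exact ENNReal.add_lt_top.2 ⟨ENNReal.mul_lt_top (by simp) hf2, ENNReal.mul_lt_top (by simp) hg2⟩

theorem adjoint_op (hK : SchurKernel μ K M) :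
    ContinuousLinearMap.adjoint hK.op = hK.swap.op := by
  symm
  rw [ContinuousLinearMap.eq_adjoint_iff]
  intro g f
  rw [L2.inner_def, L2.inner_def]
  have h1 : ∫ a, inner ℝ (hK.swap.op g a) (f a) ∂μ = ∫ y, ∫ x, K x y * f y * g x ∂μ ∂μ := by
    refine integral_congr_ae ?_
    filter_upwards [hK.swap.op_ae g] with y hy
    rw [hy, RCLike.inner_apply, conj_trivial, ← integral_const_mul]
    refine integral_congr_ae (Eventually.of_forall fun x => ?_)
    simp only; ring
  have h2 : ∫ a, inner ℝ (g a) (hK.op f a) ∂μ = ∫ x, ∫ y, K x y * f y * g x ∂μ ∂μ := by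
    refine integral_congr_ae ?_
    filter_upwards [hK.op_ae f] with x hx
    rw [hx, RCLike.inner_apply, conj_trivial, ← integral_mul_const]
  rw [h1, h2]
  exact (integral_integral_swap (hK.integrable_prod f g)).symm

end SchurKernel

/-! ### Singular kernels and their annular pieces -/

/-- A singular kernel on a metric measure space with the standard size and smoothness estimates and
vanishing integrals over annuli in each variable. -/
structure SingularKernel {X : Type*} [MetricSpace X] [MeasurableSpace X] (μ : Measure X) (Q : ℕ)
    (A B : ℝ) (k : X → X → ℝ) : Prop where
  size_nonneg : 0 ≤ A
  smooth_nonneg : 0 ≤ B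
  measurable : Measurable (Function.uncurry k)
  size : ∀ x y, x ≠ y → |k x y| ≤ A / dist x y ^ Q
  smooth : ∀ x₀ x y, 2 * dist x₀ x ≤ dist x₀ y →
    |k x y - k x₀ y| + |k y x - k y x₀| ≤ B * (dist x₀ x / dist x₀ y ^ (Q + 1))
  cancel : ∀ r₁ r₂ : ℝ, 0 < r₁ → r₁ < r₂ → ∀ x,
    (∫ y in {y | r₁ < dist x y ∧ dist x y < r₂}, k x y ∂μ) = 0 ∧
    (∫ y in {y | r₁ < dist x y ∧ dist x y < r₂}, k y x ∂μ) = 0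

open Classical in
/-- The part `k(x, y) 1_{r < d(x, y) ≤ s}` of a kernel. -/
noncomputable def annular {X : Type*} [MetricSpace X] (k : X → X → ℝ) (r s : ℝ) (x y : X) : ℝ :=
  if r < dist x y ∧ dist x y ≤ s then k x y else 0

theorem annular_add {X : Type*} [MetricSpace X] (k : X → X → ℝ) {r s t : ℝ} (hrs : r ≤ s)
    (hst : s ≤ t) (x y : X) : annular k r s x y + annular k s t x y = annular k r t x y := by
  unfold annular
  by_cases h1 : dist x y ≤ s
  · have h2 : ¬ (s < dist x y ∧ dist x y ≤ t) := fun h => absurd h.1 (not_lt.2 h1)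
    rw [if_neg h2, add_zero]
    exact if_congr ⟨fun h => ⟨h.1, h.2.trans hst⟩, fun h => ⟨h.1, h1⟩⟩ rfl rfl
  · have h2 : ¬ (r < dist x y ∧ dist x y ≤ s) := fun h => h1 h.2
    rw [if_neg h2, zero_add]
    push Not at h1
    exact if_congr ⟨fun h => ⟨hrs.trans_lt h.1, h.2⟩, fun h => ⟨h1, h.2⟩⟩ rfl rfl

theorem annular_swap {X : Type*} [MetricSpace X] (k : X → X → ℝ) (r s : ℝ) (x y : X) :
    annular (fun x y => k y x) r s x y = annular k r s y x := by
  simp only [annular, dist_comm]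

open Classical in
/-- A majorant of `|annular k ρ (2ρ) z y - annular k ρ (2ρ) x y|` for `d(x, z) < h`: the first term
comes from the smoothness of the kernel, the other two from the jumps of the cut-off. -/
noncomputable def jumpMajorant {X : Type*} [MetricSpace X] (Q : ℕ) (A B ρ h : ℝ) (x y : X) : ℝ :=
  (if dist x y ≤ 2 * ρ then B * (h / ρ ^ (Q + 1)) else 0) +
    ((if ρ - h ≤ dist x y ∧ dist x y < ρ + h then A / ρ ^ Q else 0) +
      (if 2 * ρ - h ≤ dist x y ∧ dist x y < 2 * ρ + h then A / ρ ^ Q else 0))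

namespace SingularKernel

variable {X : Type*} [MetricSpace X] [MeasurableSpace X] {μ : Measure X} {c : ℝ} {Q : ℕ}
  {A B : ℝ} {k : X → X → ℝ}

theorem swap (hk : SingularKernel μ Q A B k) : SingularKernel μ Q A B (fun x y => k y x) where
  size_nonneg := hk.size_nonneg
  smooth_nonneg := hk.smooth_nonneg
  measurable := hk.measurable.comp measurable_swap
  size x y h := by rw [dist_comm]; exact hk.size y x h.symm
  smooth x₀ x y h := by rw [add_comm]; exact hk.smooth x₀ x y h
  cancel r₁ r₂ h1 h2 x := (hk.cancel r₁ r₂ h1 h2 x).symm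

theorem abs_annular_le (hk : SingularKernel μ Q A B k) {r : ℝ} (hr : 0 < r) (s : ℝ) (x y : X) :
    |annular k r s x y| ≤ A / r ^ Q := by
  have := hk.size_nonneg
  unfold annular
  split_ifs with h
  · refine (hk.size x y (dist_pos.1 (hr.trans h.1))).trans ?_
    have := h.1.le
    gcongr
  · rw [abs_zero]; positivity

variable [BorelSpace X]

theorem lintegral_annular_le (hμ : RegularVolume μ c Q) (hk : SingularKernel μ Q A B k) {r s : ℝ}
    (hr : 0 < r) (hrs : r ≤ s) (x : X) :
    ∫⁻ y, ‖annular k r s x y‖ₑ ∂μ ≤ ENNReal.ofReal (A * c * (s / r) ^ Q) := by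
  have hA := hk.size_nonneg
  have hc := hμ.pos
  calc ∫⁻ y, ‖annular k r s x y‖ₑ ∂μ
      ≤ ∫⁻ y, (Metric.closedBall x s).indicator (fun _ => ENNReal.ofReal (A / r ^ Q)) y ∂μ := by
        refine lintegral_mono fun y => ?_
        by_cases h : y ∈ Metric.closedBall x s
        · rw [indicator_of_mem h, Real.enorm_eq_ofReal_abs]
          exact ENNReal.ofReal_le_ofReal (hk.abs_annular_le hr s x y)
        · rw [indicator_of_notMem h, annular, if_neg]
          · simp
          · rintro ⟨-, h'⟩; exact h (by rwa [Metric.mem_closedBall, dist_comm])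
    _ = ENNReal.ofReal (A * c * (s / r) ^ Q) := by
        rw [lintegral_indicator measurableSet_closedBall, setLIntegral_const,
          hμ.measure_closedBall x (hr.trans_le hrs), ← ENNReal.ofReal_mul (by positivity)]
        congr 1; rw [div_pow]; ring

variable [SecondCountableTopology X]

theorem measurable_annular (hk : SingularKernel μ Q A B k) (r s : ℝ) :
    Measurable (Function.uncurry (annular k r s)) := by
  classical
  have : Function.uncurry (annular k r s) =
      fun p : X × X => if r < dist p.1 p.2 ∧ dist p.1 p.2 ≤ s then k p.1 p.2 else 0 := by
    ext p; simp only [Function.uncurry, annular]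
  rw [this]
  refine Measurable.ite ?_ hk.measurable measurable_const
  exact (measurableSet_lt measurable_const measurable_dist).inter
    (measurableSet_le measurable_dist measurable_const)

theorem schurKernel_annular (hμ : RegularVolume μ c Q) (hk : SingularKernel μ Q A B k) {r s : ℝ}
    (hr : 0 < r) (hrs : r ≤ s) :
    SchurKernel μ (annular k r s) (A * c * (s / r) ^ Q).toNNReal where
  measurable := hk.measurable_annular r s
  row x := hk.lintegral_annular_le hμ hr hrs x
  col y := by
    have := hk.swap.lintegral_annular_le hμ hr hrs y
    simp only [annular_swap] at this
    exact this

theorem integral_annular (hμ : RegularVolume μ c Q) (hk : SingularKernel μ Q A B k) {r s : ℝ}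
    (hr : 0 < r) (hrs : r < s) (x : X) : ∫ y, annular k r s x y ∂μ = 0 := by
  have hset : MeasurableSet {y | r < dist x y ∧ dist x y ≤ s} :=
    (measurableSet_lt measurable_const (measurable_const.dist measurable_id)).inter
      (measurableSet_le (measurable_const.dist measurable_id) measurable_const)
  have h1 : annular k r s x = {y | r < dist x y ∧ dist x y ≤ s}.indicator (k x) := by
    ext y
    by_cases hy : r < dist x y ∧ dist x y ≤ s
    · rw [annular, if_pos hy, indicator_of_mem (by exact hy)]
    · rw [annular, if_neg hy, indicator_of_notMem (by exact hy)]
  rw [h1, integral_indicator hset, ← (hk.cancel r s hr hrs x).1]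
  refine setIntegral_congr_set ?_
  have hs : ∀ᵐ y ∂μ, y ∉ Metric.sphere x s :=
    measure_eq_zero_iff_ae_notMem.1 (hμ.measure_sphere x (hr.trans hrs))
  filter_upwards [hs] with y hy
  have hne : dist x y ≠ s := by rwa [Metric.mem_sphere, dist_comm] at hy
  refine propext ⟨fun h => ⟨h.1, lt_of_le_of_ne h.2 hne⟩, fun h => ⟨h.1, h.2.le⟩⟩

omit [BorelSpace X] [SecondCountableTopology X] in
/-- If only one of `x` and `z` sees `y` in its annulus, then `d(x, y)` is within `h` of one of the
radii; the restriction `h ≤ ρ / 2` makes the smoothness estimate available otherwise. -/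
theorem abs_annular_sub_le (hk : SingularKernel μ Q A B k) {ρ h : ℝ} (hρ : 0 < ρ)
    (hhρ : h ≤ ρ / 2) {x z : X} (hxz : dist x z < h) (y : X) :
    |annular k ρ (2 * ρ) z y - annular k ρ (2 * ρ) x y| ≤ jumpMajorant Q A B ρ h x y := by
  have hA := hk.size_nonneg
  have hB := hk.smooth_nonneg
  have hh : 0 < h := dist_nonneg.trans_lt hxz
  have t1 : dist x y ≤ dist x z + dist z y := dist_triangle _ _ _
  have t2 : dist z y ≤ dist x z + dist x y := by
    rw [dist_comm x z]; exact dist_triangle _ _ _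
  have n1 : 0 ≤ (if dist x y ≤ 2 * ρ then B * (h / ρ ^ (Q + 1)) else 0) := by
    split_ifs <;> positivity
  have n2 : 0 ≤ (if ρ - h ≤ dist x y ∧ dist x y < ρ + h then A / ρ ^ Q else 0) := by
    split_ifs <;> positivity
  have n3 : 0 ≤ (if 2 * ρ - h ≤ dist x y ∧ dist x y < 2 * ρ + h then A / ρ ^ Q else 0) := by
    split_ifs <;> positivity
  have jump : (ρ - h ≤ dist x y ∧ dist x y < ρ + h) ∨
      (2 * ρ - h ≤ dist x y ∧ dist x y < 2 * ρ + h) →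
      A / ρ ^ Q ≤ jumpMajorant Q A B ρ h x y := by
    rintro (h1 | h1) <;> unfold jumpMajorant <;> rw [if_pos h1] <;>
      rw [if_pos h1] at * <;> linarith
  by_cases hx : ρ < dist x y ∧ dist x y ≤ 2 * ρ <;> by_cases hz : ρ < dist z y ∧ dist z y ≤ 2 * ρ
  · have e1 : annular k ρ (2 * ρ) x y = k x y := if_pos hx
    have e2 : annular k ρ (2 * ρ) z y = k z y := if_pos hz
    rw [e1, e2]
    have h1 := hk.smooth x z y (by linarith [hx.1])
    have h2 : B * (dist x z / dist x y ^ (Q + 1)) ≤ B * (h / ρ ^ (Q + 1)) := by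
      have := hx.1.le
      gcongr
    unfold jumpMajorant
    rw [if_pos hx.2] at *
    linarith [abs_nonneg (k y z - k y x)]
  · have e2 : annular k ρ (2 * ρ) z y = 0 := if_neg hz
    rw [e2, zero_sub, abs_neg]
    refine (hk.abs_annular_le hρ _ x y).trans (jump ?_)
    rw [not_and_or, not_lt, not_le] at hz
    rcases hz with hz | hz
    · left; constructor <;> linarith [hx.1]
    · right; constructor <;> linarith [hx.2]
  · have e2 : annular k ρ (2 * ρ) x y = 0 := if_neg hx
    rw [e2, sub_zero]
    refine (hk.abs_annular_le hρ _ z y).trans (jump ?_)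
    rw [not_and_or, not_lt, not_le] at hx
    rcases hx with hx | hx
    · left; constructor <;> linarith [hz.1]
    · right; constructor <;> linarith [hz.2]
  · have e1 : annular k ρ (2 * ρ) x y = 0 := if_neg hx
    have e2 : annular k ρ (2 * ρ) z y = 0 := if_neg hz
    rw [e1, e2, sub_zero, abs_zero]
    unfold jumpMajorant; linarith

end SingularKernel

/-- The Schur constant of `jumpMajorant`, divided by `h / ρ`. -/
noncomputable def jumpConst (c : ℝ) (Q : ℕ) (A B : ℝ) : ℝ :=
  c * (B * 2 ^ Q + A * (2 * Q) * (2 ^ (Q - 1) + 4 ^ (Q - 1)))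

theorem schurKernel_jumpMajorant {X : Type*} [MetricSpace X] [MeasurableSpace X] {μ : Measure X}
    {c : ℝ} {Q : ℕ} {A B : ℝ} [BorelSpace X] [SecondCountableTopology X]
    (hμ : RegularVolume μ c Q) (hA : 0 ≤ A) (hB : 0 ≤ B) {ρ h : ℝ} (hρ : 0 < ρ) (hh : 0 < h)
    (hhρ : h ≤ ρ / 2) :
    SchurKernel μ (jumpMajorant Q A B ρ h) (jumpConst c Q A B * (h / ρ)).toNNReal := by
  classical
  have hc := hμ.pos
  have hmeas : Measurable (Function.uncurry (jumpMajorant Q A B ρ h (X := X))) := by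
    have : Function.uncurry (jumpMajorant Q A B ρ h (X := X)) = fun p : X × X =>
        (if dist p.1 p.2 ≤ 2 * ρ then B * (h / ρ ^ (Q + 1)) else 0) +
        ((if ρ - h ≤ dist p.1 p.2 ∧ dist p.1 p.2 < ρ + h then A / ρ ^ Q else 0) +
        (if 2 * ρ - h ≤ dist p.1 p.2 ∧ dist p.1 p.2 < 2 * ρ + h then A / ρ ^ Q else 0)) := by
      ext p; simp only [Function.uncurry, jumpMajorant]
    rw [this]
    refine (Measurable.ite ?_ measurable_const measurable_const).add
      ((Measurable.ite ?_ measurable_const measurable_const).add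
        (Measurable.ite ?_ measurable_const measurable_const))
    · exact measurableSet_le measurable_dist measurable_const
    · exact (measurableSet_le measurable_const measurable_dist).inter
        (measurableSet_lt measurable_dist measurable_const)
    · exact (measurableSet_le measurable_const measurable_dist).inter
        (measurableSet_lt measurable_dist measurable_const)
  have hrow : ∀ x : X, ∫⁻ y, ‖jumpMajorant Q A B ρ h x y‖ₑ ∂μ ≤
      ENNReal.ofReal (jumpConst c Q A B * (h / ρ)) := by
    intro x
    have hS : ∀ t, MeasurableSet {y | t - h ≤ dist y x ∧ dist y x < t + h} := fun t =>
      (measurableSet_le measurable_const (measurable_id.dist measurable_const)).inter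
        (measurableSet_lt (measurable_id.dist measurable_const) measurable_const)
    have hle : ∀ y, ‖jumpMajorant Q A B ρ h x y‖ₑ ≤
        (Metric.closedBall x (2 * ρ)).indicator
          (fun _ => ENNReal.ofReal (B * (h / ρ ^ (Q + 1)))) y +
        ({y | ρ - h ≤ dist y x ∧ dist y x < ρ + h}.indicator
          (fun _ => ENNReal.ofReal (A / ρ ^ Q)) y +
        {y | 2 * ρ - h ≤ dist y x ∧ dist y x < 2 * ρ + h}.indicator
          (fun _ => ENNReal.ofReal (A / ρ ^ Q)) y) := by
      intro y
      have e1 : 0 ≤ B * (h / ρ ^ (Q + 1)) := by positivity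
      have e2 : 0 ≤ A / ρ ^ Q := by positivity
      unfold jumpMajorant
      refine (enorm_add_le _ _).trans (add_le_add ?_ ((enorm_add_le _ _).trans (add_le_add ?_ ?_)))
      all_goals
        simp only [indicator, Metric.mem_closedBall, mem_ofPred_eq, dist_comm y x]
        split_ifs
        · rw [Real.enorm_of_nonneg (by assumption)]
        · simp
    refine (lintegral_mono hle).trans ?_
    rw [lintegral_add_left (measurable_const.indicator measurableSet_closedBall),
      lintegral_add_left (measurable_const.indicator (hS ρ)),
      lintegral_indicator measurableSet_closedBall, lintegral_indicator (hS ρ),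
      lintegral_indicator (hS (2 * ρ)), setLIntegral_const, setLIntegral_const, setLIntegral_const,
      hμ.measure_closedBall x (by positivity)]
    have b1 := hμ.ball_diff_le x hh (show h ≤ ρ by linarith)
    have b2 := hμ.ball_diff_le x hh (show h ≤ 2 * ρ by linarith)
    have e2 : 0 ≤ A / ρ ^ Q := by positivity
    calc _ ≤ ENNReal.ofReal (B * (h / ρ ^ (Q + 1))) * ENNReal.ofReal (c * (2 * ρ) ^ Q) +
          (ENNReal.ofReal (A / ρ ^ Q) * ENNReal.ofReal (c * (2 * Q * h * (2 * ρ) ^ (Q - 1))) +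
          ENNReal.ofReal (A / ρ ^ Q) *
            ENNReal.ofReal (c * (2 * Q * h * (2 * (2 * ρ)) ^ (Q - 1)))) := by gcongr
      _ = ENNReal.ofReal (jumpConst c Q A B * (h / ρ)) := by
        rw [← ENNReal.ofReal_mul (by positivity), ← ENNReal.ofReal_mul e2,
          ← ENNReal.ofReal_mul e2, ← ENNReal.ofReal_add (by positivity) (by positivity),
          ← ENNReal.ofReal_add (by positivity) (by positivity)]
        congr 1
        obtain ⟨q, rfl⟩ : ∃ q, Q = q + 1 := ⟨Q - 1, (Nat.sub_add_cancel hμ.one_le).symm⟩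
        simp only [Nat.add_sub_cancel, jumpConst]
        rw [show 2 * (2 * ρ) = 4 * ρ by ring]
        simp only [mul_pow, pow_succ]
        field_simp
  refine ⟨hmeas, hrow, fun y => ?_⟩
  have := hrow y
  refine le_of_eq_of_le (lintegral_congr fun x => ?_) this
  simp only [jumpMajorant, dist_comm]

/-! ### Uniform `L²` bounds for the truncated operators -/

theorem annular_sum {X : Type*} [MetricSpace X] (k : X → X → ℝ) {a : ℝ} (ha : 0 < a) (m : ℕ) (x y : X) :
    ∑ i : Fin m, annular k (a * 2 ^ (i : ℕ)) (2 * (a * 2 ^ (i : ℕ))) x y =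
      annular k a (a * 2 ^ m) x y := by
  induction m with
  | zero =>
    rw [Fin.sum_univ_zero, annular, if_neg]
    rintro ⟨h1, h2⟩; rw [pow_zero, mul_one] at h2; exact absurd h1 (not_lt.2 h2)
  | succ m ih =>
    rw [Fin.sum_univ_castSucc]
    simp only [Fin.val_castSucc, Fin.val_last]
    rw [ih, show 2 * (a * 2 ^ m) = a * 2 ^ (m + 1) by ring]
    have : (1 : ℝ) ≤ 2 ^ m := one_le_pow₀ (by norm_num)
    exact annular_add k (by nlinarith) (by rw [pow_succ]; nlinarith) x y

theorem sum_pow_dist_le (m : ℕ) (i : Fin m) :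
    ∑ j : Fin m, (3 / 4 : ℝ) ^ (((i : ℕ) - j) + ((j : ℕ) - i)) ≤ 8 := by
  have geo : ∀ n : ℕ, ∑ l ∈ Finset.range n, (3 / 4 : ℝ) ^ l ≤ 4 := by
    intro n
    have h := (summable_geometric_of_lt_one (r := (3 / 4 : ℝ)) (by norm_num)
      (by norm_num)).sum_le_tsum (Finset.range n) (fun _ _ => by positivity)
    rw [tsum_geometric_of_lt_one (by norm_num) (by norm_num)] at h
    norm_num at h; exact h
  rw [Fin.sum_univ_eq_sum_range (fun j => (3 / 4 : ℝ) ^ (((i : ℕ) - j) + (j - i))) m,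
    ← Finset.sum_range_add_sum_Ico _ i.2.le]
  have h1 : ∑ j ∈ Finset.range i, (3 / 4 : ℝ) ^ (((i : ℕ) - j) + (j - i)) ≤ 4 := by
    rw [← Finset.sum_range_reflect]
    refine le_trans (Finset.sum_le_sum (g := fun l => (3 / 4 : ℝ) ^ l) fun l hl => ?_) (geo i)
    apply pow_le_pow_of_le_one (by norm_num) (by norm_num)
    have := Finset.mem_range.1 hl
    omega
  have h2 : ∑ j ∈ Finset.Ico (i : ℕ) m, (3 / 4 : ℝ) ^ (((i : ℕ) - j) + (j - i)) ≤ 4 := by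
    rw [Finset.sum_Ico_eq_sum_range]
    refine le_trans (Finset.sum_le_sum (g := fun l => (3 / 4 : ℝ) ^ l) fun l hl => ?_)
      (geo (m - i))
    apply pow_le_pow_of_le_one (by norm_num) (by norm_num)
    omega
  linarith

namespace SingularKernel

variable {X : Type*} [MetricSpace X] [MeasurableSpace X] {μ : Measure X} {c : ℝ} {Q : ℕ}
  {A B : ℝ} {k : X → X → ℝ}

theorem integrableOn_of_memLp (hμ : RegularVolume μ c Q) {f : X → ℝ} (hf : MemLp f 2 μ) (x : X)
    (s : ℝ) : IntegrableOn f (Metric.closedBall x s) μ := by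
  have hfin : μ (Metric.closedBall x s) < ⊤ :=
    (measure_mono (Metric.closedBall_subset_ball (lt_add_one s))).trans_lt
      (hμ.measure_ball_lt_top x (s + 1))
  have : IsFiniteMeasure (μ.restrict (Metric.closedBall x s)) :=
    ⟨by rwa [Measure.restrict_apply_univ]⟩
  exact (hf.restrict _).integrable (by norm_num)

/-- The constant in the almost orthogonality estimate for dyadic scales. -/
noncomputable def orthConst (c : ℝ) (Q : ℕ) (A B : ℝ) : ℝ :=
  4 * (A * c * 2 ^ Q) ^ 2 + 3 * (A * c * 2 ^ Q * jumpConst c Q A B)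

theorem orthConst_nonneg (hμ : RegularVolume μ c Q) (hk : SingularKernel μ Q A B k) :
    0 ≤ orthConst c Q A B := by
  have hA := hk.size_nonneg
  have hB := hk.smooth_nonneg
  have hc := hμ.pos
  unfold orthConst jumpConst; positivity

variable [BorelSpace X]
variable [SecondCountableTopology X]

theorem integrable_annular_mul (hk : SingularKernel μ Q A B k) {r s : ℝ} (hr : 0 < r) {u : X → ℝ}
    {x : X} (hu : IntegrableOn u (Metric.closedBall x s) μ) :
    Integrable (fun y => annular k r s x y * u y) μ := by
  have h1 : (fun y => annular k r s x y * u y) =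
      fun y => annular k r s x y * (Metric.closedBall x s).indicator u y := by
    ext y
    by_cases h : y ∈ Metric.closedBall x s
    · rw [indicator_of_mem h]
    · rw [indicator_of_notMem h, annular, if_neg, zero_mul, zero_mul]
      rintro ⟨-, h'⟩; exact h (by rwa [Metric.mem_closedBall, dist_comm])
  rw [h1]
  refine (hu.integrable_indicator measurableSet_closedBall).bdd_mul (c := A / r ^ Q) ?_ ?_
  · exact ((hk.measurable_annular r s).comp measurable_prodMk_left).aestronglyMeasurable
  · exact Eventually.of_forall fun y => by
      rw [Real.norm_eq_abs]; exact hk.abs_annular_le hr s x y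

variable [SFinite μ]

/-- The integral operator on `L²` with kernel `k(x, y) 1_{r < d(x, y) ≤ 2 r}`. -/
noncomputable def annularOp (hμ : RegularVolume μ c Q) (hk : SingularKernel μ Q A B k) {r : ℝ}
    (hr : 0 < r) : Lp ℝ 2 μ →L[ℝ] Lp ℝ 2 μ :=
  (hk.schurKernel_annular hμ hr (show r ≤ 2 * r by linarith)).op

theorem toNNReal_schur_eq {r : ℝ} (hr : 0 < r) (a : ℝ) (Q : ℕ) :
    (a * (2 * r / r) ^ Q).toNNReal = (a * 2 ^ Q).toNNReal := by
  rw [mul_div_assoc, div_self hr.ne', mul_one]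

theorem norm_annularOp_le (hμ : RegularVolume μ c Q) (hk : SingularKernel μ Q A B k) {r : ℝ}
    (hr : 0 < r) : ‖hk.annularOp hμ hr‖ ≤ A * c * 2 ^ Q := by
  have hA := hk.size_nonneg
  have hc := hμ.pos
  refine (SchurKernel.norm_op_le _).trans ?_
  rw [toNNReal_schur_eq hr, Real.coe_toNNReal _ (by positivity)]

theorem adjoint_annularOp (hμ : RegularVolume μ c Q) (hk : SingularKernel μ Q A B k) {r : ℝ}
    (hr : 0 < r) : ContinuousLinearMap.adjoint (hk.annularOp hμ hr) =
      hk.swap.annularOp hμ hr := by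
  rw [annularOp, SchurKernel.adjoint_op]
  ext1 f
  refine Lp.ext ?_
  refine (SchurKernel.op_ae _ f).trans (EventuallyEq.trans ?_ (SchurKernel.op_ae _ f).symm)
  exact Eventually.of_forall fun x => by simp only [annular_swap]

/-- Almost orthogonality at separated scales: the cancellation of the piece at the small scale `r`
meets the regularity of the piece at the large scale `ρ`. -/
theorem norm_adjoint_mul_le (hμ : RegularVolume μ c Q) (hk : SingularKernel μ Q A B k) {r ρ : ℝ}
    (hr : 0 < r) (hρ : 0 < ρ) (hrρ : 6 * r ≤ ρ) :
    ‖ContinuousLinearMap.adjoint (hk.annularOp hμ hr) * hk.annularOp hμ hρ‖ ≤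
      A * c * 2 ^ Q * (jumpConst c Q A B * (3 * r / ρ)) := by
  have hA := hk.size_nonneg
  have hB := hk.smooth_nonneg
  have hc := hμ.pos
  have hJ : 0 ≤ jumpConst c Q A B := by unfold jumpConst; positivity
  set M : ℝ≥0 := (A * c * 2 ^ Q).toNNReal
  have hψ := schurKernel_jumpMajorant hμ hA hB hρ (show 0 < 3 * r by linarith)
    (show 3 * r ≤ ρ / 2 by linarith)
  set M' : ℝ≥0 := (jumpConst c Q A B * (3 * r / ρ)).toNNReal
  have hcoe : A * c * 2 ^ Q * (jumpConst c Q A B * (3 * r / ρ)) = ((M * M' : ℝ≥0) : ℝ) := by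
    rw [NNReal.coe_mul, Real.coe_toNNReal _ (by positivity), Real.coe_toNNReal _ (by positivity)]
  rw [hcoe, adjoint_annularOp]
  refine ContinuousLinearMap.opNorm_le_bound _ (NNReal.coe_nonneg _) fun f => ?_
  set F := hk.annularOp hμ hρ f with hF
  have hFt : F =ᵐ[μ] fun z => ∫ y, annular k ρ (2 * ρ) z y * f y ∂μ := SchurKernel.op_ae _ f
  have hsw := hk.swap.schurKernel_annular hμ hr (show r ≤ 2 * r by linarith)
  have hpt : ∀ᵐ x ∂μ, ‖(hk.swap.annularOp hμ hr F) x‖ₑ ≤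
      M * ∫⁻ y, ‖jumpMajorant Q A B ρ (3 * r) x y‖ₑ * ‖f y‖ₑ ∂μ := by
    filter_upwards [hsw.op_ae F, hsw.ae_integrable F] with x hx hint
    set t : X → ℝ := fun z => ∫ y, annular k ρ (2 * ρ) z y * f y ∂μ
    set G := ∫⁻ y, ‖jumpMajorant Q A B ρ (3 * r) x y‖ₑ * ‖f y‖ₑ ∂μ
    set a := annular (fun x y => k y x) r (2 * r) x
    have e1 : (hk.swap.annularOp hμ hr F) x = ∫ z, a z * t z ∂μ := by
      refine hx.trans (integral_congr_ae ?_)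
      filter_upwards [hFt] with z hz
      rw [hz]
    have i1 : Integrable (fun z => a z * t z) μ := by
      refine hint.congr ?_
      filter_upwards [hFt] with z hz
      rw [hz]
    have i2 : Integrable a μ := by
      have : IntegrableOn (fun _ : X => (1 : ℝ)) (Metric.closedBall x (2 * r)) μ := by
        refine integrableOn_const ?_
        rw [hμ.measure_closedBall x (by linarith)]; exact ENNReal.ofReal_ne_top
      simpa using hk.swap.integrable_annular_mul hr this
    -- cancellation of the piece at scale `r`
    have e2 : ∫ z, a z * t z ∂μ = ∫ z, a z * (t z - t x) ∂μ := by
      have : ∫ z, a z * t x ∂μ = 0 := by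
        rw [integral_mul_const, hk.swap.integral_annular hμ hr (by linarith) x, zero_mul]
      simp only [mul_sub]
      rw [integral_sub i1 (i2.mul_const _), this, sub_zero]
    have hf := Lp.memLp f
    -- the piece at scale `r` lives in `B(x, 3r)`, on which `t` is nearly constant
    have hdiff : ∀ z, dist x z < 3 * r → ‖t z - t x‖ₑ ≤ G := by
      intro z hz
      rw [← integral_sub
        (hk.integrable_annular_mul hρ (integrableOn_of_memLp hμ hf _ _))
        (hk.integrable_annular_mul hρ (integrableOn_of_memLp hμ hf _ _))]
      refine (enorm_integral_le_lintegral_enorm _).trans (lintegral_mono fun y => ?_)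
      rw [← sub_mul, enorm_mul]
      gcongr
      rw [Real.enorm_eq_ofReal_abs]
      refine (ENNReal.ofReal_le_ofReal
        (hk.abs_annular_sub_le hρ (by linarith) hz y)).trans (Real.ofReal_le_enorm _)
    rw [e1, e2]
    refine (enorm_integral_le_lintegral_enorm _).trans ?_
    calc ∫⁻ z, ‖a z * (t z - t x)‖ₑ ∂μ ≤ ∫⁻ z, ‖a z‖ₑ * G ∂μ := by
          refine lintegral_mono fun z => ?_
          rw [enorm_mul]
          by_cases hz : dist x z < 3 * r
          · gcongr; exact hdiff z hz
          · have : a z = 0 := if_neg fun h => hz (by linarith [h.2])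
            simp [this]
      _ = (∫⁻ z, ‖a z‖ₑ ∂μ) * G :=
          lintegral_mul_const'' _ i2.aestronglyMeasurable.enorm
      _ ≤ M * G := by
          gcongr
          have := hsw.row x
          rwa [toNNReal_schur_eq hr] at this
  have hnorm : eLpNorm (hk.swap.annularOp hμ hr F) 2 μ ≤ (M * M' : ℝ≥0) * eLpNorm f 2 μ := by
    rw [← ENNReal.pow_le_pow_left_iff (n := 2) two_ne_zero, mul_pow, eLpNorm_two_sq,
      eLpNorm_two_sq]
    calc ∫⁻ x, ‖(hk.swap.annularOp hμ hr F) x‖ₑ ^ 2 ∂μ ≤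
        ∫⁻ x, M ^ 2 * (∫⁻ y, ‖jumpMajorant Q A B ρ (3 * r) x y‖ₑ * ‖f y‖ₑ ∂μ) ^ 2 ∂μ := by
          refine lintegral_mono_ae ?_
          filter_upwards [hpt] with x hx
          rw [← mul_pow]; gcongr
      _ = M ^ 2 * ∫⁻ x, (∫⁻ y, ‖jumpMajorant Q A B ρ (3 * r) x y‖ₑ * ‖f y‖ₑ ∂μ) ^ 2 ∂μ :=
          lintegral_const_mul' _ _ (by simp)
      _ ≤ M ^ 2 * (M' ^ 2 * ∫⁻ x, ‖f x‖ₑ ^ 2 ∂μ) := by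
          gcongr; exact hψ.lintegral_sq_le (Lp.stronglyMeasurable f).measurable
      _ = _ := by rw [ENNReal.coe_mul]; ring
  rw [ContinuousLinearMap.mul_def, ContinuousLinearMap.comp_apply, Lp.norm_def, Lp.norm_def,
    ← ENNReal.coe_toReal, ← ENNReal.toReal_mul]
  exact ENNReal.toReal_mono
    (ENNReal.mul_lt_top ENNReal.coe_lt_top (Lp.memLp f).eLpNorm_lt_top).ne hnorm

theorem norm_adjoint_mul_dyadic_le (hμ : RegularVolume μ c Q) (hk : SingularKernel μ Q A B k)
    {a : ℝ} (ha : 0 < a) {i j : ℕ} (hij : i ≤ j) :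
    ‖ContinuousLinearMap.adjoint (hk.annularOp hμ (show 0 < a * 2 ^ i by positivity)) *
      hk.annularOp hμ (show 0 < a * 2 ^ j by positivity)‖ ≤
      orthConst c Q A B * (1 / 2) ^ (j - i) := by
  have hA := hk.size_nonneg
  have hB := hk.smooth_nonneg
  have hc := hμ.pos
  have hJ : 0 ≤ jumpConst c Q A B := by unfold jumpConst; positivity
  obtain ⟨n, rfl⟩ := Nat.exists_eq_add_of_le hij
  rw [Nat.add_sub_cancel_left]
  have hs : 0 ≤ A * c * 2 ^ Q := by positivity
  rcases Nat.lt_or_ge n 3 with hn | hn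
  · have h1 : (1 / 4 : ℝ) ≤ (1 / 2) ^ n := by
      have : n = 0 ∨ n = 1 ∨ n = 2 := by omega
      rcases this with rfl | rfl | rfl <;> norm_num
    calc _ ≤ ‖ContinuousLinearMap.adjoint (hk.annularOp hμ (show 0 < a * 2 ^ i by positivity))‖ *
          ‖hk.annularOp hμ (show 0 < a * 2 ^ (i + n) by positivity)‖ := norm_mul_le _ _
      _ ≤ (A * c * 2 ^ Q) * (A * c * 2 ^ Q) := by
          rw [LinearIsometryEquiv.norm_map]
          exact mul_le_mul (hk.norm_annularOp_le hμ _) (hk.norm_annularOp_le hμ _)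
            (norm_nonneg _) hs
      _ ≤ orthConst c Q A B * (1 / 4) := by
          unfold orthConst
          have : 0 ≤ A * c * 2 ^ Q * jumpConst c Q A B := by positivity
          linarith
      _ ≤ _ := by
          have := hk.orthConst_nonneg hμ
          gcongr
  · have h8 : (8 : ℝ) ≤ 2 ^ n := by
      calc (8 : ℝ) = 2 ^ 3 := by norm_num
        _ ≤ 2 ^ n := pow_le_pow_right₀ (by norm_num) hn
    have hai : 0 < a * 2 ^ i := by positivity
    refine (hk.norm_adjoint_mul_le hμ hai (show 0 < a * 2 ^ (i + n) by positivity) ?_).trans ?_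
    · rw [pow_add]; nlinarith
    · have e : 3 * (a * 2 ^ i) / (a * 2 ^ (i + n)) = 3 * (1 / 2) ^ n := by
        rw [pow_add, one_div, inv_pow]; field_simp
      rw [e]
      unfold orthConst
      have h2 : 0 ≤ (A * c * 2 ^ Q) ^ 2 * (1 / 2 : ℝ) ^ n := by positivity
      nlinarith

/-- The sum of the pieces of the operator at the scales `a, 2 a, …, 2 ^ (m - 1) a`. -/
noncomputable def dyadicSum (hμ : RegularVolume μ c Q) (hk : SingularKernel μ Q A B k) {a : ℝ}
    (ha : 0 < a) (m : ℕ) : Lp ℝ 2 μ →L[ℝ] Lp ℝ 2 μ :=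
  ∑ i : Fin m, hk.annularOp hμ (show 0 < a * 2 ^ (i : ℕ) by positivity)

theorem norm_dyadicSum_le (hμ : RegularVolume μ c Q) (hk : SingularKernel μ Q A B k) {a : ℝ}
    (ha : 0 < a) (m : ℕ) : ‖hk.dyadicSum hμ ha m‖ ≤ 8 * √(orthConst c Q A B) := by
  have hC := hk.orthConst_nonneg hμ
  have main : ∀ (k : X → X → ℝ) (hk : SingularKernel μ Q A B k) (i j : Fin m),
      ‖ContinuousLinearMap.adjoint (hk.annularOp hμ (show 0 < a * 2 ^ (i : ℕ) by positivity)) *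
        hk.annularOp hμ (show 0 < a * 2 ^ (j : ℕ) by positivity)‖ ≤
      (√(orthConst c Q A B) * (3 / 4 : ℝ) ^ (((i : ℕ) - j) + ((j : ℕ) - i))) ^ 2 := by
    intro k hk i j
    rw [mul_pow, Real.sq_sqrt hC, ← pow_mul, mul_comm _ 2, pow_mul]
    have hp : ∀ n : ℕ, (1 / 2 : ℝ) ^ n ≤ ((3 / 4 : ℝ) ^ 2) ^ n := fun n => by
      gcongr; norm_num
    rcases le_total (i : ℕ) j with h | h
    · rw [Nat.sub_eq_zero_of_le h, zero_add]
      refine (hk.norm_adjoint_mul_dyadic_le hμ ha h).trans ?_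
      exact mul_le_mul_of_nonneg_left (hp _) hC
    · rw [Nat.sub_eq_zero_of_le h, add_zero, ← LinearIsometryEquiv.norm_map
        (ContinuousLinearMap.adjoint (𝕜 := ℝ) (E := Lp ℝ 2 μ) (F := Lp ℝ 2 μ)),
        ContinuousLinearMap.mul_def, ContinuousLinearMap.adjoint_comp,
        ContinuousLinearMap.adjoint_adjoint, ← ContinuousLinearMap.mul_def]
      refine (hk.norm_adjoint_mul_dyadic_le hμ ha h).trans ?_
      exact mul_le_mul_of_nonneg_left (hp _) hC
  have adj : ∀ i : Fin m, hk.annularOp hμ (show 0 < a * 2 ^ (i : ℕ) by positivity) =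
      ContinuousLinearMap.adjoint
        (hk.swap.annularOp hμ (show 0 < a * 2 ^ (i : ℕ) by positivity)) :=
    fun i => (adjoint_annularOp hμ hk.swap _).symm
  have adj' : ∀ i : Fin m, ContinuousLinearMap.adjoint
        (hk.annularOp hμ (show 0 < a * 2 ^ (i : ℕ) by positivity)) =
      hk.swap.annularOp hμ (show 0 < a * 2 ^ (i : ℕ) by positivity) :=
    fun i => adjoint_annularOp hμ hk _
  refine CotlarStein.norm_sum_le
    (T := fun i : Fin m => hk.annularOp hμ (show 0 < a * 2 ^ (i : ℕ) by positivity))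
    (γ := fun i j => √(orthConst c Q A B) * (3 / 4 : ℝ) ^ (((i : ℕ) - j) + ((j : ℕ) - i)))
    (fun i j => by positivity) (by positivity) (fun i => ?_) (main k hk) (fun i j => ?_)
  · rw [← Finset.mul_sum, mul_comm]
    exact mul_le_mul_of_nonneg_right (sum_pow_dist_le m i) (Real.sqrt_nonneg _)
  · have := main _ hk.swap i j
    rw [← adj] at this
    rw [adj']
    exact this

theorem dyadicSum_ae (hμ : RegularVolume μ c Q) (hk : SingularKernel μ Q A B k) {a : ℝ}
    (ha : 0 < a) (m : ℕ) (f : Lp ℝ 2 μ) :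
    hk.dyadicSum hμ ha m f =ᵐ[μ] fun x => ∫ y, annular k a (a * 2 ^ m) x y * f y ∂μ := by
  have h1 : ∀ i : Fin m, hk.annularOp hμ (show 0 < a * 2 ^ (i : ℕ) by positivity) f =ᵐ[μ]
      fun x => ∫ y, annular k (a * 2 ^ (i : ℕ)) (2 * (a * 2 ^ (i : ℕ))) x y * f y ∂μ :=
    fun i => SchurKernel.op_ae _ f
  have h2 : ∀ s : Finset (Fin m),
      ⇑(∑ i ∈ s, hk.annularOp hμ (show 0 < a * 2 ^ (i : ℕ) by positivity) f) =ᵐ[μ]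
      ∑ i ∈ s, ⇑(hk.annularOp hμ (show 0 < a * 2 ^ (i : ℕ) by positivity) f) := by
    intro s
    induction s using Finset.cons_induction with
    | empty => exact Lp.coeFn_zero _ _ _
    | cons i s hi ih =>
      rw [Finset.sum_cons, Finset.sum_cons]
      exact (Lp.coeFn_add _ _).trans (EventuallyEq.rfl.add ih)
  have h3 : hk.dyadicSum hμ ha m f =
      ∑ i : Fin m, hk.annularOp hμ (show 0 < a * 2 ^ (i : ℕ) by positivity) f := by
    simp [dyadicSum]
  rw [h3]
  filter_upwards [h2 Finset.univ, eventually_all.2 h1] with x hx1 hx2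
  rw [hx1, Finset.sum_apply]
  simp only [hx2]
  rw [← integral_finsetSum]
  · simp only [← Finset.sum_mul, annular_sum k ha]
  · intro i _
    exact hk.integrable_annular_mul (by positivity) (integrableOn_of_memLp hμ (Lp.memLp f) _ _)

end SingularKernel

/-! ### The limit operator -/

/-- A bounded sequence of operators on a Hilbert space has a weak limit along an ultrafilter. -/
theorem exists_weak_limit {E : Type*} [NormedAddCommGroup E] [InnerProductSpace ℝ E]
    [CompleteSpace E] (U : Ultrafilter ℕ) (S : ℕ → E →L[ℝ] E) {Γ : ℝ} (hS : ∀ n, ‖S n‖ ≤ Γ) :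
    ∃ T : E →L[ℝ] E, ‖T‖ ≤ Γ ∧ ∀ f g, Tendsto (fun n => inner ℝ (S n f) g) U (𝓝 (inner ℝ (T f) g)) := by
  have hΓ : 0 ≤ Γ := (norm_nonneg _).trans (hS 0)
  have hb : ∀ n f g, |inner ℝ (S n f) g| ≤ Γ * ‖f‖ * ‖g‖ := fun n f g => by
    refine (abs_real_inner_le_norm _ _).trans ?_
    gcongr
    exact (S n).le_of_opNorm_le (hS n) f
  have hex : ∀ f g, ∃ l, |l| ≤ Γ * ‖f‖ * ‖g‖ ∧
      Tendsto (fun n => inner ℝ (S n f) g) U (𝓝 l) := by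
    intro f g
    have hc : IsCompact (Icc (-(Γ * ‖f‖ * ‖g‖)) (Γ * ‖f‖ * ‖g‖)) := isCompact_Icc
    obtain ⟨l, hl, hlim⟩ := hc.ultrafilter_le_nhds (U.map fun n : ℕ => inner ℝ (S n f) g) (by
      rw [le_principal_iff]
      exact Filter.Eventually.of_forall (f := (U : Filter ℕ)) fun n => abs_le.1 (hb n f g))
    exact ⟨l, abs_le.2 hl, hlim⟩
  choose l hl1 hl2 using hex
  let L : E → (E →L[ℝ] ℝ) := fun f => LinearMap.mkContinuous
    { toFun := l f
      map_add' := fun g h => tendsto_nhds_unique (hl2 f (g + h)) (by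
        simpa only [inner_add_right] using (hl2 f g).add (hl2 f h))
      map_smul' := fun a g => tendsto_nhds_unique (hl2 f (a • g)) (by
        simpa only [real_inner_smul_right, RingHom.id_apply, smul_eq_mul] using (hl2 f g).const_mul a) }
    (Γ * ‖f‖) (fun g => hl1 f g)
  have hT : ∀ f, ∃ t : E, ∀ g, inner ℝ t g = l f g := fun f =>
    ⟨(InnerProductSpace.toDual ℝ E).symm (L f), fun g =>
      InnerProductSpace.toDual_symm_apply⟩
  choose t ht using hT
  let T : E →ₗ[ℝ] E :=
    { toFun := t
      map_add' := fun f g => ext_inner_right ℝ fun h => by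
        rw [inner_add_left, ht, ht, ht]
        exact tendsto_nhds_unique (hl2 (f + g) h) (by
          simpa only [map_add, inner_add_left] using (hl2 f h).add (hl2 g h))
      map_smul' := fun a f => ext_inner_right ℝ fun h => by
        rw [RingHom.id_apply, real_inner_smul_left, ht, ht]
        exact tendsto_nhds_unique (hl2 (a • f) h) (by
          simpa only [map_smul, real_inner_smul_left] using (hl2 f h).const_mul a) }
  have hTb : ∀ f, ‖T f‖ ≤ Γ * ‖f‖ := fun f => by
    have h1 : ‖T f‖ * ‖T f‖ ≤ Γ * ‖f‖ * ‖T f‖ := by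
      rw [← real_inner_self_eq_norm_mul_norm]
      refine (le_abs_self _).trans ?_
      change |inner ℝ (t f) (T f)| ≤ _
      rw [ht]; exact hl1 f _
    rcases (norm_nonneg (T f)).eq_or_lt with h | h
    · rw [← h]; positivity
    · exact le_of_mul_le_mul_right h1 h
  refine ⟨T.mkContinuous Γ hTb, LinearMap.mkContinuous_norm_le _ hΓ _, fun f g => ?_⟩
  rw [LinearMap.mkContinuous_apply]
  change Tendsto _ _ (𝓝 (inner ℝ (t f) g))
  rw [ht]; exact hl2 f g

namespace SingularKernel

variable {X : Type*} [MetricSpace X] [MeasurableSpace X] {μ : Measure X} {c : ℝ} {Q : ℕ}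
  {A B : ℝ} {k : X → X → ℝ} [BorelSpace X] [SecondCountableTopology X] [SFinite μ]

/-- The operator on `L²` with kernel `k(x, y) 1_{2⁻ⁿ < d(x, y) ≤ 2ⁿ}`. -/
noncomputable def truncOp (hμ : RegularVolume μ c Q) (hk : SingularKernel μ Q A B k) (n : ℕ) :
    Lp ℝ 2 μ →L[ℝ] Lp ℝ 2 μ :=
  hk.dyadicSum hμ (show (0 : ℝ) < (1 / 2) ^ n by positivity) (2 * n)

theorem truncOp_ae (hμ : RegularVolume μ c Q) (hk : SingularKernel μ Q A B k) (n : ℕ)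
    (f : Lp ℝ 2 μ) : hk.truncOp hμ n f =ᵐ[μ]
      fun x => ∫ y, annular k ((1 / 2) ^ n) (2 ^ n) x y * f y ∂μ := by
  have : (1 / 2 : ℝ) ^ n * 2 ^ (2 * n) = 2 ^ n := by
    rw [pow_mul, ← mul_pow]; norm_num
  have h := hk.dyadicSum_ae hμ (show (0 : ℝ) < (1 / 2) ^ n by positivity) (2 * n) f
  rwa [this] at h

theorem exists_limitOp (hμ : RegularVolume μ c Q) (hk : SingularKernel μ Q A B k) :
    ∃ T : Lp ℝ 2 μ →L[ℝ] Lp ℝ 2 μ, ‖T‖ ≤ 8 * √(orthConst c Q A B) ∧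
      ∀ f g, Tendsto (fun n => inner ℝ (hk.truncOp hμ n f) g) (hyperfilter ℕ)
        (𝓝 (inner ℝ (T f) g)) :=
  exists_weak_limit _ _ fun _ => hk.norm_dyadicSum_le hμ _ _

/-- The singular integral operator on `L²`: a weak limit, along an ultrafilter, of the operators
with doubly truncated kernel. -/
noncomputable def limitOp (hμ : RegularVolume μ c Q) (hk : SingularKernel μ Q A B k) :
    Lp ℝ 2 μ →L[ℝ] Lp ℝ 2 μ :=
  (hk.exists_limitOp hμ).choose

theorem norm_limitOp_le (hμ : RegularVolume μ c Q) (hk : SingularKernel μ Q A B k) :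
    ‖hk.limitOp hμ‖ ≤ 8 * √(orthConst c Q A B) :=
  (hk.exists_limitOp hμ).choose_spec.1

/-- Weak limits preserve pointwise upper bounds on a set. -/
theorem limitOp_le_of_eventually (hμ : RegularVolume μ c Q) (hk : SingularKernel μ Q A B k)
    {s : Set X} (hs : MeasurableSet s) (f u : Lp ℝ 2 μ)
    (h : ∀ᶠ n in atTop, ∀ᵐ z ∂μ, z ∈ s → hk.truncOp hμ n f z ≤ u z) :
    ∀ᵐ z ∂μ, z ∈ s → hk.limitOp hμ f z ≤ u z := by
  set w := hk.limitOp hμ f - u with hw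
  have hm : MemLp (s.indicator (Lp.posPart w)) 2 μ := (Lp.memLp (Lp.posPart w)).indicator hs
  set H : Lp ℝ 2 μ := hm.toLp _
  have hH : H =ᵐ[μ] s.indicator fun z => max (w z) 0 := by
    filter_upwards [hm.coeFn_toLp, Lp.coeFn_posPart w] with z h1 h2
    rw [h1]
    by_cases hz : z ∈ s
    · rw [indicator_of_mem hz, indicator_of_mem hz, h2]
    · rw [indicator_of_notMem hz, indicator_of_notMem hz]
  have e1 : inner ℝ w H = ‖H‖ ^ 2 := by
    rw [← real_inner_self_eq_norm_sq, L2.inner_def, L2.inner_def]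
    refine integral_congr_ae ?_
    filter_upwards [hH] with z hz
    rw [hz, RCLike.inner_apply, RCLike.inner_apply, conj_trivial, conj_trivial]
    by_cases hzs : z ∈ s
    · rw [indicator_of_mem hzs]
      rcases le_total (w z) 0 with h0 | h0
      · rw [max_eq_right h0]; simp
      · rw [max_eq_left h0]
    · rw [indicator_of_notMem hzs]; simp
  have e2 : inner ℝ w H ≤ 0 := by
    have hlim : Tendsto (fun n => inner ℝ (hk.truncOp hμ n f - u) H) (hyperfilter ℕ)
        (𝓝 (inner ℝ w H)) := by
      simp only [hw, inner_sub_left]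
      exact ((hk.exists_limitOp hμ).choose_spec.2 f H).sub tendsto_const_nhds
    refine le_of_tendsto hlim ?_
    have hle : (hyperfilter ℕ : Filter ℕ) ≤ atTop := by
      rw [← Nat.cofinite_eq_atTop]; exact hyperfilter_le_cofinite
    filter_upwards [hle h] with n hn
    rw [L2.inner_def]
    refine integral_nonpos_of_ae ?_
    filter_upwards [hn, hH, Lp.coeFn_sub (hk.truncOp hμ n f) u] with z h1 h2 h3
    rw [h2, h3, RCLike.inner_apply, conj_trivial, Pi.sub_apply]
    by_cases hzs : z ∈ s
    · rw [indicator_of_mem hzs]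
      exact mul_nonpos_of_nonneg_of_nonpos (le_max_right _ _) (by linarith [h1 hzs])
    · rw [indicator_of_notMem hzs, zero_mul]; rfl
  have e3 : H = 0 := by
    rw [e1] at e2
    exact norm_eq_zero.1 (pow_eq_zero_iff two_ne_zero |>.1 (le_antisymm e2 (sq_nonneg _)))
  have e4 : H =ᵐ[μ] 0 := by rw [e3]; exact Lp.coeFn_zero _ _ _
  filter_upwards [hH, e4, Lp.coeFn_sub (hk.limitOp hμ f) u] with z h1 h2 h3 hzs
  rw [h2, indicator_of_mem hzs] at h1
  have h4 : w z ≤ 0 := (le_max_left _ _).trans h1.symm.le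
  rw [hw, h3, Pi.sub_apply] at h4
  linarith

theorem limitOp_ge_of_eventually (hμ : RegularVolume μ c Q) (hk : SingularKernel μ Q A B k)
    {s : Set X} (hs : MeasurableSet s) (f u : Lp ℝ 2 μ)
    (h : ∀ᶠ n in atTop, ∀ᵐ z ∂μ, z ∈ s → u z ≤ hk.truncOp hμ n f z) :
    ∀ᵐ z ∂μ, z ∈ s → u z ≤ hk.limitOp hμ f z := by
  have := hk.limitOp_le_of_eventually hμ hs (-f) (-u) (by
    filter_upwards [h] with n hn
    have e : hk.truncOp hμ n (-f) = - hk.truncOp hμ n f := map_neg _ _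
    filter_upwards [hn, Lp.coeFn_neg u, Lp.coeFn_neg (hk.truncOp hμ n f)] with z h1 h2 h3 hz
    rw [e, h2, h3, Pi.neg_apply, Pi.neg_apply]
    exact neg_le_neg (h1 hz))
  have e : hk.limitOp hμ (-f) = - hk.limitOp hμ f := map_neg _ _
  filter_upwards [this, Lp.coeFn_neg u, Lp.coeFn_neg (hk.limitOp hμ f)] with z h1 h2 h3 hz
  have := h1 hz
  rw [e, h2, h3, Pi.neg_apply, Pi.neg_apply] at this
  exact neg_le_neg_iff.1 this

theorem exists_pow_bounds {r L : ℝ} (hr : 0 < r) :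
    ∀ᶠ n : ℕ in atTop, (1 / 2 : ℝ) ^ n < r ∧ L < 2 ^ n :=
  ((tendsto_pow_atTop_nhds_zero_of_lt_one (by norm_num) (by norm_num)).eventually_lt_const hr).and
    ((tendsto_pow_atTop_atTop_of_one_lt (by norm_num)).eventually_gt_atTop L)

/-- Away from the support of `f` the singular integral is an absolutely convergent integral. -/
theorem limitOp_ae_of_vanish (hμ : RegularVolume μ c Q) (hk : SingularKernel μ Q A B k)
    {f : Lp ℝ 2 μ} {x₀ : X} {r L : ℝ} (hr : 0 < r)
    (h1 : ∀ᵐ y ∂μ, y ∈ Metric.ball x₀ (2 * r) → f y = 0)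
    (h2 : ∀ᵐ y ∂μ, y ∉ Metric.ball x₀ L → f y = 0) :
    ∀ᵐ z ∂μ, z ∈ Metric.ball x₀ r → hk.limitOp hμ f z = ∫ y, k z y * f y ∂μ := by
  have key : ∀ᶠ n : ℕ in atTop, ∀ᵐ z ∂μ, z ∈ Metric.ball x₀ r →
      hk.truncOp hμ n f z = ∫ y, k z y * f y ∂μ := by
    filter_upwards [exists_pow_bounds (L := r + L) hr] with n hn
    filter_upwards [hk.truncOp_ae hμ n f] with z hz hzb
    rw [hz]
    refine integral_congr_ae ?_
    filter_upwards [h1, h2] with y hy1 hy2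
    rw [Metric.mem_ball] at hzb
    rw [Metric.mem_ball] at hy1 hy2
    by_cases hf : f y = 0
    · simp [hf]
    · have a1 : 2 * r ≤ dist y x₀ := by by_contra h; exact hf (hy1 (not_le.1 h))
      have a2 : dist y x₀ < L := by by_contra h; exact hf (hy2 h)
      have t1 := dist_triangle y z x₀
      have t2 := dist_triangle z x₀ y
      rw [dist_comm y z] at t1
      rw [dist_comm x₀ y] at t2
      rw [annular, if_pos ⟨by linarith [hn.1], by linarith [hn.2]⟩]
  obtain ⟨n₀, hn₀⟩ := key.exists
  have l1 := hk.limitOp_le_of_eventually hμ measurableSet_ball f (hk.truncOp hμ n₀ f) (by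
    filter_upwards [key] with n hn
    filter_upwards [hn, hn₀] with z a b hz
    rw [a hz, b hz])
  have l2 := hk.limitOp_ge_of_eventually hμ measurableSet_ball f (hk.truncOp hμ n₀ f) (by
    filter_upwards [key] with n hn
    filter_upwards [hn, hn₀] with z a b hz
    rw [a hz, b hz])
  filter_upwards [l1, l2, hn₀] with z a b d hz
  rw [← d hz]; exact le_antisymm (a hz) (b hz)

/-- The indicator function of a ball, as an element of `L²`. -/
noncomputable def ballIndicator (hμ : RegularVolume μ c Q) (x : X) (L : ℝ) : Lp ℝ 2 μ :=
  indicatorConstLp 2 (measurableSet_ball (x := x) (ε := L)) (hμ.measure_ball_lt_top x L).ne (1 : ℝ)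

/-- By cancellation, the singular integral of the indicator of `B(x, L)` is small near `x`. -/
theorem abs_limitOp_ballIndicator_le (hμ : RegularVolume μ c Q) (hk : SingularKernel μ Q A B k)
    (x : X) {L h : ℝ} (hh : 0 < h) (hhL : h ≤ L / 2) :
    ∀ᵐ z ∂μ, z ∈ Metric.ball x h → |hk.limitOp hμ (ballIndicator hμ x L) z| ≤
      A * c * Q * 4 ^ Q * (h / L) := by
  have hA := hk.size_nonneg
  have hc := hμ.pos
  have hL : 0 < L := by linarith
  set D : ℝ := A * c * Q * 4 ^ Q * (h / L) with hD
  have hD0 : 0 ≤ D := by positivity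
  set S : Set X := {y | L - h ≤ dist y x ∧ dist y x < L + h}
  have hS : MeasurableSet S :=
    (measurableSet_le measurable_const (measurable_id.dist measurable_const)).inter
      (measurableSet_lt (measurable_id.dist measurable_const) measurable_const)
  have key : ∀ᶠ n : ℕ in atTop, ∀ᵐ z ∂μ, z ∈ Metric.ball x h →
      |hk.truncOp hμ n (ballIndicator hμ x L) z| ≤ D := by
    filter_upwards [exists_pow_bounds (r := L) (L := L) hL] with n hn
    filter_upwards [hk.truncOp_ae hμ n (ballIndicator hμ x L)] with z hz hzb
    rw [Metric.mem_ball] at hzb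
    have ha : (0 : ℝ) < (1 / 2) ^ n := by positivity
    have one_int : ∀ s, IntegrableOn (fun _ : X => (1 : ℝ)) (Metric.closedBall z s) μ := fun s => by
      refine integrableOn_const ((measure_mono
        (Metric.closedBall_subset_ball (lt_add_one s))).trans_lt
        (hμ.measure_ball_lt_top z (s + 1))).ne
    have e1 : ∫ y, annular k ((1 / 2) ^ n) (2 ^ n) z y * ballIndicator hμ x L y ∂μ =
        ∫ y, annular k ((1 / 2) ^ n) (2 ^ n) z y *
          (Metric.ball x L).indicator (fun _ => (1 : ℝ)) y ∂μ := by
      refine integral_congr_ae ?_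
      filter_upwards [indicatorConstLp_coeFn (p := 2) (μ := μ) (c := (1 : ℝ))
        (hs := measurableSet_ball (x := x) (ε := L)) (hμs := (hμ.measure_ball_lt_top x L).ne)]
        with y hy
      rw [ballIndicator, hy]
    -- the kernel has mean zero on the annuli about `z`, so `1_{B(x, L)}` may be replaced by its
    -- difference with `1_{B(z, L)}`, which lives in a shell of width `2 h`
    have e2 : ∀ y, annular k ((1 / 2) ^ n) L z y = annular k ((1 / 2) ^ n) (2 ^ n) z y *
          (Metric.closedBall z L).indicator (fun _ => (1 : ℝ)) y := by
      intro y
      by_cases hy : dist z y ≤ L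
      · rw [indicator_of_mem (by rwa [Metric.mem_closedBall, dist_comm]), mul_one]
        exact if_congr ⟨fun h => ⟨h.1, hy.trans hn.2.le⟩, fun h => ⟨h.1, hy⟩⟩ rfl rfl
      · rw [indicator_of_notMem (by rwa [Metric.mem_closedBall, dist_comm]), mul_zero]
        exact if_neg fun h => hy h.2
    have i1 : Integrable (fun y => annular k ((1 / 2) ^ n) (2 ^ n) z y *
          (Metric.ball x L).indicator (fun _ => (1 : ℝ)) y) μ :=
      hk.integrable_annular_mul ha ((one_int _).indicator measurableSet_ball)
    have i2 : Integrable (fun y => annular k ((1 / 2) ^ n) (2 ^ n) z y *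
          (Metric.closedBall z L).indicator (fun _ => (1 : ℝ)) y) μ :=
      hk.integrable_annular_mul ha ((one_int _).indicator measurableSet_closedBall)
    have e3 : hk.truncOp hμ n (ballIndicator hμ x L) z =
        ∫ y, annular k ((1 / 2) ^ n) (2 ^ n) z y *
          ((Metric.ball x L).indicator (fun _ => (1 : ℝ)) y -
            (Metric.closedBall z L).indicator (fun _ => (1 : ℝ)) y) ∂μ := by
      have h0 := hk.integral_annular hμ ha hn.1 z
      simp only [e2] at h0
      simp only [mul_sub]
      rw [integral_sub i1 i2, h0, sub_zero, hz, e1]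
    have e4 : ∀ y, ‖annular k ((1 / 2) ^ n) (2 ^ n) z y *
          ((Metric.ball x L).indicator (fun _ => (1 : ℝ)) y -
            (Metric.closedBall z L).indicator (fun _ => (1 : ℝ)) y)‖ ≤
        S.indicator (fun _ => A / (L / 2) ^ Q) y := by
      intro y
      have t1 := dist_triangle y z x
      have t2 := dist_triangle y x z
      have t3 := dist_comm x z
      have hann : L / 2 ≤ dist y z → |annular k ((1 / 2) ^ n) (2 ^ n) z y| ≤ A / (L / 2) ^ Q := by
        intro hle
        rw [dist_comm] at hle
        unfold annular
        split_ifs with h'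
        · refine (hk.size z y (dist_pos.1 (by linarith))).trans ?_
          gcongr
        · rw [abs_zero]; positivity
      by_cases h1 : dist y x < L <;> by_cases h2 : dist y z ≤ L
      · rw [indicator_of_mem (by exact h1), indicator_of_mem (by exact h2), sub_self, mul_zero,
          norm_zero]
        exact indicator_nonneg (fun _ _ => by positivity) _
      · rw [indicator_of_mem (by exact h1), indicator_of_notMem (by exact h2), sub_zero, mul_one,
          indicator_of_mem (by constructor <;> linarith)]
        exact hann (by linarith)
      · rw [indicator_of_notMem (by exact h1), indicator_of_mem (by exact h2), zero_sub, mul_neg,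
          mul_one, norm_neg, indicator_of_mem (by constructor <;> linarith)]
        exact hann (by linarith)
      · rw [indicator_of_notMem (by exact h1), indicator_of_notMem (by exact h2), sub_self,
          mul_zero, norm_zero]
        exact indicator_nonneg (fun _ _ => by positivity) _
    have hSm := hμ.ball_diff_le x hh (show h ≤ L by linarith)
    have iS : Integrable (S.indicator fun _ => A / (L / 2) ^ Q) μ :=
      (integrableOn_const (hSm.trans_lt ENNReal.ofReal_lt_top).ne).integrable_indicator hS
    rw [e3, ← Real.norm_eq_abs]
    refine (norm_integral_le_of_norm_le iS (Eventually.of_forall e4)).trans ?_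
    rw [integral_indicator hS, setIntegral_const, smul_eq_mul]
    calc μ.real S * (A / (L / 2) ^ Q) ≤ (c * (2 * Q * h * (2 * L) ^ (Q - 1))) * (A / (L / 2) ^ Q) := by
          gcongr
          exact ENNReal.toReal_le_of_le_ofReal (by positivity) hSm
      _ = D := by
          obtain ⟨q, rfl⟩ : ∃ q, Q = q + 1 := ⟨Q - 1, (Nat.sub_add_cancel hμ.one_le).symm⟩
          rw [hD, Nat.add_sub_cancel, mul_pow, div_pow, show (4 : ℝ) = 2 * 2 by norm_num,
            mul_pow (2 : ℝ) 2 (q + 1)]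
          simp only [pow_succ]
          field_simp
  have hm : MemLp ((Metric.ball x h).indicator fun _ => D) 2 μ :=
    memLp_indicator_const 2 measurableSet_ball D (Or.inr (hμ.measure_ball_lt_top x h).ne)
  have hm' : MemLp ((Metric.ball x h).indicator fun _ => -D) 2 μ :=
    memLp_indicator_const 2 measurableSet_ball (-D) (Or.inr (hμ.measure_ball_lt_top x h).ne)
  have l1 := hk.limitOp_le_of_eventually hμ measurableSet_ball (ballIndicator hμ x L)
    (hm.toLp _) (s := Metric.ball x h) (by
      filter_upwards [key] with n hn
      filter_upwards [hn, hm.coeFn_toLp] with z a b hz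
      rw [b, indicator_of_mem hz]; exact (abs_le.1 (a hz)).2)
  have l2 := hk.limitOp_ge_of_eventually hμ measurableSet_ball (ballIndicator hμ x L)
    (hm'.toLp _) (s := Metric.ball x h) (by
      filter_upwards [key] with n hn
      filter_upwards [hn, hm'.coeFn_toLp] with z a b hz
      rw [b, indicator_of_mem hz]; exact (abs_le.1 (a hz)).1)
  filter_upwards [l1, l2, hm.coeFn_toLp, hm'.coeFn_toLp] with z a b d e hz
  have a' := a hz
  have b' := b hz
  rw [d, indicator_of_mem hz] at a'
  rw [e, indicator_of_mem hz] at b'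
  exact abs_le.2 ⟨b', a'⟩

end SingularKernel

/-! ### Dyadic estimates for tails -/

theorem IntegrableOn.mul_of_abs_le {X : Type*} [MeasurableSpace X] {μ : Measure X} {F G : X → ℝ} {s : Set X} (hs : MeasurableSet s) {C : ℝ}
    (hF : IntegrableOn F s μ) (hGm : Measurable G) (hG : ∀ y ∈ s, |G y| ≤ C) :
    IntegrableOn (fun y => F y * G y) s μ :=
  Integrable.mul_bdd (c := C) hF hGm.aestronglyMeasurable
    ((ae_restrict_iff' hs).2 (Eventually.of_forall hG))

theorem shell_subset_ball {X : Type*} [MetricSpace X] (x : X) (r s : ℝ) :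
    {y | r ≤ dist x y ∧ dist x y < s} ⊆ Metric.ball x s := fun y hy => by
  rw [Metric.mem_ball, dist_comm]; exact hy.2

section Tail

variable {X : Type*} [MetricSpace X] [MeasurableSpace X] {μ : Measure X} {c : ℝ} {Q : ℕ}
  [BorelSpace X] [SecondCountableTopology X]

theorem measurableSet_shell (x : X) (r s : ℝ) :
    MeasurableSet {y | r ≤ dist x y ∧ dist x y < s} :=
  (measurableSet_le measurable_const (measurable_const.dist measurable_id)).inter
    (measurableSet_lt (measurable_const.dist measurable_id) measurable_const)

theorem setIntegral_shell_succ {F : X → ℝ} (x : X) {ρ : ℝ} (hρ : 0 < ρ) (J : ℕ)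
    (h1 : IntegrableOn F {y | ρ ≤ dist x y ∧ dist x y < ρ * 2 ^ J} μ)
    (h2 : IntegrableOn F {y | ρ * 2 ^ J ≤ dist x y ∧ dist x y < ρ * 2 ^ (J + 1)} μ) :
    ∫ y in {y | ρ ≤ dist x y ∧ dist x y < ρ * 2 ^ (J + 1)}, F y ∂μ =
      (∫ y in {y | ρ ≤ dist x y ∧ dist x y < ρ * 2 ^ J}, F y ∂μ) +
        ∫ y in {y | ρ * 2 ^ J ≤ dist x y ∧ dist x y < ρ * 2 ^ (J + 1)}, F y ∂μ := by
  rw [← setIntegral_union _ (measurableSet_shell x _ _) h1 h2]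
  · congr 2
    have hp : (1 : ℝ) ≤ 2 ^ J := one_le_pow₀ (by norm_num)
    have a1 : ρ ≤ ρ * 2 ^ J := by nlinarith
    have a2 : ρ * 2 ^ J ≤ ρ * 2 ^ (J + 1) := by rw [pow_succ]; nlinarith
    ext y
    simp only [mem_ofPred_eq, mem_union]
    constructor
    · rintro ⟨b1, b2⟩
      rcases lt_or_ge (dist x y) (ρ * 2 ^ J) with h | h
      · exact Or.inl ⟨b1, h⟩
      · exact Or.inr ⟨h, b2⟩
    · rintro (⟨b1, b2⟩ | ⟨b1, b2⟩)
      · exact ⟨b1, b2.trans_le a2⟩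
      · exact ⟨a1.trans b1, b2⟩
  · rw [Set.disjoint_left]
    rintro y ⟨-, h⟩ ⟨h', -⟩
    exact absurd h (not_lt.2 h')

theorem integrableOn_tail {g : X → ℝ} (x : X) {r s a : ℝ} (hr : 0 < r)
    (hg : IntegrableOn g (Metric.ball x s) μ) :
    IntegrableOn (fun y => |g y| * (a / dist x y ^ (Q + 1)))
      {y | r ≤ dist x y ∧ dist x y < s} μ := by
  refine IntegrableOn.mul_of_abs_le (measurableSet_shell x _ _) (C := |a| / r ^ (Q + 1))
    ((hg.mono_set (shell_subset_ball x r s)).abs)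
    (measurable_const.div ((measurable_const.dist measurable_id).pow_const _)) ?_
  rintro y ⟨h1, -⟩
  rw [abs_div, abs_of_nonneg (a := dist x y ^ (Q + 1)) (by positivity)]
  gcongr

/-- The part of `∫ |g(y)| ρ d(x, y)^{-Q-1} dy` over `ρ ≤ d(x, y) < 2 ^ J ρ` is controlled by
geometrically weighted averages of `|g|` over the dyadic balls about `x`. -/
theorem setIntegral_tail_le (hμ : RegularVolume μ c Q) {g : X → ℝ} (x : X) {ρ : ℝ} (hρ : 0 < ρ)
    (J : ℕ) (hg : IntegrableOn g (Metric.ball x (ρ * 2 ^ J)) μ) :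
    ∫ y in {y | ρ ≤ dist x y ∧ dist x y < ρ * 2 ^ J}, |g y| * (ρ / dist x y ^ (Q + 1)) ∂μ ≤
      c * 2 ^ Q * ∑ j ∈ Finset.range J, (1 / 2 : ℝ) ^ j *
        ((μ.real (Metric.ball x (ρ * 2 ^ (j + 1))))⁻¹ *
          ∫ y in Metric.ball x (ρ * 2 ^ (j + 1)), |g y| ∂μ) := by
  have hc := hμ.pos
  induction J with
  | zero =>
    have : {y | ρ ≤ dist x y ∧ dist x y < ρ * 2 ^ 0} = ∅ := by
      ext y; simp
    rw [this]; simp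
  | succ J ih =>
    have hp : (0 : ℝ) < ρ * 2 ^ J := by positivity
    have hg' : IntegrableOn g (Metric.ball x (ρ * 2 ^ J)) μ :=
      hg.mono_set (Metric.ball_subset_ball (by rw [pow_succ]; nlinarith))
    rw [setIntegral_shell_succ x hρ J (integrableOn_tail x hρ hg') (integrableOn_tail x hp hg),
      Finset.sum_range_succ, mul_add]
    refine add_le_add (ih hg') ?_
    calc ∫ y in {y | ρ * 2 ^ J ≤ dist x y ∧ dist x y < ρ * 2 ^ (J + 1)},
          |g y| * (ρ / dist x y ^ (Q + 1)) ∂μ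
        ≤ ∫ y in {y | ρ * 2 ^ J ≤ dist x y ∧ dist x y < ρ * 2 ^ (J + 1)},
          |g y| * (ρ / (ρ * 2 ^ J) ^ (Q + 1)) ∂μ := by
          refine setIntegral_mono_on (integrableOn_tail x hp hg)
            ((hg.mono_set (shell_subset_ball x _ _)).abs.mul_const _)
            (measurableSet_shell x _ _) ?_
          rintro y ⟨h1, -⟩
          gcongr
      _ = (∫ y in {y | ρ * 2 ^ J ≤ dist x y ∧ dist x y < ρ * 2 ^ (J + 1)}, |g y| ∂μ) *
          (ρ / (ρ * 2 ^ J) ^ (Q + 1)) := integral_mul_const _ _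
      _ ≤ (∫ y in Metric.ball x (ρ * 2 ^ (J + 1)), |g y| ∂μ) *
          (ρ / (ρ * 2 ^ J) ^ (Q + 1)) := by
          refine mul_le_mul_of_nonneg_right ?_ (by positivity)
          exact setIntegral_mono_set hg.abs (Eventually.of_forall fun y => abs_nonneg _)
            (shell_subset_ball x _ _).eventuallyLE
      _ = _ := by
          rw [hμ.measureReal_ball x (by positivity)]
          simp only [mul_pow, pow_succ, one_div, inv_pow]
          have h2 : ((2 : ℝ) ^ J) ^ Q ≠ 0 := by positivity
          field_simp

theorem sum_half_pow_le (J : ℕ) : ∑ j ∈ Finset.range J, (1 / 2 : ℝ) ^ j ≤ 2 := by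
  have h := (summable_geometric_two).sum_le_tsum (Finset.range J) (fun _ _ => by positivity)
  rwa [tsum_geometric_two] at h

/-- If the averages of `|g|` over small balls about `x` tend to zero, then so does
`ε ∫_{d(x, y) ≥ ε} |g(y)| d(x, y)^{-Q-1} dy`. -/
theorem tendsto_tail (hμ : RegularVolume μ c Q) {g : X → ℝ} (hg : Integrable g μ) (x : X)
    (hsmall : ∀ η > 0, ∃ δ > 0, ∀ s, 0 < s → s ≤ δ →
      ∫ y in Metric.ball x s, |g y| ∂μ ≤ η * μ.real (Metric.ball x s)) :
    Tendsto (fun ε => ∫ y in {y | ε ≤ dist x y}, |g y| * (ε / dist x y ^ (Q + 1)) ∂μ)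
      (𝓝[>] 0) (𝓝 0) := by
  have hc := hμ.pos
  have hset : ∀ r, MeasurableSet {y | r ≤ dist x y} := fun r =>
    measurableSet_le measurable_const (measurable_const.dist measurable_id)
  have hint : ∀ {a r : ℝ}, 0 < r → IntegrableOn (fun y => |g y| * (a / dist x y ^ (Q + 1)))
      {y | r ≤ dist x y} μ := by
    intro a r hr
    refine IntegrableOn.mul_of_abs_le (hset r) (C := |a| / r ^ (Q + 1)) hg.abs.integrableOn
      (measurable_const.div ((measurable_const.dist measurable_id).pow_const _)) ?_
    intro y (h1 : r ≤ dist x y)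
    rw [abs_div, abs_of_nonneg (a := dist x y ^ (Q + 1)) (by positivity)]
    gcongr
  rw [Metric.tendsto_nhdsWithin_nhds]
  intro e he
  obtain ⟨δ, hδ, hs⟩ := hsmall (e / (4 * (c * 2 ^ Q))) (by positivity)
  set G := ∫ y, |g y| ∂μ
  have hG : 0 ≤ G := integral_nonneg fun y => abs_nonneg _
  refine ⟨min δ (e / 4 * (δ / 2) ^ (Q + 1) / (G + 1)), by positivity, ?_⟩
  intro ε hε hdist
  have hε : 0 < ε := hε
  rw [Real.dist_eq, sub_zero, abs_of_pos hε] at hdist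
  have hεδ : ε < δ := hdist.trans_le (min_le_left _ _)
  have hεG : ε < e / 4 * (δ / 2) ^ (Q + 1) / (G + 1) := hdist.trans_le (min_le_right _ _)
  -- split at the distance `ε 2ᴶ`, which is comparable to `δ`: small averages below it, a factor `ε`
  -- against a fixed power of `δ` above it
  obtain ⟨J, hJ1, hJ2⟩ := exists_nat_pow_near (x := δ / ε) (y := 2)
    ((one_le_div hε).2 hεδ.le) (by norm_num)
  rw [le_div_iff₀ hε] at hJ1
  rw [div_lt_iff₀ hε, pow_succ] at hJ2
  have hpJ : (1 : ℝ) ≤ 2 ^ J := one_le_pow₀ (by norm_num)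
  have e1 : ∫ y in {y | ε ≤ dist x y}, |g y| * (ε / dist x y ^ (Q + 1)) ∂μ =
      (∫ y in {y | ε ≤ dist x y ∧ dist x y < ε * 2 ^ J}, |g y| * (ε / dist x y ^ (Q + 1)) ∂μ) +
      ∫ y in {y | ε * 2 ^ J ≤ dist x y}, |g y| * (ε / dist x y ^ (Q + 1)) ∂μ := by
    rw [← setIntegral_union _ (hset _)
      ((hint hε).mono_set fun y hy => hy.1) (hint (by positivity))]
    · congr 2
      ext y
      simp only [mem_ofPred_eq, mem_union]
      constructor
      · intro b1
        rcases lt_or_ge (dist x y) (ε * 2 ^ J) with h | h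
        · exact Or.inl ⟨b1, h⟩
        · exact Or.inr h
      · rintro (⟨b1, b2⟩ | b1)
        · exact b1
        · nlinarith
    · rw [Set.disjoint_left]
      rintro y ⟨-, h⟩ h'
      exact absurd h (not_lt.2 h')
  have e2 : ∫ y in {y | ε ≤ dist x y ∧ dist x y < ε * 2 ^ J},
      |g y| * (ε / dist x y ^ (Q + 1)) ∂μ ≤ e / 2 := by
    refine (setIntegral_tail_le hμ x hε J hg.integrableOn).trans ?_
    calc c * 2 ^ Q * ∑ j ∈ Finset.range J, (1 / 2 : ℝ) ^ j *
        ((μ.real (Metric.ball x (ε * 2 ^ (j + 1))))⁻¹ *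
          ∫ y in Metric.ball x (ε * 2 ^ (j + 1)), |g y| ∂μ)
        ≤ c * 2 ^ Q * ∑ j ∈ Finset.range J, (1 / 2 : ℝ) ^ j * (e / (4 * (c * 2 ^ Q))) := by
          gcongr with j hj
          have hjJ : j + 1 ≤ J := Finset.mem_range.1 hj
          have hle : (2 : ℝ) ^ (j + 1) ≤ 2 ^ J := pow_le_pow_right₀ (by norm_num) hjJ
          have hpos : 0 < ε * 2 ^ (j + 1) := by positivity
          have h1 := hs (ε * 2 ^ (j + 1)) hpos (by nlinarith)
          rw [inv_mul_le_iff₀ (hμ.measureReal_ball_pos x hpos)]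
          linarith
      _ = (∑ j ∈ Finset.range J, (1 / 2 : ℝ) ^ j) * (e / 4) := by
          rw [← Finset.sum_mul]; field_simp
      _ ≤ 2 * (e / 4) := by gcongr; exact sum_half_pow_le J
      _ = e / 2 := by ring
  have e3 : ∫ y in {y | ε * 2 ^ J ≤ dist x y}, |g y| * (ε / dist x y ^ (Q + 1)) ∂μ ≤ e / 4 := by
    have hδ2 : δ / 2 ≤ ε * 2 ^ J := by nlinarith
    calc _ ≤ ∫ y in {y | ε * 2 ^ J ≤ dist x y}, |g y| * (ε / (δ / 2) ^ (Q + 1)) ∂μ := by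
          refine setIntegral_mono_on (hint (by positivity)) (hg.abs.integrableOn.mul_const _)
            (hset _) ?_
          intro y (hy : ε * 2 ^ J ≤ dist x y)
          have := hδ2.trans hy
          gcongr
      _ = (∫ y in {y | ε * 2 ^ J ≤ dist x y}, |g y| ∂μ) * (ε / (δ / 2) ^ (Q + 1)) :=
          integral_mul_const _ _
      _ ≤ (G + 1) * (ε / (δ / 2) ^ (Q + 1)) := by
          gcongr
          exact (setIntegral_le_integral hg.abs (Eventually.of_forall fun y => abs_nonneg _)).trans
            (by linarith)
      _ ≤ e / 4 := by
          rw [lt_div_iff₀ (by positivity)] at hεG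
          rw [← mul_div_assoc, div_le_iff₀ (by positivity)]
          linarith
  have e0 : 0 ≤ ∫ y in {y | ε ≤ dist x y}, |g y| * (ε / dist x y ^ (Q + 1)) ∂μ :=
    integral_nonneg fun y => by positivity
  rw [Real.dist_eq, sub_zero, abs_of_nonneg e0, e1]
  linarith

end Tail

/-! ### `L²` norms and averages -/

section LTwo

variable {X : Type*} [MeasurableSpace X] {μ : Measure X}

theorem norm_sq_eq_integral (g : Lp ℝ 2 μ) : ‖g‖ ^ 2 = ∫ y, g y ^ 2 ∂μ := by
  rw [← real_inner_self_eq_norm_sq, L2.inner_def]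
  refine integral_congr_ae (Eventually.of_forall fun y => ?_)
  simp only [RCLike.inner_apply, conj_trivial]; ring

theorem setIntegral_abs_le (h : Lp ℝ 2 μ) {s : Set X} (hs : MeasurableSet s) (hμs : μ s ≠ ⊤) :
    ∫ y in s, |h y| ∂μ ≤ √(μ.real s) * ‖h‖ := by
  have h1 := L2.inner_indicatorConstLp_one (𝕜 := ℝ) hs hμs |h|
  have h2 : ∫ y in s, |h| y ∂μ = ∫ y in s, |h y| ∂μ :=
    integral_congr_ae (ae_restrict_of_ae (by
      filter_upwards [Lp.coeFn_abs h] with y hy; rw [hy]))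
  rw [← h2, ← h1]
  refine (real_inner_le_norm _ _).trans ?_
  rw [norm_indicatorConstLp (by norm_num) (by norm_num), norm_abs_eq_norm]
  apply le_of_eq
  rw [norm_one, one_mul, Real.sqrt_eq_rpow]; norm_num

end LTwo

/-! ### Principal values -/

namespace SingularKernel

variable {X : Type*} [MetricSpace X] [MeasurableSpace X] {μ : Measure X} {c : ℝ} {Q : ℕ}
  {A B : ℝ} {k : X → X → ℝ} [BorelSpace X]

theorem integrable_of_vanish (hμ : RegularVolume μ c Q) (f : Lp ℝ 2 μ) {o : X} {L : ℝ}
    (h0 : ∀ᵐ y ∂μ, y ∉ Metric.ball o L → f y = 0) : Integrable f μ := by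
  have h1 : IntegrableOn f (Metric.ball o L) μ :=
    (integrableOn_of_memLp hμ (Lp.memLp f) o L).mono_set Metric.ball_subset_closedBall
  refine (h1.integrable_indicator measurableSet_ball).congr ?_
  filter_upwards [h0] with y hy
  by_cases h : y ∈ Metric.ball o L
  · rw [indicator_of_mem h]
  · rw [indicator_of_notMem h, hy h]

variable [SecondCountableTopology X]

theorem integrable_mul_of_far (hk : SingularKernel μ Q A B k) {g : X → ℝ} (hg : Integrable g μ)
    {z : X} {ε : ℝ} (hε : 0 < ε) (h0 : ∀ᵐ y ∂μ, dist z y < ε → g y = 0) :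
    Integrable (fun y => k z y * g y) μ := by
  have hA := hk.size_nonneg
  have hS : MeasurableSet {y | ε ≤ dist z y} :=
    measurableSet_le measurable_const (measurable_const.dist measurable_id)
  have h1 : IntegrableOn (fun y => g y * k z y) {y | ε ≤ dist z y} μ := by
    refine IntegrableOn.mul_of_abs_le hS (C := A / ε ^ Q) hg.integrableOn
      (hk.measurable.comp measurable_prodMk_left) ?_
    intro y (hy : ε ≤ dist z y)
    refine (hk.size z y (dist_pos.1 (hε.trans_le hy))).trans ?_
    gcongr
  refine (h1.integrable_indicator hS).congr ?_
  filter_upwards [h0] with y hy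
  by_cases h : ε ≤ dist z y
  · rw [indicator_of_mem (by exact h), mul_comm]
  · rw [indicator_of_notMem (by exact h), hy (not_le.1 h), mul_zero]

theorem integrableOn_truncated (hk : SingularKernel μ Q A B k) {f : X → ℝ} (hf : Integrable f μ)
    (x : X) {ε : ℝ} (hε : 0 < ε) :
    IntegrableOn (fun y => k x y * f y) {y | ε < dist x y} μ := by
  have hS : MeasurableSet {y | ε < dist x y} :=
    measurableSet_lt measurable_const (measurable_const.dist measurable_id)
  have h := hk.integrable_mul_of_far (hf.indicator hS) hε (z := x) (Eventually.of_forall fun y hy =>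
    indicator_of_notMem (by rw [mem_ofPred_eq]; exact not_lt.2 hy.le) f)
  have h' := h.integrableOn (s := {y | ε < dist x y})
  refine h'.congr_fun (fun y hy => ?_) hS
  simp only [indicator_of_mem hy]

variable [SFinite μ]

/-- Convergence of the truncations at a point `x` that is a Lebesgue point, in the `L²` sense for
`f` and in the `L¹` sense for the singular integral of `f`. The truncated integral is compared with
the average over `B(x, ε / 2)` of the singular integral of `(f - f(x)) 1_{d(x, ·) ≥ ε}`. -/
theorem tendsto_truncated_of_lebesgue (hμ : RegularVolume μ c Q) (hk : SingularKernel μ Q A B k)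
    (f : Lp ℝ 2 μ) {o : X} {L₀ : ℝ} (h0 : ∀ᵐ y ∂μ, y ∉ Metric.ball o L₀ → f y = 0) (x : X)
    {ℓ m : ℝ}
    (h1 : Tendsto (fun s => (μ.real (Metric.ball x s))⁻¹ * ∫ y in Metric.ball x s, (f y - ℓ) ^ 2 ∂μ)
      (𝓝[>] 0) (𝓝 0))
    (h2 : Tendsto (fun s => (μ.real (Metric.ball x s))⁻¹ *
      ∫ y in Metric.ball x s, |hk.limitOp hμ f y - m| ∂μ) (𝓝[>] 0) (𝓝 0)) :
    Tendsto (fun ε => ∫ y in {y | ε < dist x y}, k x y * f y ∂μ) (𝓝[>] 0) (𝓝 m) := by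
  have hA := hk.size_nonneg
  have hB := hk.smooth_nonneg
  have hc := hμ.pos
  -- `f = g + ℓ 1_{B(x, L)}`, where `B(x, L)` contains the support of `f`
  set L : ℝ := dist x o + |L₀| + 1 with hLdef
  have hL : 0 < L := by positivity
  have hf0 : ∀ᵐ y ∂μ, y ∉ Metric.ball x L → f y = 0 := by
    filter_upwards [h0] with y hy hyL
    refine hy fun h => hyL ?_
    rw [Metric.mem_ball] at h ⊢
    have := dist_triangle y o x
    rw [dist_comm o x] at this
    linarith [le_abs_self L₀]
  set χ := ballIndicator hμ x L
  have hχ : ∀ᵐ y ∂μ, χ y = (Metric.ball x L).indicator (fun _ => (1 : ℝ)) y := indicatorConstLp_coeFn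
  set g : Lp ℝ 2 μ := f - ℓ • χ with hg
  have hgf : ∀ᵐ y ∂μ, g y = (Metric.ball x L).indicator (fun y => f y - ℓ) y := by
    filter_upwards [Lp.coeFn_sub f (ℓ • χ), Lp.coeFn_smul ℓ χ, hχ, hf0] with y a1 a2 a3 a4
    rw [a1, Pi.sub_apply, a2, Pi.smul_apply, a3, smul_eq_mul]
    by_cases hy : y ∈ Metric.ball x L
    · rw [indicator_of_mem hy, indicator_of_mem hy, mul_one]
    · rw [indicator_of_notMem hy, indicator_of_notMem hy, a4 hy, mul_zero, sub_zero]
  have hg0 : ∀ᵐ y ∂μ, y ∉ Metric.ball x L → g y = 0 := by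
    filter_upwards [hgf] with y a1 a2
    rw [a1, indicator_of_notMem a2]
  have hgint : Integrable g μ := integrable_of_vanish hμ g hg0
  set v : ℝ → ℝ := fun s => (μ.real (Metric.ball x s))⁻¹ *
    ∫ y in Metric.ball x s, (f y - ℓ) ^ 2 ∂μ with hv
  set w : ℝ → ℝ := fun s => (μ.real (Metric.ball x s))⁻¹ *
      ∫ y in Metric.ball x s, |hk.limitOp hμ f y - m| ∂μ with hw
  have hm1 : ∀ s, MemLp ((Metric.ball x s).indicator g) 2 μ := fun s =>
    (Lp.memLp g).indicator measurableSet_ball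
  -- the part of `g` near `x` has small `L²` norm
  have hnorm : ∀ s, 0 < s → s ≤ L →
      ‖(hm1 s).toLp _‖ ^ 2 = μ.real (Metric.ball x s) * v s := by
    intro s hs hsL
    rw [norm_sq_eq_integral, hv]
    simp only
    rw [mul_inv_cancel_left₀ (hμ.measureReal_ball_pos x hs).ne', ← integral_indicator
      measurableSet_ball]
    refine integral_congr_ae ?_
    filter_upwards [(hm1 s).coeFn_toLp, hgf] with y a1 a2
    rw [a1]
    by_cases hy : y ∈ Metric.ball x s
    · rw [indicator_of_mem hy, indicator_of_mem hy, a2,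
        indicator_of_mem (Metric.ball_subset_ball hsL hy)]
    · rw [indicator_of_notMem hy, indicator_of_notMem hy]; simp
  have hsmall : ∀ η > 0, ∃ δ > 0, ∀ s, 0 < s → s ≤ δ →
      ∫ y in Metric.ball x s, |g y| ∂μ ≤ η * μ.real (Metric.ball x s) := by
    intro η hη
    have := h1.eventually_lt_const (show 0 < η ^ 2 by positivity)
    obtain ⟨δ, hδ, hs⟩ := mem_nhdsGT_iff_exists_Ioc_subset.1 this
    have hδ : 0 < δ := hδ
    refine ⟨min δ L, by positivity, fun s hs0 hsδ => ?_⟩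
    have hvs : v s < η ^ 2 := hs ⟨hs0, hsδ.trans (min_le_left _ _)⟩
    have e1 : ∫ y in Metric.ball x s, |g y| ∂μ = ∫ y in Metric.ball x s, |(hm1 s).toLp _ y| ∂μ := by
      refine setIntegral_congr_ae measurableSet_ball ?_
      filter_upwards [(hm1 s).coeFn_toLp] with y a1 hy
      rw [a1, indicator_of_mem hy]
    have hp := hμ.measureReal_ball_pos x hs0
    rw [e1]
    refine (setIntegral_abs_le _ measurableSet_ball (hμ.measure_ball_lt_top x s).ne).trans ?_
    have h3 : ‖(hm1 s).toLp _‖ ≤ √(μ.real (Metric.ball x s)) * η := by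
      refine le_of_sq_le_sq ?_ (by positivity)
      rw [hnorm s hs0 (hsδ.trans (min_le_right _ _)), mul_pow, Real.sq_sqrt hp.le]
      gcongr
    calc _ ≤ √(μ.real (Metric.ball x s)) * (√(μ.real (Metric.ball x s)) * η) := by gcongr
      _ = η * μ.real (Metric.ball x s) := by
        rw [← mul_assoc, Real.mul_self_sqrt hp.le, mul_comm]
  have hE := tendsto_tail hμ hgint x hsmall
  set E : ℝ → ℝ := fun ε => ∫ y in {y | ε ≤ dist x y}, |g y| * (ε / dist x y ^ (Q + 1)) ∂μ
  set Γ := ‖hk.limitOp hμ‖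
  set D : ℝ := A * c * Q * 4 ^ Q / L
  have main : ∀ ε, 0 < ε → ε < L →
      |(∫ y in {y | ε < dist x y}, k x y * f y ∂μ) - m| ≤
        B * E ε + w (ε / 2) + Γ * √(2 ^ Q * v ε) + |ℓ| * (D * ε) := by
    intro ε hε hεL
    set b := Metric.ball x (ε / 2)
    have hb : 0 < μ.real b := hμ.measureReal_ball_pos x (by positivity)
    have hbfin : μ b ≠ ⊤ := (hμ.measure_ball_lt_top x _).ne
    set I := ∫ y in {y | ε < dist x y}, k x y * f y ∂μ
    -- `g = g₁ + g₂`, with `g₁` supported in `B(x, ε)` and `g₂` outside of it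
    have hm2 : MemLp ((Metric.ball x ε)ᶜ.indicator g) 2 μ :=
      (Lp.memLp g).indicator measurableSet_ball.compl
    set g₁ : Lp ℝ 2 μ := (hm1 ε).toLp _
    set g₂ : Lp ℝ 2 μ := hm2.toLp _
    have hg₂ : ∀ᵐ y ∂μ, g₂ y = (Metric.ball x ε)ᶜ.indicator g y := hm2.coeFn_toLp
    have hsum : g = g₁ + g₂ := by
      rw [← MemLp.toLp_add]
      refine Lp.ext ?_
      filter_upwards [((hm1 ε).add hm2).coeFn_toLp] with y a1
      rw [a1, Pi.add_apply, indicator_self_add_compl_apply]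
    have hTf : hk.limitOp hμ f = hk.limitOp hμ g₁ + hk.limitOp hμ g₂ + ℓ • hk.limitOp hμ χ := by
      rw [← map_add, ← hsum, hg, map_sub, map_smul, sub_add_cancel]
    have hg₂0 : ∀ᵐ y ∂μ, y ∉ Metric.ball x L → g₂ y = 0 := by
      filter_upwards [hg₂, hg0] with y a1 a2 hy
      rw [a1, indicator, a2 hy, ite_self]
    have hg₂near : ∀ᵐ y ∂μ, dist x y < ε → g₂ y = 0 := by
      filter_upwards [hg₂] with y a1 hy
      rw [a1, indicator_of_notMem]
      rw [notMem_compl_iff, Metric.mem_ball, dist_comm]; exact hy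
    have hoff := hk.limitOp_ae_of_vanish hμ (f := g₂) (x₀ := x) (r := ε / 2) (L := L)
      (by positivity) (by
        filter_upwards [hg₂near] with y a1 hy
        refine a1 ?_
        rw [Metric.mem_ball, dist_comm] at hy; linarith) hg₂0
    have hg₂int : Integrable g₂ μ := integrable_of_vanish hμ g₂ hg₂0
    have hS : MeasurableSet {y | ε < dist x y} :=
      measurableSet_lt measurable_const (measurable_const.dist measurable_id)
    have hSle : MeasurableSet {y | ε ≤ dist x y} :=
      measurableSet_le measurable_const (measurable_const.dist measurable_id)
    have hx₂ : Integrable (fun y => k x y * g₂ y) μ := hk.integrable_mul_of_far hg₂int hε hg₂near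
    -- the truncated integral of `f` is that of `g`, since the kernel has mean zero on annuli
    have hI : I = ∫ y, k x y * g₂ y ∂μ := by
      have e1 : ∫ y, k x y * g₂ y ∂μ = ∫ y in {y | ε < dist x y}, k x y * g y ∂μ := by
        rw [← integral_indicator hS]
        have hsph : ∀ᵐ y ∂μ, y ∉ Metric.sphere x ε :=
          measure_eq_zero_iff_ae_notMem.1 (hμ.measure_sphere x hε)
        refine integral_congr_ae ?_
        filter_upwards [hsph, hg₂] with y a1 a2
        rw [Metric.mem_sphere, dist_comm] at a1
        rcases lt_trichotomy (dist x y) ε with h | h | h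
        · rw [indicator_of_notMem (by rw [mem_ofPred_eq]; linarith), a2, indicator_of_notMem,
            mul_zero]
          rw [notMem_compl_iff, Metric.mem_ball, dist_comm]; exact h
        · exact absurd h a1
        · rw [indicator_of_mem (by exact h), a2, indicator_of_mem]
          rw [mem_compl_iff, Metric.mem_ball, dist_comm]; linarith
      have e2 : ∫ y in {y | ε < dist x y}, k x y * χ y ∂μ = 0 := by
        have hSL : MeasurableSet {y | ε < dist x y ∧ dist x y < L} :=
          hS.inter (measurableSet_lt (measurable_const.dist measurable_id) measurable_const)
        rw [← (hk.cancel ε L hε hεL x).1, ← integral_indicator hS, ← integral_indicator hSL]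
        refine integral_congr_ae ?_
        filter_upwards [hχ] with y a1
        rcases lt_or_ge ε (dist x y) with h | h
        · rw [indicator_of_mem (by exact h), a1]
          rcases lt_or_ge (dist x y) L with h' | h'
          · rw [indicator_of_mem (by rw [Metric.mem_ball, dist_comm]; exact h'), mul_one,
              indicator_of_mem (by exact ⟨h, h'⟩)]
          · rw [indicator_of_notMem (by rw [Metric.mem_ball, dist_comm]; linarith), mul_zero,
              indicator_of_notMem (by rintro ⟨-, h''⟩; exact absurd h'' (not_lt.2 h'))]
        · rw [indicator_of_notMem (by rw [mem_ofPred_eq]; linarith),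
            indicator_of_notMem (by rintro ⟨h'', -⟩; exact absurd h'' (not_lt.2 h))]
      have iχ : IntegrableOn (fun y => k x y * χ y) {y | ε < dist x y} μ :=
        hk.integrableOn_truncated (integrable_of_vanish hμ χ (o := x) (L := L) (by
          filter_upwards [hχ] with y a1 a2; rw [a1, indicator_of_notMem a2])) x hε
      rw [e1]
      have e3 : I = ∫ y in {y | ε < dist x y}, (k x y * g y + ℓ * (k x y * χ y)) ∂μ := by
        refine setIntegral_congr_ae hS ?_
        filter_upwards [Lp.coeFn_sub f (ℓ • χ), Lp.coeFn_smul ℓ χ] with y a1 a2 _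
        rw [hg, a1, Pi.sub_apply, a2, Pi.smul_apply, smul_eq_mul]; ring
      rw [e3, integral_add (hk.integrableOn_truncated hgint x hε) (iχ.const_mul ℓ),
        integral_const_mul, e2, mul_zero, add_zero]
    -- moving `x` to `z ∈ B(x, ε / 2)` costs only a tail, by the smoothness of the kernel
    have hItail : ∀ᵐ z ∂μ, z ∈ b → |I - hk.limitOp hμ g₂ z| ≤ B * E ε := by
      filter_upwards [hoff] with z hz hzb
      have hdz : dist x z < ε / 2 := by rw [dist_comm]; exact hzb
      have hz₂ : Integrable (fun y => k z y * g₂ y) μ := by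
        refine hk.integrable_mul_of_far hg₂int (ε := ε / 2) (by positivity) ?_
        filter_upwards [hg₂near] with y a1 a2
        exact a1 (by linarith [dist_triangle x z y])
      rw [hz hzb, hI, ← integral_sub hx₂ hz₂, ← Real.norm_eq_abs]
      have hEint : Integrable ({y | ε ≤ dist x y}.indicator
          fun y => B * (|g y| * (ε / dist x y ^ (Q + 1)))) μ := by
        refine IntegrableOn.integrable_indicator (Integrable.const_mul ?_ B) hSle
        refine IntegrableOn.mul_of_abs_le hSle (C := ε / ε ^ (Q + 1)) hgint.abs.integrableOn
          (measurable_const.div ((measurable_const.dist measurable_id).pow_const _)) ?_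
        intro y (hy : ε ≤ dist x y)
        rw [abs_of_nonneg (by positivity)]; gcongr
      have : B * E ε = ∫ y, ({y | ε ≤ dist x y}.indicator
          fun y => B * (|g y| * (ε / dist x y ^ (Q + 1)))) y ∂μ := by
        rw [integral_indicator hSle, integral_const_mul]
      rw [this]
      refine norm_integral_le_of_norm_le hEint ?_
      filter_upwards [hg₂near, hg₂] with y a1 a2
      by_cases hy : ε ≤ dist x y
      · have hmem : y ∈ (Metric.ball x ε)ᶜ := by
          rw [mem_compl_iff, Metric.mem_ball, dist_comm]; linarith
        rw [indicator_of_mem (by exact hy), a2, indicator_of_mem hmem, ← sub_mul, Real.norm_eq_abs,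
          abs_mul]
        have h3 := hk.smooth x z y (by linarith)
        have h4 : |k x y - k z y| ≤ B * (ε / dist x y ^ (Q + 1)) := by
          rw [abs_sub_comm]
          have : B * (dist x z / dist x y ^ (Q + 1)) ≤ B * (ε / dist x y ^ (Q + 1)) := by
            have : dist x z ≤ ε := by linarith
            gcongr
          linarith [abs_nonneg (k y z - k y x)]
        calc |k x y - k z y| * |g y| ≤ B * (ε / dist x y ^ (Q + 1)) * |g y| := by gcongr
          _ = _ := by ring
      · rw [indicator_of_notMem (by exact hy), a1 (not_le.1 hy)]; simp
    have hχb := hk.abs_limitOp_ballIndicator_le hμ x (L := L) (h := ε / 2) (by positivity)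
      (by linarith)
    -- pointwise comparison on `B(x, ε / 2)`, to be averaged over that ball
    have hpt : ∀ᵐ z ∂μ, z ∈ b → |I - m| ≤
        B * E ε + |hk.limitOp hμ f z - m| + |hk.limitOp hμ g₁ z| + |ℓ| * (D * ε) := by
      filter_upwards [hItail, hχb, Lp.coeFn_add (hk.limitOp hμ g₁ + hk.limitOp hμ g₂)
        (ℓ • hk.limitOp hμ χ), Lp.coeFn_add (hk.limitOp hμ g₁) (hk.limitOp hμ g₂),
        Lp.coeFn_smul ℓ (hk.limitOp hμ χ)] with z a1 a2 a3 a4 a5 hzb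
      rw [← hTf, Pi.add_apply, a4, a5, Pi.add_apply, Pi.smul_apply, smul_eq_mul] at a3
      have b1 := a1 hzb
      have b2 : |ℓ * hk.limitOp hμ χ z| ≤ |ℓ| * (D * ε) := by
        rw [abs_mul]
        have h5 : A * c * Q * 4 ^ Q * (ε / 2 / L) ≤ D * ε := by
          have : A * c * Q * 4 ^ Q * (ε / 2 / L) = D * ε / 2 := by
            simp only [D]; ring
          rw [this]
          have : 0 ≤ D * ε := by positivity
          linarith
        gcongr
        exact (a2 hzb).trans h5
      have e : I - m = (I - hk.limitOp hμ g₂ z) + (hk.limitOp hμ f z - m) -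
          hk.limitOp hμ g₁ z - ℓ * hk.limitOp hμ χ z := by rw [a3]; ring
      rw [e]
      refine (abs_sub _ _).trans (add_le_add ((abs_sub _ _).trans
        (add_le_add ((abs_add_le _ _).trans (add_le_add b1 le_rfl)) le_rfl)) b2)
    have i1 : IntegrableOn (fun z => |hk.limitOp hμ f z - m|) b μ := by
      refine Integrable.abs (Integrable.sub ?_ (integrableOn_const hbfin))
      exact (integrableOn_of_memLp hμ (Lp.memLp _) x _).mono_set Metric.ball_subset_closedBall
    have i2 : IntegrableOn (fun z => |hk.limitOp hμ g₁ z|) b μ :=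
      Integrable.abs ((integrableOn_of_memLp hμ (Lp.memLp _) x _).mono_set
        Metric.ball_subset_closedBall)
    have ic : ∀ a : ℝ, IntegrableOn (fun _ => a) b μ := fun a => integrableOn_const hbfin
    have hint : |I - m| * μ.real b ≤ (B * E ε) * μ.real b + μ.real b * w (ε / 2) +
        (∫ z in b, |hk.limitOp hμ g₁ z| ∂μ) + |ℓ| * (D * ε) * μ.real b := by
      have e1 : ∫ z in b, |I - m| ∂μ = |I - m| * μ.real b := by
        rw [setIntegral_const, smul_eq_mul, mul_comm]
      rw [← e1]
      have e2 : ∫ z in b, (B * E ε + |hk.limitOp hμ f z - m| + |hk.limitOp hμ g₁ z| +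
          |ℓ| * (D * ε)) ∂μ = (B * E ε) * μ.real b + μ.real b * w (ε / 2) +
          (∫ z in b, |hk.limitOp hμ g₁ z| ∂μ) + |ℓ| * (D * ε) * μ.real b := by
        have i3 : IntegrableOn (fun z => B * E ε + |hk.limitOp hμ f z - m|) b μ :=
          (ic _).add i1
        have i4 : IntegrableOn (fun z => B * E ε + |hk.limitOp hμ f z - m| +
          |hk.limitOp hμ g₁ z|) b μ := i3.add i2
        rw [integral_add i4 (ic _), integral_add i3 i2, integral_add (ic _) i1, setIntegral_const,
          setIntegral_const, smul_eq_mul, smul_eq_mul, hw]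
        simp only
        rw [mul_inv_cancel_left₀ hb.ne']
        ring
      rw [← e2]
      exact setIntegral_mono_on_ae (ic _) (((((ic _).add i1)).add i2).add (ic _))
        measurableSet_ball hpt
    -- `L²` boundedness handles the part of `g` near `x`
    have hTg₁ : ∫ z in b, |hk.limitOp hμ g₁ z| ∂μ ≤ μ.real b * (Γ * √(2 ^ Q * v ε)) := by
      refine (setIntegral_abs_le _ measurableSet_ball hbfin).trans ?_
      have h3 : ‖hk.limitOp hμ g₁‖ ≤ Γ * ‖g₁‖ := ContinuousLinearMap.le_opNorm _ _
      have hv0 : 0 ≤ v ε := mul_nonneg (by positivity) (integral_nonneg fun y => sq_nonneg _)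
      have h4 : ‖g₁‖ = √(μ.real b) * √(2 ^ Q * v ε) := by
        have hv2 := hnorm ε hε hεL.le
        have : μ.real (Metric.ball x ε) = 2 ^ Q * μ.real b := by
          have := hμ.measureReal_ball_mul x x (r := ε / 2) (a := 2) (by positivity) (by norm_num)
          rwa [mul_div_cancel₀ _ (two_ne_zero)] at this
        rw [← Real.sqrt_mul hb.le, ← Real.sqrt_sq (norm_nonneg g₁), hv2, this]
        congr 1; ring
      calc √(μ.real b) * ‖hk.limitOp hμ g₁‖ ≤ √(μ.real b) * (Γ * (√(μ.real b) * √(2 ^ Q * v ε))) := by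
            rw [← h4]; gcongr
        _ = (√(μ.real b) * √(μ.real b)) * (Γ * √(2 ^ Q * v ε)) := by ring
        _ = _ := by rw [Real.mul_self_sqrt hb.le]
    refine le_of_mul_le_mul_right (a := μ.real b) ?_ hb
    calc |I - m| * μ.real b ≤ _ := hint
      _ ≤ (B * E ε) * μ.real b + μ.real b * w (ε / 2) + μ.real b * (Γ * √(2 ^ Q * v ε)) +
          |ℓ| * (D * ε) * μ.real b := by gcongr
      _ = _ := by ring
  have hlim : Tendsto (fun ε => B * E ε + w (ε / 2) + Γ * √(2 ^ Q * v ε) + |ℓ| * (D * ε))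
      (𝓝[>] 0) (𝓝 0) := by
    have t0 : Tendsto (fun ε : ℝ => ε) (𝓝[>] 0) (𝓝 0) := tendsto_id.mono_left nhdsWithin_le_nhds
    have t1 : Tendsto (fun ε => w (ε / 2)) (𝓝[>] 0) (𝓝 0) := by
      refine h2.comp (tendsto_nhdsWithin_iff.2 ⟨?_, ?_⟩)
      · simpa using t0.div_const 2
      · filter_upwards [self_mem_nhdsWithin] with ε hε
        have : 0 < ε := hε
        exact half_pos this
    have t2 : Tendsto (fun ε => √(2 ^ Q * v ε)) (𝓝[>] 0) (𝓝 0) := by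
      have := (h1.const_mul (2 ^ Q)).sqrt
      simpa using this
    have := (((hE.const_mul B).add t1).add (t2.const_mul Γ)).add ((t0.const_mul D).const_mul |ℓ|)
    simpa using this
  rw [tendsto_iff_dist_tendsto_zero]
  refine squeeze_zero' (Eventually.of_forall fun _ => dist_nonneg) ?_ hlim
  filter_upwards [Ioo_mem_nhdsGT hL] with ε hε
  rw [Real.dist_eq]
  exact main ε hε.1 hε.2

/-- Almost everywhere convergence of the truncated integrals of a square integrable function with
bounded support. -/
theorem ae_tendsto_truncated (hμ : RegularVolume μ c Q) (hk : SingularKernel μ Q A B k)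
    (f : Lp ℝ 2 μ) {o : X} {L₀ : ℝ} (h0 : ∀ᵐ y ∂μ, y ∉ Metric.ball o L₀ → f y = 0) :
    ∀ᵐ x ∂μ, Tendsto (fun ε => ∫ y in {y | ε < dist x y}, k x y * f y ∂μ) (𝓝[>] 0)
      (𝓝 (hk.limitOp hμ f x)) := by
  have := hμ.isUnifLocDoublingMeasure
  have := hμ.isLocallyFiniteMeasure
  have hloc : ∀ g : Lp ℝ 2 μ, LocallyIntegrable g μ := fun g x =>
    ⟨Metric.closedBall x 1, Metric.closedBall_mem_nhds x one_pos,
      integrableOn_of_memLp hμ (Lp.memLp g) x 1⟩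
  have hsq : LocallyIntegrable (fun y => f y ^ 2) μ := (Lp.memLp f).integrable_sq.locallyIntegrable
  have hmem : ∀ x : X, ∀ᶠ s : ℝ in 𝓝[>] 0, x ∈ Metric.closedBall x (1 * s) := fun x => by
    filter_upwards [self_mem_nhdsWithin] with s hs
    have hs : 0 < s := hs
    exact Metric.mem_closedBall_self (by linarith)
  have havg : ∀ (u : X → ℝ) (x : X), ∀ᶠ s : ℝ in 𝓝[>] 0, ⨍ y in Metric.closedBall x s, u y ∂μ =
      (μ.real (Metric.ball x s))⁻¹ * ∫ y in Metric.ball x s, u y ∂μ := fun u x => by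
    filter_upwards [self_mem_nhdsWithin] with s hs
    rw [setAverage_eq, smul_eq_mul, hμ.restrict_closedBall x hs,
      measureReal_congr (hμ.ball_ae_eq_closedBall x hs)]
  filter_upwards [IsUnifLocDoublingMeasure.ae_tendsto_average μ (hloc f) 1,
    IsUnifLocDoublingMeasure.ae_tendsto_average μ hsq 1,
    IsUnifLocDoublingMeasure.ae_tendsto_average_norm_sub μ (hloc (hk.limitOp hμ f)) 1]
    with x a1 a2 a3
  refine hk.tendsto_truncated_of_lebesgue hμ f h0 x (ℓ := f x) ?_ ?_
  · have b1 := (a1 (fun _ => x) (fun s => s) tendsto_id (hmem x)).congr' (havg _ x)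
    have b2 := (a2 (fun _ => x) (fun s => s) tendsto_id (hmem x)).congr' (havg _ x)
    have b3 := (b2.sub (b1.const_mul (2 * f x))).add_const (f x ^ 2)
    have e0 : f x ^ 2 - 2 * f x * f x + f x ^ 2 = 0 := by ring
    rw [e0] at b3
    refine b3.congr' ?_
    filter_upwards [self_mem_nhdsWithin] with s hs
    have hpos := hμ.measureReal_ball_pos x hs
    have i1 : IntegrableOn f (Metric.ball x s) μ :=
      (integrableOn_of_memLp hμ (Lp.memLp f) x s).mono_set Metric.ball_subset_closedBall
    have i2 : IntegrableOn (fun y => f y ^ 2) (Metric.ball x s) μ :=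
      (Lp.memLp f).integrable_sq.integrableOn
    have ic : IntegrableOn (fun _ : X => f x ^ 2) (Metric.ball x s) μ :=
      integrableOn_const (hμ.measure_ball_lt_top x s).ne
    have e1 : ∫ y in Metric.ball x s, (f y - f x) ^ 2 ∂μ =
        (∫ y in Metric.ball x s, f y ^ 2 ∂μ) - 2 * f x * (∫ y in Metric.ball x s, f y ∂μ) +
          μ.real (Metric.ball x s) * f x ^ 2 := by
      have hcst : μ.real (Metric.ball x s) * f x ^ 2 = ∫ _ in Metric.ball x s, f x ^ 2 ∂μ := by
        rw [setIntegral_const, smul_eq_mul]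
      have i3 : IntegrableOn (fun y => f y ^ 2 - 2 * f x * f y) (Metric.ball x s) μ :=
        i2.sub (i1.const_mul _)
      rw [← integral_const_mul, hcst, ← integral_sub i2 (i1.const_mul _), ← integral_add i3 ic]
      refine integral_congr_ae (Eventually.of_forall fun y => ?_)
      simp only; ring
    rw [e1, mul_add, mul_sub, inv_mul_cancel_left₀ hpos.ne']
    ring
  · have b1 := (a3 (fun _ => x) (fun s => s) tendsto_id (hmem x)).congr' (havg _ x)
    simpa only [Real.norm_eq_abs] using b1

end SingularKernel

/-! ### The John–Nirenberg inequality for fourth powers -/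

/-- The function `f` is integrable on `B(z, s)`, with mean oscillation at most `M`. -/
def OscLE {X : Type*} [MetricSpace X] [MeasurableSpace X] (μ : Measure X) (f : X → ℝ) (z : X)
    (s M : ℝ) : Prop :=
  IntegrableOn f (Metric.ball z s) μ ∧
    ∫ y in Metric.ball z s, |f y - ⨍ w in Metric.ball z s, f w ∂μ| ∂μ ≤
      M * μ.real (Metric.ball z s)

theorem abs_setAverage_sub_le {X : Type*} [MeasurableSpace X] {μ : Measure X} {f : X → ℝ}
    {s : Set X} (hf : IntegrableOn f s μ) (h0 : 0 < μ.real s) (a : ℝ) :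
    |(⨍ y in s, f y ∂μ) - a| ≤ (μ.real s)⁻¹ * ∫ y in s, |f y - a| ∂μ := by
  have hfin : μ s ≠ ⊤ := fun h => by simp [Measure.real, h] at h0
  have e1 : (⨍ y in s, f y ∂μ) - a = (μ.real s)⁻¹ * ∫ y in s, (f y - a) ∂μ := by
    rw [integral_sub hf (integrableOn_const hfin), setAverage_eq, setIntegral_const, smul_eq_mul,
      smul_eq_mul, mul_sub, inv_mul_cancel_left₀ h0.ne']
  rw [e1, abs_mul, abs_of_pos (inv_pos.2 h0)]
  exact mul_le_mul_of_nonneg_left abs_integral_le_integral_abs (inv_pos.2 h0).le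

theorem integrableOn_abs_sub_const {X : Type*} [MeasurableSpace X] {μ : Measure X} {f : X → ℝ}
    {s : Set X} (hf : IntegrableOn f s μ) (hs : μ s ≠ ⊤) (a : ℝ) :
    IntegrableOn (fun y => |f y - a|) s μ :=
  (hf.sub (integrableOn_const hs)).abs

theorem setIntegral_abs_sub_setAverage_le {X : Type*} [MeasurableSpace X] {μ : Measure X}
    {f : X → ℝ} {s : Set X} (hf : IntegrableOn f s μ) (h0 : 0 < μ.real s) (a : ℝ) :
    ∫ y in s, |f y - ⨍ w in s, f w ∂μ| ∂μ ≤ 2 * ∫ y in s, |f y - a| ∂μ := by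
  have hfin : μ s ≠ ⊤ := fun h => by simp [Measure.real, h] at h0
  have ic : ∀ b : ℝ, IntegrableOn (fun _ => b) s μ := fun b => integrableOn_const hfin
  set m := ⨍ w in s, f w ∂μ
  have h1 := abs_setAverage_sub_le hf h0 a
  calc ∫ y in s, |f y - m| ∂μ ≤ ∫ y in s, (|f y - a| + |m - a|) ∂μ := by
        refine setIntegral_mono (hf.sub (ic m)).abs ((hf.sub (ic a)).abs.add (ic _)) fun y => ?_
        have : f y - m = (f y - a) - (m - a) := by ring
        simp only
        rw [this]; exact abs_sub _ _
    _ = (∫ y in s, |f y - a| ∂μ) + μ.real s * |m - a| := by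
        rw [integral_add (integrableOn_abs_sub_const hf hfin a) (ic _), setIntegral_const, smul_eq_mul]
    _ ≤ _ := by
        have : μ.real s * |m - a| ≤ ∫ y in s, |f y - a| ∂μ := by
          calc _ ≤ μ.real s * ((μ.real s)⁻¹ * ∫ y in s, |f y - a| ∂μ) := by gcongr
            _ = _ := by rw [mul_inv_cancel_left₀ h0.ne']
        linarith

section JohnNirenberg

variable {X : Type*} [MetricSpace X] [MeasurableSpace X] {μ : Measure X} {c : ℝ} {Q : ℕ}

theorem OscLE.abs_average_sub_le (hμ : RegularVolume μ c Q) {f : X → ℝ} {z z' : X} {s s' M : ℝ}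
    (hs : 0 < s) (hs' : 0 < s') (h : OscLE μ f z s M)
    (hsub : Metric.ball z' s' ⊆ Metric.ball z s) :
    |(⨍ y in Metric.ball z' s', f y ∂μ) - ⨍ y in Metric.ball z s, f y ∂μ| ≤ (s / s') ^ Q * M := by
  have hp := hμ.measureReal_ball_pos z' hs'
  have hc := hμ.pos
  have hfin : μ (Metric.ball z s) ≠ ⊤ := (hμ.measure_ball_lt_top z s).ne
  refine (abs_setAverage_sub_le (h.1.mono_set hsub) hp _).trans ?_
  rw [inv_mul_le_iff₀ hp]
  calc ∫ y in Metric.ball z' s', |f y - ⨍ y in Metric.ball z s, f y ∂μ| ∂μ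
      ≤ ∫ y in Metric.ball z s, |f y - ⨍ y in Metric.ball z s, f y ∂μ| ∂μ :=
        setIntegral_mono_set (h.1.sub (integrableOn_const hfin)).abs
          (Eventually.of_forall fun y => abs_nonneg _) hsub.eventuallyLE
    _ ≤ M * μ.real (Metric.ball z s) := h.2
    _ = _ := by
        rw [hμ.measureReal_ball z hs, hμ.measureReal_ball z' hs', div_pow]; field_simp

/-- The level, relative to the mean oscillation, at which the stopping time argument stops. -/
def stoppingLevel (Q : ℕ) : ℝ := 32 * 20 ^ Q

variable [BorelSpace X] [SecondCountableTopology X]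

theorem enorm_sub_pow_four_le (u v w : ℝ) :
    ‖u - w‖ₑ ^ 4 ≤ 8 * (‖u - v‖ₑ ^ 4 + ‖v - w‖ₑ ^ 4) := by
  have h := ENNReal.rpow_add_le_mul_rpow_add_rpow ‖u - v‖ₑ ‖v - w‖ₑ (p := 4) (by norm_num)
  have e : (2 : ℝ≥0∞) ^ ((4 : ℝ) - 1) = 8 := by
    rw [show (4 : ℝ) - 1 = ((3 : ℕ) : ℝ) by norm_num, ENNReal.rpow_natCast]; norm_num
  have e4 : ∀ a : ℝ≥0∞, a ^ (4 : ℝ) = a ^ 4 := fun a => by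
    rw [show (4 : ℝ) = ((4 : ℕ) : ℝ) by norm_num, ENNReal.rpow_natCast]
  rw [e, e4, e4, e4] at h
  refine le_trans ?_ h
  gcongr
  calc ‖u - w‖ₑ = ‖(u - v) + (v - w)‖ₑ := by rw [sub_add_sub_cancel]
    _ ≤ _ := enorm_add_le _ _

/-- One step of a self-improving bound for the fourth moments of the oscillation. The points where
`|f - f_B|` is large are covered by balls with a small total volume, on which the averages of
`|f - f_B|` are still under control; there the a priori bound `Y` is used. -/
theorem lintegral_osc_pow_four_step (hμ : RegularVolume μ c Q) {f : X → ℝ} {x₀ : X} {D M Y : ℝ}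
    (hM : 0 < M) (hY : 0 ≤ Y)
    (hosc : ∀ z s, 0 < s → dist x₀ z + s ≤ D → OscLE μ f z s M)
    (hbd : ∀ z s, 0 < s → dist x₀ z + 5 / 4 * s ≤ D →
      ∫⁻ y in Metric.ball z s, ‖f y - ⨍ w in Metric.ball z s, f w ∂μ‖ₑ ^ 4 ∂μ ≤
        ENNReal.ofReal Y * μ (Metric.ball z s)) (z : X) (s : ℝ) (hs : 0 < s)
    (hzs : dist x₀ z + 5 / 4 * s ≤ D) :
    ∫⁻ y in Metric.ball z s, ‖f y - ⨍ w in Metric.ball z s, f w ∂μ‖ₑ ^ 4 ∂μ ≤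
      ENNReal.ofReal (3 / 2 * (stoppingLevel Q * M) ^ 4 + Y / 2) * μ (Metric.ball z s) := by
  have := hμ.isUnifLocDoublingMeasure
  have := hμ.isLocallyFiniteMeasure
  have hc := hμ.pos
  set B := Metric.ball z s with hB
  set a := ⨍ w in B, f w ∂μ with ha
  set B' := Metric.ball z (2 * s * (3 / 5)) with hB'
  have hs' : 0 < 2 * s * (3 / 5) := by positivity
  have hBB' : B ⊆ B' := Metric.ball_subset_ball (by linarith)
  have hosc' := hosc z (2 * s * (3 / 5)) hs' (by linarith)
  have hBpos : 0 < μ.real B := hμ.measureReal_ball_pos z hs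
  have hB'fin : μ B' ≠ ⊤ := (hμ.measure_ball_lt_top _ _).ne
  have hBfin : μ B ≠ ⊤ := (hμ.measure_ball_lt_top _ _).ne
  have hB'vol : μ.real B' ≤ 2 ^ Q * μ.real B := by
    rw [hμ.measureReal_ball z hs', hμ.measureReal_ball z hs]
    have : (2 * s * (3 / 5)) ^ Q ≤ (2 * s) ^ Q :=
      pow_le_pow_left₀ (by positivity) (by linarith) _
    calc c * (2 * s * (3 / 5)) ^ Q ≤ c * (2 * s) ^ Q := by gcongr
      _ = _ := by rw [mul_pow]; ring
  set lam := stoppingLevel Q * M with hlam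
  have hlam0 : 0 < lam := by simp only [hlam, stoppingLevel]; positivity
  set g : X → ℝ := B'.indicator fun y => |f y - a| with hg
  have hgint : Integrable g μ :=
    IntegrableOn.integrable_indicator (hosc'.1.sub (integrableOn_const hB'fin)).abs measurableSet_ball
  have hg0 : ∀ y, 0 ≤ g y := fun y => indicator_nonneg (fun _ _ => abs_nonneg _) _
  -- by doubling, `|f - f_B|` still has mean at most a multiple of `M` on the enlarged ball
  have hmass : ∫ y, g y ∂μ ≤ 2 * 4 ^ Q * M * μ.real B := by
    rw [integral_indicator measurableSet_ball]
    set a' := ⨍ w in B', f w ∂μ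
    have h1 : |a - a'| ≤ 2 ^ Q * M := by
      refine (hosc'.abs_average_sub_le hμ hs' hs hBB').trans ?_
      gcongr
      rw [div_le_iff₀ hs]; linarith
    calc ∫ y in B', |f y - a| ∂μ ≤ ∫ y in B', (|f y - a'| + |a - a'|) ∂μ := by
          refine setIntegral_mono (hosc'.1.sub (integrableOn_const hB'fin)).abs
            ((hosc'.1.sub (integrableOn_const hB'fin)).abs.add (integrableOn_const hB'fin))
            fun y => ?_
          have : f y - a = (f y - a') - (a - a') := by ring
          simp only
          rw [this]; exact abs_sub _ _
      _ = (∫ y in B', |f y - a'| ∂μ) + μ.real B' * |a - a'| := by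
          rw [integral_add (integrableOn_abs_sub_const hosc'.1 hB'fin a')
            (integrableOn_const hB'fin), setIntegral_const, smul_eq_mul]
      _ ≤ M * (2 ^ Q * μ.real B) + (2 ^ Q * μ.real B) * (2 ^ Q * M) := by
          gcongr
          exact hosc'.2.trans (by gcongr)
      _ ≤ 2 * 4 ^ Q * M * μ.real B := by
          have h4 : (4 : ℝ) ^ Q = 2 ^ Q * 2 ^ Q := by rw [← mul_pow]; norm_num
          have h2 : (1 : ℝ) ≤ 2 ^ Q := one_le_pow₀ (by norm_num)
          rw [h4]
          have : 0 ≤ 2 ^ Q * M * μ.real B := by positivity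
          nlinarith
  -- ratio `1 / 5`: the fivefold enlargement of Vitali's lemma of a ball of one generation is a ball
  -- of the previous generation
  set ρ : ℕ → ℝ := fun k => s * (1 / 5) ^ (k + 1) with hρ
  have hρpos : ∀ k, 0 < ρ k := fun k => by simp only [hρ]; positivity
  have hρle : ∀ k, ρ k ≤ s / 5 := fun k => by
    have : (1 / 5 : ℝ) ^ k ≤ 1 := pow_le_one₀ (by norm_num) (by norm_num)
    simp only [hρ, pow_succ]; nlinarith
  have hsubB' : ∀ x ∈ B, ∀ k, Metric.ball x (ρ k) ⊆ B' := by
    intro x hx k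
    refine Metric.ball_subset_ball' ?_
    have := Metric.mem_ball.1 hx
    linarith [hρle k]
  let bad : X → ℕ → Prop := fun x k =>
    lam * μ.real (Metric.ball x (ρ k)) < ∫ y in Metric.ball x (ρ k), g y ∂μ
  set E : Set X := {x | x ∈ B ∧ ∃ k, bad x k}
  -- the stopping level is so high that no ball of the first generation is bad
  have hbad0 : ∀ x, ¬ bad x 0 := by
    intro x
    simp only [bad, not_lt]
    calc ∫ y in Metric.ball x (ρ 0), g y ∂μ ≤ ∫ y, g y ∂μ :=
          setIntegral_le_integral hgint (Eventually.of_forall hg0)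
      _ ≤ 2 * 4 ^ Q * M * μ.real B := hmass
      _ ≤ lam * μ.real (Metric.ball x (ρ 0)) := by
          have e : μ.real B = 5 ^ Q * μ.real (Metric.ball x (ρ 0)) := by
            rw [hB, ← hμ.measureReal_ball_mul z x (hρpos 0) (by norm_num)]
            congr 2; simp only [hρ]; ring
          rw [e, hlam, stoppingLevel, show (20 : ℝ) = 4 * 5 by norm_num, mul_pow]
          have : 0 ≤ 4 ^ Q * 5 ^ Q * M * μ.real (Metric.ball x (ρ 0)) := by positivity
          nlinarith
  classical
  -- the first bad generation at `x`; the previous one is good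
  let kk : X → ℕ := fun x => if h : ∃ k, bad x k then Nat.find h else 0
  have hkk1 : ∀ x ∈ E, bad x (kk x) := fun x hx => by
    simp only [kk, dif_pos hx.2]; exact Nat.find_spec hx.2
  have hkk2 : ∀ x ∈ E, ∃ l, kk x = l + 1 ∧ ¬ bad x l := fun x hx => by
    have h0 : kk x ≠ 0 := fun h => hbad0 x (h ▸ hkk1 x hx)
    obtain ⟨l, hl⟩ := Nat.exists_eq_succ_of_ne_zero h0
    refine ⟨l, hl, ?_⟩
    refine Nat.find_min hx.2 ?_
    have : kk x = Nat.find hx.2 := by simp only [kk, dif_pos hx.2]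
    omega
  obtain ⟨u, huE, hudisj, hucov⟩ := Vitali.exists_disjoint_subfamily_covering_enlargement_closedBall
    E (fun x => x) (fun x => ρ (kk x)) (s / 5) (fun x _ => hρle _) 5 (by norm_num)
  have hucount : u.Countable := hudisj.countable_of_nonempty_interior fun x _ =>
    ⟨x, Metric.ball_subset_interior_closedBall (Metric.mem_ball_self (hρpos _))⟩
  have : Countable u := hucount.to_subtype
  set W : Set X := ⋃ b : u, Metric.closedBall (b : X) (5 * ρ (kk b))
  -- off the covering balls the function is bounded by the stopping level
  have hgood : ∀ᵐ x ∂μ, x ∈ B \ W → |f x - a| ≤ lam := by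
    filter_upwards [IsUnifLocDoublingMeasure.ae_tendsto_average μ hgint.locallyIntegrable 1]
      with x hx hxW
    have hnb : ∀ k, ¬ bad x k := by
      intro k hk
      obtain ⟨b, hb, hsub⟩ := hucov x ⟨hxW.1, k, hk⟩
      exact hxW.2 (mem_iUnion.2 ⟨⟨b, hb⟩, hsub (Metric.mem_closedBall_self (hρpos _).le)⟩)
    have hρ0 : Tendsto ρ atTop (𝓝[>] 0) := by
      refine tendsto_nhdsWithin_iff.2 ⟨?_, Eventually.of_forall hρpos⟩
      have h1 := (tendsto_pow_atTop_nhds_zero_of_lt_one (r := (1 / 5 : ℝ)) (by norm_num)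
        (by norm_num)).comp (tendsto_add_atTop_nat 1)
      have h2 := h1.const_mul s
      rw [mul_zero] at h2
      exact h2
    have hlim := hx (fun _ => x) ρ hρ0 (Eventually.of_forall fun k => by
      rw [one_mul]; exact Metric.mem_closedBall_self (hρpos k).le)
    have hgx : g x ≤ lam := by
      refine le_of_tendsto hlim (Eventually.of_forall fun k => ?_)
      rw [setAverage_eq, smul_eq_mul, hμ.restrict_closedBall x (hρpos k),
        ← measureReal_congr (hμ.ball_ae_eq_closedBall x (hρpos k)),
        inv_mul_le_iff₀ (hμ.measureReal_ball_pos x (hρpos k)), mul_comm]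
      exact not_lt.1 (hnb k)
    rwa [hg, indicator_of_mem (hBB' hxW.1)] at hgx
  -- on an enlarged stopping ball `f_B` is replaced by the average over that ball, at a cost `lam`
  -- because the enlarged ball is good; its measure is controlled because the ball itself is bad
  have hterm : ∀ b : u, ∫⁻ y in Metric.closedBall (b : X) (5 * ρ (kk b)), ‖f y - a‖ₑ ^ 4 ∂μ ≤
      ENNReal.ofReal (8 * (Y + lam ^ 4) * 5 ^ Q / lam) *
        ∫⁻ y in Metric.closedBall (b : X) (ρ (kk b)), ‖g y‖ₑ ∂μ := by
    rintro ⟨b, hb⟩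
    simp only
    have hbE := huE hb
    obtain ⟨l, hl, hnl⟩ := hkk2 b hbE
    have hr := hρpos (kk b)
    have h5 : 5 * ρ (kk b) = ρ l := by simp only [hρ, hl, pow_succ]; ring
    have hball : dist x₀ b + 5 / 4 * ρ l ≤ D := by
      have h1 := dist_triangle x₀ z b
      have h2 : dist z b < s := by rw [dist_comm]; exact hbE.1
      linarith [hρle l]
    have hsubl := hsubB' b hbE.1 l
    set a' := ⨍ w in Metric.ball b (ρ l), f w ∂μ
    have haa : |a' - a| ≤ lam := by
      refine (abs_setAverage_sub_le (hosc'.1.mono_set hsubl)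
        (hμ.measureReal_ball_pos b (hρpos l)) a).trans ?_
      rw [inv_mul_le_iff₀ (hμ.measureReal_ball_pos b (hρpos l)), mul_comm]
      refine le_trans (le_of_eq ?_) (not_lt.1 hnl)
      refine setIntegral_congr_fun measurableSet_ball fun y hy => ?_
      simp only [hg, indicator_of_mem (hsubl hy)]
    have hvol : μ (Metric.ball b (ρ l)) = ENNReal.ofReal (5 ^ Q) * μ (Metric.ball b (ρ (kk b))) := by
      rw [← h5, hμ.measure_ball b _ (by positivity), hμ.measure_ball b _ hr,
        ← ENNReal.ofReal_mul (by positivity)]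
      congr 1; rw [mul_pow]; ring
    have hsmall : μ (Metric.ball b (ρ (kk b))) ≤
        ENNReal.ofReal lam⁻¹ * ∫⁻ y in Metric.ball b (ρ (kk b)), ‖g y‖ₑ ∂μ := by
      have h1 := hkk1 b hbE
      have h2 : ∫⁻ y in Metric.ball b (ρ (kk b)), ‖g y‖ₑ ∂μ =
          ENNReal.ofReal (∫ y in Metric.ball b (ρ (kk b)), g y ∂μ) := by
        rw [ofReal_integral_eq_lintegral_ofReal hgint.integrableOn (Eventually.of_forall hg0)]
        exact lintegral_congr fun y => Real.enorm_of_nonneg (hg0 y)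
      rw [h2, ← ENNReal.ofReal_mul (by positivity), ← ofReal_measureReal
        (hμ.measure_ball_lt_top _ _).ne]
      refine ENNReal.ofReal_le_ofReal ?_
      rw [le_inv_mul_iff₀ hlam0]
      exact h1.le
    rw [h5, hμ.restrict_closedBall b (hρpos l), hμ.restrict_closedBall b hr]
    calc ∫⁻ y in Metric.ball b (ρ l), ‖f y - a‖ₑ ^ 4 ∂μ
        ≤ ∫⁻ y in Metric.ball b (ρ l), 8 * (‖f y - a'‖ₑ ^ 4 + ENNReal.ofReal (lam ^ 4)) ∂μ := by
          refine lintegral_mono fun y => (enorm_sub_pow_four_le (f y) a' a).trans ?_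
          gcongr
          rw [ENNReal.ofReal_pow hlam0.le, Real.enorm_eq_ofReal_abs]
          gcongr
      _ = 8 * ((∫⁻ y in Metric.ball b (ρ l), ‖f y - a'‖ₑ ^ 4 ∂μ) +
            ENNReal.ofReal (lam ^ 4) * μ (Metric.ball b (ρ l))) := by
          rw [lintegral_const_mul' _ _ (by simp), lintegral_add_right _ measurable_const,
            setLIntegral_const]
      _ ≤ 8 * (ENNReal.ofReal Y * μ (Metric.ball b (ρ l)) +
            ENNReal.ofReal (lam ^ 4) * μ (Metric.ball b (ρ l))) := by
          gcongr
          exact hbd b (ρ l) (hρpos l) hball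
      _ = ENNReal.ofReal (8 * (Y + lam ^ 4)) * μ (Metric.ball b (ρ l)) := by
          rw [← add_mul, ← ENNReal.ofReal_add hY (by positivity), ← mul_assoc,
            ENNReal.ofReal_mul (by norm_num)]
          norm_num
      _ ≤ ENNReal.ofReal (8 * (Y + lam ^ 4)) * (ENNReal.ofReal (5 ^ Q) *
            (ENNReal.ofReal lam⁻¹ * ∫⁻ y in Metric.ball b (ρ (kk b)), ‖g y‖ₑ ∂μ)) := by
          rw [hvol]; gcongr
      _ = _ := by
          rw [← mul_assoc, ← mul_assoc, ← ENNReal.ofReal_mul (by positivity),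
            ← ENNReal.ofReal_mul (by positivity), div_eq_mul_inv]
  have hsum : ∑' b : u, ∫⁻ y in Metric.closedBall (b : X) (ρ (kk b)), ‖g y‖ₑ ∂μ ≤
      ENNReal.ofReal (2 * 4 ^ Q * M) * μ B := by
    rw [← lintegral_iUnion (s := fun b : u => Metric.closedBall (b : X) (ρ (kk b)))
      (fun b => measurableSet_closedBall) (fun i j hij => hudisj i.2 j.2 fun h => hij (Subtype.ext h))]
    calc _ ≤ ∫⁻ y, ‖g y‖ₑ ∂μ := setLIntegral_le_lintegral _ _
      _ = ENNReal.ofReal (∫ y, g y ∂μ) := by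
          rw [ofReal_integral_eq_lintegral_ofReal hgint (Eventually.of_forall hg0)]
          exact lintegral_congr fun y => Real.enorm_of_nonneg (hg0 y)
      _ ≤ ENNReal.ofReal (2 * 4 ^ Q * M * μ.real B) := ENNReal.ofReal_le_ofReal hmass
      _ = _ := by rw [ENNReal.ofReal_mul (by positivity), ofReal_measureReal hBfin]
  calc ∫⁻ y in B, ‖f y - a‖ₑ ^ 4 ∂μ
      ≤ ∫⁻ y in (B \ W) ∪ W, ‖f y - a‖ₑ ^ 4 ∂μ :=
        lintegral_mono_set (by rw [sdiff_union_self]; exact subset_union_left)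
    _ ≤ (∫⁻ y in B \ W, ‖f y - a‖ₑ ^ 4 ∂μ) + ∫⁻ y in W, ‖f y - a‖ₑ ^ 4 ∂μ :=
        lintegral_union_le _ _ _
    _ ≤ ENNReal.ofReal (lam ^ 4) * μ B + ∑' b : u, ENNReal.ofReal (8 * (Y + lam ^ 4) * 5 ^ Q / lam) *
        ∫⁻ y in Metric.closedBall (b : X) (ρ (kk b)), ‖g y‖ₑ ∂μ := by
        refine add_le_add ?_ ((lintegral_iUnion_le _ _).trans (ENNReal.tsum_le_tsum hterm))
        have hmeas : MeasurableSet (B \ W) :=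
          measurableSet_ball.diff (MeasurableSet.iUnion fun _ => measurableSet_closedBall)
        calc ∫⁻ y in B \ W, ‖f y - a‖ₑ ^ 4 ∂μ ≤ ∫⁻ _ in B \ W, ENNReal.ofReal (lam ^ 4) ∂μ := by
              refine setLIntegral_mono_ae' hmeas ?_
              filter_upwards [hgood] with y hy hyW
              rw [ENNReal.ofReal_pow hlam0.le, Real.enorm_eq_ofReal_abs]
              gcongr
              exact hy hyW
          _ ≤ ENNReal.ofReal (lam ^ 4) * μ B := by
              rw [setLIntegral_const]; gcongr; exact sdiff_subset
    _ ≤ ENNReal.ofReal (lam ^ 4) * μ B + ENNReal.ofReal (8 * (Y + lam ^ 4) * 5 ^ Q / lam) *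
        (ENNReal.ofReal (2 * 4 ^ Q * M) * μ B) := by
        rw [ENNReal.tsum_mul_left]; gcongr
    _ = ENNReal.ofReal (3 / 2 * lam ^ 4 + Y / 2) * μ B := by
        rw [← mul_assoc, ← ENNReal.ofReal_mul (by positivity), ← add_mul,
          ← ENNReal.ofReal_add (by positivity) (by positivity)]
        congr 2
        have e : 8 * (Y + lam ^ 4) * 5 ^ Q / lam * (2 * 4 ^ Q * M) = (Y + lam ^ 4) / 2 := by
          rw [div_mul_eq_mul_div, div_eq_iff hlam0.ne', hlam, stoppingLevel,
            show (20 : ℝ) = 4 * 5 by norm_num, mul_pow (4 : ℝ) 5]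
          ring
        rw [e]; ring

/-- The constant in the John–Nirenberg inequality for fourth powers. -/
def johnNirenbergConst (Q : ℕ) : ℝ := 3 * (stoppingLevel Q * 2) ^ 4

/-- For bounded functions the self-improving bound can be iterated, starting from the trivial one. -/
theorem lintegral_osc_pow_four_le_of_bounded (hμ : RegularVolume μ c Q) {f : X → ℝ} {x₀ : X}
    {D M N : ℝ} (hM : 0 < M) (hN : ∀ x, |f x| ≤ N)
    (hosc : ∀ z s, 0 < s → dist x₀ z + s ≤ D → OscLE μ f z s M) (z : X) (s : ℝ) (hs : 0 < s)
    (hzs : dist x₀ z + 5 / 4 * s ≤ D) :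
    ∫⁻ y in Metric.ball z s, ‖f y - ⨍ w in Metric.ball z s, f w ∂μ‖ₑ ^ 4 ∂μ ≤
      ENNReal.ofReal (3 * (stoppingLevel Q * M) ^ 4) * μ (Metric.ball z s) := by
  have hN0 : 0 ≤ N := (abs_nonneg _).trans (hN z)
  set a := (stoppingLevel Q * M) ^ 4
  have ha : 0 ≤ a := by positivity
  set Y : ℕ → ℝ := fun n => 3 * a + (2 * N) ^ 4 * (1 / 2) ^ n with hY
  have key : ∀ n : ℕ, ∀ z s, 0 < s → dist x₀ z + 5 / 4 * s ≤ D →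
      ∫⁻ y in Metric.ball z s, ‖f y - ⨍ w in Metric.ball z s, f w ∂μ‖ₑ ^ 4 ∂μ ≤
        ENNReal.ofReal (Y n) * μ (Metric.ball z s) := by
    intro n
    induction n with
    | zero =>
      intro z s hs hzs
      have hint := (hosc z s hs (by linarith)).1
      have hpos := hμ.measureReal_ball_pos z hs
      have hav : |⨍ w in Metric.ball z s, f w ∂μ| ≤ N := by
        have h1 := abs_setAverage_sub_le hint hpos 0
        simp only [sub_zero] at h1
        refine h1.trans ?_
        rw [inv_mul_le_iff₀ hpos, ← smul_eq_mul, ← setIntegral_const]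
        exact setIntegral_mono hint.abs (integrableOn_const (hμ.measure_ball_lt_top z s).ne) hN
      rw [← setLIntegral_const]
      refine lintegral_mono fun y => ?_
      simp only [hY, pow_zero, mul_one]
      calc ‖f y - ⨍ w in Metric.ball z s, f w ∂μ‖ₑ ^ 4 ≤ ENNReal.ofReal (2 * N) ^ 4 := by
            gcongr
            rw [Real.enorm_eq_ofReal_abs]
            refine ENNReal.ofReal_le_ofReal ((abs_sub _ _).trans ?_)
            linarith [hN y]
        _ = ENNReal.ofReal ((2 * N) ^ 4) := (ENNReal.ofReal_pow (by positivity) 4).symm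
        _ ≤ _ := ENNReal.ofReal_le_ofReal (by linarith)
    | succ n ih =>
      intro z s hs hzs
      have h := lintegral_osc_pow_four_step hμ hM (show 0 ≤ Y n by positivity) hosc ih z s hs hzs
      have e : 3 / 2 * (stoppingLevel Q * M) ^ 4 + Y n / 2 = Y (n + 1) := by
        simp only [hY, pow_succ (1 / 2 : ℝ) n]; ring
      rwa [e] at h
  have hlim : Tendsto (fun n => ENNReal.ofReal (Y n) * μ (Metric.ball z s)) atTop
      (𝓝 (ENNReal.ofReal (3 * a) * μ (Metric.ball z s))) := by
    refine ENNReal.Tendsto.mul_const ?_ (Or.inr (hμ.measure_ball_lt_top z s).ne)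
    refine ENNReal.tendsto_ofReal ?_
    have h1 := ((tendsto_pow_atTop_nhds_zero_of_lt_one (r := (1 / 2 : ℝ)) (by norm_num)
        (by norm_num)).const_mul ((2 * N) ^ 4)).const_add (3 * a)
    rw [mul_zero, add_zero] at h1
    exact h1
  exact ge_of_tendsto' hlim fun n => key n z s hs hzs

/-- The truncation of a function at height `N`; it at most doubles the mean oscillation. -/
def clampFun (f : X → ℝ) (N : ℝ) (x : X) : ℝ := max (-N) (min N (f x))

theorem abs_clamp_sub_le (N a b : ℝ) : |max (-N) (min N a) - max (-N) (min N b)| ≤ |a - b| := by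
  refine (abs_max_sub_max_le_max _ _ _ _).trans ?_
  rw [sub_self, abs_zero, max_eq_right (abs_nonneg _)]
  refine (abs_min_sub_min_le_max _ _ _ _).trans ?_
  rw [sub_self, abs_zero, max_eq_right (abs_nonneg _)]

omit [MetricSpace X] [MeasurableSpace X] [BorelSpace X] [SecondCountableTopology X] in
theorem abs_clampFun_le (f : X → ℝ) {N : ℝ} (hN : 0 ≤ N) (x : X) : |clampFun f N x| ≤ |f x| := by
  have h := abs_clamp_sub_le N (f x) 0
  have h0 : max (-N) (min N 0) = 0 := by
    rw [min_eq_right hN, max_eq_right (neg_nonpos.2 hN)]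
  rwa [h0, sub_zero, sub_zero] at h

omit [BorelSpace X] [SecondCountableTopology X] in
theorem OscLE.clamp (hμ : RegularVolume μ c Q) {f : X → ℝ} {z : X} {s M N : ℝ} (hs : 0 < s)
    (hN : 0 ≤ N) (h : OscLE μ f z s M) : OscLE μ (clampFun f N) z s (M * 2) := by
  have hfin := (hμ.measure_ball_lt_top z s).ne
  have hint : IntegrableOn (clampFun f N) (Metric.ball z s) μ := by
    refine Integrable.mono' h.1.abs ?_ (Eventually.of_forall fun y => ?_)
    · exact aestronglyMeasurable_const.sup (aestronglyMeasurable_const.inf h.1.aestronglyMeasurable)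
    · exact abs_clampFun_le f hN y
  refine ⟨hint, ?_⟩
  refine (setIntegral_abs_sub_setAverage_le hint (hμ.measureReal_ball_pos z hs)
    (max (-N) (min N (⨍ w in Metric.ball z s, f w ∂μ)))).trans ?_
  have h1 : ∫ y in Metric.ball z s,
      |clampFun f N y - max (-N) (min N (⨍ w in Metric.ball z s, f w ∂μ))| ∂μ ≤
      ∫ y in Metric.ball z s, |f y - ⨍ w in Metric.ball z s, f w ∂μ| ∂μ :=
    setIntegral_mono (integrableOn_abs_sub_const hint hfin _)
      (integrableOn_abs_sub_const h.1 hfin _) fun y => abs_clamp_sub_le _ _ _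
  linarith [h.2]

/-- **John–Nirenberg inequality**, for fourth powers and with the oscillation controlled on the
balls contained in a fixed ball. -/
theorem lintegral_osc_pow_four_le (hμ : RegularVolume μ c Q) {f : X → ℝ} {x₀ : X} {D M : ℝ}
    (hM : 0 ≤ M) (hosc : ∀ z s, 0 < s → dist x₀ z + s ≤ D → OscLE μ f z s M) (z : X) (s : ℝ)
    (hs : 0 < s) (hzs : dist x₀ z + 5 / 4 * s ≤ D) :
    ∫⁻ y in Metric.ball z s, ‖f y - ⨍ w in Metric.ball z s, f w ∂μ‖ₑ ^ 4 ∂μ ≤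
      ENNReal.ofReal (johnNirenbergConst Q * M ^ 4) * μ (Metric.ball z s) := by
  have hint := (hosc z s hs (by linarith)).1
  -- the bound for bounded functions needs a positive oscillation bound: use `M' > M`, truncate `f`
  -- at height `n`, and apply Fatou's lemma
  have pos_case : ∀ M', M < M' →
      ∫⁻ y in Metric.ball z s, ‖f y - ⨍ w in Metric.ball z s, f w ∂μ‖ₑ ^ 4 ∂μ ≤
      ENNReal.ofReal (johnNirenbergConst Q * M' ^ 4) * μ (Metric.ball z s) := by
    intro M' hM'
    have hM'0 : 0 < M' := hM.trans_lt hM'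
    have hosc' : ∀ n : ℕ, ∀ z s, 0 < s → dist x₀ z + s ≤ D →
        OscLE μ (clampFun f n) z s (M' * 2) := fun n z s hs hzs => by
      refine OscLE.clamp hμ hs n.cast_nonneg ⟨(hosc z s hs hzs).1, ?_⟩
      exact (hosc z s hs hzs).2.trans (by gcongr)
    have hn : ∀ n : ℕ, ∫⁻ y in Metric.ball z s,
        ‖clampFun f n y - ⨍ w in Metric.ball z s, clampFun f n w ∂μ‖ₑ ^ 4 ∂μ ≤
        ENNReal.ofReal (johnNirenbergConst Q * M' ^ 4) * μ (Metric.ball z s) := by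
      intro n
      have hb : ∀ x, |clampFun f n x| ≤ n := fun x =>
        abs_le.2 ⟨le_max_left _ _, max_le (by linarith [n.cast_nonneg (α := ℝ)]) (min_le_left _ _)⟩
      have h := lintegral_osc_pow_four_le_of_bounded hμ (by positivity) hb (hosc' n) z s hs hzs
      have e : 3 * (stoppingLevel Q * (M' * 2)) ^ 4 = johnNirenbergConst Q * M' ^ 4 := by
        rw [johnNirenbergConst]; ring
      rwa [e] at h
    have hpt : ∀ y, Tendsto (fun n : ℕ => clampFun f n y) atTop (𝓝 (f y)) := by
      intro y
      refine tendsto_const_nhds.congr' ?_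
      obtain ⟨n₀, hn₀⟩ := exists_nat_ge |f y|
      filter_upwards [eventually_ge_atTop n₀] with n hn
      have h1 : |f y| ≤ n := hn₀.trans (by exact_mod_cast hn)
      have h2 := abs_le.1 h1
      rw [clampFun, min_eq_right h2.2, max_eq_right h2.1]
    have hav : Tendsto (fun n : ℕ => ⨍ w in Metric.ball z s, clampFun f n w ∂μ) atTop
        (𝓝 (⨍ w in Metric.ball z s, f w ∂μ)) := by
      simp only [setAverage_eq]
      refine Tendsto.const_smul ?_ _
      refine tendsto_integral_of_dominated_convergence (fun y => |f y|)
        (fun n => (hosc' n z s hs (by linarith)).1.aestronglyMeasurable) hint.abs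
        (fun n => Eventually.of_forall fun y => ?_) (Eventually.of_forall hpt)
      exact abs_clampFun_le f n.cast_nonneg y
    have hlim : ∀ y, liminf (fun n : ℕ => ‖clampFun f n y -
        ⨍ w in Metric.ball z s, clampFun f n w ∂μ‖ₑ ^ 4) atTop =
        ‖f y - ⨍ w in Metric.ball z s, f w ∂μ‖ₑ ^ 4 := fun y => by
      refine Tendsto.liminf_eq ?_
      exact ENNReal.Tendsto.pow ((hpt y).sub hav).enorm
    calc _ = ∫⁻ y in Metric.ball z s, liminf (fun n : ℕ => ‖clampFun f n y -
          ⨍ w in Metric.ball z s, clampFun f n w ∂μ‖ₑ ^ 4) atTop ∂μ := by simp only [hlim]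
      _ ≤ liminf (fun n : ℕ => ∫⁻ y in Metric.ball z s, ‖clampFun f n y -
          ⨍ w in Metric.ball z s, clampFun f n w ∂μ‖ₑ ^ 4 ∂μ) atTop := by
          refine lintegral_liminf_le' fun n => ?_
          exact (((hosc' n z s hs (by linarith)).1.aestronglyMeasurable.sub
            aestronglyMeasurable_const).enorm).pow_const 4
      _ ≤ _ := liminf_le_of_frequently_le' (Frequently.of_forall hn)
  have hlim : Tendsto (fun M' => ENNReal.ofReal (johnNirenbergConst Q * M' ^ 4) *
      μ (Metric.ball z s)) (𝓝[>] M)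
      (𝓝 (ENNReal.ofReal (johnNirenbergConst Q * M ^ 4) * μ (Metric.ball z s))) := by
    refine ENNReal.Tendsto.mul_const ?_ (Or.inr (hμ.measure_ball_lt_top z s).ne)
    refine ENNReal.tendsto_ofReal ?_
    exact ((continuous_const.mul (continuous_pow 4)).tendsto M).mono_left nhdsWithin_le_nhds
  refine ge_of_tendsto hlim ?_
  filter_upwards [self_mem_nhdsWithin] with M' hM' using pos_case M' hM'

end JohnNirenberg

/-! ### Moments of functions of bounded mean oscillation -/

theorem lintegral_mul_le_of_sq_le {X : Type*} [MeasurableSpace X] {μ : Measure X} {S : Set X}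
    {u v : X → ℝ≥0∞} (hu : AEMeasurable u (μ.restrict S)) (hv : AEMeasurable v (μ.restrict S))
    {a b : ℝ} (ha : 0 ≤ a) (h1 : ∫⁻ y in S, u y ^ 2 ∂μ ≤ ENNReal.ofReal (a ^ 2) * μ S)
    (hb : 0 ≤ b) (h2 : ∫⁻ y in S, v y ^ 2 ∂μ ≤ ENNReal.ofReal (b ^ 2) * μ S) :
    ∫⁻ y in S, u y * v y ∂μ ≤ ENNReal.ofReal (a * b) * μ S := by
  have h := ENNReal.lintegral_mul_le_Lp_mul_Lq (μ.restrict S) (p := 2) (q := 2)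
    (Real.holderConjugate_iff.2 ⟨by norm_num, by norm_num⟩) hu hv
  simp only [Pi.mul_apply] at h
  refine h.trans ?_
  have e2 : ∀ t : ℝ≥0∞, t ^ (2 : ℝ) = t ^ 2 := fun t => by
    rw [show (2 : ℝ) = ((2 : ℕ) : ℝ) by norm_num, ENNReal.rpow_natCast]
  have e3 : ∀ t : ℝ, 0 ≤ t → (ENNReal.ofReal (t ^ 2)) ^ (1 / 2 : ℝ) = ENNReal.ofReal t := fun t ht => by
    rw [ENNReal.ofReal_pow ht, ← e2, ← ENNReal.rpow_mul]; norm_num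
  simp only [e2]
  calc _ ≤ (ENNReal.ofReal (a ^ 2) * μ S) ^ (1 / 2 : ℝ) *
        (ENNReal.ofReal (b ^ 2) * μ S) ^ (1 / 2 : ℝ) := by gcongr
    _ = ENNReal.ofReal a * ENNReal.ofReal b * ((μ S) ^ (1 / 2 : ℝ) * (μ S) ^ (1 / 2 : ℝ)) := by
        rw [ENNReal.mul_rpow_of_nonneg _ _ (by norm_num), ENNReal.mul_rpow_of_nonneg _ _ (by norm_num),
          e3 a ha, e3 b hb]; ring
    _ = _ := by
        rw [← ENNReal.rpow_add_of_nonneg _ _ (by norm_num) (by norm_num), ENNReal.ofReal_mul ha]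
        norm_num

theorem lintegral_sq_le_of_pow_four {X : Type*} [MeasurableSpace X] {μ : Measure X} {S : Set X}
    {h : X → ℝ} {a : ℝ} (hm : AEStronglyMeasurable h (μ.restrict S))
    (h4 : ∫⁻ y in S, ‖h y‖ₑ ^ 4 ∂μ ≤ ENNReal.ofReal (a ^ 4) * μ S) :
    ∫⁻ y in S, ‖h y‖ₑ ^ 2 ∂μ ≤ ENNReal.ofReal (a ^ 2) * μ S := by
  have := lintegral_mul_le_of_sq_le (μ := μ) (S := S) (u := fun y => ‖h y‖ₑ ^ 2) (v := fun _ => 1)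
    (hm.enorm.pow_const 2) aemeasurable_const (a := a ^ 2) (b := 1) (by positivity)
    (by simpa only [← pow_mul] using h4) zero_le_one (by simp)
  simpa using this

theorem lintegral_mul_sq_le_of_pow_four {X : Type*} [MeasurableSpace X] {μ : Measure X} {S : Set X}
    {h g : X → ℝ} {a b : ℝ}
    (hm : AEStronglyMeasurable h (μ.restrict S)) (gm : AEStronglyMeasurable g (μ.restrict S))
    (h4 : ∫⁻ y in S, ‖h y‖ₑ ^ 4 ∂μ ≤ ENNReal.ofReal (a ^ 4) * μ S)
    (g4 : ∫⁻ y in S, ‖g y‖ₑ ^ 4 ∂μ ≤ ENNReal.ofReal (b ^ 4) * μ S) :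
    ∫⁻ y in S, ‖h y * g y‖ₑ ^ 2 ∂μ ≤ ENNReal.ofReal ((a * b) ^ 2) * μ S := by
  have := lintegral_mul_le_of_sq_le (μ := μ) (S := S) (u := fun y => ‖h y‖ₑ ^ 2)
    (v := fun y => ‖g y‖ₑ ^ 2)
    (hm.enorm.pow_const 2) (gm.enorm.pow_const 2) (a := a ^ 2) (b := b ^ 2) (by positivity)
    (by simpa only [← pow_mul] using h4) (by positivity) (by simpa only [← pow_mul] using g4)
  simpa only [enorm_mul, mul_pow] using this

theorem lintegral_enorm_le_of_sq {X : Type*} [MeasurableSpace X] {μ : Measure X} {S : Set X}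
    {h : X → ℝ} {a : ℝ} (ha : 0 ≤ a)
    (hm : AEStronglyMeasurable h (μ.restrict S))
    (h2 : ∫⁻ y in S, ‖h y‖ₑ ^ 2 ∂μ ≤ ENNReal.ofReal (a ^ 2) * μ S) :
    ∫⁻ y in S, ‖h y‖ₑ ∂μ ≤ ENNReal.ofReal a * μ S := by
  have := lintegral_mul_le_of_sq_le (μ := μ) (S := S) (u := fun y => ‖h y‖ₑ) (v := fun _ => 1)
    hm.enorm aemeasurable_const ha h2 zero_le_one (by simp)
  simpa using this

theorem setIntegral_abs_le_of_lintegral {X : Type*} [MeasurableSpace X] {μ : Measure X} {S : Set X}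
    {h : X → ℝ} {a : ℝ} (ha : 0 ≤ a)
    (hS : μ S ≠ ⊤) (h1 : ∫⁻ y in S, ‖h y‖ₑ ∂μ ≤ ENNReal.ofReal a * μ S) :
    ∫ y in S, |h y| ∂μ ≤ a * μ.real S := by
  by_cases hm : AEStronglyMeasurable (fun y => |h y|) (μ.restrict S)
  · rw [integral_eq_lintegral_of_nonneg_ae (Eventually.of_forall fun y => abs_nonneg _) hm]
    refine ENNReal.toReal_le_of_le_ofReal (by positivity) ?_
    simp only [← Real.enorm_eq_ofReal_abs]
    refine h1.trans ?_
    rw [ENNReal.ofReal_mul ha, Measure.real, ENNReal.ofReal_toReal hS]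
  · rw [integral_non_aestronglyMeasurable hm]; positivity

/-- The constant of the moment bounds for functions of bounded mean oscillation. -/
noncomputable def momentConst (Q : ℕ) : ℝ := 8 * (johnNirenbergConst Q + 1)

theorem one_le_momentConst (Q : ℕ) : 1 ≤ momentConst Q := by
  have : 0 ≤ johnNirenbergConst Q := by rw [johnNirenbergConst]; positivity
  rw [momentConst]; linarith

section Moments

variable {X : Type*} [MetricSpace X] [MeasurableSpace X] {μ : Measure X} {c : ℝ} {Q : ℕ}

/-- Averages over concentric dyadic balls grow at most linearly in the number of doublings. -/
theorem abs_average_sub_le_of_chain (hμ : RegularVolume μ c Q) {h : X → ℝ} {x₀ : X} {ρ w : ℝ}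
    (hρ : 0 < ρ) (n : ℕ) (hh : ∀ i < n, OscLE μ h x₀ (ρ * 2 ^ (i + 1)) w) :
    |(⨍ y in Metric.ball x₀ ρ, h y ∂μ) - ⨍ y in Metric.ball x₀ (ρ * 2 ^ n), h y ∂μ| ≤
      n * (2 ^ Q * w) := by
  induction n with
  | zero => simp
  | succ n ih =>
    have h1 := ih fun i hi => hh i (hi.trans n.lt_succ_self)
    have h2 := OscLE.abs_average_sub_le hμ (z' := x₀) (s' := ρ * 2 ^ n) (by positivity)
      (by positivity) (hh n n.lt_succ_self)
      (Metric.ball_subset_ball (mul_le_mul_of_nonneg_left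
        (pow_le_pow_right₀ (by norm_num) n.le_succ) hρ.le))
    have e : ρ * 2 ^ (n + 1) / (ρ * 2 ^ n) = 2 := by
      rw [pow_succ]; field_simp
    rw [e] at h2
    have := abs_sub_le (⨍ y in Metric.ball x₀ ρ, h y ∂μ) (⨍ y in Metric.ball x₀ (ρ * 2 ^ n), h y ∂μ)
      (⨍ y in Metric.ball x₀ (ρ * 2 ^ (n + 1)), h y ∂μ)
    push_cast
    linarith

variable [BorelSpace X] [SecondCountableTopology X]

/-- The fourth moment on a ball is controlled by the mean oscillation and the average there. -/
theorem lintegral_pow_four_le (hμ : RegularVolume μ c Q) {h : X → ℝ} {x₀ : X} {s w E : ℝ}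
    (hs : 0 < s) (hw : 0 ≤ w) (hwE : w ≤ E)
    (hosc : ∀ z r, 0 < r → dist x₀ z + r ≤ 5 / 4 * s → OscLE μ h z r w)
    (hav : |⨍ y in Metric.ball x₀ s, h y ∂μ| ≤ E) :
    ∫⁻ y in Metric.ball x₀ s, ‖h y‖ₑ ^ 4 ∂μ ≤
      ENNReal.ofReal ((momentConst Q * E) ^ 4) * μ (Metric.ball x₀ s) := by
  have hJN : 0 ≤ johnNirenbergConst Q := by rw [johnNirenbergConst]; positivity
  have h1 := lintegral_osc_pow_four_le hμ hw hosc x₀ s hs (by rw [dist_self, zero_add])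
  set m := ⨍ y in Metric.ball x₀ s, h y ∂μ
  have hpt : ∀ y, ‖h y‖ₑ ^ 4 ≤ 8 * (‖h y - m‖ₑ ^ 4 + ENNReal.ofReal (E ^ 4)) := fun y => by
    have := enorm_sub_pow_four_le (h y) m 0
    rw [sub_zero, sub_zero] at this
    refine this.trans ?_
    gcongr
    rw [ENNReal.ofReal_pow ((abs_nonneg _).trans hav), Real.enorm_eq_ofReal_abs]
    gcongr
  have hE : 0 ≤ E := hw.trans hwE
  calc ∫⁻ y in Metric.ball x₀ s, ‖h y‖ₑ ^ 4 ∂μ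
      ≤ ∫⁻ y in Metric.ball x₀ s, 8 * (‖h y - m‖ₑ ^ 4 + ENNReal.ofReal (E ^ 4)) ∂μ :=
        lintegral_mono hpt
    _ = 8 * ((∫⁻ y in Metric.ball x₀ s, ‖h y - m‖ₑ ^ 4 ∂μ) +
          ENNReal.ofReal (E ^ 4) * μ (Metric.ball x₀ s)) := by
        rw [lintegral_const_mul' _ _ (by norm_num), lintegral_add_right _ measurable_const,
          setLIntegral_const]
    _ ≤ 8 * (ENNReal.ofReal (johnNirenbergConst Q * w ^ 4) * μ (Metric.ball x₀ s) +
          ENNReal.ofReal (E ^ 4) * μ (Metric.ball x₀ s)) := by gcongr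
    _ = ENNReal.ofReal (8 * (johnNirenbergConst Q * w ^ 4 + E ^ 4)) * μ (Metric.ball x₀ s) := by
        rw [ENNReal.ofReal_mul (p := 8) (by norm_num),
          ENNReal.ofReal_add (by positivity) (by positivity)]
        norm_num; ring
    _ ≤ _ := by
        gcongr
        have e1 : w ^ 4 ≤ E ^ 4 := by gcongr
        calc 8 * (johnNirenbergConst Q * w ^ 4 + E ^ 4)
            ≤ 8 * (johnNirenbergConst Q * E ^ 4 + E ^ 4) := by gcongr
          _ = momentConst Q * E ^ 4 := by rw [momentConst]; ring
          _ ≤ momentConst Q ^ 4 * E ^ 4 := by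
              gcongr
              exact le_self_pow₀ (one_le_momentConst Q) (by norm_num)
          _ = _ := by ring

end Moments

/-! ### Singular integrals on a ball: near and far contributions -/

namespace SingularKernel

variable {X : Type*} [MetricSpace X] [MeasurableSpace X] {μ : Measure X} {c : ℝ} {Q : ℕ}
  {A B : ℝ} {k : X → X → ℝ} [BorelSpace X]

theorem setIntegral_shell_eq_zero (hμ : RegularVolume μ c Q) (hk : SingularKernel μ Q A B k) (x : X)
    {r s : ℝ} (hr : 0 < r) (hrs : r < s) :
    ∫ y in {y | r ≤ dist x y ∧ dist x y < s}, k x y ∂μ = 0 := by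
  rw [← (hk.cancel r s hr hrs x).1]
  refine setIntegral_congr_set ?_
  have h0 : ∀ᵐ y ∂μ, y ∉ Metric.sphere x r := measure_eq_zero_iff_ae_notMem.1 (hμ.measure_sphere x hr)
  refine eventuallyEq_set.2 ?_
  filter_upwards [h0] with y hy
  rw [Metric.mem_sphere, dist_comm] at hy
  exact ⟨fun h => ⟨lt_of_le_of_ne h.1 (Ne.symm hy), h.2⟩, fun h => ⟨h.1.le, h.2⟩⟩

variable [SecondCountableTopology X]

theorem integrableOn_mul_shell (hk : SingularKernel μ Q A B k) {f : X → ℝ} (x : X) {r s : ℝ}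
    (hr : 0 < r) (hf : IntegrableOn f (Metric.ball x s) μ) :
    IntegrableOn (fun y => k x y * f y) {y | r ≤ dist x y ∧ dist x y < s} μ := by
  have hA := hk.size_nonneg
  have h := IntegrableOn.mul_of_abs_le (measurableSet_shell x r s) (C := A / r ^ Q)
    (hf.mono_set (shell_subset_ball x r s)) (hk.measurable.comp measurable_prodMk_left : Measurable (k x))
    (by
      rintro y ⟨h1, -⟩
      refine (hk.size x y (dist_pos.1 (hr.trans_le h1))).trans ?_
      gcongr)
  exact h.congr_fun (fun y _ => mul_comm _ _) (measurableSet_shell x r s)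

/-- The cancellation of the kernel lets only the oscillation of `f` count on an annulus. -/
theorem abs_setIntegral_shell_le (hμ : RegularVolume μ c Q) (hk : SingularKernel μ Q A B k)
    {f : X → ℝ} (x : X) {r M : ℝ} (hr : 0 < r) (hf : OscLE μ f x (r * 2) M) :
    |∫ y in {y | r ≤ dist x y ∧ dist x y < r * 2}, k x y * f y ∂μ| ≤ A * c * 2 ^ Q * M := by
  have hA := hk.size_nonneg
  have hc := hμ.pos
  set m := ⨍ y in Metric.ball x (r * 2), f y ∂μ
  have hfin := (hμ.measure_ball_lt_top x (r * 2)).ne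
  have i1 : IntegrableOn (fun y => f y - m) (Metric.ball x (r * 2)) μ :=
    hf.1.sub (integrableOn_const hfin)
  have e : ∫ y in {y | r ≤ dist x y ∧ dist x y < r * 2}, k x y * f y ∂μ =
      ∫ y in {y | r ≤ dist x y ∧ dist x y < r * 2}, k x y * (f y - m) ∂μ := by
    have e1 := integral_add (hk.integrableOn_mul_shell x hr i1)
      (hk.integrableOn_mul_shell (f := fun _ => m) x hr (integrableOn_const hfin))
    rw [integral_mul_const, hk.setIntegral_shell_eq_zero hμ x hr (by linarith), zero_mul,
      add_zero] at e1
    rw [← e1]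
    refine integral_congr_ae (Eventually.of_forall fun y => ?_)
    simp only; ring
  rw [e]
  refine abs_integral_le_integral_abs.trans ?_
  have hsh := measurableSet_shell x r (r * 2)
  calc ∫ y in {y | r ≤ dist x y ∧ dist x y < r * 2}, |k x y * (f y - m)| ∂μ
      ≤ ∫ y in {y | r ≤ dist x y ∧ dist x y < r * 2}, A / r ^ Q * |f y - m| ∂μ := by
        refine setIntegral_mono_on (hk.integrableOn_mul_shell x hr i1).abs
          ((i1.mono_set (shell_subset_ball x _ _)).abs.const_mul _) hsh ?_
        rintro y ⟨h1, -⟩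
        rw [abs_mul]
        gcongr
        refine (hk.size x y (dist_pos.1 (hr.trans_le h1))).trans ?_
        gcongr
    _ = A / r ^ Q * ∫ y in {y | r ≤ dist x y ∧ dist x y < r * 2}, |f y - m| ∂μ :=
        integral_const_mul _ _
    _ ≤ A / r ^ Q * ∫ y in Metric.ball x (r * 2), |f y - m| ∂μ := by
        refine mul_le_mul_of_nonneg_left ?_ (by positivity)
        exact setIntegral_mono_set i1.abs (Eventually.of_forall fun y => abs_nonneg _)
          (shell_subset_ball x _ _).eventuallyLE
    _ ≤ A / r ^ Q * (M * μ.real (Metric.ball x (r * 2))) := by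
        gcongr
        exact hf.2
    _ = _ := by
        rw [hμ.measureReal_ball x (by positivity), mul_pow]
        field_simp

theorem abs_setIntegral_shells_le (hμ : RegularVolume μ c Q) (hk : SingularKernel μ Q A B k)
    {f : X → ℝ} (x : X) {ρ M : ℝ} (hρ : 0 < ρ) (n : ℕ)
    (hf : ∀ i < n, OscLE μ f x (ρ * 2 ^ (i + 1)) M) :
    |∫ y in {y | ρ ≤ dist x y ∧ dist x y < ρ * 2 ^ n}, k x y * f y ∂μ| ≤
      n * (A * c * 2 ^ Q * M) := by
  induction n with
  | zero =>
    have : {y | ρ ≤ dist x y ∧ dist x y < ρ * 2 ^ 0} = ∅ := by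
      ext y; simp only [pow_zero, mul_one, mem_ofPred_eq, mem_empty_iff_false, iff_false, not_and,
        not_lt, imp_self]
    rw [this]; simp
  | succ n ih =>
    have hn := (hf n n.lt_succ_self)
    have hpos : 0 < ρ * 2 ^ n := by positivity
    have e : ρ * 2 ^ (n + 1) = ρ * 2 ^ n * 2 := by rw [pow_succ]; ring
    have i2 := hk.integrableOn_mul_shell x hpos hn.1
    have i1 := hk.integrableOn_mul_shell x hρ (hn.1.mono_set
      (Metric.ball_subset_ball (show ρ * 2 ^ n ≤ ρ * 2 ^ (n + 1) by rw [e]; linarith)))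
    rw [setIntegral_shell_succ x hρ n i1 i2]
    have h1 := ih fun i hi => hf i (hi.trans n.lt_succ_self)
    rw [e] at hn
    have h2 := hk.abs_setIntegral_shell_le hμ x hpos hn
    rw [← e] at h2
    refine (abs_add_le _ _).trans ?_
    push_cast; linarith

variable [SFinite μ]

/-- The singular integral of a function supported far from `x₀` is nearly constant
near `x₀`. -/
theorem limitOp_ae_abs_sub_le (hμ : RegularVolume μ c Q) (hk : SingularKernel μ Q A B k)
    {g : Lp ℝ 2 μ} {x₀ : X} {ρ : ℝ} (hρ : 0 < ρ) (J : ℕ)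
    (h1 : ∀ᵐ y ∂μ, y ∈ Metric.ball x₀ (2 * ρ) → g y = 0)
    (h2 : ∀ᵐ y ∂μ, y ∉ Metric.ball x₀ (ρ * 2 ^ J) → g y = 0) :
    ∀ᵐ z ∂μ, z ∈ Metric.ball x₀ ρ → |hk.limitOp hμ g z - ∫ y, k x₀ y * g y ∂μ| ≤
      B * (c * 2 ^ Q * ∑ j ∈ Finset.range J, (1 / 2 : ℝ) ^ j *
        ((μ.real (Metric.ball x₀ (ρ * 2 ^ (j + 1))))⁻¹ *
          ∫ y in Metric.ball x₀ (ρ * 2 ^ (j + 1)), |g y| ∂μ)) := by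
  have hB := hk.smooth_nonneg
  have hg := integrable_of_vanish hμ g h2
  filter_upwards [hk.limitOp_ae_of_vanish hμ hρ h1 h2] with z hz hzb
  rw [hz hzb]
  rw [Metric.mem_ball, dist_comm] at hzb
  have iz : Integrable (fun y => k z y * g y) μ := hk.integrable_mul_of_far hg hρ (by
    filter_upwards [h1] with y hy hd
    refine hy ?_
    rw [Metric.mem_ball, dist_comm]
    linarith [dist_triangle x₀ z y])
  have i0 : Integrable (fun y => k x₀ y * g y) μ := hk.integrable_mul_of_far hg hρ (by
    filter_upwards [h1] with y hy hd
    refine hy ?_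
    rw [Metric.mem_ball, dist_comm]
    linarith)
  rw [← integral_sub iz i0]
  refine abs_integral_le_integral_abs.trans ?_
  have hsh := measurableSet_shell x₀ ρ (ρ * 2 ^ J)
  have hoff : ∀ᵐ y ∂μ, y ∉ {y | ρ ≤ dist x₀ y ∧ dist x₀ y < ρ * 2 ^ J} →
      |k z y * g y - k x₀ y * g y| = 0 := by
    filter_upwards [h1, h2] with y a1 a2 hy
    have : g y = 0 := by
      by_cases hb : y ∈ Metric.ball x₀ (ρ * 2 ^ J)
      · refine a1 ?_
        rw [Metric.mem_ball, dist_comm] at hb ⊢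
        by_contra hc'
        exact hy ⟨by linarith, hb⟩
      · exact a2 hb
    simp [this]
  rw [← setIntegral_eq_integral_of_ae_compl_eq_zero hoff]
  refine le_trans ?_ (mul_le_mul_of_nonneg_left
    (setIntegral_tail_le hμ x₀ hρ J hg.integrableOn) hB)
  rw [← integral_const_mul]
  refine integral_mono_ae (iz.sub i0).abs.integrableOn
    ((integrableOn_tail (Q := Q) x₀ hρ hg.integrableOn).const_mul B) ?_
  filter_upwards [ae_restrict_of_ae h1] with y a1
  by_cases hy : y ∈ Metric.ball x₀ (2 * ρ)
  · simp [a1 hy]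
  · rw [Metric.mem_ball, not_lt, dist_comm] at hy
    have hs := hk.smooth x₀ z y (by linarith)
    rw [← sub_mul, abs_mul]
    have h3 : |k z y - k x₀ y| ≤ B * (ρ / dist x₀ y ^ (Q + 1)) := by
      have h4 : B * (dist x₀ z / dist x₀ y ^ (Q + 1)) ≤ B * (ρ / dist x₀ y ^ (Q + 1)) := by gcongr
      linarith [abs_nonneg (k y z - k y x₀)]
    calc |k z y - k x₀ y| * |g y| ≤ B * (ρ / dist x₀ y ^ (Q + 1)) * |g y| := by gcongr
      _ = _ := by ring

/-- The operator norm bound used for the singular integral. -/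
noncomputable def opConst (c : ℝ) (Q : ℕ) (A B : ℝ) : ℝ := 8 * √(orthConst c Q A B)

/-- Splitting of a singular integral near `x₀` into a part that is small in `L²` and a part that is
nearly constant. -/
theorem exists_limitOp_split (hμ : RegularVolume μ c Q) (hk : SingularKernel μ Q A B k)
    {h : Lp ℝ 2 μ} {x₀ : X} {ρ : ℝ} (hρ : 0 < ρ) (J : ℕ)
    (h0 : ∀ᵐ y ∂μ, y ∉ Metric.ball x₀ (ρ * 2 ^ J) → h y = 0) {a : ℝ}
    (hnear : ∫⁻ y in Metric.ball x₀ (ρ * 2 ^ (min 1 J)), ‖h y‖ₑ ^ 2 ∂μ ≤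
      ENNReal.ofReal (a ^ 2) * μ (Metric.ball x₀ (ρ * 2 ^ (min 1 J)))) {e : ℕ → ℝ}
    (hfar : ∀ j < J, ∫ y in Metric.ball x₀ (ρ * 2 ^ (j + 1)), |h y| ∂μ ≤
      e j * μ.real (Metric.ball x₀ (ρ * 2 ^ (j + 1)))) :
    ∃ v w : Lp ℝ 2 μ, hk.limitOp hμ h = v + w ∧
      ∫⁻ y in Metric.ball x₀ ρ, ‖v y‖ₑ ^ 2 ∂μ ≤
        ENNReal.ofReal ((opConst c Q A B * √(2 ^ Q) * a) ^ 2) * μ (Metric.ball x₀ ρ) ∧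
      ∀ᵐ z ∂μ, z ∈ Metric.ball x₀ ρ →
        |w z - ∫ y in {y | 2 * ρ ≤ dist x₀ y ∧ dist x₀ y < ρ * 2 ^ J}, k x₀ y * h y ∂μ| ≤
          B * (c * 2 ^ Q * ∑ j ∈ Finset.range J, (1 / 2 : ℝ) ^ j * e j) := by
  have hB := hk.smooth_nonneg
  have hc := hμ.pos
  set N := Metric.ball x₀ (ρ * 2 ^ (min 1 J)) with hN
  have hm1 : MemLp (N.indicator h) 2 μ := (Lp.memLp h).indicator measurableSet_ball
  set h₁ : Lp ℝ 2 μ := hm1.toLp _ with hh₁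
  set h₂ : Lp ℝ 2 μ := h - h₁ with hh₂
  have e1 : h₁ =ᵐ[μ] N.indicator h := hm1.coeFn_toLp
  have e2 : ∀ᵐ y ∂μ, h₂ y = h y - N.indicator h y := by
    filter_upwards [Lp.coeFn_sub h h₁, e1] with y a1 a2
    rw [hh₂, a1, Pi.sub_apply, a2]
  have z1 : ∀ᵐ y ∂μ, y ∈ Metric.ball x₀ (2 * ρ) → h₂ y = 0 := by
    filter_upwards [e2, h0] with y a1 a2 hy
    rw [a1]
    by_cases hyN : y ∈ N
    · rw [indicator_of_mem hyN, sub_self]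
    · rw [indicator_of_notMem hyN, sub_zero]
      rcases Nat.eq_zero_or_pos J with hJ | hJ
      · refine a2 ?_
        subst hJ
        exact hyN
      · rw [hN, min_eq_left hJ, pow_one, mul_comm] at hyN
        exact absurd hy hyN
  have z2 : ∀ᵐ y ∂μ, y ∉ Metric.ball x₀ (ρ * 2 ^ J) → h₂ y = 0 := by
    filter_upwards [e2, h0] with y a1 a2 hy
    rw [a1, a2 hy]
    by_cases hyN : y ∈ N
    · rw [indicator_of_mem hyN, a2 hy, sub_self]
    · rw [indicator_of_notMem hyN, sub_zero]
  have hle : ∀ᵐ y ∂μ, |h₂ y| ≤ |h y| := by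
    filter_upwards [e2] with y a1
    rw [a1]
    by_cases hyN : y ∈ N
    · rw [indicator_of_mem hyN, sub_self, abs_zero]; exact abs_nonneg _
    · rw [indicator_of_notMem hyN, sub_zero]
  refine ⟨hk.limitOp hμ h₁, hk.limitOp hμ h₂, ?_, ?_, ?_⟩
  · rw [← map_add, hh₂, add_sub_cancel]
  · have n1 : ‖h₁‖ₑ ^ 2 ≤ ENNReal.ofReal (a ^ 2) * μ N := by
      rw [Lp.enorm_def, eLpNorm_congr_ae e1, eLpNorm_two_sq]
      refine le_trans (le_of_eq ?_) hnear
      rw [← lintegral_indicator measurableSet_ball]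
      refine lintegral_congr fun y => ?_
      by_cases hyN : y ∈ N
      · rw [indicator_of_mem hyN, indicator_of_mem hyN]
      · rw [indicator_of_notMem hyN, indicator_of_notMem hyN]; simp
    have n2 : μ N ≤ ENNReal.ofReal (2 ^ Q) * μ (Metric.ball x₀ ρ) := by
      rw [hN, hμ.measure_ball x₀ _ (by positivity), hμ.measure_ball x₀ _ hρ,
        ← ENNReal.ofReal_mul (by positivity)]
      refine ENNReal.ofReal_le_ofReal ?_
      have : (2 : ℝ) ^ (min 1 J) ≤ 2 := by
        calc (2 : ℝ) ^ (min 1 J) ≤ 2 ^ 1 := pow_le_pow_right₀ (by norm_num) (min_le_left _ _)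
          _ = 2 := pow_one _
      calc c * (ρ * 2 ^ min 1 J) ^ Q ≤ c * (ρ * 2) ^ Q := by gcongr
        _ = _ := by rw [mul_pow]; ring
    have n3 : ‖hk.limitOp hμ h₁‖ₑ ≤ ENNReal.ofReal (opConst c Q A B) * ‖h₁‖ₑ := by
      rw [← ofReal_norm, ← ofReal_norm, ← ENNReal.ofReal_mul (by
        rw [opConst]; positivity)]
      exact ENNReal.ofReal_le_ofReal ((hk.limitOp hμ).le_of_opNorm_le (hk.norm_limitOp_le hμ) _)
    have hop : 0 ≤ opConst c Q A B := by rw [opConst]; positivity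
    calc ∫⁻ y in Metric.ball x₀ ρ, ‖hk.limitOp hμ h₁ y‖ₑ ^ 2 ∂μ
        ≤ ∫⁻ y, ‖hk.limitOp hμ h₁ y‖ₑ ^ 2 ∂μ := setLIntegral_le_lintegral _ _
      _ = ‖hk.limitOp hμ h₁‖ₑ ^ 2 := by rw [Lp.enorm_def, eLpNorm_two_sq]
      _ ≤ (ENNReal.ofReal (opConst c Q A B) * ‖h₁‖ₑ) ^ 2 := by gcongr
      _ = ENNReal.ofReal (opConst c Q A B ^ 2) * ‖h₁‖ₑ ^ 2 := by
          rw [mul_pow, ENNReal.ofReal_pow hop]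
      _ ≤ ENNReal.ofReal (opConst c Q A B ^ 2) * (ENNReal.ofReal (a ^ 2) *
            (ENNReal.ofReal (2 ^ Q) * μ (Metric.ball x₀ ρ))) := by
          gcongr
          exact n1.trans (by gcongr)
      _ = _ := by
          rw [mul_pow, mul_pow, Real.sq_sqrt (by positivity), ENNReal.ofReal_mul (by positivity),
            ENNReal.ofReal_mul (by positivity)]
          ring
  · have hD : ∫ y, k x₀ y * h₂ y ∂μ =
        ∫ y in {y | 2 * ρ ≤ dist x₀ y ∧ dist x₀ y < ρ * 2 ^ J}, k x₀ y * h y ∂μ := by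
      have hoff : ∀ᵐ y ∂μ, y ∉ {y | 2 * ρ ≤ dist x₀ y ∧ dist x₀ y < ρ * 2 ^ J} →
          k x₀ y * h₂ y = 0 := by
        filter_upwards [z1, z2] with y a1 a2 hy
        have : h₂ y = 0 := by
          by_cases hb : y ∈ Metric.ball x₀ (ρ * 2 ^ J)
          · refine a1 ?_
            rw [Metric.mem_ball, dist_comm] at hb ⊢
            by_contra hc'
            exact hy ⟨by linarith, hb⟩
          · exact a2 hb
        rw [this, mul_zero]
      rw [← setIntegral_eq_integral_of_ae_compl_eq_zero hoff]
      refine setIntegral_congr_ae (measurableSet_shell _ _ _) ?_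
      filter_upwards [e2] with y a1 hy
      rw [a1, indicator_of_notMem, sub_zero]
      rw [hN, Metric.mem_ball, dist_comm, not_lt]
      have : (2 : ℝ) ^ (min 1 J) ≤ 2 := by
        calc (2 : ℝ) ^ (min 1 J) ≤ 2 ^ 1 := pow_le_pow_right₀ (by norm_num) (min_le_left _ _)
          _ = 2 := pow_one _
      nlinarith [hy.1]
    rw [← hD]
    filter_upwards [hk.limitOp_ae_abs_sub_le hμ hρ J z1 z2] with z hz hzb
    refine (hz hzb).trans ?_
    gcongr with j hj
    have hp := hμ.measureReal_ball_pos x₀ (show 0 < ρ * 2 ^ (j + 1) by positivity)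
    rw [inv_mul_le_iff₀ hp, mul_comm (μ.real _)]
    refine le_trans ?_ (hfar j (Finset.mem_range.1 hj))
    have ib : ∀ u : Lp ℝ 2 μ, IntegrableOn (fun y => |u y|) (Metric.ball x₀ (ρ * 2 ^ (j + 1))) μ :=
      fun u => ((integrableOn_of_memLp hμ (Lp.memLp u) _ _).mono_set
        Metric.ball_subset_closedBall).abs
    exact integral_mono_ae (ib h₂) (ib h) (ae_restrict_of_ae hle)

end SingularKernel

/-! ### The oscillation of the commutator on a ball -/

theorem sum_half_pow_mul_le (J : ℕ) :
    ∑ j ∈ Finset.range J, (1 / 2 : ℝ) ^ j * ((j : ℝ) + 2) ≤ 6 := by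
  have h : ∑ j ∈ Finset.range J, (1 / 2 : ℝ) ^ j * ((j : ℝ) + 2) =
      6 - (1 / 2 : ℝ) ^ J * (2 * J + 6) := by
    induction J with
    | zero => norm_num
    | succ n ih => rw [Finset.sum_range_succ, ih, pow_succ]; push_cast; ring
  rw [h]
  have : 0 ≤ (1 / 2 : ℝ) ^ J * (2 * J + 6) := by positivity
  linarith

theorem memLp_two_of_lintegral_sq {X : Type*} [MeasurableSpace X] {μ : Measure X} {S : Set X}
    {h : X → ℝ} {a : ℝ} (hS : μ S ≠ ⊤) (hm : AEStronglyMeasurable h (μ.restrict S))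
    (h2 : ∫⁻ y in S, ‖h y‖ₑ ^ 2 ∂μ ≤ ENNReal.ofReal (a ^ 2) * μ S) : MemLp h 2 (μ.restrict S) := by
  refine ⟨hm, ?_⟩
  have h3 : eLpNorm h 2 (μ.restrict S) ^ 2 < ⊤ := by
    rw [eLpNorm_two_sq]
    exact h2.trans_lt (ENNReal.mul_lt_top ENNReal.ofReal_lt_top hS.lt_top)
  by_contra hc
  rw [not_lt, top_le_iff] at hc
  rw [hc] at h3
  simp at h3

/-- The constant in the bound for the oscillation of the commutator. -/
noncomputable def commutatorConst (c : ℝ) (Q : ℕ) (A B : ℝ) : ℝ :=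
  SingularKernel.opConst c Q A B * √(2 ^ Q) * (momentConst Q * 2 ^ Q * (momentConst Q * 2 ^ Q) * 2) +
    B * (c * 2 ^ Q * (momentConst Q * 2 ^ Q * (momentConst Q * 2 ^ Q) * 6)) +
    SingularKernel.opConst c Q A B * √(2 ^ Q) * (momentConst Q * 2 ^ Q * (momentConst Q * 2 ^ Q)) +
    (A * c * 2 ^ Q + B * (c * 2 ^ Q * (momentConst Q * 2 ^ Q * 2)))

section Commutator

variable {X : Type*} [MetricSpace X] [MeasurableSpace X] {μ : Measure X} {c : ℝ} {Q : ℕ}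
  {A B : ℝ} {k : X → X → ℝ}

theorem SingularKernel.commutatorConst_nonneg (hμ : RegularVolume μ c Q)
    (hk : SingularKernel μ Q A B k) : 0 ≤ commutatorConst c Q A B := by
  have := hk.size_nonneg
  have := hk.smooth_nonneg
  have := hμ.pos
  have := one_le_momentConst Q
  have : 0 ≤ SingularKernel.opConst c Q A B := by rw [SingularKernel.opConst]; positivity
  rw [commutatorConst]
  positivity

variable [BorelSpace X] [SecondCountableTopology X] [SFinite μ]

/-- **Oscillation of the commutator**, for a multiplier `β` of mean zero on the small ball. The
averages of `f` over the balls `B(x₀, ρ 2ʲ)` grow like `1 + J - j`, while the oscillation of `β`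
there decays like `1 / (1 + J - j)`: the two effects cancel in `T(β f)` and in `β T f`. -/
theorem exists_integral_commutator_sub_le_of_average_eq_zero (hμ : RegularVolume μ c Q)
    (hk : SingularKernel μ Q A B k) (J : ℕ) {x₀ : X} {ρ Λ M : ℝ} (hρ : 0 < ρ) (hΛ : 0 ≤ Λ)
    (hM : 0 ≤ M) {f g : Lp ℝ 2 μ} {β : X → ℝ} (hf : ∀ z s, 0 < s → OscLE μ f z s M)
    (hf0 : ∀ᵐ y ∂μ, y ∉ Metric.ball x₀ (ρ * 2 ^ J) → f y = 0)
    (hfJ : ∫ y in Metric.ball x₀ (ρ * 2 ^ J), |f y| ∂μ ≤ M * μ.real (Metric.ball x₀ (ρ * 2 ^ J)))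
    (hβ : ∀ j ≤ J, ∀ z s, 0 < s → dist x₀ z + s ≤ 5 / 4 * (ρ * 2 ^ j) →
      OscLE μ β z s (Λ / (1 + J - j)))
    (hβ0 : ⨍ y in Metric.ball x₀ ρ, β y ∂μ = 0) (hg : ∀ᵐ y ∂μ, g y = β y * f y) :
    IntegrableOn (fun z => hk.limitOp hμ g z - β z * hk.limitOp hμ f z) (Metric.ball x₀ ρ) μ ∧
    ∃ a, ∫ z in Metric.ball x₀ ρ, |hk.limitOp hμ g z - β z * hk.limitOp hμ f z - a| ∂μ ≤
      commutatorConst c Q A B * (Λ * M) * μ.real (Metric.ball x₀ ρ) := by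
  have hA := hk.size_nonneg
  have hB := hk.smooth_nonneg
  have hc := hμ.pos
  have hm := one_le_momentConst Q
  have hop : 0 ≤ SingularKernel.opConst c Q A B := by rw [SingularKernel.opConst]; positivity
  set m := momentConst Q with hmdef
  set q : ℝ := 2 ^ Q with hq
  have hq1 : 1 ≤ q := one_le_pow₀ (by norm_num)
  set b : ℕ → Set X := fun j => Metric.ball x₀ (ρ * 2 ^ j) with hb
  have hpos : ∀ j, 0 < ρ * 2 ^ j := fun j => by positivity
  have hb0 : Metric.ball x₀ ρ = b 0 := by simp only [hb, pow_zero, mul_one]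
  have hfin : ∀ j, μ (b j) ≠ ⊤ := fun j => (hμ.measure_ball_lt_top _ _).ne
  have hden : ∀ j ≤ J, (1 : ℝ) ≤ 1 + J - j := fun j hj => by
    have : (j : ℝ) ≤ J := by exact_mod_cast hj
    linarith
  -- chains of doublings: from `b j` up to `b J` for `f`, from `b 0` up to `b j` for `β`
  have avf : ∀ j ≤ J, |⨍ y in b j, f y ∂μ| ≤ q * (M * (1 + J - j)) := by
    intro j hj
    have h1 := abs_average_sub_le_of_chain hμ (h := f) (x₀ := x₀) (w := M) (hpos j) (J - j)
      fun i _ => hf _ _ (by positivity)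
    rw [mul_assoc, ← pow_add, Nat.add_sub_cancel' hj, Nat.cast_sub hj] at h1
    have h2 : |⨍ y in b J, f y ∂μ| ≤ M := by
      have h3 := abs_setAverage_sub_le (hf x₀ _ (hpos J)).1 (hμ.measureReal_ball_pos x₀ (hpos J)) 0
      simp only [sub_zero] at h3
      refine h3.trans ?_
      rw [inv_mul_le_iff₀ (hμ.measureReal_ball_pos x₀ (hpos J)), mul_comm (μ.real _)]
      exact hfJ
    have h4 := abs_add_le ((⨍ y in b j, f y ∂μ) - ⨍ y in b J, f y ∂μ) (⨍ y in b J, f y ∂μ)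
    rw [sub_add_cancel] at h4
    nlinarith [mul_nonneg (sub_nonneg.2 hq1) hM]
  have avβ : ∀ j ≤ J, |⨍ y in b j, β y ∂μ| ≤ q * ((j + 1) * (Λ / (1 + J - j))) := by
    intro j hj
    have hw : 0 ≤ Λ / (1 + J - j) := div_nonneg hΛ (by linarith [hden j hj])
    have h1 := abs_average_sub_le_of_chain hμ (h := β) (x₀ := x₀) (w := Λ / (1 + J - j)) hρ j
      fun i hi => hβ j hj x₀ _ (by positivity) (by
        rw [dist_self, zero_add]
        have : ρ * 2 ^ (i + 1) ≤ ρ * 2 ^ j :=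
          mul_le_mul_of_nonneg_left (pow_le_pow_right₀ (by norm_num) hi) hρ.le
        linarith [hpos j])
    rw [hβ0, zero_sub, abs_neg] at h1
    refine h1.trans ?_
    nlinarith [mul_nonneg (le_trans zero_le_one hq1) hw]
  -- by John–Nirenberg the averages and oscillations control the fourth moments
  have f4 : ∀ j ≤ J, ∫⁻ y in b j, ‖f y‖ₑ ^ 4 ∂μ ≤
      ENNReal.ofReal ((m * (q * (M * (1 + J - j)))) ^ 4) * μ (b j) := fun j hj => by
    refine lintegral_pow_four_le hμ (hpos j) hM ?_ (fun z r hr _ => hf z r hr) (avf j hj)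
    have h1 : M ≤ M * (1 + J - j) := le_mul_of_one_le_right hM (hden j hj)
    exact h1.trans (le_mul_of_one_le_left (hM.trans h1) hq1)
  have β4 : ∀ j ≤ J, ∫⁻ y in b j, ‖β y‖ₑ ^ 4 ∂μ ≤
      ENNReal.ofReal ((m * (q * ((j + 1) * (Λ / (1 + J - j))))) ^ 4) * μ (b j) := fun j hj => by
    have hw : 0 ≤ Λ / (1 + J - j) := div_nonneg hΛ (by linarith [hden j hj])
    refine lintegral_pow_four_le hμ (hpos j) hw ?_ (hβ j hj) (avβ j hj)
    have h1 : Λ / (1 + J - j) ≤ (j + 1) * (Λ / (1 + J - j)) :=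
      le_mul_of_one_le_left hw (by linarith [j.cast_nonneg (α := ℝ)])
    exact h1.trans (le_mul_of_one_le_left (hw.trans h1) hq1)
  have mf : ∀ j, AEStronglyMeasurable f (μ.restrict (b j)) := fun j =>
    (Lp.aestronglyMeasurable f).restrict
  have mβ : ∀ j ≤ J, AEStronglyMeasurable β (μ.restrict (b j)) := fun j hj =>
    (hβ j hj x₀ _ (hpos j) (by rw [dist_self, zero_add]; linarith [hpos j])).1.aestronglyMeasurable
  -- `β f` is as large as `ΛM` times the number of doublings
  have g2 : ∀ j ≤ J, ∫⁻ y in b j, ‖g y‖ₑ ^ 2 ∂μ ≤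
      ENNReal.ofReal ((m * q * (m * q) * (Λ * M) * (j + 1)) ^ 2) * μ (b j) := fun j hj => by
    have h1 := lintegral_mul_sq_le_of_pow_four (mβ j hj) (mf j) (β4 j hj) (f4 j hj)
    have e : m * (q * ((j + 1) * (Λ / (1 + J - j)))) * (m * (q * (M * (1 + J - j)))) =
        m * q * (m * q) * (Λ * M) * (j + 1) := by
      have : (1 + J - j : ℝ) ≠ 0 := by linarith [hden j hj]
      field_simp
    rw [e] at h1
    refine le_trans (le_of_eq ?_) h1
    refine lintegral_congr_ae (ae_restrict_of_ae ?_)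
    filter_upwards [hg] with y hy
    rw [hy]
  have g1 : ∀ j ≤ J, ∫ y in b j, |g y| ∂μ ≤ m * q * (m * q) * (Λ * M) * (j + 1) * μ.real (b j) :=
    fun j hj => setIntegral_abs_le_of_lintegral (by positivity) (hfin j)
      (lintegral_enorm_le_of_sq (by positivity) (Lp.aestronglyMeasurable g).restrict (g2 j hj))
  have f2 : ∀ j ≤ J, ∫⁻ y in b j, ‖f y‖ₑ ^ 2 ∂μ ≤
      ENNReal.ofReal ((m * q * (M * (1 + J))) ^ 2) * μ (b j) := fun j hj => by
    refine (lintegral_sq_le_of_pow_four (mf j) (f4 j hj)).trans ?_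
    have := hden j hj
    gcongr ENNReal.ofReal ?_ * _
    rw [mul_assoc m q]
    gcongr
    linarith [j.cast_nonneg (α := ℝ)]
  have f1 : ∀ j ≤ J, ∫ y in b j, |f y| ∂μ ≤ m * q * (M * (1 + J)) * μ.real (b j) :=
    fun j hj => setIntegral_abs_le_of_lintegral (by positivity) (hfin j)
      (lintegral_enorm_le_of_sq (by positivity) (mf j) (f2 j hj))
  have hg0 : ∀ᵐ y ∂μ, y ∉ b J → g y = 0 := by
    filter_upwards [hg, hf0] with y a1 a2 hy
    rw [a1, a2 hy, mul_zero]
  -- the near parts `v`, `v'` are bounded in `L²`, the far parts `w`, `w'` pointwise; only the constant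
  -- `D` is to be subtracted, since `|β|` has mean at most `Λ / (1 + J)`, against `w' = O(M (1 + J))`
  obtain ⟨v, w, hvw, hv, hw⟩ := hk.exists_limitOp_split hμ hρ J hg0
    (a := m * q * (m * q) * (Λ * M) * 2) (e := fun j => m * q * (m * q) * (Λ * M) * (j + 2)) (by
      refine (g2 _ (min_le_right 1 J)).trans ?_
      gcongr ENNReal.ofReal ((_ * ?_) ^ 2) * _
      have : ((min 1 J : ℕ) : ℝ) ≤ 1 := by exact_mod_cast min_le_left 1 J
      linarith) (fun j hj => by
      have := g1 (j + 1) hj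
      push_cast at this
      rwa [add_assoc (j : ℝ), one_add_one_eq_two] at this)
  obtain ⟨v', w', hvw', hv', hw'⟩ := hk.exists_limitOp_split hμ hρ J hf0
    (a := m * q * (M * (1 + J))) (e := fun _ => m * q * (M * (1 + J)))
    (f2 _ (min_le_right 1 J)) (fun j hj => f1 (j + 1) hj)
  set D := ∫ y in {y | 2 * ρ ≤ dist x₀ y ∧ dist x₀ y < ρ * 2 ^ J}, k x₀ y * g y ∂μ
  set D' := ∫ y in {y | 2 * ρ ≤ dist x₀ y ∧ dist x₀ y < ρ * 2 ^ J}, k x₀ y * f y ∂μ with hD'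
  have hD'le : |D'| ≤ J * (A * c * q * M) := by
    rcases Nat.eq_zero_or_pos J with hJ | hJ
    · have : {y | 2 * ρ ≤ dist x₀ y ∧ dist x₀ y < ρ * 2 ^ J} = ∅ := by
        ext y
        simp only [hJ, pow_zero, mul_one, mem_ofPred_eq, mem_empty_iff_false, iff_false, not_and,
          not_lt]
        intro h; linarith
      rw [hD', this]; simp [hJ]
    · obtain ⟨n, rfl⟩ : ∃ n, J = n + 1 := ⟨J - 1, by omega⟩
      have h1 := hk.abs_setIntegral_shells_le hμ (f := f) x₀ (show 0 < 2 * ρ by positivity) n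
        (M := M) fun i _ => hf _ _ (by positivity)
      rw [show 2 * ρ * 2 ^ n = ρ * 2 ^ (n + 1) by rw [pow_succ]; ring] at h1
      refine h1.trans ?_
      push_cast
      have : 0 ≤ A * c * q * M := by positivity
      linarith
  set W : ℝ := B * (c * q * (m * q * (m * q) * 6)) * (Λ * M) with hW
  set W' : ℝ := (A * c * q + B * (c * q * (m * q * 2))) * (M * (1 + J)) with hW'
  have hwle : ∀ᵐ z ∂μ, z ∈ Metric.ball x₀ ρ → |w z - D| ≤ W := by
    filter_upwards [hw] with z hz hzb
    refine (hz hzb).trans ?_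
    have e : ∑ j ∈ Finset.range J, (1 / 2 : ℝ) ^ j * (m * q * (m * q) * (Λ * M) * ((j : ℝ) + 2)) =
        m * q * (m * q) * (Λ * M) * ∑ j ∈ Finset.range J, (1 / 2 : ℝ) ^ j * ((j : ℝ) + 2) := by
      rw [Finset.mul_sum]
      exact Finset.sum_congr rfl fun j _ => by ring
    rw [e]
    calc _ ≤ B * (c * q * (m * q * (m * q) * (Λ * M) * 6)) := by
          gcongr
          exact sum_half_pow_mul_le J
      _ = W := by rw [hW]; ring
  have hw'le : ∀ᵐ z ∂μ, z ∈ Metric.ball x₀ ρ → |w' z| ≤ W' := by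
    filter_upwards [hw'] with z hz hzb
    have h1 := hz hzb
    rw [← Finset.sum_mul] at h1
    have h2 : B * (c * q * ((∑ j ∈ Finset.range J, (1 / 2 : ℝ) ^ j) * (m * q * (M * (1 + J))))) ≤
        B * (c * q * (2 * (m * q * (M * (1 + J))))) := by
      gcongr
      exact sum_half_pow_le J
    have h3 := abs_add_le (w' z - D') D'
    rw [sub_add_cancel] at h3
    have h4 : J * (A * c * q * M) ≤ A * c * q * (M * (1 + J)) := by
      have : 0 ≤ A * c * q * M := by positivity
      linarith
    calc |w' z| ≤ A * c * q * (M * (1 + J)) + B * (c * q * (2 * (m * q * (M * (1 + J))))) := by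
          linarith
      _ = W' := by rw [hW']; ring
  have hfin0 : μ (Metric.ball x₀ ρ) ≠ ⊤ := (hμ.measure_ball_lt_top _ _).ne
  have J0 : (0 : ℕ) ≤ J := Nat.zero_le _
  have β2 : ∫⁻ y in Metric.ball x₀ ρ, ‖β y‖ₑ ^ 2 ∂μ ≤
      ENNReal.ofReal ((m * (q * (Λ / (1 + J)))) ^ 2) * μ (Metric.ball x₀ ρ) := by
    have h1 := lintegral_sq_le_of_pow_four (mβ 0 J0) (β4 0 J0)
    rw [← hb0] at h1
    simpa using h1
  have mβ0 : AEStronglyMeasurable β (μ.restrict (Metric.ball x₀ ρ)) := by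
    rw [hb0]; exact mβ 0 J0
  have βL : MemLp β 2 (μ.restrict (Metric.ball x₀ ρ)) := memLp_two_of_lintegral_sq hfin0 mβ0 β2
  have iL : ∀ u : Lp ℝ 2 μ, IntegrableOn u (Metric.ball x₀ ρ) μ := fun u =>
    (SingularKernel.integrableOn_of_memLp hμ (Lp.memLp u) _ _).mono_set Metric.ball_subset_closedBall
  have iβL : ∀ u : Lp ℝ 2 μ, IntegrableOn (fun z => β z * u z) (Metric.ball x₀ ρ) μ := fun u =>
    βL.integrable_mul ((Lp.memLp u).restrict _)
  have iβ := hβ 0 J0 x₀ ρ hρ (by rw [dist_self, zero_add, pow_zero]; linarith)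
  have oβ := iβ.2
  rw [hβ0] at oβ
  simp only [sub_zero, Nat.cast_zero] at oβ
  have hi : IntegrableOn (fun z => hk.limitOp hμ g z - β z * hk.limitOp hμ f z)
    (Metric.ball x₀ ρ) μ := (iL _).sub (iβL _)
  refine ⟨hi, D, ?_⟩
  have p1 : ∫ z in Metric.ball x₀ ρ, |v z| ∂μ ≤
      SingularKernel.opConst c Q A B * √q * (m * q * (m * q) * (Λ * M) * 2) * μ.real (Metric.ball x₀ ρ) :=
    setIntegral_abs_le_of_lintegral (by positivity) hfin0
      (lintegral_enorm_le_of_sq (by positivity) (Lp.aestronglyMeasurable v).restrict hv)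
  have p2 : ∫ z in Metric.ball x₀ ρ, |β z * v' z| ∂μ ≤
      m * (q * (Λ / (1 + J))) * (SingularKernel.opConst c Q A B * √q * (m * q * (M * (1 + J)))) *
        μ.real (Metric.ball x₀ ρ) := by
    refine setIntegral_abs_le_of_lintegral (by positivity) hfin0 ?_
    simp only [enorm_mul]
    exact lintegral_mul_le_of_sq_le mβ0.enorm (Lp.aestronglyMeasurable v').restrict.enorm
      (by positivity) β2 (by positivity) hv'
  have hV := hμ.measureReal_ball_pos x₀ hρ
  have iW : IntegrableOn (fun _ : X => W) (Metric.ball x₀ ρ) μ := integrableOn_const hfin0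
  have iβW : IntegrableOn (fun z => |β z| * W') (Metric.ball x₀ ρ) μ := iβ.1.abs.mul_const W'
  calc ∫ z in Metric.ball x₀ ρ, |hk.limitOp hμ g z - β z * hk.limitOp hμ f z - D| ∂μ
      ≤ ∫ z in Metric.ball x₀ ρ, (|v z| + W + (|β z * v' z| + |β z| * W')) ∂μ := by
        refine integral_mono_ae (hi.sub (integrableOn_const hfin0)).abs
          (((iL v).abs.add iW).add ((iβL v').abs.add iβW)) ?_
        refine (ae_restrict_iff' measurableSet_ball).2 ?_
        filter_upwards [hwle, hw'le, Lp.coeFn_add v w, Lp.coeFn_add v' w'] with z a1 a2 a3 a4 hz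
        rw [hvw, hvw', a3, a4, Pi.add_apply, Pi.add_apply]
        have e : v z + w z - β z * (v' z + w' z) - D =
            v z + (w z - D) - (β z * v' z + β z * w' z) := by ring
        rw [e]
        refine (abs_sub _ _).trans ?_
        have t1 := abs_add_le (v z) (w z - D)
        have t2 := abs_add_le (β z * v' z) (β z * w' z)
        have t3 : |β z * w' z| ≤ |β z| * W' := by
          rw [abs_mul]
          exact mul_le_mul_of_nonneg_left (a2 hz) (abs_nonneg _)
        linarith [a1 hz]
    _ = (∫ z in Metric.ball x₀ ρ, |v z| ∂μ) + μ.real (Metric.ball x₀ ρ) * W +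
          ((∫ z in Metric.ball x₀ ρ, |β z * v' z| ∂μ) +
            (∫ z in Metric.ball x₀ ρ, |β z| ∂μ) * W') := by
        have e1 : ∫ z in Metric.ball x₀ ρ, (|v z| + W + (|β z * v' z| + |β z| * W')) ∂μ =
            (∫ z in Metric.ball x₀ ρ, (|v z| + W) ∂μ) +
              ∫ z in Metric.ball x₀ ρ, (|β z * v' z| + |β z| * W') ∂μ :=
          integral_add ((iL v).abs.add iW) ((iβL v').abs.add iβW)
        rw [e1, integral_add (iL v).abs iW, integral_add (iβL v').abs iβW, setIntegral_const,
          smul_eq_mul, integral_mul_const]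
    _ ≤ SingularKernel.opConst c Q A B * √q * (m * q * (m * q) * (Λ * M) * 2) * μ.real (Metric.ball x₀ ρ) +
          μ.real (Metric.ball x₀ ρ) * W +
          (m * (q * (Λ / (1 + J))) * (SingularKernel.opConst c Q A B * √q * (m * q * (M * (1 + J)))) *
            μ.real (Metric.ball x₀ ρ) +
            Λ / (1 + J) * μ.real (Metric.ball x₀ ρ) * W') := by
        have : 0 ≤ W' := by positivity
        gcongr
    _ = commutatorConst c Q A B * (Λ * M) * μ.real (Metric.ball x₀ ρ) := by
        rw [hW, hW', commutatorConst]
        simp only [← hmdef, ← hq]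
        have : (1 + J : ℝ) ≠ 0 := by positivity
        field_simp
        ring

/-- **Oscillation of the commutator** `T(bf) - b Tf` on `B(x₀, ρ)`. -/
theorem exists_integral_commutator_sub_le (hμ : RegularVolume μ c Q)
    (hk : SingularKernel μ Q A B k) (J : ℕ) {x₀ : X} {ρ Λ M : ℝ} (hρ : 0 < ρ) (hΛ : 0 ≤ Λ)
    (hM : 0 ≤ M) {f g : Lp ℝ 2 μ} {β : X → ℝ} (hf : ∀ z s, 0 < s → OscLE μ f z s M)
    (hf0 : ∀ᵐ y ∂μ, y ∉ Metric.ball x₀ (ρ * 2 ^ J) → f y = 0)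
    (hfJ : ∫ y in Metric.ball x₀ (ρ * 2 ^ J), |f y| ∂μ ≤ M * μ.real (Metric.ball x₀ (ρ * 2 ^ J)))
    (hβ : ∀ j ≤ J, ∀ z s, 0 < s → dist x₀ z + s ≤ 5 / 4 * (ρ * 2 ^ j) →
      OscLE μ β z s (Λ / (1 + J - j))) (hg : ∀ᵐ y ∂μ, g y = β y * f y) :
    IntegrableOn (fun z => hk.limitOp hμ g z - β z * hk.limitOp hμ f z) (Metric.ball x₀ ρ) μ ∧
    ∃ a, ∫ z in Metric.ball x₀ ρ, |hk.limitOp hμ g z - β z * hk.limitOp hμ f z - a| ∂μ ≤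
      commutatorConst c Q A B * (Λ * M) * μ.real (Metric.ball x₀ ρ) := by
  set n := ⨍ y in Metric.ball x₀ ρ, β y ∂μ with hn
  have hav : ∀ z s, 0 < s → IntegrableOn β (Metric.ball z s) μ →
      ⨍ y in Metric.ball z s, (β y - n) ∂μ = (⨍ y in Metric.ball z s, β y ∂μ) - n := by
    intro z s hs hi
    have hp := hμ.measureReal_ball_pos z hs
    rw [setAverage_eq, integral_sub hi (integrableOn_const (hμ.measure_ball_lt_top z s).ne),
      setIntegral_const, setAverage_eq, smul_sub, smul_eq_mul, smul_eq_mul, smul_eq_mul,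
      inv_mul_cancel_left₀ hp.ne']
  have hβ' : ∀ j ≤ J, ∀ z s, 0 < s → dist x₀ z + s ≤ 5 / 4 * (ρ * 2 ^ j) →
      OscLE μ (fun y => β y - n) z s (Λ / (1 + J - j)) := by
    intro j hj z s hs hzs
    have h := hβ j hj z s hs hzs
    refine ⟨h.1.sub (integrableOn_const (hμ.measure_ball_lt_top z s).ne), ?_⟩
    rw [hav z s hs h.1]
    simpa only [sub_sub_sub_cancel_right] using h.2
  have h0 : ⨍ y in Metric.ball x₀ ρ, (β y - n) ∂μ = 0 := by
    rw [hav x₀ ρ hρ (hβ 0 (Nat.zero_le _) x₀ ρ hρ (by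
      rw [dist_self, zero_add, pow_zero]; linarith)).1, sub_self]
  have hg' : ∀ᵐ y ∂μ, (g - n • f) y = (β y - n) * f y := by
    filter_upwards [hg, Lp.coeFn_sub g (n • f), Lp.coeFn_smul n f] with y a1 a2 a3
    rw [a2, Pi.sub_apply, a3, Pi.smul_apply, a1, smul_eq_mul]; ring
  have h := exists_integral_commutator_sub_le_of_average_eq_zero hμ hk J hρ hΛ hM hf hf0 hfJ hβ' h0 hg'
  have e : ∀ᵐ z ∂μ, hk.limitOp hμ (g - n • f) z - (β z - n) * hk.limitOp hμ f z =
      hk.limitOp hμ g z - β z * hk.limitOp hμ f z := by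
    rw [map_sub, map_smul]
    filter_upwards [Lp.coeFn_sub (hk.limitOp hμ g) (n • hk.limitOp hμ f),
      Lp.coeFn_smul n (hk.limitOp hμ f)] with y a2 a3
    rw [a2, Pi.sub_apply, a3, Pi.smul_apply, smul_eq_mul]; ring
  obtain ⟨hi, a, ha⟩ := h
  refine ⟨hi.congr (ae_restrict_of_ae e), a, le_trans (le_of_eq ?_) ha⟩
  refine integral_congr_ae (ae_restrict_of_ae ?_)
  filter_upwards [e] with z hz
  rw [hz]

end Commutator

/-! ### The commutator on spaces with regular volume growth -/

section Transfer

variable {X : Type*} [MetricSpace X] [MeasurableSpace X] {μ : Measure X} {c : ℝ} {Q : ℕ}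

theorem RegularVolume.le_of_ball_subset_ball (hμ : RegularVolume μ c Q) {x z : X} {r s : ℝ}
    (hr : 0 < r) (h : Metric.ball x r ⊆ Metric.ball z s) : r ≤ s := by
  have hc := hμ.pos
  have hs : 0 < s := by
    by_contra hs
    rw [Metric.ball_eq_empty.2 (not_lt.1 hs)] at h
    exact h (Metric.mem_ball_self hr)
  have h1 := measureReal_mono h (hμ.measure_ball_lt_top z s).ne
  rw [hμ.measureReal_ball x hr, hμ.measureReal_ball z hs] at h1
  exact (pow_le_pow_iff_left₀ hr.le hs.le (Nat.one_le_iff_ne_zero.1 hμ.one_le)).1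
    (le_of_mul_le_mul_left h1 hc)

theorem OscLE.of_integral_sub_le (hμ : RegularVolume μ c Q) {f : X → ℝ} {z z' : X} {s s' M : ℝ}
    (a : ℝ) (hs' : 0 < s') (hs : 0 < s) (hM : 0 ≤ M) (hss : s ≤ 2 * s')
    (hsub : Metric.ball z' s' ⊆ Metric.ball z s)
    (hi : IntegrableOn f (Metric.ball z s) μ)
    (h : ∫ y in Metric.ball z s, |f y - a| ∂μ ≤ M * μ.real (Metric.ball z s)) :
    OscLE μ f z' s' (2 * 2 ^ Q * M) := by
  have hc := hμ.pos
  refine ⟨hi.mono_set hsub, ?_⟩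
  refine (setIntegral_abs_sub_setAverage_le (hi.mono_set hsub)
    (hμ.measureReal_ball_pos z' hs') a).trans ?_
  have h1 : ∫ y in Metric.ball z' s', |f y - a| ∂μ ≤ ∫ y in Metric.ball z s, |f y - a| ∂μ :=
    setIntegral_mono_set (integrableOn_abs_sub_const hi (hμ.measure_ball_lt_top z s).ne a)
      (Eventually.of_forall fun y => abs_nonneg _) hsub.eventuallyLE
  have h2 : μ.real (Metric.ball z s) ≤ 2 ^ Q * μ.real (Metric.ball z' s') := by
    rw [hμ.measureReal_ball z hs, hμ.measureReal_ball z' hs']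
    calc c * s ^ Q ≤ c * (2 * s') ^ Q := by gcongr
      _ = _ := by rw [mul_pow]; ring
  calc 2 * ∫ y in Metric.ball z' s', |f y - a| ∂μ
      ≤ 2 * (M * (2 ^ Q * μ.real (Metric.ball z' s'))) := by
        gcongr
        exact h1.trans (h.trans (by gcongr))
    _ = _ := by ring

theorem OscLE.mono {f : X → ℝ} {z : X} {s M M' : ℝ} (h : OscLE μ f z s M) (hM : M ≤ M') :
    OscLE μ f z s M' :=
  ⟨h.1, h.2.trans (by gcongr)⟩

variable [BorelSpace X]

/-- A function supported in `B(o, R)` whose mean oscillation is controlled on the balls centered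
there has bounded mean oscillation on the whole space. -/
theorem OscLE.of_local (hμ : RegularVolume μ c Q) {f : X → ℝ} {o : X} {R m n : ℝ} (hR : 0 < R)
    (hm : 0 ≤ m) (hn : 0 ≤ n)
    (hosc : ∀ x ∈ Metric.ball o R, ∀ r, 0 < r → Metric.ball x r ⊆ Metric.ball o (3 * R) →
      OscLE μ f x r m)
    (hf0 : ∀ᵐ y ∂μ, y ∉ Metric.ball o R → f y = 0) (hint : Integrable f μ)
    (hfR : ∫ y in Metric.ball o R, |f y| ∂μ ≤ n * μ.real (Metric.ball o R)) (z : X) (s : ℝ)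
    (hs : 0 < s) : OscLE μ f z s (2 * 2 ^ Q * (m + n)) := by
  have hc := hμ.pos
  have hq : (1 : ℝ) ≤ 2 ^ Q := one_le_pow₀ (by norm_num)
  rcases le_or_gt s R with hsR | hsR
  -- a small ball meeting `B(o, R)` lies in a ball of twice the radius centered in `B(o, R)`
  · by_cases hd : ∃ y, y ∈ Metric.ball z s ∧ y ∈ Metric.ball o R
    · obtain ⟨y, hyz, hyo⟩ := hd
      have hsub : Metric.ball z s ⊆ Metric.ball y (2 * s) := Metric.ball_subset_ball' (by
        rw [Metric.mem_ball, dist_comm] at hyz; linarith)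
      have h := hosc y hyo (2 * s) (by positivity) (Metric.ball_subset_ball' (by
        rw [Metric.mem_ball] at hyo; linarith))
      refine (OscLE.of_integral_sub_le hμ _ hs (by positivity) hm le_rfl hsub h.1 h.2).mono ?_
      gcongr; linarith
    · have h0 : ∀ᵐ y ∂μ.restrict (Metric.ball z s), f y = 0 := by
        refine (ae_restrict_iff' measurableSet_ball).2 ?_
        filter_upwards [hf0] with y hy hyz
        exact hy fun hyo => hd ⟨y, hyz, hyo⟩
      refine OscLE.mono (M := 2 * 2 ^ Q * 0) ?_ (by gcongr; linarith)
      refine OscLE.of_integral_sub_le hμ 0 hs hs le_rfl (by linarith) subset_rfl hint.integrableOn ?_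
      rw [zero_mul]
      refine le_of_eq (integral_eq_zero_of_ae ?_)
      filter_upwards [h0] with y hy
      simp [hy]
  -- a large ball has at least the measure of `B(o, R)`, and `f` is small in `L¹`
  · refine OscLE.mono (M := 2 * 2 ^ Q * n) ?_ (by gcongr; linarith)
    refine OscLE.of_integral_sub_le hμ 0 hs hs hn (by linarith) subset_rfl hint.integrableOn ?_
    simp only [sub_zero]
    calc ∫ y in Metric.ball z s, |f y| ∂μ ≤ ∫ y, |f y| ∂μ :=
          setIntegral_le_integral hint.abs (Eventually.of_forall fun y => abs_nonneg _)
      _ = ∫ y in Metric.ball o R, |f y| ∂μ := by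
          rw [setIntegral_eq_integral_of_ae_compl_eq_zero]
          filter_upwards [hf0] with y hy h
          rw [hy h, abs_zero]
      _ ≤ n * μ.real (Metric.ball o R) := hfR
      _ ≤ n * μ.real (Metric.ball z s) := by
          rw [hμ.measureReal_ball o hR, hμ.measureReal_ball z hs]
          gcongr

theorem memLp_two_of_ae_eq_zero {h : X → ℝ} {o : X} {R : ℝ}
    (hh : MemLp h 2 (μ.restrict (Metric.ball o R)))
    (h0 : ∀ᵐ y ∂μ, y ∉ Metric.ball o R → h y = 0) : MemLp h 2 μ := by
  refine ((memLp_indicator_iff_restrict (s := Metric.ball o R) measurableSet_ball).2 hh).ae_eq ?_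
  filter_upwards [h0] with y hy
  by_cases hyo : y ∈ Metric.ball o R
  · rw [indicator_of_mem hyo]
  · rw [indicator_of_notMem hyo, hy hyo]

/-- Conversion of a number of doublings into a logarithm; the factor `2` absorbs `log 2 < 1`. -/
theorem half_le_one_add_log {u v : ℝ} (n : ℕ) (hv : 0 < v) (h : v * 2 ^ n ≤ u) :
    (1 + n : ℝ) / 2 ≤ 1 + Real.log (u / v) := by
  have h1 : (2 : ℝ) ^ n ≤ u / v := by rw [le_div_iff₀ hv]; linarith
  have h2 := Real.log_le_log (by positivity) h1
  rw [Real.log_pow] at h2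
  have := Real.log_two_gt_d9
  have hn : (0 : ℝ) ≤ n := n.cast_nonneg
  nlinarith

variable [SecondCountableTopology X] [SFinite μ] {A B : ℝ} {k : X → X → ℝ}

/-- Boundedness of the commutator from functions of bounded mean oscillation supported in
`B(o, R)` to functions of bounded mean oscillation, for a multiplier `b` of bounded logarithmic mean
oscillation. -/
theorem SingularKernel.commutator_oscLE (hμ : RegularVolume μ c Q) (hk : SingularKernel μ Q A B k)
    {f b : X → ℝ} {o : X} {R m n Λ : ℝ} (hR : 0 < R) (hm : 0 ≤ m) (hn : 0 ≤ n) (hΛ : 0 ≤ Λ)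
    (hosc : ∀ x ∈ Metric.ball o R, ∀ r, 0 < r → Metric.ball x r ⊆ Metric.ball o (3 * R) →
      OscLE μ f x r m)
    (hf0 : ∀ᵐ y ∂μ, y ∉ Metric.ball o R → f y = 0)
    (hfR : ∫ y in Metric.ball o R, |f y| ∂μ ≤ n * μ.real (Metric.ball o R))
    (hb : ∀ x ∈ Metric.ball o (4 * R), ∀ r, 0 < r → Metric.ball x r ⊆ Metric.ball o (6 * R) →
      OscLE μ b x r (Λ / (1 + Real.log (6 * R / r)))) :
    (∀ᵐ x ∂μ, ((∀ ε, 0 < ε → IntegrableOn (fun y => k x y * f y) {y | ε < dist x y} μ) ∧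
        ∃ l, Tendsto (fun ε => ∫ y in {y | ε < dist x y}, k x y * f y ∂μ) (𝓝[>] 0) (𝓝 l)) ∧
      ((∀ ε, 0 < ε → IntegrableOn (fun y => k x y * (b y * f y)) {y | ε < dist x y} μ) ∧
        ∃ l, Tendsto (fun ε => ∫ y in {y | ε < dist x y}, k x y * (b y * f y) ∂μ) (𝓝[>] 0)
          (𝓝 l))) ∧
    IntegrableOn (fun x =>
      limUnder (𝓝[>] (0 : ℝ)) (fun ε => ∫ y in {y | ε < dist x y}, k x y * (b y * f y) ∂μ) -
        b x * limUnder (𝓝[>] (0 : ℝ)) (fun ε => ∫ y in {y | ε < dist x y}, k x y * f y ∂μ))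
      (Metric.ball o (3 * R)) μ ∧
    ∀ x ∈ Metric.ball o R, ∀ r, 0 < r → Metric.ball x r ⊆ Metric.ball o (3 * R) →
      OscLE μ (fun x =>
        limUnder (𝓝[>] (0 : ℝ)) (fun ε => ∫ y in {y | ε < dist x y}, k x y * (b y * f y) ∂μ) -
          b x * limUnder (𝓝[>] (0 : ℝ)) (fun ε => ∫ y in {y | ε < dist x y}, k x y * f y ∂μ)) x r
        (8 * 4 ^ Q * commutatorConst c Q A B * (Λ * (m + n))) := by
  have hc := hμ.pos
  have hC := hk.commutatorConst_nonneg hμ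
  have hoo : o ∈ Metric.ball o R := Metric.mem_ball_self hR
  have hfi : IntegrableOn f (Metric.ball o R) μ :=
    (hosc o hoo R hR (Metric.ball_subset_ball (by linarith))).1
  have hint : Integrable f μ := by
    refine (hfi.integrable_indicator measurableSet_ball).congr ?_
    filter_upwards [hf0] with y hy
    by_cases hyo : y ∈ Metric.ball o R
    · rw [indicator_of_mem hyo]
    · rw [indicator_of_notMem hyo, hy hyo]
  set M := 2 * 2 ^ Q * (m + n) with hMdef
  have hM : 0 ≤ M := by positivity
  have hfM : ∀ z s, 0 < s → OscLE μ f z s M :=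
    OscLE.of_local hμ hR hm hn hosc hf0 hint hfR
  -- the fourth powers of `f` and `b` are integrable near the support of `f`
  have f4 := lintegral_pow_four_le hμ hR hM (le_max_left M |⨍ y in Metric.ball o R, f y ∂μ|)
    (fun z r hr _ => hfM z r hr) (le_max_right _ _)
  have hb1 : ∀ z r, 0 < r → dist o z + r ≤ 5 / 4 * R → OscLE μ b z r (2 * Λ) := by
    intro z r hr hz
    have h := hb z (by rw [Metric.mem_ball, dist_comm]; linarith) r hr
      (Metric.ball_subset_ball' (by rw [dist_comm]; linarith))
    refine h.mono ?_
    have h1 := half_le_one_add_log (u := 6 * R) (v := r) 0 hr (by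
      rw [pow_zero, mul_one]; linarith [dist_nonneg (x := o) (y := z)])
    rw [div_le_iff₀ (by norm_num at h1; linarith)]
    norm_num at h1
    nlinarith
  have b4 := lintegral_pow_four_le hμ hR (by positivity)
    (le_max_left (2 * Λ) |⨍ y in Metric.ball o R, b y ∂μ|) hb1 (le_max_right _ _)
  have bm : AEStronglyMeasurable b (μ.restrict (Metric.ball o R)) :=
    (hb1 o R hR (by rw [dist_self]; linarith)).1.aestronglyMeasurable
  have hfin := (hμ.measure_ball_lt_top o R).ne
  have hfL : MemLp f 2 μ := memLp_two_of_ae_eq_zero (memLp_two_of_lintegral_sq hfin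
    hfi.aestronglyMeasurable (lintegral_sq_le_of_pow_four hfi.aestronglyMeasurable f4)) hf0
  have hbf0 : ∀ᵐ y ∂μ, y ∉ Metric.ball o R → b y * f y = 0 := by
    filter_upwards [hf0] with y hy h
    rw [hy h, mul_zero]
  have hgL : MemLp (fun y => b y * f y) 2 μ := memLp_two_of_ae_eq_zero (memLp_two_of_lintegral_sq
    hfin (bm.mul hfi.aestronglyMeasurable)
      (lintegral_mul_sq_le_of_pow_four bm hfi.aestronglyMeasurable b4 f4)) hbf0
  set F : Lp ℝ 2 μ := hfL.toLp f
  set g : Lp ℝ 2 μ := hgL.toLp _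
  have hF : F =ᵐ[μ] f := hfL.coeFn_toLp
  have hG : g =ᵐ[μ] fun y => b y * f y := hgL.coeFn_toLp
  -- the principal values agree with the `L²` theory almost everywhere
  have pv : ∀ (u : X → ℝ) (U : Lp ℝ 2 μ), U =ᵐ[μ] u →
      (∀ᵐ y ∂μ, y ∉ Metric.ball o R → u y = 0) → ∀ᵐ x ∂μ,
      (∀ ε, 0 < ε → IntegrableOn (fun y => k x y * u y) {y | ε < dist x y} μ) ∧
        Tendsto (fun ε => ∫ y in {y | ε < dist x y}, k x y * u y ∂μ) (𝓝[>] 0)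
          (𝓝 (hk.limitOp hμ U x)) := by
    intro u U hU hu
    have hU0 : ∀ᵐ y ∂μ, y ∉ Metric.ball o R → U y = 0 := by
      filter_upwards [hU, hu] with y a1 a2 hy
      rw [a1, a2 hy]
    filter_upwards [hk.ae_tendsto_truncated hμ U hU0] with x hx
    refine ⟨fun ε hε => hk.integrableOn_truncated
      ((integrable_of_vanish hμ U hU0).congr hU) x hε, ?_⟩
    refine hx.congr fun ε => integral_congr_ae (ae_restrict_of_ae ?_)
    filter_upwards [hU] with y hy
    rw [hy]
  have pf := pv f F hF hf0
  have pg := pv _ g hG hbf0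
  refine ⟨?_, ?_⟩
  · filter_upwards [pf, pg] with x h1 h2
    exact ⟨⟨h1.1, _, h1.2⟩, ⟨h2.1, _, h2.2⟩⟩
  set Tb : X → ℝ := fun x =>
    limUnder (𝓝[>] (0 : ℝ)) (fun ε => ∫ y in {y | ε < dist x y}, k x y * (b y * f y) ∂μ) -
      b x * limUnder (𝓝[>] (0 : ℝ)) (fun ε => ∫ y in {y | ε < dist x y}, k x y * f y ∂μ)
  have hTb : ∀ᵐ x ∂μ, hk.limitOp hμ g x - b x * hk.limitOp hμ F x = Tb x := by
    filter_upwards [pf, pg] with x h1 h2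
    simp only [Tb]
    rw [h1.2.limUnder_eq, h2.2.limUnder_eq]
  have hFM : ∀ z s, 0 < s → OscLE μ F z s M := by
    intro z s hs
    have h := hfM z s hs
    have hr : F =ᵐ[μ.restrict (Metric.ball z s)] f := ae_restrict_of_ae hF
    refine ⟨h.1.congr hr.symm, ?_⟩
    rw [setAverage_eq, integral_congr_ae hr, ← setAverage_eq]
    refine le_trans (le_of_eq ?_) h.2
    refine integral_congr_ae ?_
    filter_upwards [hr] with y hy
    rw [hy]
  have hgb : ∀ᵐ y ∂μ, g y = b y * F y := by
    filter_upwards [hF, hG] with y h1 h2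
    rw [h1, h2]
  -- `B(x₀, P)` contains the support of `f`, and `5 / 4 * P` keeps the balls that enter within the
  -- region where the oscillation of `b` is controlled
  have key : ∀ (x₀ : X) (P : ℝ), R ≤ P → dist o x₀ + R ≤ P → dist o x₀ + 5 / 4 * P < 4 * R →
      ∀ J : ℕ, IntegrableOn Tb (Metric.ball x₀ (P / 2 ^ J)) μ ∧
        ∃ a, ∫ z in Metric.ball x₀ (P / 2 ^ J), |Tb z - a| ∂μ ≤
          commutatorConst c Q A B * (2 * Λ * M) * μ.real (Metric.ball x₀ (P / 2 ^ J)) := by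
    intro x₀ P hRP h1 h2 J
    have hP : 0 < P := hR.trans_le hRP
    have hPJ : P / 2 ^ J * 2 ^ J = P := div_mul_cancel₀ _ (by positivity)
    have hd := dist_nonneg (x := o) (y := x₀)
    have hsubP : Metric.ball o R ⊆ Metric.ball x₀ P := Metric.ball_subset_ball' (by linarith)
    obtain ⟨hi, a, ha⟩ := exists_integral_commutator_sub_le hμ hk J (x₀ := x₀)
      (show 0 < P / 2 ^ J by positivity) (show 0 ≤ 2 * Λ by positivity) hM (f := F) (g := g) (β := b)
      hFM (by
        rw [hPJ]
        filter_upwards [hF, hf0] with y a1 a2 hy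
        rw [a1, a2 fun h => hy (hsubP h)]) (by
        rw [hPJ]
        calc ∫ y in Metric.ball x₀ P, |F y| ∂μ = ∫ y in Metric.ball x₀ P, |f y| ∂μ :=
              integral_congr_ae (ae_restrict_of_ae (by
                filter_upwards [hF] with y hy; rw [hy]))
          _ ≤ ∫ y, |f y| ∂μ :=
              setIntegral_le_integral hint.abs (Eventually.of_forall fun y => abs_nonneg _)
          _ = ∫ y in Metric.ball o R, |f y| ∂μ := by
              rw [setIntegral_eq_integral_of_ae_compl_eq_zero]
              filter_upwards [hf0] with y hy h
              rw [hy h, abs_zero]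
          _ ≤ n * μ.real (Metric.ball o R) := hfR
          _ ≤ M * μ.real (Metric.ball x₀ P) := by
              have e1 : n ≤ M := by
                have : (1 : ℝ) ≤ 2 ^ Q := one_le_pow₀ (by norm_num)
                rw [hMdef]
                nlinarith [mul_nonneg (sub_nonneg.2 this) (add_nonneg hm hn)]
              have e2 := measureReal_mono hsubP (hμ.measure_ball_lt_top x₀ P).ne
              gcongr) (by
        intro j hj z s hs hzs
        have hjJ : (2 : ℝ) ^ J = 2 ^ (J - j) * 2 ^ j := by rw [← pow_add, Nat.sub_add_cancel hj]
        have e1 : P / 2 ^ J * 2 ^ j = P / 2 ^ (J - j) := by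
          rw [hjJ]; field_simp
        rw [e1] at hzs
        have hpow : (1 : ℝ) ≤ 2 ^ (J - j) := one_le_pow₀ (by norm_num)
        have e2 : P / 2 ^ (J - j) ≤ P := div_le_self hP.le hpow
        have tri := dist_triangle o x₀ z
        have hz := hb z (by rw [Metric.mem_ball, dist_comm]; linarith) s hs
          (Metric.ball_subset_ball' (by rw [dist_comm]; linarith))
        refine hz.mono ?_
        have e3 := half_le_one_add_log (u := 6 * R) (v := s) (J - j) hs (by
          have : s ≤ 5 / 4 * (P / 2 ^ (J - j)) := by linarith [dist_nonneg (x := x₀) (y := z)]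
          calc s * 2 ^ (J - j) ≤ 5 / 4 * (P / 2 ^ (J - j)) * 2 ^ (J - j) := by gcongr
            _ = 5 / 4 * P := by field_simp
            _ ≤ 6 * R := by linarith)
        rw [Nat.cast_sub hj] at e3
        have e4 : (0 : ℝ) < 1 + J - j := by
          have : (j : ℝ) ≤ J := by exact_mod_cast hj
          linarith
        rw [div_le_div_iff₀ (by linarith) e4]
        nlinarith) hgb
    refine ⟨hi.congr (ae_restrict_of_ae hTb), a, le_trans (le_of_eq ?_) ha⟩
    refine integral_congr_ae (ae_restrict_of_ae ?_)
    filter_upwards [hTb] with z hz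
    rw [hz]
  -- radii above `2 R` are compared with `B(o, 3 R)`, smaller ones with `B(x, 2 R / 2ᴶ)`
  have key3 := key o (3 * R) (by linarith) (by rw [dist_self]; linarith)
    (by rw [dist_self]; linarith) 0
  rw [pow_zero, div_one] at key3
  refine ⟨key3.1, fun x hx r hr hsub => ?_⟩
  have hconst : 2 * 2 ^ Q * (commutatorConst c Q A B * (2 * Λ * M)) =
      8 * 4 ^ Q * commutatorConst c Q A B * (Λ * (m + n)) := by
    rw [hMdef, show (4 : ℝ) = 2 * 2 by norm_num, mul_pow]; ring
  rw [← hconst]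
  rcases le_or_gt r (2 * R) with hr2 | hr2
  · obtain ⟨J, hJ1, hJ2⟩ := exists_nat_pow_near (x := 2 * R / r) (y := 2)
      (by rw [le_div_iff₀ hr]; linarith) (by norm_num)
    rw [le_div_iff₀ hr] at hJ1
    rw [div_lt_iff₀ hr, pow_succ] at hJ2
    have hp : (0 : ℝ) < 2 ^ J := by positivity
    rw [Metric.mem_ball, dist_comm] at hx
    obtain ⟨hi, a, ha⟩ := key x (2 * R) (by linarith) (by linarith) (by linarith) J
    refine OscLE.of_integral_sub_le hμ a hr (by positivity) (by positivity) ?_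
      (Metric.ball_subset_ball ?_) hi ha
    · rw [div_le_iff₀ hp]; linarith
    · rw [le_div_iff₀ hp]; linarith
  · obtain ⟨hi, a, ha⟩ := key3
    exact OscLE.of_integral_sub_le hμ a hr (by positivity) (by positivity) (by linarith) hsub hi ha

end Transfer

/-! ### Horizontal curves -/

/-- Mean value inequality for absolutely continuous curves, by integrating the derivative of the
inner product with the increment. -/
theorem norm_sub_le_of_absolutelyContinuous {F : Type*} [NormedAddCommGroup F]
    [InnerProductSpace ℝ F] {φ : ℝ → F} {a b L : ℝ} (hab : a ≤ b)
    (hφ : AbsolutelyContinuousOnInterval φ a b)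
    (h : ∀ᵐ t, t ∈ Ioo a b → ∃ w, HasDerivAt φ w t ∧ ‖w‖ ≤ L) : ‖φ b - φ a‖ ≤ L * (b - a) := by
  set v := φ b - φ a with hv
  have hg : AbsolutelyContinuousOnInterval (fun t => inner ℝ v (φ t)) a b := by
    rw [absolutelyContinuousOnInterval_iff] at hφ ⊢
    intro ε hε
    obtain ⟨δ, hδ, H⟩ := hφ (ε / (‖v‖ + 1)) (by positivity)
    refine ⟨δ, hδ, fun E hE hEδ => ?_⟩
    have h1 := H E hE hEδ
    rw [lt_div_iff₀ (by positivity)] at h1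
    refine lt_of_le_of_lt ?_ h1
    rw [Finset.sum_mul]
    refine Finset.sum_le_sum fun i _ => ?_
    rw [dist_eq_norm, dist_eq_norm, ← inner_sub_right]
    refine (norm_inner_le_norm v _).trans ?_
    rw [mul_comm]
    gcongr
    linarith
  have h1 := hg.integral_deriv_eq_sub
  have h2 : inner ℝ v (φ b) - inner ℝ v (φ a) = ‖v‖ ^ 2 := by
    rw [← inner_sub_right, ← hv, real_inner_self_eq_norm_sq]
  rw [h2] at h1
  have h3 : ‖∫ t in a..b, deriv (fun t => inner ℝ v (φ t)) t‖ ≤ ‖v‖ * L * |b - a| := by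
    refine intervalIntegral.norm_integral_le_of_norm_le_const_ae ?_
    have hb : ∀ᵐ t : ℝ, t ≠ b := by simp [ae_iff, measure_singleton]
    filter_upwards [h, hb] with t ht htb hI
    rw [uIoc_of_le hab] at hI
    obtain ⟨w, hw, hwL⟩ := ht ⟨hI.1, lt_of_le_of_ne hI.2 htb⟩
    have h4 : HasDerivAt (fun t => inner ℝ v (φ t)) (inner ℝ v w) t := by
      simpa using (hasDerivAt_const t v).inner ℝ hw
    rw [h4.deriv]
    exact (norm_inner_le_norm v w).trans (by gcongr)
  rw [h1, abs_of_nonneg (sub_nonneg.2 hab), Real.norm_of_nonneg (by positivity)] at h3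
  rcases eq_or_lt_of_le (norm_nonneg v) with h0 | h0
  · rw [← h0]
    have : 0 ≤ ‖v‖ ^ 2 := by positivity
    rcases eq_or_lt_of_le hab with rfl | hlt
    · simp
    · have : ∃ t : ℝ, ∃ w, HasDerivAt φ w t ∧ ‖w‖ ≤ L := by
        have h5 : ∃ᶠ t in ae (volume : Measure ℝ), t ∈ Ioo a b := by
          rw [frequently_ae_iff]
          simp only [ofPred_mem_eq, Real.volume_Ioo, ne_eq, ENNReal.ofReal_eq_zero, not_le]
          linarith
        obtain ⟨t, h6, h7⟩ := (h5.and_eventually h).exists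
        exact ⟨t, h7 h6⟩
      obtain ⟨t, w, -, hw⟩ := this
      exact mul_nonneg ((norm_nonneg w).trans hw) (sub_nonneg.2 hab)
  · nlinarith

namespace HomogeneousGroup

variable {N : ℕ} (G : HomogeneousGroup N)

/-- The left invariant vector field with value `w` at the origin. -/
noncomputable def leftField (w x : EuclideanSpace ℝ (Fin N)) : EuclideanSpace ℝ (Fin N) :=
  fderiv ℝ (G.mul x) 0 w

theorem contDiff_mul_left (x : EuclideanSpace ℝ (Fin N)) : ContDiff ℝ ∞ (G.mul x) :=
  G.contDiff_mul.comp (contDiff_const.prodMk contDiff_id)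

theorem differentiable_mul_left (x : EuclideanSpace ℝ (Fin N)) : Differentiable ℝ (G.mul x) :=
  (G.contDiff_mul_left x).differentiable (by simp)

theorem continuous_mul : Continuous
    (fun z : EuclideanSpace ℝ (Fin N) × EuclideanSpace ℝ (Fin N) => G.mul z.1 z.2) :=
  G.contDiff_mul.continuous

theorem leftField_eq (w x : EuclideanSpace ℝ (Fin N)) : G.leftField w x =
    fderiv ℝ (fun z : EuclideanSpace ℝ (Fin N) × EuclideanSpace ℝ (Fin N) => G.mul z.1 z.2)
      (x, 0) (0, w) := by
  have h1 := (G.contDiff_mul.differentiable (by simp) (x, (0 : EuclideanSpace ℝ (Fin N)))).hasFDerivAt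
  have h2 : HasFDerivAt (fun y : EuclideanSpace ℝ (Fin N) => (x, y))
      (ContinuousLinearMap.inr ℝ (EuclideanSpace ℝ (Fin N)) (EuclideanSpace ℝ (Fin N))) 0 :=
    hasFDerivAt_prodMk_right x 0
  have h3 := h1.comp (0 : EuclideanSpace ℝ (Fin N)) h2
  rw [leftField, show G.mul x = (fun z : EuclideanSpace ℝ (Fin N) × EuclideanSpace ℝ (Fin N) =>
    G.mul z.1 z.2) ∘ fun y => (x, y) from rfl, h3.fderiv]
  simp

theorem contDiff_leftField (w : EuclideanSpace ℝ (Fin N)) : ContDiff ℝ 2 (G.leftField w) := by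
  rw [show G.leftField w = fun x => _ from funext (G.leftField_eq w)]
  have h : ContDiff ℝ 2 (fderiv ℝ
      (fun z : EuclideanSpace ℝ (Fin N) × EuclideanSpace ℝ (Fin N) => G.mul z.1 z.2)) :=
    G.contDiff_mul.fderiv_right (m := 2) (n := ∞) (by norm_cast)
  exact (h.comp (contDiff_id.prodMk contDiff_const)).clm_apply contDiff_const

theorem leftField_zero (w : EuclideanSpace ℝ (Fin N)) : G.leftField w 0 = w := by
  rw [leftField, show G.mul 0 = id from funext G.zero_mul, fderiv_id]; rfl

/-- Left translations preserve the left invariant fields. -/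
theorem fderiv_mul_left_leftField (w x y : EuclideanSpace ℝ (Fin N)) :
    fderiv ℝ (G.mul x) y (G.leftField w y) = G.leftField w (G.mul x y) := by
  have h : G.mul (G.mul x y) = G.mul x ∘ G.mul y := funext fun z => G.mul_assoc x y z
  rw [leftField, leftField, h, fderiv_comp (0 : EuclideanSpace ℝ (Fin N))
    (G.differentiable_mul_left x _) (G.differentiable_mul_left y _), G.mul_zero]
  rfl

/-- The vector `w` is a combination, with coefficients bounded by `δ`, of the values at `x` of the
fields of homogeneity `1`. -/
def IsHorizontal (δ : ℝ) (x w : EuclideanSpace ℝ (Fin N)) : Prop :=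
  ∃ a : Fin N → ℝ, (∀ i, |a i| ≤ δ) ∧ w = ∑ i with G.weight i = 1, a i • G.field i x

theorem exists_norm_le_of_isHorizontal {S : Set (EuclideanSpace ℝ (Fin N))}
    (hS : Bornology.IsBounded S) :
    ∃ C, 0 ≤ C ∧ ∀ δ, ∀ x ∈ S, ∀ w, G.IsHorizontal δ x w → ‖w‖ ≤ C * δ := by
  have hf : ∀ i, ∃ C, ∀ x ∈ S, ‖G.field i x‖ ≤ C := fun i => by
    have hc : Continuous (G.field i) := (G.contDiff_leftField (EuclideanSpace.single i 1)).continuous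
    obtain ⟨C, hC⟩ := (hS.isCompact_closure.image hc).isBounded.exists_norm_le
    exact ⟨C, fun x hx => hC _ (mem_image_of_mem _ (subset_closure hx))⟩
  choose C hC using hf
  refine ⟨∑ i, |C i|, Finset.sum_nonneg fun i _ => abs_nonneg _, ?_⟩
  rintro δ x hx w ⟨a, ha, rfl⟩
  calc ‖∑ i with G.weight i = 1, a i • G.field i x‖
      ≤ ∑ i with G.weight i = 1, ‖a i • G.field i x‖ := norm_sum_le _ _
    _ ≤ ∑ i, ‖a i • G.field i x‖ :=
        Finset.sum_le_sum_of_subset_of_nonneg (Finset.filter_subset _ _) fun _ _ _ => norm_nonneg _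
    _ ≤ ∑ i, |C i| * δ := by
        refine Finset.sum_le_sum fun i _ => ?_
        rw [norm_smul, Real.norm_eq_abs, mul_comm]
        exact mul_le_mul ((hC i x hx).trans (le_abs_self _)) (ha i) (abs_nonneg _) (abs_nonneg _)
    _ = _ := (Finset.sum_mul _ _ _).symm

/-- The point `y` can be reached from `x` in time `T` along a Lipschitz horizontal curve with
controls bounded by `1`. -/
def Reach (T : ℝ) (x y : EuclideanSpace ℝ (Fin N)) : Prop :=
  0 ≤ T ∧ ∃ (φ : ℝ → EuclideanSpace ℝ (Fin N)) (K : ℝ≥0), LipschitzOnWith K φ (Icc 0 T) ∧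
    φ 0 = x ∧ φ T = y ∧
      ∀ᵐ t : ℝ, t ∈ Ioo 0 T → ∃ w, HasDerivAt φ w t ∧ G.IsHorizontal 1 (φ t) w

variable {G}

theorem Reach.refl {T : ℝ} (hT : 0 ≤ T) (x : EuclideanSpace ℝ (Fin N)) : G.Reach T x x :=
  ⟨hT, fun _ => x, 0, LipschitzOnWith.of_dist_le_mul fun _ _ _ _ => by simp, rfl, rfl,
    Eventually.of_forall fun t _ => ⟨0, hasDerivAt_const t x, 0, by simp, by simp⟩⟩

theorem ae_comp_affine {p : ℝ → Prop} (h : ∀ᵐ t, p t) {a : ℝ} (ha : a ≠ 0) (b : ℝ) :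
    ∀ᵐ t, p (a * t + b) := by
  have h1 : ∀ᵐ t, p (t + b) := (measurePreserving_add_right volume b).quasiMeasurePreserving.ae h
  have h2 : Measure.QuasiMeasurePreserving (fun t : ℝ => a * t) volume volume := by
    refine ⟨measurable_const_mul a, ?_⟩
    rw [Real.map_volume_mul_left ha]
    exact Measure.smul_absolutelyContinuous
  exact h2.ae h1

theorem IsHorizontal.neg {δ : ℝ} {x w : EuclideanSpace ℝ (Fin N)} (h : G.IsHorizontal δ x w) :
    G.IsHorizontal δ x (-w) := by
  obtain ⟨a, ha, rfl⟩ := h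
  exact ⟨fun i => - a i, fun i => by rw [abs_neg]; exact ha i, by simp⟩

theorem IsHorizontal.smul {δ : ℝ} {x w : EuclideanSpace ℝ (Fin N)} (h : G.IsHorizontal δ x w)
    (s : ℝ) : G.IsHorizontal (|s| * δ) x (s • w) := by
  obtain ⟨a, ha, rfl⟩ := h
  refine ⟨fun i => s * a i, fun i => ?_, ?_⟩
  · rw [abs_mul]; exact mul_le_mul_of_nonneg_left (ha i) (abs_nonneg _)
  · rw [Finset.smul_sum]; simp only [mul_smul]

theorem Reach.symm {T : ℝ} {x y : EuclideanSpace ℝ (Fin N)} (h : G.Reach T x y) :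
    G.Reach T y x := by
  obtain ⟨hT, φ, K, hK, h0, h1, hd⟩ := h
  refine ⟨hT, fun t => φ (T - t), K, ?_, by simpa using h1, by simpa using h0, ?_⟩
  · refine LipschitzOnWith.of_dist_le_mul fun s hs t ht => ?_
    have := hK.dist_le_mul (T - s) ⟨by linarith [hs.2], by linarith [hs.1]⟩ (T - t)
      ⟨by linarith [ht.2], by linarith [ht.1]⟩
    rwa [dist_sub_left] at this
  · filter_upwards [ae_comp_affine hd (show (-1 : ℝ) ≠ 0 by norm_num) T] with t ht hI
    rw [show -1 * t + T = T - t by ring] at ht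
    obtain ⟨w, hw, hh⟩ := ht ⟨by linarith [hI.2], by linarith [hI.1]⟩
    exact ⟨-w, hw.comp_const_sub T t, hh.neg⟩

theorem Reach.trans {T T' : ℝ} {x y z : EuclideanSpace ℝ (Fin N)} (h : G.Reach T x y)
    (h' : G.Reach T' y z) : G.Reach (T + T') x z := by
  obtain ⟨hT, φ, K, hK, h0, h1, hd⟩ := h
  obtain ⟨hT', φ', K', hK', h0', h1', hd'⟩ := h'
  set ψ : ℝ → EuclideanSpace ℝ (Fin N) := fun t => if t ≤ T then φ t else φ' (t - T) with hψ
  have e1 : ∀ t ≤ T, ψ t = φ t := fun t ht => if_pos ht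
  have e2 : ∀ t, T ≤ t → ψ t = φ' (t - T) := fun t ht => by
    rcases eq_or_lt_of_le ht with rfl | ht
    · rw [e1 _ le_rfl, sub_self, h1, h0']
    · exact if_neg (not_le.2 ht)
  have d1 : ∀ s t, 0 ≤ s → s ≤ t → t ≤ T → dist (ψ s) (ψ t) ≤ (max K K') * (t - s) := by
    intro s t hs hst ht
    rw [e1 s (hst.trans ht), e1 t ht]
    have := hK.dist_le_mul s ⟨hs, hst.trans ht⟩ t ⟨hs.trans hst, ht⟩
    rw [Real.dist_eq, abs_sub_comm, abs_of_nonneg (sub_nonneg.2 hst)] at this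
    refine this.trans (mul_le_mul_of_nonneg_right ?_ (sub_nonneg.2 hst))
    exact_mod_cast le_max_left K K'
  have d2 : ∀ s t, T ≤ s → s ≤ t → t ≤ T + T' → dist (ψ s) (ψ t) ≤ (max K K') * (t - s) := by
    intro s t hs hst ht
    rw [e2 s hs, e2 t (hs.trans hst)]
    have := hK'.dist_le_mul (s - T) ⟨by linarith, by linarith⟩ (t - T) ⟨by linarith, by linarith⟩
    rw [dist_sub_right, Real.dist_eq, abs_sub_comm, abs_of_nonneg (sub_nonneg.2 hst)] at this
    refine this.trans (mul_le_mul_of_nonneg_right ?_ (sub_nonneg.2 hst))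
    exact_mod_cast le_max_right K K'
  have d3 : ∀ s t, 0 ≤ s → s ≤ t → t ≤ T + T' → dist (ψ s) (ψ t) ≤ (max K K') * (t - s) := by
    intro s t hs hst ht
    rcases le_total t T with h | h
    · exact d1 s t hs hst h
    rcases le_total T s with h' | h'
    · exact d2 s t h' hst ht
    have a1 := d1 s T hs h' le_rfl
    have a2 := d2 T t le_rfl h ht
    have a3 := dist_triangle (ψ s) (ψ T) (ψ t)
    linarith
  refine ⟨add_nonneg hT hT', ψ, max K K', ?_, ?_, ?_, ?_⟩
  · refine LipschitzOnWith.of_dist_le_mul fun s hs t ht => ?_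
    rw [NNReal.coe_max]
    rcases le_total s t with h | h
    · rw [Real.dist_eq, abs_sub_comm, abs_of_nonneg (sub_nonneg.2 h)]
      exact d3 s t hs.1 h ht.2
    · rw [dist_comm, Real.dist_eq, abs_of_nonneg (sub_nonneg.2 h)]
      exact d3 t s ht.1 h hs.2
  · rw [e1 0 hT, h0]
  · rw [e2 _ (by linarith), add_sub_cancel_left, h1']
  · have hne : ∀ᵐ t : ℝ, t ≠ T := by simp [ae_iff, measure_singleton]
    filter_upwards [hd, ae_comp_affine hd' one_ne_zero (-T), hne] with t a1 a2 a3 hI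
    rcases lt_or_gt_of_ne a3 with ht | ht
    · obtain ⟨w, hw, hh⟩ := a1 ⟨hI.1, ht⟩
      have hev : ψ =ᶠ[𝓝 t] φ := by
        filter_upwards [Iio_mem_nhds ht] with s hs using e1 s (le_of_lt hs)
      exact ⟨w, hw.congr_of_eventuallyEq hev, by rw [e1 t ht.le]; exact hh⟩
    · rw [one_mul, ← sub_eq_add_neg] at a2
      obtain ⟨w, hw, hh⟩ := a2 ⟨by linarith, by linarith [hI.2]⟩
      have hev : ψ =ᶠ[𝓝 t] fun s => φ' (s - T) := by
        filter_upwards [Ioi_mem_nhds ht] with s hs using e2 s (le_of_lt hs)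
      exact ⟨w, (hw.comp_sub_const t T).congr_of_eventuallyEq hev, by rw [e2 t ht.le]; exact hh⟩

theorem Reach.mono {T T' : ℝ} {x y : EuclideanSpace ℝ (Fin N)} (h : G.Reach T x y)
    (hT : T ≤ T') : G.Reach T' x y := by
  have := h.trans (Reach.refl (sub_nonneg.2 hT) y)
  rwa [add_sub_cancel] at this

/-- A smooth map that sends horizontal vectors to horizontal vectors, enlarging the
controls at most `s` times, sends horizontal curves to horizontal curves. -/
theorem Reach.map {T s : ℝ} {x y : EuclideanSpace ℝ (Fin N)} (h : G.Reach T x y) (hs : 0 < s)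
    {f : EuclideanSpace ℝ (Fin N) → EuclideanSpace ℝ (Fin N)} (hf : ContDiff ℝ 1 f)
    (hh : ∀ z w, G.IsHorizontal 1 z w → G.IsHorizontal s (f z) (fderiv ℝ f z w)) :
    G.Reach (s * T) (f x) (f y) := by
  obtain ⟨hT, φ, K, hK, h0, h1, hd⟩ := h
  obtain ⟨R, hR⟩ := (isCompact_Icc.image_of_continuousOn hK.continuousOn).isBounded.subset_closedBall 0
  obtain ⟨L, hL⟩ := hf.contDiffOn.exists_lipschitzOnWith one_ne_zero (convex_closedBall 0 R)
    (isCompact_closedBall (0 : EuclideanSpace ℝ (Fin N)) R)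
  have hmaps : MapsTo φ (Icc 0 T) (Metric.closedBall 0 R) := fun t ht => hR (mem_image_of_mem _ ht)
  have hsT : ∀ t ∈ Icc 0 (s * T), s⁻¹ * t ∈ Icc 0 T := fun t ht =>
    ⟨mul_nonneg (inv_pos.2 hs).le ht.1, by rw [inv_mul_le_iff₀ hs]; exact ht.2⟩
  refine ⟨by positivity, fun t => f (φ (s⁻¹ * t)), L * (K * NNReal.mk s⁻¹ (inv_pos.2 hs).le), ?_, ?_, ?_, ?_⟩
  · refine LipschitzOnWith.of_dist_le_mul fun t ht t' ht' => ?_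
    have a1 := hL.dist_le_mul _ (hmaps (hsT t ht)) _ (hmaps (hsT t' ht'))
    have a2 := hK.dist_le_mul _ (hsT t ht) _ (hsT t' ht')
    have a3 : dist (s⁻¹ * t) (s⁻¹ * t') = s⁻¹ * dist t t' := by
      rw [Real.dist_eq, ← mul_sub, abs_mul, abs_of_pos (inv_pos.2 hs), Real.dist_eq]
    rw [a3] at a2
    push_cast
    calc _ ≤ L * dist (φ (s⁻¹ * t)) (φ (s⁻¹ * t')) := a1
      _ ≤ L * (K * (s⁻¹ * dist t t')) := by gcongr
      _ = _ := by ring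
  · simp only [MulZeroClass.mul_zero, h0]
  · simp only [inv_mul_cancel_left₀ hs.ne', h1]
  · filter_upwards [ae_comp_affine hd (inv_pos.2 hs).ne' 0] with t ht hI
    rw [add_zero] at ht
    obtain ⟨w, hw, hhw⟩ := ht ⟨mul_pos (inv_pos.2 hs) hI.1, by
      rw [inv_mul_lt_iff₀ hs]; exact hI.2⟩
    have b1 : HasDerivAt (fun t => s⁻¹ * t) s⁻¹ t := by
      simpa using (hasDerivAt_id t).const_mul s⁻¹
    have b2 := hw.scomp t b1
    have b3 := ((hf.differentiable one_ne_zero) (φ (s⁻¹ * t))).hasFDerivAt.comp_hasDerivAt t b2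
    refine ⟨_, b3, ?_⟩
    rw [map_smul]
    have b4 := (hh _ _ hhw).smul s⁻¹
    rwa [abs_of_pos (inv_pos.2 hs), inv_mul_cancel₀ hs.ne'] at b4

theorem Reach.mul_left {T : ℝ} {x y : EuclideanSpace ℝ (Fin N)} (h : G.Reach T x y)
    (z : EuclideanSpace ℝ (Fin N)) : G.Reach T (G.mul z x) (G.mul z y) := by
  have := h.map one_pos ((G.contDiff_mul_left z).of_le (by exact_mod_cast le_top)) (by
    rintro u w ⟨a, ha, rfl⟩
    refine ⟨a, ha, ?_⟩
    rw [map_sum]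
    refine Finset.sum_congr rfl fun i _ => ?_
    rw [map_smul]
    congr 1
    exact G.fderiv_mul_left_leftField _ z u)
  rwa [_root_.one_mul] at this

/-- Points reached in a short time are close in the Euclidean norm. -/
theorem exists_norm_le_of_reach : ∃ C, 0 < C ∧ ∀ T y, C * T < 1 → G.Reach T 0 y → ‖y‖ ≤ C * T := by
  obtain ⟨C, hC0, hC⟩ := G.exists_norm_le_of_isHorizontal
    (S := Metric.closedBall 0 1) Metric.isBounded_closedBall
  refine ⟨C + 1, by linarith, ?_⟩
  rintro T y hCT ⟨hT, φ, K, hK, h0, rfl, hd⟩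
  have key : ∀ τ ∈ Icc 0 T, (∀ t, 0 ≤ t → t < τ → ‖φ t‖ ≤ 1) → ‖φ τ‖ ≤ (C + 1) * τ := by
    intro τ hτ hle
    have h1 := norm_sub_le_of_absolutelyContinuous (φ := φ) (L := C * 1) hτ.1
      (LipschitzOnWith.absolutelyContinuousOnInterval (K := K) (by
        rw [uIcc_of_le hτ.1]; exact hK.mono (Icc_subset_Icc le_rfl hτ.2))) (by
        filter_upwards [hd] with t ht hI
        obtain ⟨w, hw, hh⟩ := ht ⟨hI.1, hI.2.trans_le hτ.2⟩
        exact ⟨w, hw, hC 1 _ (by simpa using hle t hI.1.le hI.2) w hh⟩)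
    rw [h0, sub_zero, sub_zero, mul_one] at h1
    linarith [hτ.1]
  refine key T ⟨hT, le_rfl⟩ fun t ht0 htT => ?_
  by_contra hcon
  have hclosed : IsCompact {t | t ∈ Icc 0 T ∧ 1 ≤ ‖φ t‖} :=
    isCompact_Icc.of_isClosed_subset
      (hK.continuousOn.norm.preimage_isClosed_of_isClosed isClosed_Icc isClosed_Ici)
      (fun t ht => ht.1)
  obtain ⟨τ, hτ, hmin⟩ := hclosed.exists_isLeast ⟨t, ⟨ht0, htT.le⟩, (not_le.1 hcon).le⟩
  have h2 := key τ hτ.1 fun u hu huτ => by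
    by_contra hc
    exact absurd (hmin ⟨⟨hu, huτ.le.trans hτ.1.2⟩, (not_le.1 hc).le⟩) (not_le.2 huτ)
  have h3 : (C + 1) * τ ≤ (C + 1) * T := mul_le_mul_of_nonneg_left hτ.1.2 (by linarith)
  linarith [hτ.2]

end HomogeneousGroup

/-! ### Dilations and the control distance -/

namespace HomogeneousGroup

variable {N : ℕ} (G : HomogeneousGroup N)

/-- The dilation `D(t)`, as a continuous linear map. -/
noncomputable def dilation (t : ℝ) : EuclideanSpace ℝ (Fin N) →L[ℝ] EuclideanSpace ℝ (Fin N) :=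
  LinearMap.toContinuousLinearMap
    { toFun := fun x => WithLp.toLp 2 (fun i => t ^ G.weight i * x i)
      map_add' := fun x y => by ext i; simp [mul_add]
      map_smul' := fun a x => by ext i; simp; ring }

theorem dilation_apply (t : ℝ) (x : EuclideanSpace ℝ (Fin N)) (i : Fin N) :
    G.dilation t x i = t ^ G.weight i * x i := rfl

theorem dilation_map_mul {t : ℝ} (ht : 0 < t) (x y : EuclideanSpace ℝ (Fin N)) :
    G.dilation t (G.mul x y) = G.mul (G.dilation t x) (G.dilation t y) :=
  G.dilation_mul t ht x y

theorem dilation_dilation (s t : ℝ) (x : EuclideanSpace ℝ (Fin N)) :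
    G.dilation s (G.dilation t x) = G.dilation (s * t) x := by
  ext i; simp only [dilation_apply, mul_pow]; ring

theorem dilation_one (x : EuclideanSpace ℝ (Fin N)) : G.dilation 1 x = x := by
  ext i; simp [dilation_apply]

theorem dilation_single (t : ℝ) (i : Fin N) :
    G.dilation t (EuclideanSpace.single i 1) = t ^ G.weight i • EuclideanSpace.single i (1 : ℝ) := by
  ext j
  simp only [dilation_apply, PiLp.single_apply, PiLp.smul_apply, smul_eq_mul]
  split_ifs with h <;> simp [h]

/-- As the weights are positive, `D(t) x` tends to the origin with `t`. -/
theorem tendsto_dilation (x : EuclideanSpace ℝ (Fin N)) :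
    Tendsto (fun t => G.dilation t x) (𝓝 0) (𝓝 0) := by
  have h : Continuous fun t => G.dilation t x := by
    refine (PiLp.continuous_toLp 2 _).comp (continuous_pi fun i => ?_)
    exact (continuous_pow _).mul continuous_const
  have h0 : G.dilation 0 x = 0 := by
    ext i
    rw [dilation_apply, zero_pow (Nat.one_le_iff_ne_zero.1 (G.one_le_weight i)), MulZeroClass.zero_mul]
    rfl
  simpa only [h0] using h.tendsto 0

theorem dilation_field {t : ℝ} (ht : 0 < t) (i : Fin N) (x : EuclideanSpace ℝ (Fin N)) :
    G.dilation t (G.field i x) = t ^ G.weight i • G.field i (G.dilation t x) := by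
  have h : G.dilation t ∘ G.mul x = G.mul (G.dilation t x) ∘ G.dilation t :=
    funext fun y => G.dilation_map_mul ht x y
  have h1 := congrArg (fun f => fderiv ℝ f 0 (EuclideanSpace.single i 1)) h
  rw [fderiv_comp (0 : EuclideanSpace ℝ (Fin N)) (G.dilation t).differentiableAt
    (G.differentiable_mul_left x _), fderiv_comp (0 : EuclideanSpace ℝ (Fin N))
    (G.differentiable_mul_left _ _) (G.dilation t).differentiableAt,
    ContinuousLinearMap.fderiv, ContinuousLinearMap.fderiv, ContinuousLinearMap.comp_apply,
    ContinuousLinearMap.comp_apply, map_zero, dilation_single, map_smul] at h1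
  exact h1

variable {G}

theorem Reach.dilation {T t : ℝ} {x y : EuclideanSpace ℝ (Fin N)} (h : G.Reach T x y)
    (ht : 0 < t) : G.Reach (t * T) (G.dilation t x) (G.dilation t y) := by
  refine h.map ht (G.dilation t).contDiff ?_
  rintro u w ⟨a, ha, rfl⟩
  refine ⟨fun i => t * a i, fun i => ?_, ?_⟩
  · rw [abs_mul, abs_of_pos ht]
    exact mul_le_of_le_one_right ht.le (ha i)
  · rw [ContinuousLinearMap.fderiv, map_sum]
    refine Finset.sum_congr rfl fun i hi => ?_
    rw [map_smul, G.dilation_field ht, (Finset.mem_filter.1 hi).2, pow_one, smul_smul, mul_comm]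

end HomogeneousGroup

namespace CarnotGroup

variable {N : ℕ} {G : CarnotGroup N}

theorem IsAdmissible.reach {δ : ℝ} (hδ : 0 < δ) {x y : EuclideanSpace ℝ (Fin N)}
    {φ : ℝ → EuclideanSpace ℝ (Fin N)} (h : G.IsAdmissible δ x y φ) : G.Reach δ x y := by
  obtain ⟨hac, h0, h1, a, ha, hd⟩ := h
  have hd' : ∀ᵐ t : ℝ, t ∈ Ioo (0 : ℝ) 1 → ∃ w, HasDerivAt φ w t ∧ G.IsHorizontal δ (φ t) w := by
    filter_upwards [(ae_restrict_iff' measurableSet_Ioo).1 hd] with t ht hI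
    exact ⟨_, ht hI, fun i => a i t, fun i => ha i t hI, rfl⟩
  have hbdd : Bornology.IsBounded (φ '' Icc 0 1) := by
    have := hac.continuousOn
    rw [uIcc_of_le zero_le_one] at this
    exact (isCompact_Icc.image_of_continuousOn this).isBounded
  obtain ⟨C, hC0, hC⟩ := G.exists_norm_le_of_isHorizontal hbdd
  have hL : ∀ s t, 0 ≤ s → s ≤ t → t ≤ 1 → dist (φ s) (φ t) ≤ C * δ * (t - s) := by
    intro s t hs hst ht
    rw [dist_comm, dist_eq_norm]
    refine norm_sub_le_of_absolutelyContinuous hst (hac.mono ?_) ?_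
    · rw [uIcc_of_le hst, uIcc_of_le zero_le_one]
      exact Icc_subset_Icc hs ht
    · filter_upwards [hd'] with u hu hI
      have hu01 : u ∈ Ioo (0 : ℝ) 1 := ⟨hs.trans_lt hI.1, hI.2.trans_le ht⟩
      obtain ⟨w, hw, hh⟩ := hu hu01
      exact ⟨w, hw, hC δ _ (mem_image_of_mem _ ⟨hu01.1.le, hu01.2.le⟩) w hh⟩
  have hδt : ∀ t ∈ Icc 0 δ, 0 ≤ δ⁻¹ * t ∧ δ⁻¹ * t ≤ 1 := fun t ht =>
    ⟨mul_nonneg (inv_pos.2 hδ).le ht.1, by rw [inv_mul_le_iff₀ hδ, mul_one]; exact ht.2⟩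
  have hL' : ∀ s ∈ Icc 0 δ, ∀ t ∈ Icc 0 δ, s ≤ t →
      dist (φ (δ⁻¹ * s)) (φ (δ⁻¹ * t)) ≤ C * (t - s) := fun s hs t ht hst => by
    refine (hL _ _ (hδt s hs).1 (mul_le_mul_of_nonneg_left hst (inv_pos.2 hδ).le)
      (hδt t ht).2).trans (le_of_eq ?_)
    field_simp
  refine ⟨hδ.le, fun t => φ (δ⁻¹ * t), NNReal.mk C hC0, ?_, ?_, ?_, ?_⟩
  · refine LipschitzOnWith.of_dist_le_mul fun s hs t ht => ?_
    rcases le_total s t with hst | hst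
    · rw [Real.dist_eq, abs_sub_comm, abs_of_nonneg (sub_nonneg.2 hst)]
      exact hL' s hs t ht hst
    · rw [dist_comm, Real.dist_eq, abs_of_nonneg (sub_nonneg.2 hst)]
      exact hL' t ht s hs hst
  · simp only [mul_zero, h0]
  · simp only [inv_mul_cancel₀ hδ.ne', h1]
  · filter_upwards [HomogeneousGroup.ae_comp_affine hd' (inv_pos.2 hδ).ne' 0] with t ht hI
    rw [add_zero] at ht
    obtain ⟨w, hw, hh⟩ := ht ⟨mul_pos (inv_pos.2 hδ) hI.1, by
      rw [inv_mul_lt_iff₀ hδ, mul_one]; exact hI.2⟩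
    have b1 : HasDerivAt (fun t => δ⁻¹ * t) δ⁻¹ t := by
      simpa using (hasDerivAt_id t).const_mul δ⁻¹
    refine ⟨_, hw.scomp t b1, ?_⟩
    have := hh.smul δ⁻¹
    rwa [abs_of_pos (inv_pos.2 hδ), inv_mul_cancel₀ hδ.ne'] at this

theorem exists_isAdmissible_of_reach {δ : ℝ} (hδ : 0 < δ) {x y : EuclideanSpace ℝ (Fin N)}
    (h : G.Reach δ x y) : ∃ φ, G.IsAdmissible δ x y φ := by
  classical
  obtain ⟨-, φ, K, hK, h0, h1, hd⟩ := h
  set ψ : ℝ → EuclideanSpace ℝ (Fin N) := fun t => φ (δ * t) with hψ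
  let P : ℝ → (Fin N → ℝ) → Prop := fun t c => (∀ i, |c i| ≤ δ) ∧
    HasDerivAt ψ (∑ i with G.weight i = 1, c i • G.field i (ψ t)) t
  refine ⟨ψ, ?_, by simp only [hψ, mul_zero, h0], by simp only [hψ, mul_one, h1],
    fun i t => if h : ∃ c, P t c then h.choose i else 0, fun i t _ => ?_, ?_⟩
  · refine LipschitzOnWith.absolutelyContinuousOnInterval (K := K * NNReal.mk δ hδ.le) ?_
    rw [uIcc_of_le zero_le_one]
    refine LipschitzOnWith.of_dist_le_mul fun s hs t ht => ?_
    have hm : ∀ u ∈ Icc (0 : ℝ) 1, δ * u ∈ Icc 0 δ := fun u hu =>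
      ⟨mul_nonneg hδ.le hu.1, mul_le_of_le_one_right hδ.le hu.2⟩
    have := hK.dist_le_mul _ (hm s hs) _ (hm t ht)
    rw [Real.dist_eq, ← mul_sub, abs_mul, abs_of_pos hδ, ← Real.dist_eq, ← mul_assoc] at this
    exact this
  · beta_reduce
    split_ifs with hc
    · exact hc.choose_spec.1 i
    · rw [abs_zero]; exact hδ.le
  · refine (ae_restrict_iff' measurableSet_Ioo).2 ?_
    filter_upwards [HomogeneousGroup.ae_comp_affine hd hδ.ne' 0] with t ht hI
    rw [add_zero] at ht
    obtain ⟨w, hw, hh⟩ := ht ⟨mul_pos hδ hI.1, mul_lt_of_lt_one_right hδ hI.2⟩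
    have b1 : HasDerivAt (fun t => δ * t) δ t := by
      simpa using (hasDerivAt_id t).const_mul δ
    obtain ⟨c, hc1, hc2⟩ := hh.smul δ
    have hex : ∃ c, P t c := ⟨c, fun i => by
      have := hc1 i
      rwa [abs_of_pos hδ, mul_one] at this, by
      rw [← hc2]; exact hw.scomp t b1⟩
    simp only [dif_pos hex]
    exact hex.choose_spec.2

theorem ccDist_eq (x y : EuclideanSpace ℝ (Fin N)) :
    G.ccDist x y = sInf {δ : ℝ | 0 < δ ∧ G.Reach δ x y} := by
  rw [ccDist]
  congr 1
  ext δ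
  exact ⟨fun ⟨h1, φ, h2⟩ => ⟨h1, h2.reach h1⟩, fun ⟨h1, h2⟩ =>
    ⟨h1, exists_isAdmissible_of_reach h1 h2⟩⟩

end CarnotGroup

/-! ### The adjoint action and Chow's theorem -/

namespace HomogeneousGroup

variable {N : ℕ} (G : HomogeneousGroup N)

theorem eq_neg_of_mul_eq_zero {x y : EuclideanSpace ℝ (Fin N)} (h : G.mul x y = 0) : y = -x := by
  have := G.mul_assoc (-x) x y
  rw [G.neg_mul, G.zero_mul, h, G.mul_zero] at this
  exact this

theorem neg_mul_rev (x y : EuclideanSpace ℝ (Fin N)) : -(G.mul x y) = G.mul (-y) (-x) := by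
  refine (G.eq_neg_of_mul_eq_zero ?_).symm
  rw [G.mul_assoc, ← G.mul_assoc y, G.mul_neg, G.zero_mul, G.mul_neg]

/-- Conjugation by `h`. -/
noncomputable def conj (h x : EuclideanSpace ℝ (Fin N)) : EuclideanSpace ℝ (Fin N) :=
  G.mul (G.mul h x) (-h)

/-- The adjoint action `Ad(h)` on the tangent space at the origin. -/
noncomputable def adjoint (h : EuclideanSpace ℝ (Fin N)) :
    EuclideanSpace ℝ (Fin N) →L[ℝ] EuclideanSpace ℝ (Fin N) :=
  fderiv ℝ (G.conj h) 0

theorem contDiff_conj (h : EuclideanSpace ℝ (Fin N)) : ContDiff ℝ ∞ (G.conj h) :=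
  G.contDiff_mul.comp ((G.contDiff_mul_left h).prodMk contDiff_const)

theorem conj_zero (h : EuclideanSpace ℝ (Fin N)) : G.conj h 0 = 0 := by
  rw [conj, G.mul_zero, G.mul_neg]

theorem adjoint_zero : G.adjoint 0 = ContinuousLinearMap.id ℝ _ := by
  have : G.conj 0 = id := funext fun x => by
    rw [conj, G.zero_mul, neg_zero, G.mul_zero]; rfl
  rw [adjoint, this, fderiv_id]

theorem adjoint_mul (h k : EuclideanSpace ℝ (Fin N)) :
    G.adjoint (G.mul h k) = (G.adjoint h).comp (G.adjoint k) := by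
  have e : G.conj (G.mul h k) = G.conj h ∘ G.conj k := funext fun x => by
    simp only [conj, Function.comp, G.neg_mul_rev, G.mul_assoc]
  rw [adjoint, e, fderiv_comp (0 : EuclideanSpace ℝ (Fin N))
    ((G.contDiff_conj h).differentiable (by simp) _) ((G.contDiff_conj k).differentiable (by simp) _),
    G.conj_zero]
  rfl

/-- The derivative of the adjoint action at the origin is the Lie bracket of left invariant
fields. -/
theorem hasFDerivAt_adjoint (w : EuclideanSpace ℝ (Fin N)) :
    ∃ L : EuclideanSpace ℝ (Fin N) →L[ℝ] EuclideanSpace ℝ (Fin N),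
      HasFDerivAt (fun h => G.adjoint h w) L 0 ∧
        ∀ v, L v = VectorField.lieBracket ℝ (G.leftField v) (G.leftField w) 0 := by
  set m : EuclideanSpace ℝ (Fin N) × EuclideanSpace ℝ (Fin N) → EuclideanSpace ℝ (Fin N) :=
    fun z => G.mul z.1 z.2 with hm
  have hmd : ∀ z, HasFDerivAt m (fderiv ℝ m z) z := fun z =>
    (G.contDiff_mul.differentiable (by simp) z).hasFDerivAt
  have h2 : ContDiff ℝ 1 (fderiv ℝ m) := G.contDiff_mul.fderiv_right (m := 1) (n := ∞) (by norm_cast)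
  set S := fderiv ℝ (fderiv ℝ m) 0 with hS
  have hSd : HasFDerivAt (fderiv ℝ m) S 0 := (h2.differentiable one_ne_zero 0).hasFDerivAt
  have hsymm : ∀ u v, S u v = S v u := by
    have : IsSymmSndFDerivAt ℝ m 0 := by
      refine (G.contDiff_mul.contDiffAt (x := 0)).isSymmSndFDerivAt (n := ∞) ?_
      rw [minSmoothness_of_isRCLikeNormedField]
      norm_cast
    exact this
  -- `m(x, 0) = x`, so the derivative in the first factor is the identity along that factor
  have hfst : ∀ x u, fderiv ℝ m (x, 0) (u, 0) = u := by
    intro x u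
    have a1 : HasFDerivAt (fun y : EuclideanSpace ℝ (Fin N) => (y, (0 : EuclideanSpace ℝ (Fin N))))
        (ContinuousLinearMap.inl ℝ _ _) x := hasFDerivAt_prodMk_left x 0
    have a2 := ((hmd (x, 0)).comp x a1).fderiv
    have a3 : m ∘ (fun y : EuclideanSpace ℝ (Fin N) => (y, (0 : EuclideanSpace ℝ (Fin N)))) = id :=
      funext fun y => G.mul_zero y
    rw [a3, fderiv_id] at a2
    have := congrArg (fun f : EuclideanSpace ℝ (Fin N) →L[ℝ] EuclideanSpace ℝ (Fin N) => f u) a2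
    simpa using this.symm
  have hSl : HasFDerivAt (fun y : EuclideanSpace ℝ (Fin N) => fderiv ℝ m (y, 0))
      (S.comp (ContinuousLinearMap.inl ℝ _ _)) 0 :=
    HasFDerivAt.comp (f := fun y : EuclideanSpace ℝ (Fin N) => (y, (0 : EuclideanSpace ℝ (Fin N))))
      (0 : EuclideanSpace ℝ (Fin N)) (g := fderiv ℝ m) hSd (hasFDerivAt_prodMk_left 0 0)
  have hS0 : ∀ v u, S (v, 0) (u, 0) = 0 := by
    intro v u
    have a2 := hSl.clm_apply
      (hasFDerivAt_const ((u, 0) : EuclideanSpace ℝ (Fin N) × EuclideanSpace ℝ (Fin N)) 0)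
    have a3 := a2.fderiv
    simp only [hfst] at a3
    rw [fderiv_fun_const] at a3
    have := congrArg (fun f : EuclideanSpace ℝ (Fin N) →L[ℝ] EuclideanSpace ℝ (Fin N) => f v) a3
    simpa using this.symm
  have hfield : ∀ u, HasFDerivAt (G.leftField u)
      ((S.flip (0, u)).comp (ContinuousLinearMap.inl ℝ _ _)) 0 := by
    intro u
    have a2 := hSl.clm_apply
      (hasFDerivAt_const ((0, u) : EuclideanSpace ℝ (Fin N) × EuclideanSpace ℝ (Fin N)) 0)
    have a3 : G.leftField u = fun x => fderiv ℝ m (x, 0) (0, u) := funext (G.leftField_eq u)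
    rw [a3]
    refine a2.congr_fderiv ?_
    ext v
    simp
  have hbr : ∀ v, VectorField.lieBracket ℝ (G.leftField v) (G.leftField w) 0 =
      S (v, 0) (0, w) - S (w, 0) (0, v) := by
    intro v
    rw [VectorField.lieBracket, (hfield w).fderiv, (hfield v).fderiv, G.leftField_zero,
      G.leftField_zero]
    simp
  -- `Ad(h) w` is the derivative of `x ↦ m(m(h, x), -h)`; differentiate once more in `h`, and use the
  -- symmetry of the second derivative `S` of `m`
  have hconj : ∀ h, G.adjoint h w = fderiv ℝ m (h, -h) (G.leftField w h, 0) := by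
    intro h
    have a1 := ((G.differentiable_mul_left h) 0).hasFDerivAt.prodMk
      (hasFDerivAt_const (-h) (0 : EuclideanSpace ℝ (Fin N)))
    have a2 := HasFDerivAt.comp (0 : EuclideanSpace ℝ (Fin N)) (g := m)
      (hmd (G.mul h 0, -h)) a1
    rw [adjoint, show G.conj h = m ∘ fun x => (G.mul h x, -h) from rfl, a2.fderiv, G.mul_zero]
    rfl
  have a1 : HasFDerivAt (fun h : EuclideanSpace ℝ (Fin N) => (h, -h))
      ((ContinuousLinearMap.id ℝ _).prod (-ContinuousLinearMap.id ℝ _)) 0 :=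
    (hasFDerivAt_id _).prodMk (hasFDerivAt_id _).neg
  have hz : ((0 : EuclideanSpace ℝ (Fin N)), -(0 : EuclideanSpace ℝ (Fin N))) = 0 := by
    rw [neg_zero]; rfl
  have a2 : HasFDerivAt (fun h : EuclideanSpace ℝ (Fin N) => fderiv ℝ m (h, -h))
      (S.comp ((ContinuousLinearMap.id ℝ _).prod (-ContinuousLinearMap.id ℝ _))) 0 :=
    HasFDerivAt.comp (0 : EuclideanSpace ℝ (Fin N)) (g := fderiv ℝ m) (by rw [hz]; exact hSd) a1
  have a3 := a2.clm_apply ((hfield w).prodMk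
    (hasFDerivAt_const (0 : EuclideanSpace ℝ (Fin N)) (0 : EuclideanSpace ℝ (Fin N))))
  refine ⟨_, by simpa only [hconj] using a3, fun v => ?_⟩
  rw [hbr]
  have e1 : S (v, -v) (w, 0) = - S (w, 0) (0, v) := by
    have : ((v, -v) : EuclideanSpace ℝ (Fin N) × EuclideanSpace ℝ (Fin N)) = (v, 0) - (0, v) := by
      simp
    rw [this, map_sub, sub_apply, hS0, zero_sub, hsymm]
  have e2 := hfst 0 (S (v, 0) (0, w))
  simp only [neg_zero]
  simp [G.leftField_zero, e1, e2]
  abel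

end HomogeneousGroup

namespace HomogeneousGroup

variable {N : ℕ} {G : HomogeneousGroup N}

/-- Short integral curves of the fields of homogeneity `1`. -/
theorem exists_horizontal_curve {i : Fin N} (hi : G.weight i = 1) :
    ∃ γ : ℝ → EuclideanSpace ℝ (Fin N), γ 0 = 0 ∧
      HasStrictDerivAt γ (EuclideanSpace.single i 1) 0 ∧ ∀ᶠ t in 𝓝 0, G.Reach 1 0 (γ t) := by
  have hC : ContDiff ℝ 2 (G.field i) := G.contDiff_leftField (EuclideanSpace.single i 1)
  obtain ⟨γ, h0, ε, hε, hγ⟩ := ((hC.of_le (by norm_num)).contDiffAt (x := 0)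
    ).exists_forall_mem_closedBall_exists_eq_forall_mem_Ioo_hasDerivAt₀ 0
  rw [zero_sub, zero_add] at hγ
  have hcont : ContinuousOn γ (Ioo (-ε) ε) := fun t ht => (hγ t ht).continuousAt.continuousWithinAt
  refine ⟨γ, h0, ?_, ?_⟩
  · have h1 : HasStrictDerivAt γ (G.field i (γ 0)) 0 :=
      hasStrictDerivAt_of_hasDerivAt_of_continuousAt (f' := fun t => G.field i (γ t)) (by
        filter_upwards [Ioo_mem_nhds (neg_lt_zero.2 hε) hε] with t ht using hγ t ht)
        (hC.continuous.continuousAt.comp (hγ 0 ⟨neg_lt_zero.2 hε, hε⟩).continuousAt)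
    rw [h0] at h1
    have h2 : G.field i 0 = EuclideanSpace.single i 1 := G.leftField_zero _
    rwa [h2] at h1
  · have key : ∀ σ : ℝ, |σ| = 1 → ∀ T, 0 ≤ T → T < ε → G.Reach T 0 (γ (σ * T)) := by
      intro σ hσ T hT hTε
      have hm : ∀ s ∈ Icc 0 T, σ * s ∈ Ioo (-ε) ε := fun s hs => by
        rw [mem_Ioo, ← abs_lt, abs_mul, hσ, _root_.one_mul, abs_of_nonneg hs.1]
        exact hs.2.trans_lt hTε
      have hd : ∀ s ∈ Icc 0 T, HasDerivAt (fun s => γ (σ * s)) (σ • G.field i (γ (σ * s))) s := by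
        intro s hs
        have b1 : HasDerivAt (fun s => σ * s) σ s := by
          simpa using (hasDerivAt_id s).const_mul σ
        exact (hγ _ (hm s hs)).scomp s b1
      have hcs : ContinuousOn (fun s => σ • G.field i (γ (σ * s))) (Icc 0 T) := fun s hs =>
        ((hC.continuous.continuousAt.comp (hd s hs).continuousAt).const_smul σ).continuousWithinAt
      obtain ⟨C, hCb⟩ := (isCompact_Icc.image_of_continuousOn hcs).isBounded.exists_norm_le
      refine ⟨hT, fun s => γ (σ * s), C.toNNReal, ?_, by simp [h0], rfl, ?_⟩
      · refine LipschitzOnWith.of_dist_le_mul fun s hs t ht => ?_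
        rw [dist_eq_norm, Real.dist_eq, ← Real.norm_eq_abs]
        have h1 := (convex_Icc (0 : ℝ) T).norm_image_sub_le_of_norm_hasDerivWithin_le
          (fun u hu => (hd u hu).hasDerivWithinAt) (fun u hu => hCb _ (mem_image_of_mem _ hu)) ht hs
        exact h1.trans (mul_le_mul_of_nonneg_right (Real.le_coe_toNNReal C) (norm_nonneg _))
      · refine Eventually.of_forall fun s hs => ⟨_, hd s ⟨hs.1.le, hs.2.le⟩,
          fun j => if j = i then σ else 0, fun j => ?_, ?_⟩
        · simp only
          split_ifs
          · exact hσ.le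
          · simp
        · simp only [ite_smul, zero_smul]
          rw [Finset.sum_ite_eq', if_pos (by simp [hi])]
    filter_upwards [Ioo_mem_nhds (neg_lt_zero.2 (lt_min hε one_pos)) (lt_min hε one_pos)] with t ht
    rw [mem_Ioo, ← abs_lt, lt_min_iff] at ht
    rcases le_total 0 t with h | h
    · rw [abs_of_nonneg h] at ht
      have := key 1 (by simp) t h ht.1
      rw [_root_.one_mul] at this
      exact this.mono ht.2.le
    · rw [abs_of_nonpos h] at ht
      have := key (-1) (by simp) (-t) (by linarith) ht.1
      rw [neg_one_mul, neg_neg] at this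
      exact this.mono ht.2.le

variable (G)

/-- The span of the images of the horizontal directions under the adjoint action of the
points that can be reached from the origin. -/
noncomputable def reachSpan : Submodule ℝ (EuclideanSpace ℝ (Fin N)) :=
  Submodule.span ℝ {u | ∃ h, (∃ T, G.Reach T 0 h) ∧ ∃ i, G.weight i = 1 ∧
    u = G.adjoint h (EuclideanSpace.single i 1)}

variable {G}

/-- `reachSpan` is invariant under the adjoint action of reachable points, since products of
reachable points are reachable. -/
theorem adjoint_mem_reachSpan {h w : EuclideanSpace ℝ (Fin N)} (hh : ∃ T, G.Reach T 0 h)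
    (hw : w ∈ G.reachSpan) : G.adjoint h w ∈ G.reachSpan := by
  have : G.reachSpan ≤ G.reachSpan.comap (G.adjoint h).toLinearMap := by
    refine Submodule.span_le.2 ?_
    rintro _ ⟨k, ⟨T, hk⟩, i, hi, rfl⟩
    obtain ⟨T', hh⟩ := hh
    have h1 := hk.mul_left h
    rw [G.mul_zero] at h1
    exact Submodule.subset_span ⟨G.mul h k, ⟨_, hh.trans h1⟩, i, hi, by rw [G.adjoint_mul]; rfl⟩
  exact this hw

theorem single_mem_reachSpan {i : Fin N} (hi : G.weight i = 1) :
    EuclideanSpace.single i 1 ∈ G.reachSpan :=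
  Submodule.subset_span ⟨0, ⟨0, Reach.refl le_rfl 0⟩, i, hi, by rw [G.adjoint_zero]; rfl⟩

/-- `reachSpan` is closed under brackets with horizontal fields, by differentiating its
invariance under the adjoint action along horizontal curves. -/
theorem lieBracket_mem_reachSpan {v w : EuclideanSpace ℝ (Fin N)}
    (hv : v ∈ Submodule.span ℝ {e | ∃ i, G.weight i = 1 ∧ e = EuclideanSpace.single i (1 : ℝ)})
    (hw : w ∈ G.reachSpan) :
    VectorField.lieBracket ℝ (G.leftField v) (G.leftField w) 0 ∈ G.reachSpan := by
  obtain ⟨L, hL, hLv⟩ := G.hasFDerivAt_adjoint w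
  rw [← hLv]
  have : Submodule.span ℝ {e | ∃ i, G.weight i = 1 ∧ e = EuclideanSpace.single i (1 : ℝ)} ≤
      G.reachSpan.comap L.toLinearMap := by
    refine Submodule.span_le.2 ?_
    rintro _ ⟨i, hi, rfl⟩
    obtain ⟨γ, h0, hγ, hr⟩ := exists_horizontal_curve hi
    rw [← h0] at hL
    have h1 := (hL.comp_hasDerivAt 0 hγ.hasDerivAt)
    rw [hasDerivAt_iff_tendsto_slope] at h1
    refine (Submodule.closed_of_finiteDimensional G.reachSpan).mem_of_tendsto h1 ?_
    filter_upwards [hr.filter_mono nhdsWithin_le_nhds] with t ht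
    rw [slope_def_module]
    refine Submodule.smul_mem _ _ (Submodule.sub_mem _ ?_ ?_)
    · exact adjoint_mem_reachSpan ⟨1, ht⟩ hw
    · simp only [Function.comp, h0, G.adjoint_zero]
      exact hw
  exact this hv

theorem exists_eq_leftField_of_mem_layer {j : ℕ}
    {X : EuclideanSpace ℝ (Fin N) → EuclideanSpace ℝ (Fin N)} (hX : X ∈ G.layer j) :
    ∃ v ∈ Submodule.span ℝ {e | ∃ i, G.weight i = j ∧ e = EuclideanSpace.single i (1 : ℝ)},
      X = G.leftField v := by
  induction hX using Submodule.span_induction with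
  | mem X hX =>
    obtain ⟨i, hi, rfl⟩ := hX
    exact ⟨_, Submodule.subset_span ⟨i, hi, rfl⟩, rfl⟩
  | zero => exact ⟨0, Submodule.zero_mem _, funext fun x => by simp [leftField]⟩
  | add X Y _ _ hX hY =>
    obtain ⟨v, hv, rfl⟩ := hX
    obtain ⟨w, hw, rfl⟩ := hY
    exact ⟨v + w, Submodule.add_mem _ hv hw, funext fun x => by simp [leftField]⟩
  | smul a X _ hX =>
    obtain ⟨v, hv, rfl⟩ := hX
    exact ⟨a • v, Submodule.smul_mem _ a hv, funext fun x => by simp [leftField]⟩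

end HomogeneousGroup

namespace CarnotGroup

variable {N : ℕ} (G : CarnotGroup N)

theorem apply_zero_mem_reachSpan {j : ℕ} (hj : 1 ≤ j) :
    ∀ Y ∈ G.layer j, Y 0 ∈ G.reachSpan := by
  induction j, hj using Nat.le_induction with
  | base =>
    intro Y hY
    obtain ⟨v, hv, rfl⟩ := HomogeneousGroup.exists_eq_leftField_of_mem_layer hY
    rw [G.leftField_zero]
    refine (Submodule.span_le.2 ?_ : _ ≤ G.reachSpan) hv
    rintro _ ⟨i, hi, rfl⟩
    exact HomogeneousGroup.single_mem_reachSpan hi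
  | succ j hj ih =>
    intro Y hY
    rw [G.stratified j hj] at hY
    induction hY using Submodule.span_induction with
    | mem Z hZ =>
      obtain ⟨X, hX, Y, hY, rfl⟩ := hZ
      obtain ⟨v, hv, rfl⟩ := HomogeneousGroup.exists_eq_leftField_of_mem_layer hX
      obtain ⟨w, -, rfl⟩ := HomogeneousGroup.exists_eq_leftField_of_mem_layer hY
      have := ih _ hY
      rw [G.leftField_zero] at this
      exact HomogeneousGroup.lieBracket_mem_reachSpan hv this
    | zero => exact Submodule.zero_mem _
    | add X Y _ _ hX hY => exact Submodule.add_mem _ hX hY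
    | smul a X _ hX => exact Submodule.smul_mem _ a hX

/-- The stratification forces `reachSpan`, which contains the values at `0` of every layer, to be
the whole space. -/
theorem reachSpan_eq_top : G.reachSpan = ⊤ := by
  refine eq_top_iff.2 fun w _ => ?_
  have h : w = ∑ i, w i • EuclideanSpace.single i (1 : ℝ) := by
    ext j
    simp [Finset.sum_apply, Pi.single_apply]
  rw [h]
  refine Submodule.sum_mem _ fun i _ => Submodule.smul_mem _ _ ?_
  have := G.apply_zero_mem_reachSpan (G.one_le_weight i) (G.field i) (Submodule.subset_span ⟨i, rfl, rfl⟩)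
  rwa [show G.field i 0 = _ from G.leftField_zero _] at this

/-- **Chow's theorem**, quantitative near the origin: products of conjugates of horizontal curves
give a submersion at the origin. -/
theorem exists_eventually_reach : ∃ T, ∀ᶠ y in 𝓝 0, G.Reach T 0 y := by
  classical
  obtain ⟨s, hsub, hspan⟩ := (Submodule.fg_span_iff_fg_span_finset_subset _).1
    (IsNoetherian.noetherian G.reachSpan)
  have htop : Submodule.span ℝ (s : Set (EuclideanSpace ℝ (Fin N))) = ⊤ := by
    rw [← hspan]; exact G.reachSpan_eq_top
  -- a curve of reachable points in each of the spanning directions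
  have hcurve : ∀ u : s, ∃ c : ℝ → EuclideanSpace ℝ (Fin N), c 0 = 0 ∧
      HasStrictDerivAt c u.1 0 ∧ ∃ T, ∀ᶠ t in 𝓝 0, G.Reach T 0 (c t) := by
    intro u
    obtain ⟨h, ⟨T, hT⟩, i, hi, hu⟩ := hsub u.2
    obtain ⟨γ, h0, hγ, hr⟩ := HomogeneousGroup.exists_horizontal_curve hi
    refine ⟨fun t => G.conj h (γ t), by simp only [h0, G.conj_zero], ?_, T + 1 + T, ?_⟩
    · have h1 : HasStrictFDerivAt (G.conj h) (G.adjoint h) (γ 0) := by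
        rw [h0]
        exact (G.contDiff_conj h).contDiffAt.hasStrictFDerivAt (by simp)
      have := h1.comp_hasStrictDerivAt 0 hγ
      rw [← hu] at this
      exact this
    · filter_upwards [hr] with t ht
      have a1 := ht.mul_left h
      rw [G.mul_zero] at a1
      have a2 := hT.symm.mul_left (G.mul (G.mul h (γ t)) (-h))
      have a3 : G.mul (G.mul (G.mul h (γ t)) (-h)) h = G.mul h (γ t) := by
        rw [G.mul_assoc, G.neg_mul, G.mul_zero]
      rw [a3, G.mul_zero] at a2
      exact (hT.trans a1).trans a2
  choose c hc0 hcd hcr using hcurve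
  have hprod : ∀ l : List s, ∃ (F : (s → ℝ) → EuclideanSpace ℝ (Fin N))
      (F' : (s → ℝ) →L[ℝ] EuclideanSpace ℝ (Fin N)) (T : ℝ), F 0 = 0 ∧ HasStrictFDerivAt F F' 0 ∧
        (∀ x, F' x = (l.map fun u => x u • u.1).sum) ∧ ∀ᶠ x in 𝓝 0, G.Reach T 0 (F x) := by
    intro l
    induction l with
    | nil =>
      exact ⟨fun _ => 0, 0, 0, rfl, hasStrictFDerivAt_const _ _, fun x => by simp,
        Eventually.of_forall fun x => HomogeneousGroup.Reach.refl le_rfl 0⟩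
    | cons u l ih =>
      obtain ⟨F, F', T, hF0, hF, hF', hr⟩ := ih
      obtain ⟨T', hT'⟩ := hcr u
      have hp : HasStrictFDerivAt (fun x : s → ℝ => c u (x u))
          ((ContinuousLinearMap.toSpanSingleton ℝ u.1).comp (ContinuousLinearMap.proj u)) 0 :=
        HasStrictFDerivAt.comp (0 : s → ℝ) (g := c u) (f := fun x : s → ℝ => x u)
          (hcd u).hasStrictFDerivAt (hasStrictFDerivAt_apply u 0)
      set m : EuclideanSpace ℝ (Fin N) × EuclideanSpace ℝ (Fin N) → EuclideanSpace ℝ (Fin N) :=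
        fun z => G.mul z.1 z.2 with hm
      have hmd : HasStrictFDerivAt m (fderiv ℝ m 0) 0 :=
        G.contDiff_mul.contDiffAt.hasStrictFDerivAt (by simp)
      have hadd : ∀ a b, fderiv ℝ m 0 (a, b) = a + b := by
        intro a b
        have e1 : fderiv ℝ m 0 (0, b) = b := by
          have := G.leftField_eq b 0
          rw [G.leftField_zero] at this
          exact this.symm
        have e2 : fderiv ℝ m 0 (a, 0) = a := by
          have b1 : HasFDerivAt (fun y : EuclideanSpace ℝ (Fin N) =>
              m (y, (0 : EuclideanSpace ℝ (Fin N)))) ((fderiv ℝ m 0).comp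
                (ContinuousLinearMap.inl ℝ _ _)) 0 :=
            HasFDerivAt.comp (f := fun y : EuclideanSpace ℝ (Fin N) =>
              (y, (0 : EuclideanSpace ℝ (Fin N)))) (0 : EuclideanSpace ℝ (Fin N)) (g := m)
              hmd.hasFDerivAt (hasFDerivAt_prodMk_left 0 0)
          have b2 : (fun y : EuclideanSpace ℝ (Fin N) =>
              m (y, (0 : EuclideanSpace ℝ (Fin N)))) = id := funext fun y => G.mul_zero y
          rw [b2] at b1
          have := congrArg (fun f : EuclideanSpace ℝ (Fin N) →L[ℝ] EuclideanSpace ℝ (Fin N) => f a)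
            (b1.unique (hasFDerivAt_id 0))
          simpa using this
        have e3 : ((a, b) : EuclideanSpace ℝ (Fin N) × EuclideanSpace ℝ (Fin N)) =
          (a, 0) + (0, b) := by simp
        rw [e3, map_add, e1, e2]
      have hmd' : HasStrictFDerivAt m (fderiv ℝ m 0) (c u ((0 : s → ℝ) u), F 0) := by
        rw [Pi.zero_apply, hc0, hF0]; exact hmd
      have hcomp := HasStrictFDerivAt.comp (0 : s → ℝ) (g := m)
        (f := fun x : s → ℝ => (c u (x u), F x)) hmd' (hp.prodMk hF)
      refine ⟨fun x => G.mul (c u (x u)) (F x), _, T' + T, ?_, hcomp, fun x => ?_, ?_⟩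
      · change G.mul (c u ((0 : s → ℝ) u)) (F 0) = 0
        rw [Pi.zero_apply, hc0, hF0, G.mul_zero]
      · rw [List.map_cons, List.sum_cons, ← hF' x]
        exact hadd _ _
      · have hto : Tendsto (fun x : s → ℝ => x u) (𝓝 0) (𝓝 0) := by
          simpa using (continuous_apply u).tendsto (0 : s → ℝ)
        filter_upwards [hr, hto.eventually hT'] with x h1 h2
        have h3 := h1.mul_left (c u (x u))
        rw [G.mul_zero] at h3
        exact h2.trans h3
  obtain ⟨F, F', T, hF0, hF, hF', hr⟩ := hprod (Finset.univ : Finset s).toList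
  have hsurj : F'.range = ⊤ := by
    rw [← top_le_iff, ← htop]
    refine Submodule.span_le.2 fun u hu => ?_
    refine ⟨Pi.single ⟨u, hu⟩ 1, ?_⟩
    have h1 := hF' (Pi.single ⟨u, hu⟩ 1)
    rw [Finset.sum_map_toList] at h1
    refine h1.trans ?_
    rw [Finset.sum_eq_single ⟨u, hu⟩]
    · simp
    · intro v _ hv
      rw [Pi.single_eq_of_ne hv, zero_smul]
    · intro h; exact absurd (Finset.mem_univ _) h
  have hmap := hF.map_nhds_eq_of_surj hsurj
  rw [hF0] at hmap
  refine ⟨T, ?_⟩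
  rw [← hmap]
  exact hr

theorem eventually_reach {r : ℝ} (hr : 0 < r) : ∀ᶠ y in 𝓝 0, G.Reach r 0 y := by
  obtain ⟨T₀, hT₀⟩ := G.exists_eventually_reach
  set T := max T₀ 1
  have hT : 0 < T := lt_of_lt_of_le one_pos (le_max_right _ _)
  have hto : Tendsto (G.dilation (T / r)) (𝓝 0) (𝓝 0) := by
    simpa using (G.dilation (T / r)).continuous.tendsto 0
  filter_upwards [hto.eventually hT₀] with y hy
  have h1 := (hy.mono (le_max_left T₀ 1)).dilation (show 0 < r / T by positivity)
  rw [map_zero, G.dilation_dilation, show r / T * (T / r) = 1 by field_simp, G.dilation_one,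
    div_mul_cancel₀ _ hT.ne'] at h1
  exact h1

theorem exists_reach (x y : EuclideanSpace ℝ (Fin N)) : ∃ T, G.Reach T x y := by
  have h0 : ∀ z, ∃ T, G.Reach T 0 z := by
    intro z
    have h1 := ((G.tendsto_dilation z).mono_left (nhdsWithin_le_nhds (s := Ioi 0))).eventually
      (G.eventually_reach one_pos)
    obtain ⟨t, ht, hpos⟩ := (h1.and (self_mem_nhdsWithin (s := Ioi (0 : ℝ)))).exists
    have hpos : 0 < t := hpos
    have h2 := ht.dilation (inv_pos.2 hpos)
    rw [map_zero, G.dilation_dilation, inv_mul_cancel₀ hpos.ne', G.dilation_one] at h2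
    exact ⟨_, h2⟩
  obtain ⟨T, hT⟩ := h0 x
  obtain ⟨T', hT'⟩ := h0 y
  exact ⟨_, hT.symm.trans hT'⟩

end CarnotGroup

/-! ### The control distance as a metric -/

namespace CarnotGroup

variable {N : ℕ} (G : CarnotGroup N)

theorem bddBelow_reach (x y : EuclideanSpace ℝ (Fin N)) :
    BddBelow {δ : ℝ | 0 < δ ∧ G.Reach δ x y} := ⟨0, fun _ h => h.1.le⟩

theorem nonempty_reach (x y : EuclideanSpace ℝ (Fin N)) :
    {δ : ℝ | 0 < δ ∧ G.Reach δ x y}.Nonempty := by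
  obtain ⟨T, hT⟩ := G.exists_reach x y
  exact ⟨max T 1, lt_of_lt_of_le one_pos (le_max_right _ _), hT.mono (le_max_left _ _)⟩

theorem ccDist_lt_iff {x y : EuclideanSpace ℝ (Fin N)} {r : ℝ} :
    G.ccDist x y < r ↔ ∃ δ, (0 < δ ∧ G.Reach δ x y) ∧ δ < r := by
  rw [ccDist_eq, csInf_lt_iff (G.bddBelow_reach x y) (G.nonempty_reach x y)]
  rfl

theorem ccDist_le_of_reach {x y : EuclideanSpace ℝ (Fin N)} {δ : ℝ} (hδ : 0 < δ)
    (h : G.Reach δ x y) : G.ccDist x y ≤ δ := by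
  rw [ccDist_eq]
  exact csInf_le (G.bddBelow_reach x y) ⟨hδ, h⟩

theorem ccDist_nonneg (x y : EuclideanSpace ℝ (Fin N)) : 0 ≤ G.ccDist x y := by
  rw [ccDist_eq]
  exact Real.sInf_nonneg fun _ h => h.1.le

theorem ccDist_self (x : EuclideanSpace ℝ (Fin N)) : G.ccDist x x = 0 := by
  refine le_antisymm (le_of_forall_pos_le_add fun ε hε => ?_) (G.ccDist_nonneg x x)
  rw [zero_add]
  exact G.ccDist_le_of_reach hε (HomogeneousGroup.Reach.refl hε.le x)

theorem ccDist_comm (x y : EuclideanSpace ℝ (Fin N)) : G.ccDist x y = G.ccDist y x := by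
  rw [ccDist_eq, ccDist_eq]
  congr 1
  ext δ
  exact ⟨fun h => ⟨h.1, h.2.symm⟩, fun h => ⟨h.1, h.2.symm⟩⟩

theorem ccDist_triangle (x y z : EuclideanSpace ℝ (Fin N)) :
    G.ccDist x z ≤ G.ccDist x y + G.ccDist y z := by
  refine le_of_forall_pos_le_add fun ε hε => ?_
  obtain ⟨a, ⟨ha, hxy⟩, ha'⟩ := G.ccDist_lt_iff.1 (lt_add_of_pos_right (G.ccDist x y) (half_pos hε))
  obtain ⟨b, ⟨hb, hyz⟩, hb'⟩ := G.ccDist_lt_iff.1 (lt_add_of_pos_right (G.ccDist y z) (half_pos hε))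
  have := G.ccDist_le_of_reach (add_pos ha hb) (hxy.trans hyz)
  linarith

theorem mul_neg_mul (x y : EuclideanSpace ℝ (Fin N)) : G.mul x (G.mul (-x) y) = y := by
  rw [← G.mul_assoc, G.mul_neg, G.zero_mul]

theorem neg_mul_mul (x y : EuclideanSpace ℝ (Fin N)) : G.mul (-x) (G.mul x y) = y := by
  rw [← G.mul_assoc, G.neg_mul, G.zero_mul]

theorem ccDist_mul_left (z x y : EuclideanSpace ℝ (Fin N)) :
    G.ccDist (G.mul z x) (G.mul z y) = G.ccDist x y := by
  rw [ccDist_eq, ccDist_eq]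
  congr 1
  ext δ
  refine ⟨fun h => ⟨h.1, ?_⟩, fun h => ⟨h.1, h.2.mul_left z⟩⟩
  have := h.2.mul_left (-z)
  rwa [G.neg_mul_mul, G.neg_mul_mul] at this

theorem ccDist_zero_neg_mul (x y : EuclideanSpace ℝ (Fin N)) :
    G.ccDist 0 (G.mul (-x) y) = G.ccDist x y := by
  rw [← G.ccDist_mul_left x, G.mul_zero, G.mul_neg_mul]

theorem ccDist_dilation_le {t : ℝ} (ht : 0 < t) (x y : EuclideanSpace ℝ (Fin N)) :
    G.ccDist (G.dilation t x) (G.dilation t y) ≤ t * G.ccDist x y := by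
  rw [mul_comm, ← div_le_iff₀ ht]
  refine le_of_forall_pos_le_add fun ε hε => ?_
  obtain ⟨a, ⟨ha, hxy⟩, ha'⟩ := G.ccDist_lt_iff.1 (lt_add_of_pos_right (G.ccDist x y) hε)
  have := G.ccDist_le_of_reach (mul_pos ht ha) (hxy.dilation ht)
  rw [div_le_iff₀ ht]
  nlinarith

theorem ccDist_dilation {t : ℝ} (ht : 0 < t) (x y : EuclideanSpace ℝ (Fin N)) :
    G.ccDist (G.dilation t x) (G.dilation t y) = t * G.ccDist x y := by
  refine le_antisymm (G.ccDist_dilation_le ht x y) ?_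
  have h := G.ccDist_dilation_le (inv_pos.2 ht) (G.dilation t x) (G.dilation t y)
  rwa [G.dilation_dilation, G.dilation_dilation, inv_mul_cancel₀ ht.ne', G.dilation_one,
    G.dilation_one, inv_mul_eq_div, le_div_iff₀ ht, mul_comm] at h

theorem exists_norm_neg_mul_lt (x : EuclideanSpace ℝ (Fin N)) {ε : ℝ} (hε : 0 < ε) :
    ∃ r, 0 < r ∧ ∀ y, G.ccDist x y < r → ‖G.mul (-x) y‖ < ε := by
  obtain ⟨C, hC, h⟩ := G.exists_norm_le_of_reach
  refine ⟨min 1 ε / C, by positivity, fun y hy => ?_⟩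
  obtain ⟨a, ⟨ha, hxy⟩, ha'⟩ := G.ccDist_lt_iff.1 hy
  have h1 := hxy.mul_left (-x)
  rw [G.neg_mul] at h1
  rw [lt_div_iff₀ hC, mul_comm] at ha'
  exact (h a _ (ha'.trans_le (min_le_left _ _)) h1).trans_lt (ha'.trans_le (min_le_right _ _))

theorem eq_of_ccDist_eq_zero {x y : EuclideanSpace ℝ (Fin N)} (h : G.ccDist x y = 0) : x = y := by
  have h1 : G.mul (-x) y = 0 := by
    by_contra hne
    obtain ⟨r, hr, hr'⟩ := G.exists_norm_neg_mul_lt x (norm_pos_iff.2 hne)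
    exact lt_irrefl _ (hr' y (h ▸ hr))
  rw [← G.mul_neg_mul x y, h1, G.mul_zero]

/-- The control distance induces the Euclidean topology. -/
theorem nhds_hasBasis_ball (x : EuclideanSpace ℝ (Fin N)) :
    (𝓝 x).HasBasis (fun r : ℝ => 0 < r) (G.ball x) := by
  refine ⟨fun s => ⟨fun hs => ?_, ?_⟩⟩
  · have h1 : G.mul x ⁻¹' s ∈ 𝓝 0 := by
      refine (G.differentiable_mul_left x).continuous.continuousAt.preimage_mem_nhds ?_
      rwa [G.mul_zero]
    obtain ⟨ε, hε, hs'⟩ := Metric.mem_nhds_iff.1 h1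
    obtain ⟨r, hr, hr'⟩ := G.exists_norm_neg_mul_lt x hε
    refine ⟨r, hr, fun y hy => ?_⟩
    have h2 := hs' (mem_ball_zero_iff.2 (hr' y hy))
    rwa [mem_preimage, G.mul_neg_mul] at h2
  · rintro ⟨r, hr, hs⟩
    refine mem_of_superset ?_ hs
    have h1 : Tendsto (G.mul (-x)) (𝓝 x) (𝓝 0) := by
      have := (G.differentiable_mul_left (-x)).continuous.tendsto x
      rwa [G.neg_mul] at this
    filter_upwards [h1.eventually (G.eventually_reach (half_pos hr))] with y hy
    have h2 := hy.mul_left x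
    rw [G.mul_zero, G.mul_neg_mul] at h2
    exact lt_of_le_of_lt (G.ccDist_le_of_reach (half_pos hr) h2) (half_lt_self hr)

/-- `ℝ^N` as a metric space for the control distance, with the Euclidean topology and Lebesgue
measure. -/
def Space (_ : CarnotGroup N) : Type := EuclideanSpace ℝ (Fin N)

/-- The identity map from `ℝ^N` to `ℝ^N` with the control distance. -/
def toSpace (x : EuclideanSpace ℝ (Fin N)) : G.Space := x

noncomputable instance : MetricSpace G.Space :=
  MetricSpace.ofDistTopology (α := EuclideanSpace ℝ (Fin N)) G.ccDist G.ccDist_self G.ccDist_comm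
    G.ccDist_triangle
    (fun s => by
      rw [isOpen_iff_mem_nhds]
      exact forall₂_congr fun x _ => (G.nhds_hasBasis_ball x).mem_iff)
    (fun _ _ h => G.eq_of_ccDist_eq_zero h)

noncomputable instance : MeasureSpace G.Space :=
  inferInstanceAs (MeasureSpace (EuclideanSpace ℝ (Fin N)))

instance : BorelSpace G.Space := inferInstanceAs (BorelSpace (EuclideanSpace ℝ (Fin N)))

instance : SecondCountableTopology G.Space :=
  inferInstanceAs (SecondCountableTopology (EuclideanSpace ℝ (Fin N)))

instance : SFinite (volume : Measure G.Space) :=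
  inferInstanceAs (SFinite (volume : Measure (EuclideanSpace ℝ (Fin N))))

theorem ball_space (x : G.Space) (r : ℝ) : Metric.ball x r = G.ball x r := by
  ext y
  rw [Metric.mem_ball, dist_comm]
  rfl

end CarnotGroup

/-! ### Lebesgue measure is a Haar measure of the group -/

namespace CarnotGroup

variable {N : ℕ} (G : CarnotGroup N)

theorem det_dilation (t : ℝ) : (G.dilation t).det = t ^ G.homDim := by
  have h : LinearMap.toMatrix (EuclideanSpace.basisFun (Fin N) ℝ).toBasis
      (EuclideanSpace.basisFun (Fin N) ℝ).toBasis
      (G.dilation t : EuclideanSpace ℝ (Fin N) →ₗ[ℝ] EuclideanSpace ℝ (Fin N)) =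
      Matrix.diagonal fun i => t ^ G.weight i := by
    ext i j
    rw [LinearMap.toMatrix_apply]
    simp only [OrthonormalBasis.coe_toBasis, EuclideanSpace.basisFun_apply,
      ContinuousLinearMap.coe_coe, OrthonormalBasis.coe_toBasis_repr_apply,
      EuclideanSpace.basisFun_repr, G.dilation_apply, Matrix.diagonal_apply]
    by_cases hij : i = j
    · simp [hij]
    · simp [hij]
  rw [ContinuousLinearMap.det, ← LinearMap.det_toMatrix (EuclideanSpace.basisFun (Fin N) ℝ).toBasis,
    h, Matrix.det_diagonal, Finset.prod_pow_eq_pow_sum]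
  rfl

theorem fderiv_mul_left_comp (x y : EuclideanSpace ℝ (Fin N)) :
    (fderiv ℝ (G.mul x) y).comp (fderiv ℝ (G.mul y) 0) = fderiv ℝ (G.mul (G.mul x y)) 0 := by
  have h : G.mul (G.mul x y) = G.mul x ∘ G.mul y := funext fun z => G.mul_assoc x y z
  rw [h, fderiv_comp _ (G.differentiable_mul_left x _) (G.differentiable_mul_left y _), G.mul_zero]

/-- The Jacobian at `0` of the left translation by `x` is unchanged by dilations of `x`, hence
equals its limit as `x` is contracted to `0`. -/
theorem det_fderiv_mul_left_zero (x : EuclideanSpace ℝ (Fin N)) :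
    (fderiv ℝ (G.mul x) 0).det = 1 := by
  have hinv : ∀ t : ℝ, 0 < t → (fderiv ℝ (G.mul (G.dilation t x)) 0).det =
      (fderiv ℝ (G.mul x) 0).det := by
    intro t ht
    have h : G.mul (G.dilation t x) ∘ G.dilation t = G.dilation t ∘ G.mul x :=
      funext fun z => (G.dilation_map_mul ht x z).symm
    have h1 := congrArg (fun f => (fderiv ℝ f 0).det) h
    rw [fderiv_comp _ (G.differentiable_mul_left _ _) (G.dilation t).differentiableAt,
      fderiv_comp _ (G.dilation t).differentiableAt (G.differentiable_mul_left _ _),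
      ContinuousLinearMap.fderiv, ContinuousLinearMap.fderiv, map_zero] at h1
    change LinearMap.det ((fderiv ℝ (G.mul (G.dilation t x)) 0).toLinearMap ∘ₗ
      (G.dilation t).toLinearMap) = LinearMap.det ((G.dilation t).toLinearMap ∘ₗ
        (fderiv ℝ (G.mul x) 0).toLinearMap) at h1
    rw [LinearMap.det_comp, LinearMap.det_comp, mul_comm] at h1
    have h2 : LinearMap.det (G.dilation t : EuclideanSpace ℝ (Fin N) →ₗ[ℝ] _) ≠ 0 := by
      have := G.det_dilation t
      rw [ContinuousLinearMap.det] at this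
      rw [this]
      exact (pow_pos ht _).ne'
    exact mul_left_cancel₀ h2 h1
  have hcont : Continuous fun y => (fderiv ℝ (G.mul y) 0).det := by
    refine ContinuousLinearMap.continuous_det.comp (continuous_clm_apply.2 fun w => ?_)
    exact (G.contDiff_leftField w).continuous
  have hlim : Tendsto (fun t => (fderiv ℝ (G.mul (G.dilation t x)) 0).det) (𝓝[>] 0)
      (𝓝 (fderiv ℝ (G.mul 0) 0).det) :=
    (hcont.tendsto 0).comp ((G.tendsto_dilation x).mono_left nhdsWithin_le_nhds)
  have hconst : Tendsto (fun t => (fderiv ℝ (G.mul (G.dilation t x)) 0).det) (𝓝[>] 0)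
      (𝓝 (fderiv ℝ (G.mul x) 0).det) :=
    tendsto_const_nhds.congr' (by
      filter_upwards [self_mem_nhdsWithin] with t ht
      exact (hinv t ht).symm)
  have h0 : G.mul 0 = id := funext G.zero_mul
  rw [tendsto_nhds_unique hconst hlim, h0, fderiv_id]
  exact LinearMap.det_id

theorem det_fderiv_mul_left (x y : EuclideanSpace ℝ (Fin N)) :
    (fderiv ℝ (G.mul x) y).det = 1 := by
  have h := congrArg ContinuousLinearMap.det (G.fderiv_mul_left_comp x y)
  change LinearMap.det ((fderiv ℝ (G.mul x) y).toLinearMap ∘ₗ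
      (fderiv ℝ (G.mul y) 0).toLinearMap) = _ at h
  rw [LinearMap.det_comp, G.det_fderiv_mul_left_zero] at h
  have h1 := G.det_fderiv_mul_left_zero y
  rw [ContinuousLinearMap.det] at h1 ⊢
  rwa [h1, _root_.mul_one] at h

theorem injective_mul_left (x : EuclideanSpace ℝ (Fin N)) : Function.Injective (G.mul x) :=
  Function.LeftInverse.injective (g := G.mul (-x)) (G.neg_mul_mul x)

theorem volume_image_mul_left (x : EuclideanSpace ℝ (Fin N)) {S : Set (EuclideanSpace ℝ (Fin N))}
    (hS : MeasurableSet S) : volume (G.mul x '' S) = volume S := by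
  rw [← lintegral_abs_det_fderiv_eq_addHaar_image volume hS
    (fun y _ => (G.differentiable_mul_left x y).hasFDerivAt.hasFDerivWithinAt)
    (G.injective_mul_left x).injOn]
  simp [G.det_fderiv_mul_left]

theorem ball_eq_image (x : EuclideanSpace ℝ (Fin N)) {r : ℝ} (hr : 0 < r) :
    G.ball x r = G.mul x '' (G.dilation r '' G.ball 0 1) := by
  rw [image_image]
  ext y
  constructor
  · intro hy
    refine ⟨G.dilation r⁻¹ (G.mul (-x) y), ?_, ?_⟩
    · have h := G.ccDist_dilation (inv_pos.2 hr) 0 (G.mul (-x) y)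
      rw [map_zero, G.ccDist_zero_neg_mul, inv_mul_eq_div] at h
      have hy : G.ccDist x y < r := hy
      change G.ccDist 0 _ < 1
      rwa [h, div_lt_one hr]
    · simp only
      rw [G.dilation_dilation, mul_inv_cancel₀ hr.ne', G.dilation_one, G.mul_neg_mul]
  · rintro ⟨z, hz, rfl⟩
    have hz : G.ccDist 0 z < 1 := hz
    have h := G.ccDist_mul_left x 0 (G.dilation r z)
    have h' := G.ccDist_dilation hr 0 z
    rw [G.mul_zero] at h
    rw [map_zero] at h'
    change G.ccDist x (G.mul x (G.dilation r z)) < r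
    rw [h, h']
    nlinarith

theorem isOpen_ball (x : EuclideanSpace ℝ (Fin N)) (r : ℝ) : IsOpen (G.ball x r) := by
  have h : IsOpen (Metric.ball (G.toSpace x) r) := Metric.isOpen_ball
  rw [G.ball_space] at h
  exact h

theorem volume_ball_eq_mul (x : EuclideanSpace ℝ (Fin N)) {r : ℝ} (hr : 0 < r) :
    volume (G.ball x r) = ENNReal.ofReal (r ^ G.homDim) * volume (G.ball 0 1) := by
  have hm : MeasurableSet (G.dilation r '' G.ball 0 1) := by
    refine (G.isOpen_ball 0 1).measurableSet.image_of_continuousOn_injOn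
      (G.dilation r).continuous.continuousOn ?_
    refine (Function.LeftInverse.injective (g := G.dilation r⁻¹) fun z => ?_).injOn
    rw [G.dilation_dilation, inv_mul_cancel₀ hr.ne', G.dilation_one]
  rw [G.ball_eq_image x hr, G.volume_image_mul_left x hm,
    Measure.addHaar_image_continuousLinearMap, ← ContinuousLinearMap.det, G.det_dilation, abs_of_pos (pow_pos hr _)]

theorem mem_ball_self {x : EuclideanSpace ℝ (Fin N)} {r : ℝ} (hr : 0 < r) : x ∈ G.ball x r :=
  (G.ccDist_self x).trans_lt hr

theorem volume_ball_pos (x : EuclideanSpace ℝ (Fin N)) {r : ℝ} (hr : 0 < r) :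
    0 < volume (G.ball x r) :=
  (G.isOpen_ball x r).measure_pos _ ⟨x, G.mem_ball_self hr⟩

theorem volume_unit_ball_lt_top : volume (G.ball 0 1) < ⊤ := by
  obtain ⟨r, hr, h⟩ := G.exists_norm_neg_mul_lt 0 one_pos
  have hsub : G.ball 0 r ⊆ Metric.ball 0 1 := by
    intro y hy
    have := h y hy
    rw [neg_zero, G.zero_mul] at this
    rwa [mem_ball_zero_iff]
  have h1 := (measure_mono hsub).trans_lt
    (measure_ball_lt_top (μ := volume) (x := (0 : EuclideanSpace ℝ (Fin N))) (r := 1))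
  rw [G.volume_ball_eq_mul 0 hr] at h1
  by_contra hne
  rw [not_lt_top_iff.1 hne, ENNReal.mul_top (ENNReal.ofReal_pos.2 (pow_pos hr _)).ne'] at h1
  exact lt_irrefl _ h1

theorem volume_ball_lt_top (x : EuclideanSpace ℝ (Fin N)) (r : ℝ) : volume (G.ball x r) < ⊤ := by
  rcases le_or_gt r 0 with hr | hr
  · have : G.ball x r = ∅ := eq_empty_of_forall_notMem fun y hy =>
      absurd ((G.ccDist_nonneg x y).trans_lt hy) (not_lt.2 hr)
    simp [this]
  · rw [G.volume_ball_eq_mul x hr]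
    exact ENNReal.mul_lt_top ENNReal.ofReal_lt_top G.volume_unit_ball_lt_top

theorem one_le_homDim (hN : 0 < N) : 1 ≤ G.homDim :=
  (G.one_le_weight ⟨0, hN⟩).trans
    (Finset.single_le_sum (f := G.weight) (fun _ _ => Nat.zero_le _) (Finset.mem_univ _))

theorem regularVolume (hN : 0 < N) :
    RegularVolume (volume : Measure G.Space) (volume (G.ball 0 1)).toReal G.homDim where
  pos := ENNReal.toReal_pos (G.volume_ball_pos 0 one_pos).ne' G.volume_unit_ball_lt_top.ne
  one_le := G.one_le_homDim hN
  measure_ball x r hr := by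
    rw [G.ball_space, mul_comm, ENNReal.ofReal_mul (pow_nonneg hr.le _),
      ENNReal.ofReal_toReal G.volume_unit_ball_lt_top.ne]
    exact G.volume_ball_eq_mul x hr

/-! ### The convolution kernel -/

/-- Continuity off the origin, from the smoothness estimate of the kernel at the points `x`, `x₀`
and `y = 0`. -/
theorem IsSingularKernel.continuousAt {G : CarnotGroup N} {k₀ : EuclideanSpace ℝ (Fin N) → ℝ}
    {A B : ℝ} (hk : G.IsSingularKernel k₀ A B) {x₀ : EuclideanSpace ℝ (Fin N)} (hx₀ : x₀ ≠ 0) :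
    ContinuousAt k₀ x₀ := by
  have hd : 0 < G.ccDist x₀ 0 := lt_of_le_of_ne (G.ccDist_nonneg _ _)
    fun h => hx₀ (G.eq_of_ccDist_eq_zero h.symm)
  have hdist : Tendsto (fun x => G.ccDist x₀ x) (𝓝 x₀) (𝓝 0) := by
    have : Tendsto (fun x => dist (G.toSpace x₀) x) (𝓝 (G.toSpace x₀))
        (𝓝 (dist (G.toSpace x₀) (G.toSpace x₀))) :=
      (continuous_const.dist continuous_id).tendsto _
    rw [dist_self] at this
    exact this
  have hbd : Tendsto (fun x => B * (G.ccDist x₀ x / G.ccDist x₀ 0 ^ (G.homDim + 1))) (𝓝 x₀)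
      (𝓝 0) := by
    have := (hdist.div_const (G.ccDist x₀ 0 ^ (G.homDim + 1))).const_mul B
    simpa using this
  rw [ContinuousAt, tendsto_iff_dist_tendsto_zero]
  refine squeeze_zero' (Eventually.of_forall fun _ => dist_nonneg) ?_ hbd
  filter_upwards [hdist.eventually (gt_mem_nhds (half_pos hd))] with x hx
  have h := hk.smooth x₀ x 0 (by linarith)
  have e : ∀ z, G.kernel k₀ z 0 = k₀ z := fun z => by rw [kernel, neg_zero, G.zero_mul]
  rw [e, e] at h
  rw [Real.dist_eq]
  linarith [abs_nonneg (G.kernel k₀ 0 x - G.kernel k₀ 0 x₀)]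

theorem IsSingularKernel.measurable {G : CarnotGroup N} {k₀ : EuclideanSpace ℝ (Fin N) → ℝ}
    {A B : ℝ} (hk : G.IsSingularKernel k₀ A B) : Measurable k₀ :=
  measurable_of_continuousOn_compl_singleton 0 fun _ hx =>
    (hk.continuousAt hx).continuousWithinAt

theorem IsSingularKernel.singularKernel {G : CarnotGroup N} {k₀ : EuclideanSpace ℝ (Fin N) → ℝ}
    {A B : ℝ} (hN : 0 < N) (hk : G.IsSingularKernel k₀ A B) :
    SingularKernel (volume : Measure G.Space) G.homDim A B (G.kernel k₀) := by
  have : Nonempty (Fin N) := ⟨⟨0, hN⟩⟩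
  obtain ⟨e, he⟩ := exists_ne (0 : EuclideanSpace ℝ (Fin N))
  have hpos : 0 < G.ccDist 0 e := lt_of_le_of_ne (G.ccDist_nonneg _ _)
    fun h => he (G.eq_of_ccDist_eq_zero h.symm).symm
  have hhalf : G.ccDist 0 (G.dilation (1 / 2) e) = 1 / 2 * G.ccDist 0 e := by
    have := G.ccDist_dilation (t := 1 / 2) (by norm_num) 0 e
    rwa [map_zero] at this
  refine ⟨?_, ?_, ?_, hk.size, hk.smooth, hk.cancel⟩
  · have h := (abs_nonneg _).trans (hk.size 0 e he.symm)
    by_contra hA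
    exact absurd h (not_le.2 (div_neg_of_neg_of_pos (not_le.1 hA) (pow_pos hpos _)))
  · have h := hk.smooth 0 (G.dilation (1 / 2) e) e (by rw [hhalf]; linarith)
    have h1 := (add_nonneg (abs_nonneg _) (abs_nonneg _)).trans h
    by_contra hB
    refine absurd h1 (not_le.2 (mul_neg_of_neg_of_pos (not_le.1 hB) ?_))
    rw [hhalf]
    positivity
  · have h1 : Continuous fun z : EuclideanSpace ℝ (Fin N) × EuclideanSpace ℝ (Fin N) =>
        G.mul (-z.2) z.1 :=
      G.continuous_mul.comp (continuous_snd.neg.prodMk continuous_fst)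
    exact hk.measurable.comp h1.measurable

end CarnotGroup

/-! ### Local mean oscillation in a Carnot group -/

namespace CarnotGroup

variable {N : ℕ} (G : CarnotGroup N)

theorem oscLE_space_iff (f : G.Space → ℝ) (x : G.Space) (r M : ℝ) :
    OscLE volume f x r M ↔ IntegrableOn f (G.ball x r) ∧
      ∫ y in G.ball x r, |f y - ⨍ z in G.ball x r, f z| ≤ M * volume.real (G.ball x r) := by
  unfold OscLE
  rw [G.ball_space]
  rfl

theorem oscLE_of_meanOsc_le {f : EuclideanSpace ℝ (Fin N) → ℝ} {x : EuclideanSpace ℝ (Fin N)}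
    {r M : ℝ} (hM : 0 ≤ M) (hr : 0 < r)
    (hf : AEStronglyMeasurable f (volume.restrict (G.ball x r)))
    (h : G.meanOsc f x r ≤ ENNReal.ofReal M) :
    OscLE (volume : Measure G.Space) f x r M := by
  have hv := (G.volume_ball_pos x hr).ne'
  have hv' := (G.volume_ball_lt_top x r).ne
  rw [meanOsc, ENNReal.div_le_iff hv hv'] at h
  set c := ⨍ z in G.ball x r, f z
  have hfin : ∫⁻ y in G.ball x r, ‖f y - c‖ₑ < ⊤ :=
    h.trans_lt (ENNReal.mul_lt_top ENNReal.ofReal_lt_top hv'.lt_top)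
  have hint : IntegrableOn (fun y => f y - c) (G.ball x r) :=
    ⟨hf.sub aestronglyMeasurable_const, hfin⟩
  have hint' : IntegrableOn f (G.ball x r) := by
    have h1 := hint.add (integrableOn_const (C := c) hv')
    refine h1.congr (Eventually.of_forall fun y => ?_)
    simp
  have hreal : ∫ y in G.ball x r, |f y - c| ≤ M * volume.real (G.ball x r) := by
    have h1 : ENNReal.ofReal (∫ y in G.ball x r, |f y - c|) ≤
        ENNReal.ofReal (M * volume.real (G.ball x r)) := by
      have h2 := ofReal_integral_norm_eq_lintegral_enorm hint
      simp only [Real.norm_eq_abs] at h2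
      rw [h2, ENNReal.ofReal_mul hM, Measure.real, ENNReal.ofReal_toReal hv']
      exact h
    exact (ENNReal.ofReal_le_ofReal_iff (mul_nonneg hM measureReal_nonneg)).1 h1
  exact (G.oscLE_space_iff f x r M).2 ⟨hint', hreal⟩

theorem meanOsc_le_of_oscLE {f : EuclideanSpace ℝ (Fin N) → ℝ} {x : EuclideanSpace ℝ (Fin N)}
    {r M : ℝ} (hM : 0 ≤ M) (hr : 0 < r) (h : OscLE (volume : Measure G.Space) f x r M) :
    G.meanOsc f x r ≤ ENNReal.ofReal M := by
  replace h := (G.oscLE_space_iff f x r M).1 h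
  have hv := (G.volume_ball_pos x hr).ne'
  have hv' := (G.volume_ball_lt_top x r).ne
  rw [meanOsc, ENNReal.div_le_iff hv hv']
  have hf : IntegrableOn f (G.ball x r) := h.1
  have hint : IntegrableOn (fun y => f y - ⨍ z in G.ball x r, f z) (G.ball x r) :=
    hf.sub (integrableOn_const hv')
  have h2 := ofReal_integral_norm_eq_lintegral_enorm hint
  simp only [Real.norm_eq_abs] at h2
  have h3 : (∫ y in G.ball x r, |f y - ⨍ z in G.ball x r, f z|) ≤
    M * volume.real (G.ball x r) := h.2
  rw [← h2, ← ENNReal.ofReal_toReal hv', ← ENNReal.ofReal_mul hM]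
  exact ENNReal.ofReal_le_ofReal h3

/-- By comparison of volumes. -/
theorem radius_le_of_ball_subset_ball (hN : 0 < N) {x z : EuclideanSpace ℝ (Fin N)} {r s : ℝ}
    (hr : 0 < r) (h : G.ball x r ⊆ G.ball z s) : r ≤ s := by
  refine (G.regularVolume hN).le_of_ball_subset_ball (x := G.toSpace x) (z := G.toSpace z) hr ?_
  rw [G.ball_space, G.ball_space]
  exact h

theorem continuous_ccDist_zero : Continuous (G.ccDist 0) := by
  have h : Continuous fun x => dist (G.toSpace 0) x := continuous_const.dist continuous_id
  exact h

theorem bddAbove_ccDist {S : Set (EuclideanSpace ℝ (Fin N))} (hS : Bornology.IsBounded S) :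
    BddAbove {t | ∃ x ∈ S, ∃ y ∈ S, t = G.ccDist x y} := by
  obtain ⟨M, hM⟩ := (hS.isCompact_closure.image G.continuous_ccDist_zero).bddAbove
  refine ⟨M + M, ?_⟩
  rintro _ ⟨x, hx, y, hy, rfl⟩
  have h1 := hM (mem_image_of_mem _ (subset_closure hx))
  have h2 := hM (mem_image_of_mem _ (subset_closure hy))
  have h3 := G.ccDist_triangle x 0 y
  rw [G.ccDist_comm x 0] at h3
  linarith

theorem diam_mono {S Ω : Set (EuclideanSpace ℝ (Fin N))} (hS : S.Nonempty) (h : S ⊆ Ω)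
    (hΩ : Bornology.IsBounded Ω) : G.diam S ≤ G.diam Ω := by
  obtain ⟨x, hx⟩ := hS
  refine csSup_le_csSup (G.bddAbove_ccDist hΩ) ⟨_, x, hx, x, hx, rfl⟩ ?_
  rintro _ ⟨x, hx, y, hy, rfl⟩
  exact ⟨x, h hx, y, h hy, rfl⟩

/-- A ball of diameter less than its radius would be contained in a smaller concentric ball. -/
theorem le_diam_ball (hN : 0 < N) (x : EuclideanSpace ℝ (Fin N)) {s : ℝ} (hs : 0 < s) :
    s ≤ G.diam (G.ball x s) := by
  by_contra! hlt
  obtain ⟨t, ht, hts⟩ := exists_between hlt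
  refine absurd (G.radius_le_of_ball_subset_ball hN (x := x) (z := x) (s := t) hs
    fun y hy => ?_) (not_le.2 hts)
  refine lt_of_le_of_lt (le_csSup (s := {t | ∃ u ∈ G.ball x s, ∃ v ∈ G.ball x s,
    t = G.ccDist u v}) ⟨s + s, ?_⟩ ⟨x, G.mem_ball_self hs, y, hy, rfl⟩) ht
  rintro _ ⟨u, hu, v, hv, rfl⟩
  have h3 := G.ccDist_triangle u x v
  rw [G.ccDist_comm u x] at h3
  have hu : G.ccDist x u < s := hu
  have hv : G.ccDist x v < s := hv
  linarith

/-- A ball contained in `B(z, s)` has radius at most `s`, and the logarithmic weight increases with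
the diameter of the ambient set. -/
theorem lmoSeminorm_ball_le_vlmoModulus (hN : 0 < N) (b : EuclideanSpace ℝ (Fin N) → ℝ)
    {Ω S : Set (EuclideanSpace ℝ (Fin N))} (hΩ : Bornology.IsBounded Ω)
    {z : EuclideanSpace ℝ (Fin N)} {s : ℝ} (hs : 0 < s) (hsub : G.ball z s ⊆ Ω) :
    G.lmoSeminorm b S (G.ball z s) ≤ G.vlmoModulus b Ω s := by
  refine iSup_le fun x => iSup_le fun r => iSup_le fun ⟨_, hr, hxr⟩ => ?_
  refine le_trans ?_ (le_iSup_of_le x (le_iSup_of_le r (le_iSup_of_le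
    ⟨hr, G.radius_le_of_ball_subset_ball hN hr hxr, hxr.trans hsub⟩ le_rfl)))
  have h1 := G.diam_mono ⟨z, G.mem_ball_self hs⟩ hsub hΩ
  have h2 := G.le_diam_ball hN z hs
  gcongr
  exact div_pos (hs.trans_le h2) hr

theorem vlmoModulus_le_lmoSeminorm (b : EuclideanSpace ℝ (Fin N) → ℝ)
    (Ω : Set (EuclideanSpace ℝ (Fin N))) (s : ℝ) :
    G.vlmoModulus b Ω s ≤ G.lmoSeminorm b Ω Ω :=
  iSup_le fun x => iSup_le fun r => iSup_le fun ⟨hr, _, hsub⟩ =>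
    le_iSup_of_le x (le_iSup_of_le r (le_iSup_of_le ⟨hsub (G.mem_ball_self hr), hr, hsub⟩ le_rfl))

theorem oscLE_of_bmoSeminorm {f : EuclideanSpace ℝ (Fin N) → ℝ}
    {Ω₁ Ω₂ : Set (EuclideanSpace ℝ (Fin N))} (hf : G.MemBMOLoc f Ω₁ Ω₂)
    {x : EuclideanSpace ℝ (Fin N)} {r : ℝ} (hx : x ∈ Ω₁) (hr : 0 < r) (h : G.ball x r ⊆ Ω₂) :
    OscLE (volume : Measure G.Space) f x r (G.bmoSeminorm f Ω₁ Ω₂).toReal := by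
  refine G.oscLE_of_meanOsc_le ENNReal.toReal_nonneg hr (hf.1.mono_set h).aestronglyMeasurable ?_
  rw [ENNReal.ofReal_toReal hf.2.ne]
  exact le_iSup_of_le x (le_iSup_of_le r (le_iSup_of_le ⟨hx, hr, h⟩ le_rfl))

theorem oscLE_of_lmoSeminorm (hN : 0 < N) {b : EuclideanSpace ℝ (Fin N) → ℝ}
    {S : Set (EuclideanSpace ℝ (Fin N))} {x z : EuclideanSpace ℝ (Fin N)} {r s : ℝ}
    (hb : LocallyIntegrableOn b (G.ball z s)) (hfin : G.lmoSeminorm b S (G.ball z s) < ⊤)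
    (hx : x ∈ S) (hr : 0 < r) (h : G.ball x r ⊆ G.ball z s) :
    OscLE (volume : Measure G.Space) b x r
      ((G.lmoSeminorm b S (G.ball z s)).toReal / (1 + Real.log (s / r))) := by
  have hrs := G.radius_le_of_ball_subset_ball hN hr h
  have hs := hr.trans_le hrs
  have hlog : 0 < 1 + Real.log (s / r) := by
    have := Real.log_nonneg ((one_le_div hr).2 hrs)
    linarith
  refine G.oscLE_of_meanOsc_le (div_nonneg ENNReal.toReal_nonneg hlog.le) hr
    (hb.mono_set h).aestronglyMeasurable ?_
  rw [ENNReal.ofReal_div_of_pos hlog, ENNReal.ofReal_toReal hfin.ne, ENNReal.le_div_iff_mul_le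
    (Or.inl (ENNReal.ofReal_pos.2 hlog).ne') (Or.inl ENNReal.ofReal_ne_top), mul_comm]
  refine le_trans ?_ (le_iSup_of_le x (le_iSup_of_le r (le_iSup_of_le ⟨hx, hr, h⟩ le_rfl)))
  have h2 := G.le_diam_ball hN z hs
  gcongr

/-- Hölder's inequality on a ball. -/
theorem setIntegral_abs_le_eLpNorm {f : EuclideanSpace ℝ (Fin N) → ℝ} {p : ℝ} (hp : 1 < p)
    {z : EuclideanSpace ℝ (Fin N)} {R : ℝ} (hR : 0 < R)
    (hf : MemLp f (ENNReal.ofReal p) (volume.restrict (G.ball z R))) :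
    (∫ y in G.ball z R, |f y|) ≤ (eLpNorm f (ENNReal.ofReal p) (volume.restrict (G.ball z R)) /
      volume (G.ball z R) ^ (1 / p)).toReal * volume.real (G.ball z R) := by
  have hv := (G.volume_ball_pos z hR).ne'
  have hv' := (G.volume_ball_lt_top z R).ne
  have : IsFiniteMeasure (volume.restrict (G.ball z R)) := ⟨by simpa using hv'.lt_top⟩
  have hp1 : (1 : ℝ≥0∞) ≤ ENNReal.ofReal p := by
    rw [ENNReal.one_le_ofReal]; exact hp.le
  have hint : Integrable f (volume.restrict (G.ball z R)) := hf.integrable hp1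
  have h1 := eLpNorm_le_eLpNorm_mul_rpow_measure_univ hp1 hf.1
  rw [eLpNorm_one_eq_lintegral_enorm, Measure.restrict_apply_univ, ENNReal.toReal_one,
    ENNReal.toReal_ofReal (by linarith), ENNReal.rpow_sub _ _ hv hv', div_one,
    ENNReal.rpow_one] at h1
  have h2 := ofReal_integral_norm_eq_lintegral_enorm hint
  simp only [Real.norm_eq_abs] at h2
  have hpow : volume (G.ball z R) ^ (1 / p) ≠ 0 :=
    (ENNReal.rpow_pos (G.volume_ball_pos z hR) hv').ne'
  have hn : eLpNorm f (ENNReal.ofReal p) (volume.restrict (G.ball z R)) /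
      volume (G.ball z R) ^ (1 / p) ≠ ⊤ := ENNReal.div_ne_top hf.2.ne hpow
  rw [← ENNReal.ofReal_le_ofReal_iff (mul_nonneg ENNReal.toReal_nonneg measureReal_nonneg), h2,
    ENNReal.ofReal_mul ENNReal.toReal_nonneg, ENNReal.ofReal_toReal hn, Measure.real,
    ENNReal.ofReal_toReal hv']
  refine h1.trans_eq ?_
  rw [ENNReal.div_eq_inv_mul, ENNReal.div_eq_inv_mul]
  ring

end CarnotGroup

/-! ### The commutator on a Carnot group -/

namespace CarnotGroup

variable {N : ℕ} (G : CarnotGroup N)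

/-- The constant of the commutator bound: it depends on the group through the homogeneous dimension
and the volume of the unit ball, and not on the exponent of integrability. -/
noncomputable def commutatorBound (A B : ℝ) : ℝ≥0 :=
  (8 * 4 ^ G.homDim * commutatorConst (volume (G.ball 0 1)).toReal G.homDim A B).toNNReal

theorem commutator_bmo_le (hN : 0 < N) {p A B : ℝ} (hp : 1 < p)
    {k₀ : EuclideanSpace ℝ (Fin N) → ℝ} (hk : G.IsSingularKernel k₀ A B)
    {b f : EuclideanSpace ℝ (Fin N) → ℝ} {z : EuclideanSpace ℝ (Fin N)} {R : ℝ} (hR : 0 < R)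
    (hb : LocallyIntegrableOn b (G.ball z (6 * R)))
    (hfin : G.lmoSeminorm b (G.ball z (4 * R)) (G.ball z (6 * R)) < ⊤)
    (hf : G.MemBMOLocP f p (G.ball z R) (G.ball z (3 * R)))
    (hf0 : ∀ᵐ x, x ∉ G.ball z R → f x = 0) :
    (∀ᵐ x, G.PVExists k₀ f x ∧ G.PVExists k₀ (fun y => b y * f y) x) ∧
    G.MemBMOLoc (G.commutator k₀ b f) (G.ball z R) (G.ball z (3 * R)) ∧
    G.bmoSeminorm (G.commutator k₀ b f) (G.ball z R) (G.ball z (3 * R)) ≤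
      G.commutatorBound A B * G.lmoSeminorm b (G.ball z (4 * R)) (G.ball z (6 * R)) *
        (G.bmoSeminorm f (G.ball z R) (G.ball z (3 * R)) +
          eLpNorm f (ENNReal.ofReal p) (volume.restrict (G.ball z R)) /
            volume (G.ball z R) ^ (1 / p)) := by
  have hμ := G.regularVolume hN
  have hk' := hk.singularKernel hN
  have hC := hk'.commutatorConst_nonneg hμ
  have hsub : G.ball z R ⊆ G.ball z (3 * R) := fun y hy =>
    lt_of_lt_of_le (show G.ccDist z y < R from hy) (by linarith)
  have hfp : MemLp f (ENNReal.ofReal p) (volume.restrict (G.ball z R)) :=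
    hf.1.mono_measure (Measure.restrict_mono hsub le_rfl)
  set L := G.lmoSeminorm b (G.ball z (4 * R)) (G.ball z (6 * R))
  set S := G.bmoSeminorm f (G.ball z R) (G.ball z (3 * R))
  set E := eLpNorm f (ENNReal.ofReal p) (volume.restrict (G.ball z R)) /
    volume (G.ball z R) ^ (1 / p) with hE
  have hE' : E ≠ ⊤ := ENNReal.div_ne_top hfp.2.ne
    (ENNReal.rpow_pos (G.volume_ball_pos z hR) (G.volume_ball_lt_top z R).ne).ne'
  have hS' : S ≠ ⊤ := hf.2.2.ne
  have main := hk'.commutator_oscLE hμ (f := f) (b := b) (o := G.toSpace z) (R := R)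
    (m := S.toReal) (n := E.toReal) (Λ := L.toReal) hR ENNReal.toReal_nonneg
    ENNReal.toReal_nonneg ENNReal.toReal_nonneg
    (fun x hx r hr h => by
      rw [G.ball_space] at hx
      rw [G.ball_space, G.ball_space] at h
      exact G.oscLE_of_bmoSeminorm hf.2 hx hr h)
    (by rw [G.ball_space]; exact hf0)
    (by rw [G.ball_space]; exact G.setIntegral_abs_le_eLpNorm hp hR hfp)
    (fun x hx r hr h => by
      rw [G.ball_space] at hx
      rw [G.ball_space, G.ball_space] at h
      exact G.oscLE_of_lmoSeminorm hN hb hfin hx hr h)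
  obtain ⟨hpv, hint, hosc⟩ := main
  rw [G.ball_space] at hint
  have hM : 0 ≤ 8 * 4 ^ G.homDim *
      commutatorConst (volume (G.ball 0 1)).toReal G.homDim A B := by positivity
  have hbound : G.bmoSeminorm (G.commutator k₀ b f) (G.ball z R) (G.ball z (3 * R)) ≤
      G.commutatorBound A B * L * (S + E) := by
    refine iSup_le fun x => iSup_le fun r => iSup_le fun ⟨hx, hr, h⟩ => ?_
    have h1 := hosc (G.toSpace x) (by rw [G.ball_space]; exact hx) r hr
      (by rw [G.ball_space, G.ball_space]; exact h)
    refine (G.meanOsc_le_of_oscLE (mul_nonneg hM (mul_nonneg ENNReal.toReal_nonneg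
      (add_nonneg ENNReal.toReal_nonneg ENNReal.toReal_nonneg))) hr h1).trans_eq ?_
    rw [ENNReal.ofReal_mul hM, ENNReal.ofReal_mul ENNReal.toReal_nonneg,
      ENNReal.ofReal_add ENNReal.toReal_nonneg ENNReal.toReal_nonneg,
      ENNReal.ofReal_toReal hfin.ne, ENNReal.ofReal_toReal hS', ENNReal.ofReal_toReal hE',
      ← mul_assoc]
    rfl
  refine ⟨hpv, ⟨IntegrableOn.locallyIntegrableOn hint, hbound.trans_lt ?_⟩, hbound⟩
  exact ENNReal.mul_lt_top (ENNReal.mul_lt_top ENNReal.coe_lt_top hfin)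
    (ENNReal.add_lt_top.2 ⟨hS'.lt_top, hE'.lt_top⟩)

theorem exists_radius_of_memVLMOLoc (hN : 0 < N) (C : ℝ≥0)
    {Ω : Set (EuclideanSpace ℝ (Fin N))} (hΩo : IsOpen Ω) (hΩ : Bornology.IsBounded Ω)
    {b : EuclideanSpace ℝ (Fin N) → ℝ} (hb : G.MemVLMOLoc b Ω) {z : EuclideanSpace ℝ (Fin N)}
    (hz : z ∈ Ω) {ε : ℝ} (hε : 0 < ε) :
    ∃ R₀ : ℝ, 0 < R₀ ∧ ∀ R : ℝ, 0 < R → R ≤ R₀ → G.ball z (6 * R) ⊆ Ω ∧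
      C * G.lmoSeminorm b (G.ball z (4 * R)) (G.ball z (6 * R)) < ENNReal.ofReal ε := by
  obtain ⟨r, hr, hsub⟩ := (G.nhds_hasBasis_ball z).mem_iff.1 (hΩo.mem_nhds hz)
  have hlim : Tendsto (fun ρ => C * G.vlmoModulus b Ω ρ) (𝓝[>] 0) (𝓝 0) := by
    have := ENNReal.Tendsto.const_mul (a := (C : ℝ≥0∞)) hb.2 (Or.inr ENNReal.coe_ne_top)
    rwa [MulZeroClass.mul_zero] at this
  have hev := hlim.eventually (gt_mem_nhds (ENNReal.ofReal_pos.2 hε))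
  obtain ⟨s, hs, hs'⟩ := mem_nhdsGT_iff_exists_Ioo_subset.1 hev
  have hs : 0 < s := hs
  refine ⟨min r (s / 2) / 6, by positivity, fun R hR hRR => ?_⟩
  rw [le_div_iff₀ (by norm_num), mul_comm] at hRR
  have h6 : G.ball z (6 * R) ⊆ Ω := fun y hy =>
    hsub (lt_of_lt_of_le (show G.ccDist z y < 6 * R from hy) (hRR.trans (min_le_left _ _)))
  refine ⟨h6, lt_of_le_of_lt (mul_le_mul_right
    (G.lmoSeminorm_ball_le_vlmoModulus hN b hΩ (by positivity) h6) _) (hs' ⟨by positivity, ?_⟩)⟩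
  exact (hRR.trans (min_le_right _ _)).trans_lt (half_lt_self hs)

/-! ### The trivial group -/

theorem meanOsc_eq_zero_of_subsingleton [Subsingleton (EuclideanSpace ℝ (Fin N))]
    (f : EuclideanSpace ℝ (Fin N) → ℝ) (x : EuclideanSpace ℝ (Fin N)) {r : ℝ} (hr : 0 < r) :
    G.meanOsc f x r = 0 := by
  have h : ∀ y, f y = f x := fun y => congrArg f (Subsingleton.elim y x)
  have h1 : (⨍ z in G.ball x r, f z) = f x := by
    simp_rw [h]
    exact setAverage_const (G.volume_ball_pos x hr).ne' (G.volume_ball_lt_top x r).ne _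
  rw [meanOsc, h1]
  simp [h]

theorem bmoSeminorm_eq_zero_of_subsingleton [Subsingleton (EuclideanSpace ℝ (Fin N))]
    (f : EuclideanSpace ℝ (Fin N) → ℝ) (Ω₁ Ω₂ : Set (EuclideanSpace ℝ (Fin N))) :
    G.bmoSeminorm f Ω₁ Ω₂ = 0 := by
  refine le_antisymm (iSup_le fun x => iSup_le fun r => iSup_le fun ⟨_, hr, _⟩ => ?_) bot_le
  rw [G.meanOsc_eq_zero_of_subsingleton f x hr]

theorem memBMOLoc_of_subsingleton [Subsingleton (EuclideanSpace ℝ (Fin N))]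
    (f : EuclideanSpace ℝ (Fin N) → ℝ) (Ω₁ Ω₂ : Set (EuclideanSpace ℝ (Fin N))) :
    G.MemBMOLoc f Ω₁ Ω₂ := by
  refine ⟨?_, by rw [G.bmoSeminorm_eq_zero_of_subsingleton]; exact ENNReal.zero_lt_top⟩
  rw [show f = fun _ => f 0 from funext fun y => congrArg f (Subsingleton.elim y 0)]
  exact (locallyIntegrable_const (f 0)).locallyIntegrableOn _

theorem pvExists_of_subsingleton [Subsingleton (EuclideanSpace ℝ (Fin N))]
    (k₀ f : EuclideanSpace ℝ (Fin N) → ℝ) (x : EuclideanSpace ℝ (Fin N)) :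
    G.PVExists k₀ f x := by
  have h : ∀ ε : ℝ, 0 < ε → {y | ε < G.ccDist x y} = ∅ := by
    refine fun ε hε => eq_empty_of_forall_notMem fun y hy => ?_
    have hy : ε < G.ccDist x y := hy
    rw [Subsingleton.elim y x, G.ccDist_self] at hy
    exact lt_asymm hε hy
  refine ⟨fun ε hε => by rw [h ε hε]; exact integrableOn_empty, 0, ?_⟩
  refine tendsto_const_nhds.congr' ?_
  filter_upwards [self_mem_nhdsWithin] with ε hε
  rw [truncated, h ε hε, setIntegral_empty]

end CarnotGroup

/-! ### Local boundedness of the commutator -/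

theorem theorem4p10 :
    ∃ K : ℝ, 4 < K ∧
    ∀ (N : ℕ) (G : CarnotGroup N) (p A B : ℝ), 1 < p →
    ∃ C : ℝ≥0, ∀ k₀ : EuclideanSpace ℝ (Fin N) → ℝ, G.IsSingularKernel k₀ A B →
    ∀ Ω : Set (EuclideanSpace ℝ (Fin N)), IsOpen Ω → IsConnected Ω → Bornology.IsBounded Ω →
    ∀ b : EuclideanSpace ℝ (Fin N) → ℝ, G.MemLMOLoc b Ω →
      (∀ (x' : EuclideanSpace ℝ (Fin N)) (R : ℝ), 0 < R → G.ball x' (K * R) ⊆ Ω →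
        ∀ f : EuclideanSpace ℝ (Fin N) → ℝ,
          G.MemBMOLocP f p (G.ball x' R) (G.ball x' (3 * R)) →
          (∀ᵐ x, x ∉ G.ball x' R → f x = 0) →
          (∀ᵐ x, G.PVExists k₀ f x ∧ G.PVExists k₀ (fun y => b y * f y) x) ∧
          G.MemBMOLoc (G.commutator k₀ b f) (G.ball x' R) (G.ball x' (3 * R)) ∧
          G.bmoSeminorm (G.commutator k₀ b f) (G.ball x' R) (G.ball x' (3 * R)) ≤
            C * G.lmoSeminorm b (G.ball x' (4 * R)) (G.ball x' (K * R)) *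
              (G.bmoSeminorm f (G.ball x' R) (G.ball x' (3 * R)) +
                eLpNorm f (ENNReal.ofReal p) (volume.restrict (G.ball x' R)) /
                  volume (G.ball x' R) ^ (1 / p))) ∧
      (G.MemVLMOLoc b Ω → ∀ x' ∈ Ω, ∀ ε : ℝ, 0 < ε →
        ∃ R₀ : ℝ, 0 < R₀ ∧ ∀ R : ℝ, 0 < R → R ≤ R₀ → G.ball x' (K * R) ⊆ Ω ∧
          C * G.lmoSeminorm b (G.ball x' (4 * R)) (G.ball x' (K * R)) < ENNReal.ofReal ε) := by
  -- the oscillation of `b` matters only on balls contained in `B(x', 4 R)`: any `K > 4` would serve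
  refine ⟨6, by norm_num, fun N G p A B hp => ?_⟩
  rcases Nat.eq_zero_or_pos N with rfl | hN
  · have : Subsingleton (EuclideanSpace ℝ (Fin 0)) := inferInstance
    refine ⟨0, fun k₀ _ Ω _ _ _ b _ => ⟨fun z R hR _ f _ _ => ⟨?_, ?_, ?_⟩, ?_⟩⟩
    · exact Eventually.of_forall fun x =>
        ⟨G.pvExists_of_subsingleton k₀ f x, G.pvExists_of_subsingleton k₀ _ x⟩
    · exact G.memBMOLoc_of_subsingleton _ _ _
    · rw [G.bmoSeminorm_eq_zero_of_subsingleton]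
      exact bot_le
    · intro _ z hz ε hε
      refine ⟨1, one_pos, fun R hR _ => ⟨fun y _ => by rwa [Subsingleton.elim y z], ?_⟩⟩
      simpa using hε
  · refine ⟨G.commutatorBound A B, fun k₀ hk Ω hΩo _ hΩ b hb => ⟨?_, ?_⟩⟩
    · intro z R hR hsub f hf hf0
      refine G.commutator_bmo_le hN hp hk hR (hb.1.mono_set hsub) ?_ hf hf0
      exact (G.lmoSeminorm_ball_le_vlmoModulus hN b hΩ (by positivity) hsub).trans_lt
        ((G.vlmoModulus_le_lmoSeminorm b Ω _).trans_lt hb.2)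
    · intro hV z hz ε hε
      exact G.exists_radius_of_memVLMOLoc hN _ hΩo hΩ hV hz hε
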